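/- **Setting.** Let $T>0$, let $\Omega\subset\mathbb R^3$ be a domain, and let $\mathbf w=\mathbf w(x,t)\in\mathbb R^3$ be a smooth velocity field. For $t\in[0,T]$ let $\Gamma(t)\subset\Omega$ be a smooth, closed (compact, without boundary), connected, oriented hypersurface with unit normal $\mathbf n$, passively advected by $\mathbf w$: $\Gamma(t)=\Phi(\Gamma(0),t)$, where the smooth flow map $\Phi$ satisfies $\Phi(y,0)=y$ and $\partial_t\Phi(y,t)=\mathbf w(\Phi(y,t),t)$ for $y\in\Gamma(0)$, $t\in[0,T]$. Let $\mathcal S=\bigcup_{t\in(0,T)}\Gamma(t)\times\{t\}$, let $|\Gamma(t)|$ be the area of $\Gamma(t)$, $\nabla_\Gamma$ the tangential gradient on $\Gamma(t)$, $\operatorname{div}_\Gamma\mathbf w=\operatorname{tr}((I-\mathbf n\mathbf n^T)\nabla\mathbf w)$, $\bar u(t)=\int_{\Gamma(t)}u(s,t)\,ds$ and $\nu_d>0$. Put $(u,v)_0=\int_0^T\int_{\Gamma(t)}uv\,ds\,dt$, and let $H=\{v\in L^2(\mathcal S):\nabla_\Gamma v\in L^2(\mathcal S)\}$ (weak gradient)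 with $(u,v)_H=(u,v)_0+(\nabla_\Gamma u,\nabla_\Gamma v)_0$. Let $N\ge1$, $t_n=nT/N$, $I_n=(t_{n-1},t_n]$, and let $H_n\subset H$ be the subspace of functions vanishing for $t\notin I_n$. The material derivative $\dot u$ of $u\in H_n$ is the distribution $\langle\dot u,\varphi\rangle=-\int_0^T\int_{\Gamma(t)}u\,(\partial_t\varphi+\mathbf w\cdot\nabla\varphi+\varphi\operatorname{div}_\Gamma\mathbf w)\,ds\,dt$ on $C^1$ functions $\varphi$ with compact support in the open slab $\{t_{n-1}<t<t_n\}$. Let $W_n$ be the space of $u\in H_n$ for which $\dot u$ extends to a bounded linear functional on $H_n$, and $W^b=\bigoplus_{n=1}^N W_n$, where $(u_1,\dots,u_N)$ is identified with $u=\sum_nu_n\in H$. For $u\in W^b$ let $u_\pm^n\in L^2(\Gamma(t_n))$ be the one-sided limits of $u$ at $t_n$, $[u]^n=u_+^n-u_-^n$ for $1\le n\le N-1$, $[u]^0=u_+^0$, and let $(\cdot,\cdot)_{t}$, $\|\cdot\|_{t}$ be the scalar product and norm of $L^2(\Gamma(t))$. For $\sigma\ge0$ set $$\langle\dot u,v\rangle_b=\sum_{n=1}^N\langle\dot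 u_n,v_n\rangle,\qquad d(u,v)=\sum_{n=1}^N([u]^{n-1},v_+^{n-1})_{t_{n-1}},$$ $$a_\sigma(u,v)=\nu_d(\nabla_\Gamma u,\nabla_\Gamma v)_0+(\operatorname{div}_\Gamma\mathbf w\,u,v)_0+\sigma\int_0^T\bar u(t)\bar v(t)\,dt,$$ $$|||u|||_h=\Big(\max_{n=1,\dots,N}\|u_-^n\|_{t_n}^2+\sum_{n=1}^N\|[u]^{n-1}\|_{t_{n-1}}^2+\|u\|_H^2\Big)^{1/2}.$$ For each $n$ let $\mathcal T_n$ be a tetrahedral triangulation of $\Omega$ and $V_n$ the space of continuous piecewise affine functions on $\mathcal T_n$. Let $W_h\subset W^b$ be the space of functions on $\mathcal S$ which on each slab $t\in I_n$ are of the form $\phi_0(x)+t\,\phi_1(x)$ with $\phi_0,\phi_1\in V_n$. Let $c_F(t)>0$ satisfy the Friedrichs inequality $\int_{\Gamma(t)}|\nabla_\Gamma v|^2\,ds\ge c_F(t)\int_{\Gamma(t)}\big(v-\tfrac1{|\Gamma(t)|}\int_{\Gamma(t)}v\,ds\big)^2ds$ for all $v\in H^1(\Gamma(t))$, $t\in[0,T]$.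 **Theorem.** Assume that there is $c_0>0$ with $$\operatorname{div}_\Gamma\mathbf w(x,t)+\nu_d\,c_F(t)\ge c_0\quad\text{for all }x\in\Gamma(t),\ t\in[0,T],$$ and that $\sigma\ge\frac{\nu_d}2\,\frac{c_F(t)}{|\Gamma(t)|}$ for all $t\in[0,T]$. Let $c_s=\frac14\min\{1,\nu_d,c_0\}$. Then $$\inf_{0\ne u\in W^b}\ \sup_{0\ne v\in W^b}\frac{\langle\dot u,v\rangle_b+a_\sigma(u,v)+d(u,v)}{|||v|||_h\,|||u|||_h}\ge c_s,$$ and for all $u\in W^b$ $$\langle\dot u,u\rangle_b+a_\sigma(u,u)+d(u,u)\ \ge\ 2c_s\Big(\|u_-^N\|_{T}^2+\sum_{n=1}^N\|[u]^{n-1}\|_{t_{n-1}}^2+\|u\|_H^2\Big).$$ Both estimates also hold with $W^b$ replaced by $W_h$ (with infimum, supremum and "for all" over $W_h$). There is no restriction on the triangulations $\mathcal T_n$ or on the step size $T/N$. -/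

import Mathlib

open Set Filter Topology MeasureTheory
open scoped ContDiff ENNReal

/-- The ambient space `ℝ³` with its Euclidean norm. -/
abbrev R3 : Type := EuclideanSpace ℝ (Fin 3)

/-- `M` is a smooth closed (compact, without boundary) connected embedded hypersurface of `ℝ³`,
oriented by the unit normal field `ν`: near each of its points `M` is the zero set of a smooth
function with nonvanishing gradient, and `ν` is the normalized gradient. -/
structure IsClosedOrientedSurface (M : Set R3) (ν : R3 → R3) : Prop where
  isCompact : IsCompact M
  isConnected : IsConnected M
  exists_local : ∀ x ∈ M, ∃ (U : Set R3) (f : R3 → ℝ), IsOpen U ∧ x ∈ U ∧ ContDiffOn ℝ ∞ f U ∧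
    M ∩ U = {y | y ∈ U ∧ f y = 0} ∧
    ∀ y ∈ M ∩ U, gradient f y ≠ 0 ∧ ν y = ‖gradient f y‖⁻¹ • gradient f y

/-- A surface `Γ(t)`, `t ∈ [0, T]`, inside a fixed domain `Ω`, passively advected by the smooth
velocity field `w(x, t)`: the points of `Γ(t)` are the end points of the trajectories of `w` that
start on `Γ(0)`. -/
structure EvolvingSurface where
  /-- the final time -/
  T : ℝ
  T_pos : 0 < T
  /-- the spatial domain -/
  Ω : Set R3
  isOpen_Ω : IsOpen Ω
  isConnected_Ω : IsConnected Ω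
  /-- the velocity field, as a function of `(x, t)` -/
  w : R3 × ℝ → R3
  contDiff_w : ContDiff ℝ ∞ w
  /-- the surface at time `t` -/
  Γ : ℝ → Set R3
  /-- the unit normal field on the surface at time `t` -/
  normal : ℝ → R3 → R3
  isSurface : ∀ t ∈ Icc 0 T, IsClosedOrientedSurface (Γ t) (normal t)
  subset_Ω : ∀ t ∈ Icc 0 T, Γ t ⊆ Ω
  /-- the Lagrangian flow map `(y, t) ↦ Φ(y, t)` -/
  Φ : R3 × ℝ → R3
  contDiff_Φ : ContDiff ℝ ∞ Φ
  Φ_zero : ∀ y ∈ Γ 0, Φ (y, 0) = y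
  hasDeriv_Φ : ∀ y ∈ Γ 0, ∀ t ∈ Icc 0 T,
    HasDerivWithinAt (fun s => Φ (y, s)) (w (Φ (y, t), t)) (Icc 0 T) t
  image_Φ : ∀ t ∈ Icc 0 T, Γ t = (fun y => Φ (y, t)) '' Γ 0

namespace EvolvingSurface

variable (S : EvolvingSurface)

/-- The surface measure `ds` on `Γ(t)`: the two-dimensional Hausdorff measure, normalized to agree
with the Lebesgue measure on planes. -/
noncomputable def surf (t : ℝ) : Measure R3 :=
  (Measure.euclideanHausdorffMeasure 2).restrict (S.Γ t)

/-- The area `|Γ(t)|`. -/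
noncomputable def area (t : ℝ) : ℝ := (S.surf t).real univ

/-- The measure `ds dt` on the space-time manifold, i.e. `B ↦ ∫₀ᵀ ∫_{Γ(t)} 1_B(x, t) ds dt`. -/
noncomputable def stMeasure : Measure (R3 × ℝ) :=
  (volume.restrict (Ioo 0 S.T)).bind fun t => (S.surf t).map fun x => (x, t)

/-- The surface divergence `tr((I - n nᵀ) ∇Ψ)` on `Γ(t)`. -/
noncomputable def divΓ (t : ℝ) (Ψ : R3 → R3) (x : R3) : ℝ :=
  LinearMap.trace ℝ R3 (fderiv ℝ Ψ x).toLinearMap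
    - inner ℝ (fderiv ℝ Ψ x (S.normal t x)) (S.normal t x)

/-- `div_Γ w` at the point `(x, t)`. -/
noncomputable def divw (p : R3 × ℝ) : ℝ := S.divΓ p.2 (fun x => S.w (x, p.2)) p.1

/-- `v ∈ H¹(Γ(t))` with weak tangential gradient `g`: both are square integrable, `g` is tangential
and `∫ v div_Γ Ψ ds = -∫ g · Ψ ds` for all tangential `C¹` fields `Ψ`. -/
structure HasWeakGrad (t : ℝ) (v : R3 → ℝ) (g : R3 → R3) : Prop where
  memLp : MemLp v 2 (S.surf t)
  memLp_grad : MemLp g 2 (S.surf t)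
  tangential : ∀ᵐ x ∂S.surf t, inner ℝ (g x) (S.normal t x) = 0
  weak : ∀ Ψ : R3 → R3, ContDiff ℝ 1 Ψ → (∀ x ∈ S.Γ t, inner ℝ (Ψ x) (S.normal t x) = 0) →
    Integrable (fun x => v x * S.divΓ t Ψ x) (S.surf t) ∧
    Integrable (fun x => inner ℝ (g x) (Ψ x)) (S.surf t) ∧
    ∫ x, v x * S.divΓ t Ψ x ∂S.surf t = - ∫ x, inner ℝ (g x) (Ψ x) ∂S.surf t

/-- `c_F(t) > 0` is a constant in the Friedrichs inequality on `H¹(Γ(t))`, for each `t ∈ [0, T]`. -/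
def IsFriedrichs (cF : ℝ → ℝ) : Prop :=
  ∀ t ∈ Icc 0 S.T, 0 < cF t ∧ ∀ (v : R3 → ℝ) (g : R3 → R3), S.HasWeakGrad t v g →
    cF t * ∫ x, (v x - (S.area t)⁻¹ * ∫ y, v y ∂S.surf t) ^ 2 ∂S.surf t
      ≤ ∫ x, ‖g x‖ ^ 2 ∂S.surf t

/-- The space of pairs (square integrable function, square integrable vector field) on the
space-time manifold, with the product inner product with respect to `ds dt`. -/
abbrev L2Pair : Type :=
  WithLp 2 (Lp ℝ 2 S.stMeasure × Lp R3 2 S.stMeasure)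

variable {S} in
theorem HasWeakGrad.add {t : ℝ} {v v' : R3 → ℝ} {g g' : R3 → R3} (h : S.HasWeakGrad t v g)
    (h' : S.HasWeakGrad t v' g') : S.HasWeakGrad t (v + v') (g + g') where
  memLp := h.memLp.add h'.memLp
  memLp_grad := h.memLp_grad.add h'.memLp_grad
  tangential := by
    filter_upwards [h.tangential, h'.tangential] with x hx hx'
    simp [inner_add_left, hx, hx']
  weak Ψ hΨ hT := by
    obtain ⟨a, b, c⟩ := h.weak Ψ hΨ hT
    obtain ⟨a', b', c'⟩ := h'.weak Ψ hΨ hT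
    simp only [Pi.add_apply, add_mul, inner_add_left]
    refine ⟨a.add a', b.add b', ?_⟩
    rw [integral_add a a', integral_add b b', c, c']
    ring

variable {S} in
theorem HasWeakGrad.smul {t : ℝ} {v : R3 → ℝ} {g : R3 → R3} (r : ℝ) (h : S.HasWeakGrad t v g) :
    S.HasWeakGrad t (r • v) (r • g) where
  memLp := h.memLp.const_smul r
  memLp_grad := h.memLp_grad.const_smul r
  tangential := by
    filter_upwards [h.tangential] with x hx
    simp [inner_smul_left, hx]
  weak Ψ hΨ hT := by
    obtain ⟨a, b, c⟩ := h.weak Ψ hΨ hT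
    simp only [Pi.smul_apply, smul_eq_mul, mul_assoc, real_inner_smul_left]
    refine ⟨a.const_mul r, b.const_mul r, ?_⟩
    rw [integral_const_mul, integral_const_mul, c]
    ring

theorem HasWeakGrad.zero (t : ℝ) : S.HasWeakGrad t 0 0 where
  memLp := MemLp.zero
  memLp_grad := MemLp.zero
  tangential := by simp
  weak Ψ _ _ := by simp

/-- The Hilbert space `H` of all `v ∈ L²` with `∇_Γ v ∈ L²`. Its elements are represented as
pairs `(v, ∇_Γ v)`, so that the inherited inner product is `(u, v)₀ + (∇_Γ u, ∇_Γ v)₀`. -/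
noncomputable def H : Submodule ℝ S.L2Pair where
  carrier := {z | ∃ (v : R3 × ℝ → ℝ) (g : R3 × ℝ → R3),
    z.fst =ᵐ[S.stMeasure] v ∧ z.snd =ᵐ[S.stMeasure] g ∧
    ∀ᵐ t ∂volume.restrict (Ioo 0 S.T),
      S.HasWeakGrad t (fun x => v (x, t)) (fun x => g (x, t))}
  add_mem' := by
    rintro z z' ⟨v, g, hv, hg, h⟩ ⟨v', g', hv', hg', h'⟩
    refine ⟨v + v', g + g', (Lp.coeFn_add z.fst z'.fst).trans (hv.add hv'),
      (Lp.coeFn_add z.snd z'.snd).trans (hg.add hg'), ?_⟩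
    filter_upwards [h, h'] with t ht ht'
    exact ht.add ht'
  zero_mem' := ⟨0, 0, Lp.coeFn_zero _ _ _, Lp.coeFn_zero _ _ _,
    Eventually.of_forall fun t => HasWeakGrad.zero S t⟩
  smul_mem' := by
    rintro r z ⟨v, g, hv, hg, h⟩
    refine ⟨r • v, r • g, (Lp.coeFn_smul r z.fst).trans (hv.const_smul r),
      (Lp.coeFn_smul r z.snd).trans (hg.const_smul r), ?_⟩
    filter_upwards [h] with t ht
    exact ht.smul r

/-- The subspace of all `v ∈ H` that vanish outside the time slab `(a, b]`. -/
noncomputable def HSlab (a b : ℝ) : Submodule ℝ S.L2Pair where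
  carrier := {z | z ∈ S.H ∧ ∀ᵐ p ∂S.stMeasure, p.2 ∉ Ioc a b → z.fst p = 0}
  add_mem' := by
    rintro z z' ⟨h, h0⟩ ⟨h', h0'⟩
    refine ⟨S.H.add_mem h h', ?_⟩
    filter_upwards [h0, h0', Lp.coeFn_add z.fst z'.fst] with p hp hp' e hn
    rw [WithLp.add_fst, e, Pi.add_apply, hp hn, hp' hn, add_zero]
  zero_mem' := by
    refine ⟨S.H.zero_mem, ?_⟩
    filter_upwards [Lp.coeFn_zero ℝ 2 S.stMeasure] with p hp _
    rw [WithLp.zero_fst, hp, Pi.zero_apply]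
  smul_mem' := by
    rintro r z ⟨h, h0⟩
    refine ⟨S.H.smul_mem r h, ?_⟩
    filter_upwards [h0, Lp.coeFn_smul r z.fst] with p hp e hn
    rw [WithLp.smul_fst, e, Pi.smul_apply, hp hn, smul_zero]

/-- The material derivative `∂φ/∂t + w · ∇φ` of a `C¹` function. -/
noncomputable def matDer (φ : R3 × ℝ → ℝ) (p : R3 × ℝ) : ℝ := fderiv ℝ φ p (S.w p, 1)

/-- The functional `ℓ` extends the distributional material derivative of `z` on the slab `(a, b)`,
that is, `ℓ(φ) = -∫∫ z (φ̇ + φ div_Γ w) ds dt` for all `C¹` functions `φ` with compact support in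
the open slab. -/
def IsMaterialDeriv (a b : ℝ) (z : S.L2Pair) (ℓ : StrongDual ℝ (S.HSlab a b)) : Prop :=
  ∀ φ : R3 × ℝ → ℝ, ContDiff ℝ 1 φ → HasCompactSupport φ → tsupport φ ⊆ {p | p.2 ∈ Ioo a b} →
    ∀ ζ : S.HSlab a b, ζ.1.fst =ᵐ[S.stMeasure] φ →
      Integrable (fun p => z.fst p * (S.matDer φ p + φ p * S.divw p)) S.stMeasure ∧
      ℓ ζ = - ∫ p, z.fst p * (S.matDer φ p + φ p * S.divw p) ∂S.stMeasure

/-- The space of all `v ∈ H` that vanish outside the slab `(a, b]` and whose material derivative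
extends to a bounded linear functional on the subspace of such functions. -/
noncomputable def WSlab (a b : ℝ) : Submodule ℝ S.L2Pair where
  carrier := {z | z ∈ S.HSlab a b ∧ ∃ ℓ, S.IsMaterialDeriv a b z ℓ}
  add_mem' := by
    rintro z z' ⟨h, ℓ, hl⟩ ⟨h', ℓ', hl'⟩
    refine ⟨(S.HSlab a b).add_mem h h', ℓ + ℓ', fun φ h1 h2 h3 ζ hζ => ?_⟩
    obtain ⟨i, e⟩ := hl φ h1 h2 h3 ζ hζ
    obtain ⟨i', e'⟩ := hl' φ h1 h2 h3 ζ hζ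
    have key : (fun p => (z + z').fst p * (S.matDer φ p + φ p * S.divw p)) =ᵐ[S.stMeasure]
        (fun p => z.fst p * (S.matDer φ p + φ p * S.divw p)) +
          fun p => z'.fst p * (S.matDer φ p + φ p * S.divw p) := by
      filter_upwards [Lp.coeFn_add z.fst z'.fst] with p hp
      rw [WithLp.add_fst, hp, Pi.add_apply, Pi.add_apply, add_mul]
    refine ⟨(i.add i').congr key.symm, ?_⟩
    rw [integral_congr_ae key, integral_add' i i', _root_.add_apply, e, e']
    ring
  zero_mem' := by
    refine ⟨(S.HSlab a b).zero_mem, 0, fun φ h1 h2 h3 ζ hζ => ?_⟩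
    have key : (fun p => (0 : S.L2Pair).fst p * (S.matDer φ p + φ p * S.divw p))
        =ᵐ[S.stMeasure] 0 := by
      filter_upwards [Lp.coeFn_zero ℝ 2 S.stMeasure] with p hp
      rw [WithLp.zero_fst, hp]
      simp
    refine ⟨(integrable_zero _ _ _).congr key.symm, ?_⟩
    rw [integral_congr_ae key]
    simp
  smul_mem' := by
    rintro r z ⟨h, ℓ, hl⟩
    refine ⟨(S.HSlab a b).smul_mem r h, r • ℓ, fun φ h1 h2 h3 ζ hζ => ?_⟩
    obtain ⟨i, e⟩ := hl φ h1 h2 h3 ζ hζ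
    have key : (fun p => (r • z).fst p * (S.matDer φ p + φ p * S.divw p)) =ᵐ[S.stMeasure]
        fun p => r * (z.fst p * (S.matDer φ p + φ p * S.divw p)) := by
      filter_upwards [Lp.coeFn_smul r z.fst] with p hp
      rw [WithLp.smul_fst, hp, Pi.smul_apply, smul_eq_mul, mul_assoc]
    refine ⟨(i.const_mul r).congr key.symm, ?_⟩
    rw [integral_congr_ae key, integral_const_mul, _root_.smul_apply, e, smul_eq_mul]
    ring

/-- The material derivative of `z ∈ WSlab a b` as a bounded linear functional. (It is unique, as
the test functions are dense.) -/
noncomputable def materialDeriv {a b : ℝ} (z : S.WSlab a b) : StrongDual ℝ (S.HSlab a b) :=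
  Classical.choose z.2.2

/-- `ψ ∈ L²(Γ(s))` is the `L²` limit of `z(·, t)` as `t` tends to `s` along the filter `F`
(disregarding null sets of times), where `Γ(t)` and `Γ(s)` are identified by the flow:
`∫_{Γ(0)} |z(Φ(y, t), t) - ψ(Φ(y, s))|² ds(y) → 0`. -/
def IsTrace (F : Filter ℝ) (s : ℝ) (z : S.L2Pair) (ψ : Lp ℝ 2 (S.surf s)) : Prop :=
  Tendsto (fun t => ∫⁻ y, ‖z.fst (S.Φ (y, t), t) - ψ (S.Φ (y, s))‖ₑ ^ 2 ∂S.surf 0)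
    (F ⊓ ae (volume : Measure ℝ)) (𝓝 0)

open Classical in
/-- The trace of `z` at time `s` along the filter `F`, an element of `L²(Γ(s))`. -/
noncomputable def trace (F : Filter ℝ) (s : ℝ) (z : S.L2Pair) : Lp ℝ 2 (S.surf s) :=
  if h : ∃ ψ, S.IsTrace F s z ψ then h.choose else 0

/-- The mean quantity `ū(t) = ∫_{Γ(t)} u(s, t) ds`. -/
noncomputable def bar (z : S.L2Pair) (t : ℝ) : ℝ := ∫ x, z.fst (x, t) ∂S.surf t

/-- The bilinear form `a_σ(u, v) = ν_d (∇_Γ u, ∇_Γ v)₀ + (div_Γ w u, v)₀ + σ ∫₀ᵀ ū v̄ dt`. -/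
noncomputable def aForm (νd σ : ℝ) (u v : S.L2Pair) : ℝ :=
  νd * inner ℝ u.snd v.snd + ∫ p, S.divw p * u.fst p * v.fst p ∂S.stMeasure
    + σ * ∫ t in 0..S.T, S.bar u t * S.bar v t

end EvolvingSurface

/-- The uniform partition of `[0, T]` into `N ≥ 1` time intervals, and for each of them a
tetrahedral triangulation of the spatial domain. -/
structure SpaceTimeMesh (S : EvolvingSurface) where
  /-- the number of time intervals -/
  N : ℕ
  N_pos : 0 < N
  /-- the triangulation that belongs to a time interval -/
  tri : Fin N → Geometry.SimplicialComplex ℝ R3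
  finite : ∀ n, (tri n).faces.Finite
  pure : ∀ n, ∀ s ∈ (tri n).faces, ∃ s' ∈ (tri n).faces, s ⊆ s' ∧ s'.card = 4
  space_eq : ∀ n, (tri n).space = closure S.Ω

namespace SpaceTimeMesh

variable {S : EvolvingSurface} (D : SpaceTimeMesh S)

/-- The time `t_n = n T / N`. -/
noncomputable def time (n : ℕ) : ℝ := n * (S.T / D.N)

/-- The broken space `W^b`, the direct sum of the spaces of the slabs `(t_n, t_{n+1}]`,
`n = 0, …, N - 1`. -/
abbrev Wb : Type := (n : Fin D.N) → S.WSlab (D.time n) (D.time (n + 1))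

variable {D}

/-- The element of `H` (with its gradient) that `u ∈ W^b` is identified with. -/
noncomputable def toH (u : D.Wb) : S.L2Pair := ∑ n, (u n : S.L2Pair)

/-- The one-sided limit `u_-^n` at `t_n` from the left. -/
noncomputable def uMinus (u : D.Wb) (n : ℕ) : Lp ℝ 2 (S.surf (D.time n)) :=
  S.trace (𝓝[<] D.time n) (D.time n) (toH u)

/-- The one-sided limit `u_+^n` at `t_n` from the right. -/
noncomputable def uPlus (u : D.Wb) (n : ℕ) : Lp ℝ 2 (S.surf (D.time n)) :=
  S.trace (𝓝[>] D.time n) (D.time n) (toH u)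

/-- The jump `[u]^n = u_+^n - u_-^n`, with `[u]^0 = u_+^0`. -/
noncomputable def jump (u : D.Wb) (n : ℕ) : Lp ℝ 2 (S.surf (D.time n)) :=
  if n = 0 then uPlus u n else uPlus u n - uMinus u n

/-- The broken pairing `⟨u̇, v⟩_b = ∑ ⟨u̇_n, v_n⟩`. -/
noncomputable def derivPairing (u v : D.Wb) : ℝ :=
  ∑ n, S.materialDeriv (u n) ⟨(v n : S.L2Pair), (v n).2.1⟩

/-- The form `d(u, v) = ∑_{n=1}^N ([u]^{n-1}, v_+^{n-1})_{t_{n-1}}`. -/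
noncomputable def dForm (u v : D.Wb) : ℝ :=
  ∑ n ∈ Finset.range D.N, inner ℝ (jump u n) (uPlus v n)

/-- The stabilized broken form `⟨u̇, v⟩_b + a_σ(u, v) + d(u, v)`. -/
noncomputable def form (νd σ : ℝ) (u v : D.Wb) : ℝ :=
  derivPairing u v + S.aForm νd σ (toH u) (toH v) + dForm u v

/-- The mesh-dependent norm `|||u|||_h`. -/
noncomputable def meshNorm (u : D.Wb) : ℝ :=
  √((⨆ n : Fin D.N, ‖uMinus u (n + 1)‖ ^ 2) + ∑ n ∈ Finset.range D.N, ‖jump u n‖ ^ 2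
    + ‖toH u‖ ^ 2)

variable (D)

/-- The space of continuous functions that are affine on each tetrahedron of the `n`-th
triangulation. -/
def P1 (n : Fin D.N) : Set (R3 → ℝ) :=
  {φ | ContinuousOn φ (closure S.Ω) ∧ ∀ s ∈ (D.tri n).faces, s.card = 4 →
    ∃ A : R3 →ᵃ[ℝ] ℝ, EqOn φ A (convexHull ℝ (s : Set R3))}

/-- The surface finite element space `W_h`, as a subset of `W^b`: in each time slab the function is
the trace on the space-time manifold of `φ₀(x) + t φ₁(x)` with continuous piecewise affine
`φ₀` and `φ₁`. -/
def Wh : Set D.Wb :=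
  {u | ∀ n : Fin D.N, ∃ φ₀ ∈ D.P1 n, ∃ φ₁ ∈ D.P1 n, ∀ᵐ p ∂S.stMeasure,
    p.2 ∈ Ioc (D.time n) (D.time (n + 1)) →
      (u n : S.L2Pair).fst p = φ₀ p.1 + p.2 * φ₁ p.1}

/-- The inf-sup value `inf_{0 ≠ u ∈ X} sup_{0 ≠ v ∈ X} B(u, v) / (|||v|||_h |||u|||_h)`, where `B` is
the stabilized broken form. -/
noncomputable def infSup (νd σ : ℝ) (X : Set D.Wb) : EReal :=
  ⨅ u ∈ X \ {0}, ⨆ v ∈ X \ {0}, ((form νd σ u v / (meshNorm v * meshNorm u) : ℝ) : EReal)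

end SpaceTimeMesh

/-! The test functions are multiples of `u` that are constant on each slab. On one slab the energy
identity reads 2⟨u̇, u⟩ = ‖u_-‖² - ‖u_+‖² - (div_Γ w u, u)₀, where u_- belongs to the end and u_+ to
the beginning of the slab. The jump term is (u_+ - u_-, u_+) = ½ (‖u_+‖² + ‖[u]‖² - ‖u_-‖²), with
u_- now taken from the previous slab, so the sum over the slabs telescopes. The remainder -½ (div_Γ
w u, u)₀ is absorbed by a_σ: half of the diffusion is spent on the Friedrichs inequality, the σ term
pays for the mean value, and together with half of the divergence term this leaves ½ c₀ ‖u‖²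
(`aForm_coercive`). Summation gives the coercivity estimate (`form_self_ge`).

The mesh norm contains the largest of the ‖u_-^n‖, not only the last one. If the maximum is attained
at the end of slab k, the test function is 3u up to slab k and u afterwards. This adds twice the
energy estimate up to slab k, which contains the maximum, at the price of one enlarged jump. The
elementary inequality `weight_inequality` shows that the constant is then exactly c_s
(`exists_test_ge`). Slabwise multiples of an element of W_h stay in W_h, which is why no condition
on the meshes appears.

Most of the work goes into the one-sided limits and the energy identity on a slab
(`exists_isTrace`). A function on the moving surface is pulled back by the flow and multiplied by
the square root of the area distortion. Norms in L²(Γ(t)) become norms in the fixed space L²(Γ(0)),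
and the material derivative becomes a weak time derivative, up to the term ½ div_Γ w. The Lions
lemma then applies (`exists_tendsto_and_energy_identity_of_weak`). Its use requires the area formula
and the divergence theorem on a closed surface, the density of smooth functions among the weakly
differentiable ones (because u(s) itself has to serve as a test function), and the facts that the
flow is an injective immersion of Γ(0) with a smooth inverse and that its area distortion obeys
Liouville's formula. -/

open scoped Convolution

/-! ### Weak derivatives on an interval -/

/-- A form of the du Bois-Reymond lemma: if the distributional derivative of `α` on `(a, b)` is the
integrable function `β`, then `α` agrees almost everywhere with a primitive of `β`. -/
theorem exists_ae_eq_const_add_integral {a b : ℝ} (hab : a < b) {α β : ℝ → ℝ}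
    (hα : IntegrableOn α (Ioo a b)) (hβ : IntegrableOn β (Ioo a b))
    (h : ∀ θ : ℝ → ℝ, ContDiff ℝ ∞ θ → HasCompactSupport θ → tsupport θ ⊆ Ioo a b →
      ∫ t in Ioo a b, deriv θ t * α t = - ∫ t in Ioo a b, θ t * β t) :
    ∃ c, ∀ᵐ t ∂volume.restrict (Ioo a b), α t = c + ∫ s in a..t, β s := by
  have hβi : IntervalIntegrable β volume a b :=
    (intervalIntegrable_iff_integrableOn_Ioo_of_le hab.le).2 hβ
  set B : ℝ → ℝ := fun t => ∫ s in a..t, β s with hB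
  have hBac : AbsolutelyContinuousOnInterval B a b :=
    hβi.absolutelyContinuousOnInterval_intervalIntegral (by simp)
  have hBint : IntegrableOn B (Ioo a b) := by
    have := hBac.continuousOn
    rw [uIcc_of_le hab.le] at this
    exact (this.integrableOn_Icc).mono_set Ioo_subset_Icc_self
  have hBd : ∀ᵐ t, t ∈ Ioo a b → deriv B t = β t := by
    filter_upwards [hβi.ae_hasDerivAt_integral] with t ht htI
    exact (ht (by rw [uIcc_of_le hab.le]; exact Ioo_subset_Icc_self htI) a (by simp)).deriv
  -- Subtracting the primitive leaves a function with vanishing weak derivative, which has to be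
  -- constant.
  set γ : ℝ → ℝ := fun t => α t - B t with hγ
  have hγint : IntegrableOn γ (Ioo a b) := hα.sub hBint
  have key : ∀ θ : ℝ → ℝ, ContDiff ℝ ∞ θ → HasCompactSupport θ → tsupport θ ⊆ Ioo a b →
      ∫ t in Ioo a b, deriv θ t * γ t = 0 := by
    intro θ h1 h2 h3
    have hθac : AbsolutelyContinuousOnInterval θ a b :=
      ((h1.of_le (by norm_num)).contDiffOn).absolutelyContinuousOnInterval
    have hz : ∀ t, t ∉ Ioo a b → θ t = 0 := fun t ht =>
      image_eq_zero_of_notMem_tsupport fun hh => ht (h3 hh)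
    have e := hθac.integral_mul_deriv_eq_deriv_mul hBac
    rw [hz a (by simp), hz b (by simp)] at e
    simp only [zero_mul, sub_zero, zero_sub] at e
    rw [intervalIntegral.integral_of_le hab.le, intervalIntegral.integral_of_le hab.le,
      integral_Ioc_eq_integral_Ioo, integral_Ioc_eq_integral_Ioo] at e
    have e2 : ∫ t in Ioo a b, θ t * deriv B t = ∫ t in Ioo a b, θ t * β t := by
      refine setIntegral_congr_ae measurableSet_Ioo ?_
      filter_upwards [hBd] with t ht hti
      rw [ht hti]
    have hdc : Continuous (deriv θ) := h1.continuous_deriv (by norm_num)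
    obtain ⟨C, hC⟩ := (h2.deriv).exists_bound_of_continuous hdc
    have i1 : IntegrableOn (fun t => deriv θ t * α t) (Ioo a b) :=
      hα.bdd_mul hdc.aestronglyMeasurable (c := C) (Eventually.of_forall hC)
    have i2 : IntegrableOn (fun t => deriv θ t * B t) (Ioo a b) :=
      hBint.bdd_mul hdc.aestronglyMeasurable (c := C) (Eventually.of_forall hC)
    simp only [hγ, mul_sub]
    rw [integral_sub i1 i2, h θ h1 h2 h3]
    linarith
  -- a normalized bump
  obtain ⟨m, hm⟩ : ∃ m, m ∈ Ioo a b := ⟨(a + b) / 2, by constructor <;> linarith⟩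
  obtain ⟨r, hr, hrb⟩ := Metric.isOpen_iff.1 isOpen_Ioo m hm
  let f : ContDiffBump m := ⟨r / 4, r / 2, by positivity, by linarith⟩
  let χ : ℝ → ℝ := f.normed volume
  have χ1 : ContDiff ℝ ∞ χ := f.contDiff_normed
  have χ2 : HasCompactSupport χ := f.hasCompactSupport_normed
  have χ3 : tsupport χ ⊆ Ioo a b := by
    rw [f.tsupport_normed_eq]
    exact (Metric.closedBall_subset_ball (show r / 2 < r by linarith)).trans hrb
  have χ4 : ∫ t, χ t = 1 := f.integral_normed
  -- The only possible value of the constant, since the bump has integral one.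
  set c := ∫ t in Ioo a b, χ t * γ t with hc
  refine ⟨c, ?_⟩
  have hfin : ∀ᵐ t, t ∈ Ioo a b → γ t - c = 0 := by
    refine isOpen_Ioo.ae_eq_zero_of_integral_contDiff_smul_eq_zero ?_ ?_
    · exact (hγint.sub (integrableOn_const (by simp))).locallyIntegrableOn
    intro g g1 g2 g3
    -- primitive of `g - (∫ g) χ`
    set k : ℝ → ℝ := fun t => g t - (∫ s, g s) * χ t with hk
    have k1 : ContDiff ℝ ∞ k := g1.sub (contDiff_const.mul χ1)
    have k2 : HasCompactSupport k := g2.sub χ2.mul_left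
    have k3 : tsupport k ⊆ Ioo a b := by
      refine (tsupport_sub _ _).trans (union_subset g3 ?_)
      exact (closure_mono (Function.support_mul_subset_right _ _)).trans χ3
    have gint : Integrable g := g1.continuous.integrable_of_hasCompactSupport g2
    have χint : Integrable χ := χ1.continuous.integrable_of_hasCompactSupport χ2
    have kint : Integrable k := k1.continuous.integrable_of_hasCompactSupport k2
    have k4 : ∫ t, k t = 0 := by
      simp only [hk]
      rw [integral_sub gint (χint.const_mul _), integral_const_mul, χ4]; ring
    have kz : ∀ t, t ∉ tsupport k → k t = 0 := fun t ht => image_eq_zero_of_notMem_tsupport ht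
    set θ : ℝ → ℝ := fun t => ∫ s in a..t, k s with hθ
    have hθd : ∀ t, HasDerivAt θ (k t) t := fun t =>
      intervalIntegral.integral_hasDerivAt_right (kint.intervalIntegrable)
        k1.continuous.aestronglyMeasurable.stronglyMeasurableAtFilter k1.continuous.continuousAt
    have hθ' : deriv θ = k := funext fun t => (hθd t).deriv
    have hθ1 : ContDiff ℝ ∞ θ := by
      rw [contDiff_infty_iff_deriv]
      exact ⟨fun t => (hθd t).differentiableAt, by rw [hθ']; exact k1⟩
    -- support of θ
    obtain ⟨p, q, hp, hq, hpq⟩ : ∃ p q, a < p ∧ q < b ∧ tsupport k ⊆ Icc p q := by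
      rcases (tsupport k).eq_empty_or_nonempty with he | hne
      · exact ⟨a + 1, b - 1, by linarith, by linarith, by simp [he]⟩
      · obtain ⟨p, hp, hp'⟩ := k2.isCompact.exists_isLeast hne
        obtain ⟨q, hq, hq'⟩ := k2.isCompact.exists_isGreatest hne
        exact ⟨p, q, (k3 hp).1, (k3 hq).2, fun x hx => ⟨hp' hx, hq' hx⟩⟩
    -- To the left of the support of k the primitive is still zero; to the right it equals ∫ k = 0.
    -- Hence the primitive is an admissible test function.
    have hθz : ∀ t, t ∉ Icc p q → θ t = 0 := by
      intro t ht
      by_cases htp : t < p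
      · refine intervalIntegral.integral_zero_ae (Eventually.of_forall fun s hs => kz s fun hs' => ?_)
        have h1 := (hpq hs').1
        rcases uIoc_subset_uIcc hs with ⟨h3, h4⟩
        have : s ≤ max a t := h4
        rcases le_max_iff.1 this with h | h <;> linarith
      · have htq : q < t := by
          by_contra hh; exact ht ⟨not_lt.1 htp, not_lt.1 hh⟩
        have : ∫ s in a..t, k s = ∫ s, k s := by
          rcases (tsupport k).eq_empty_or_nonempty with he | ⟨x0, hx0⟩
          · have : k = 0 := by
              funext x; exact kz x (by simp [he])
            simp [this]
          have hxp := hpq hx0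
          rw [intervalIntegral.integral_eq_integral_of_support_subset]
          intro s hs
          have := hpq (subset_tsupport _ hs)
          exact ⟨by linarith [this.1], by linarith [this.2]⟩
        simp only [hθ]
        rw [this, k4]
    have hts : tsupport θ ⊆ Icc p q := by
      refine closure_minimal (fun x hx => ?_) isClosed_Icc
      by_contra hh
      exact hx (hθz x hh)
    have := key θ hθ1 (HasCompactSupport.of_support_subset_isCompact isCompact_Icc
      ((subset_tsupport _).trans hts)) (hts.trans fun x hx => ⟨by linarith [hx.1], by linarith [hx.2]⟩)
    rw [hθ'] at this
    have gz : ∀ t, t ∉ Ioo a b → g t = 0 := fun t ht =>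
      image_eq_zero_of_notMem_tsupport fun hh => ht (g3 hh)
    have bdd : ∀ u : ℝ → ℝ, Continuous u → HasCompactSupport u →
        IntegrableOn (fun t => u t * γ t) (Ioo a b) := by
      intro u hu hu'
      obtain ⟨C, hC⟩ := hu'.exists_bound_of_continuous hu
      exact hγint.bdd_mul hu.aestronglyMeasurable (c := C) (Eventually.of_forall hC)
    have e1 : ∫ t in Ioo a b, k t * γ t
        = (∫ t in Ioo a b, g t * γ t) - (∫ s, g s) * c := by
      simp only [hk, sub_mul, mul_assoc]
      rw [integral_sub (bdd g g1.continuous g2) ((bdd χ χ1.continuous χ2).const_mul _),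
        integral_const_mul]
    rw [← setIntegral_eq_integral_of_forall_compl_eq_zero (s := Ioo a b)
      (fun x hx => by rw [gz x hx, zero_smul])]
    simp only [smul_eq_mul, mul_sub]
    rw [integral_sub (bdd g g1.continuous g2) (gint.integrableOn.mul_const c), integral_mul_const,
      setIntegral_eq_integral_of_forall_compl_eq_zero gz, ← e1, this]
  rw [ae_restrict_iff' measurableSet_Ioo]
  filter_upwards [hfin] with t ht hti
  have := ht hti
  simp only [hγ] at this
  linarith

/-! ### Translations in L² -/

section Translation

variable {E F : Type*} [NormedAddCommGroup E] [MeasurableSpace E] [BorelSpace E]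
  [NormedSpace ℝ E] [FiniteDimensional ℝ E] [NormedAddCommGroup F]
  (μ : Measure E) [μ.IsAddHaarMeasure]

/-- Translation on `L²`. -/
noncomputable def translateL2 (h : E) (f : Lp F 2 μ) : Lp F 2 μ :=
  Lp.compMeasurePreserving (fun x => x + h) (measurePreserving_add_right μ h) f

omit [NormedSpace ℝ E] [FiniteDimensional ℝ E] in
theorem translateL2_coeFn (h : E) (f : Lp F 2 μ) :
    translateL2 μ h f =ᵐ[μ] fun x => f (x + h) :=
  Lp.coeFn_compMeasurePreserving f (measurePreserving_add_right μ h)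

/-- Strong continuity of translations. It provides the limits of difference quotients and of
mollified pairings for functions that are merely square integrable. -/
theorem continuous_translateL2 (f : Lp F 2 μ) : Continuous fun h : E => translateL2 μ h f := by
  have : Continuous fun h : E => (⟨fun x => x + h, by fun_prop⟩ : C(E, E)) := by
    let g : C(E × E, E) := ⟨fun p => p.2 + p.1, by fun_prop⟩
    exact g.curry.continuous
  exact Continuous.compMeasurePreservingLp (f := fun _ : E => f) continuous_const this
    (fun h => measurePreserving_add_right μ h) (by simp)

end Translation

/-! ### The abstract Lions lemma: one-sided limits and the energy identity -/

section Lions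

variable {V L : Type*} [NormedAddCommGroup V] [InnerProductSpace ℝ V]
  [NormedAddCommGroup L] [InnerProductSpace ℝ L]

theorem intervalIntegrable_inner_left (R : Lp V 2 (volume : Measure ℝ)) (v : V) (s t : ℝ) :
    IntervalIntegrable (fun r => inner ℝ (R r) v) volume s t := by
  have hR : LocallyIntegrable R volume := (Lp.memLp R).locallyIntegrable (by norm_num)
  have h1 : IntegrableOn R (uIcc s t) := hR.integrableOn_isCompact isCompact_uIcc
  rw [intervalIntegrable_iff]
  exact Integrable.inner_const (h1.mono_set uIoc_subset_uIcc) v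

/-- Time derivative of `‖i U‖²`, in the sense of distributions. -/
theorem integral_deriv_mul_norm_sq {a b : ℝ} (i : V →L[ℝ] L)
    (U R : Lp V 2 (volume : Measure ℝ)) {Z : Set ℝ}
    (hZ : ∀ᵐ t, t ∈ Ioo a b → t ∈ Z)
    (H : ∀ s ∈ Z, ∀ t ∈ Z, inner ℝ (i (U t) - i (U s)) (i (U s)) = ∫ r in s..t, inner ℝ (R r) (U s))
    {θ : ℝ → ℝ} (h1 : ContDiff ℝ ∞ θ) (h2 : HasCompactSupport θ) (h3 : tsupport θ ⊆ Ioo a b) :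
    ∫ t, deriv θ t * ‖i (U t)‖ ^ 2 = - ∫ t, θ t * (2 * inner ℝ (R t) (U t)) := by
  set N : ℝ → ℝ := fun t => ‖i (U t)‖ ^ 2 with hN
  have hNint : Integrable N := by
    have := (i.comp_memLp' (Lp.memLp U))
    exact this.integrable_norm_pow (by norm_num)
  have hθb : ∃ C, ∀ x, ‖θ x‖ ≤ C := h2.exists_bound_of_continuous h1.continuous
  obtain ⟨C, hC⟩ := hθb
  have hθtop : MemLp θ ∞ (volume : Measure ℝ) :=
    memLp_top_of_bound h1.continuous.aestronglyMeasurable C (Eventually.of_forall hC)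
  -- Multiplication by θ is a bounded operator on L², so the pairing below is an L² inner product
  -- and depends continuously on translations.
  let mθ : Lp V 2 (volume : Measure ℝ) →L[ℝ] Lp V 2 (volume : Measure ℝ) :=
    (ContinuousLinearMap.lsmul ℝ ℝ : ℝ →L[ℝ] V →L[ℝ] V).holderL volume ∞ 2 2 (hθtop.toLp θ)
  have mθ_coe : ∀ f : Lp V 2 (volume : Measure ℝ), mθ f =ᵐ[volume] fun r => θ r • f r := by
    intro f
    filter_upwards [(ContinuousLinearMap.lsmul ℝ ℝ : ℝ →L[ℝ] V →L[ℝ] V).coeFn_holder (r := 2)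
      (hθtop.toLp θ) f, hθtop.coeFn_toLp] with r hr hr'
    change (ContinuousLinearMap.holder 2 _ (hθtop.toLp θ) f : ℝ → V) r = _
    rw [hr, hr']; rfl
  -- Averaged over p ∈ (0, 1) this is the difference quotient `D h` below. It is jointly continuous
  -- although neither U nor R has any regularity in time.
  let A : ℝ → ℝ → ℝ := fun h p =>
    inner ℝ (translateL2 volume (p * h) R) (mθ (U + translateL2 volume h U))
  have A_cont : Continuous (Function.uncurry A) := by
    have c1 := continuous_translateL2 (volume : Measure ℝ) R
    have c2 := continuous_translateL2 (volume : Measure ℝ) U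
    simp only [A, Function.uncurry_def]
    fun_prop
  have A_eq : ∀ h p, A h p = ∫ r, θ r * inner ℝ (R (r + p * h)) (U r + U (r + h)) := by
    intro h p
    simp only [A, L2.inner_def]
    refine integral_congr_ae ?_
    filter_upwards [mθ_coe (U + translateL2 volume h U), Lp.coeFn_add U (translateL2 volume h U),
      translateL2_coeFn volume (p * h) R, translateL2_coeFn volume h U] with r e1 e2 e3 e4
    rw [e1, e2, e3, Pi.add_apply, e4, real_inner_smul_right]
  have A_zero : ∀ p, A 0 p = ∫ t, θ t * (2 * inner ℝ (R t) (U t)) := by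
    intro p
    rw [A_eq]
    refine integral_congr_ae (Eventually.of_forall fun r => ?_)
    simp only [mul_zero, add_zero, inner_add_right]
    ring
  -- The difference quotient of ‖i U‖² tested with θ. Its limit as h ↓ 0 is computed in two ways: by
  -- moving the quotient on to θ, and from the hypothesis on increments.
  set D : ℝ → ℝ := fun h => ∫ r, h⁻¹ * (θ r * (N (r + h) - N r)) with hD
  -- first limit
  have lim1 : Tendsto D (𝓝[>] 0) (𝓝 (- ∫ t, deriv θ t * N t)) := by
    have e : ∀ h, D h = ∫ r, h⁻¹ * (θ (r - h) - θ r) * N r := by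
      intro h
      simp only [hD, mul_assoc]
      rw [integral_const_mul, integral_const_mul]
      congr 1
      have j1 : Integrable fun r => θ r * N (r + h) :=
        (hNint.comp_add_right h).bdd_mul h1.continuous.aestronglyMeasurable (c := C)
          (Eventually.of_forall hC)
      have j2 : Integrable fun r => θ r * N r :=
        hNint.bdd_mul h1.continuous.aestronglyMeasurable (c := C) (Eventually.of_forall hC)
      have j3 : Integrable fun r => θ (r - h) * N r :=
        hNint.bdd_mul (h1.continuous.comp (continuous_id.sub continuous_const)).aestronglyMeasurable
          (c := C) (Eventually.of_forall fun r => hC _)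
      simp only [mul_sub, sub_mul]
      rw [integral_sub j1 j2, integral_sub j3 j2]
      congr 1
      rw [← integral_add_right_eq_self (fun r => θ (r - h) * N r) h]
      simp
    rw [← integral_neg]
    obtain ⟨K, hK⟩ := h1.lipschitzWith_of_hasCompactSupport h2 (by simp)
    have : Tendsto (fun h => ∫ r, h⁻¹ * (θ (r - h) - θ r) * N r) (𝓝[>] 0)
        (𝓝 (∫ t, -(deriv θ t * N t))) := by
      refine tendsto_integral_filter_of_dominated_convergence (fun r => K * N r) ?_ ?_
        (hNint.const_mul _) ?_
      · refine Eventually.of_forall fun h => ?_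
        exact AEStronglyMeasurable.mul (Continuous.aestronglyMeasurable (by
          have := h1.continuous; fun_prop)) hNint.aestronglyMeasurable
      · filter_upwards [self_mem_nhdsWithin] with h hh
        refine Eventually.of_forall fun r => ?_
        have hh0 : 0 < h := hh
        have h5 := hK.dist_le_mul (r - h) r
        rw [Real.dist_eq, Real.dist_eq] at h5
        have : |r - h - r| = h := by
          rw [show r - h - r = -h by ring, abs_neg, abs_of_pos hh0]
        rw [this] at h5
        rw [norm_mul, norm_mul, Real.norm_eq_abs, Real.norm_eq_abs, Real.norm_eq_abs,
          abs_of_nonneg (sq_nonneg ‖i (U r)‖), abs_inv, abs_of_pos hh0]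
        refine mul_le_mul_of_nonneg_right ?_ (sq_nonneg _)
        rw [inv_mul_le_iff₀ hh0]; linarith
      · refine Eventually.of_forall fun r => ?_
        have hd : HasDerivAt (fun h => θ (r - h)) (-(deriv θ r)) 0 := by
          have h6 : HasDerivAt θ (deriv θ (r - 0)) (r - 0) :=
            ((h1.differentiable (by simp)) _).hasDerivAt
          have := HasDerivAt.comp_const_sub (x := 0) r h6
          simpa using this
        have := hd.tendsto_slope_zero_right
        simp only [zero_add, sub_zero, smul_eq_mul] at this
        have := this.mul_const (N r)
        simpa [neg_mul] using this
    exact this.congr fun h => (e h).symm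
  -- second limit
  obtain ⟨p, q, hp, hq, hpq⟩ : ∃ p q, a < p ∧ q < b ∧ tsupport θ ⊆ Icc p q := by
    rcases (tsupport θ).eq_empty_or_nonempty with he | hne
    · exact ⟨a + 1, b - 1, by linarith, by linarith, by simp [he]⟩
    · obtain ⟨p, hp, hp'⟩ := h2.isCompact.exists_isLeast hne
      obtain ⟨q, hq, hq'⟩ := h2.isCompact.exists_isGreatest hne
      exact ⟨p, q, (h3 hp).1, (h3 hq).2, fun x hx => ⟨hp' hx, hq' hx⟩⟩
  have D_eq : ∀ h, 0 < h → h < b - q → D h = ∫ p in (0 : ℝ)..1, A h p := by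
    intro h hh0 hhb
    have hZ' : ∀ᵐ t, t + h ∈ Ioo a b → t + h ∈ Z :=
      (quasiMeasurePreserving_add_right volume h).ae hZ
    have s1 : D h = ∫ r, ∫ p in (0 : ℝ)..1, θ r * inner ℝ (R (r + p * h)) (U r + U (r + h)) := by
      refine integral_congr_ae ?_
      filter_upwards [hZ, hZ'] with r hr hr'
      by_cases hθr : θ r = 0
      · simp [hθr]
      have hr0 := hpq (subset_tsupport _ hθr)
      have rZ : r ∈ Z := hr ⟨by linarith [hr0.1], by linarith [hr0.2]⟩
      have rZ' : r + h ∈ Z := hr' ⟨by linarith [hr0.1], by linarith [hr0.2]⟩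
      -- The increment is tested with both of its end values. The sum of the two pairings is the
      -- difference of the squares, with no quadratic remainder.
      have f1 := H r rZ (r + h) rZ'
      have f2 := H (r + h) rZ' r rZ
      rw [intervalIntegral.integral_symm] at f2
      have f3 : N (r + h) - N r = ∫ x in r..r + h, inner ℝ (R x) (U r + U (r + h)) := by
        simp only [inner_add_right]
        rw [intervalIntegral.integral_add (intervalIntegrable_inner_left R _ _ _)
          (intervalIntegrable_inner_left R _ _ _), ← f1]
        have : ∫ x in r..r + h, inner ℝ (R x) (U (r + h))
            = - inner ℝ (i (U r) - i (U (r + h))) (i (U (r + h))) := by linarith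
        rw [this]
        simp only [hN, inner_sub_left, real_inner_self_eq_norm_sq]
        rw [real_inner_comm (i (U (r + h)))]
        ring
      rw [f3, intervalIntegral.integral_const_mul]
      have := intervalIntegral.integral_comp_add_mul
        (fun x => inner ℝ (R x) (U r + U (r + h))) hh0.ne' r (a := 0) (b := 1)
      simp only [mul_zero, add_zero, mul_one, smul_eq_mul] at this
      simp_rw [mul_comm _ h]
      rw [this]; ring
    rw [s1]
    simp_rw [A_eq, intervalIntegral.integral_of_le zero_le_one]
    rw [integral_integral_swap]
    -- integrability on the product
    have hmp : MeasurePreserving (fun z : ℝ × ℝ => z.1 + z.2 * h) 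
        (volume.prod (volume.restrict (Ioc (0 : ℝ) 1))) volume := by
      refine ⟨by fun_prop, ?_⟩
      ext s hs
      rw [Measure.map_apply (by fun_prop) hs, Measure.prod_apply_symm (by
        exact (show Measurable fun z : ℝ × ℝ => z.1 + z.2 * h by fun_prop) hs)]
      have : ∀ y : ℝ, volume ((fun x => (x, y)) ⁻¹' ((fun z : ℝ × ℝ => z.1 + z.2 * h) ⁻¹' s))
          = volume s := fun y => by
        exact measure_preimage_add_right volume (y * h) s
      simp [this]
    have g1 : MemLp (fun z : ℝ × ℝ => R (z.1 + z.2 * h)) 2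
        (volume.prod (volume.restrict (Ioc (0 : ℝ) 1))) :=
      (Lp.memLp R).comp_measurePreserving hmp
    have g2 : MemLp (fun r : ℝ => θ r • (U r + U (r + h))) 2 volume := by
      refine (Lp.memLp (mθ (U + translateL2 volume h U))).ae_eq ?_
      filter_upwards [mθ_coe (U + translateL2 volume h U), Lp.coeFn_add U (translateL2 volume h U),
        translateL2_coeFn volume h U] with r e1 e2 e4
      rw [e1, e2, Pi.add_apply, e4]
    have g3 : MemLp (fun z : ℝ × ℝ => θ z.1 • (U z.1 + U (z.1 + h))) 2
        (volume.prod (volume.restrict (Ioc (0 : ℝ) 1))) := by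
      have : MeasurePreserving (Prod.fst : ℝ × ℝ → ℝ) 
        (volume.prod (volume.restrict (Ioc (0 : ℝ) 1))) volume := by
        have hprob : IsProbabilityMeasure (volume.restrict (Ioc (0 : ℝ) 1)) := ⟨by simp⟩
        exact measurePreserving_fst
      exact g2.comp_measurePreserving this
    refine (L2.integrable_inner (𝕜 := ℝ) (g1.toLp _) (g3.toLp _)).congr ?_
    filter_upwards [g1.coeFn_toLp, g3.coeFn_toLp] with z e1 e2
    rw [e1, e2, real_inner_smul_right]
    rfl
  have lim2 : Tendsto D (𝓝[>] 0) (𝓝 (∫ t, θ t * (2 * inner ℝ (R t) (U t)))) := by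
    have c : Continuous fun h => ∫ p in (0 : ℝ)..1, A h p :=
      intervalIntegral.continuous_parametric_intervalIntegral_of_continuous' A_cont 0 1
    have := (c.tendsto 0).mono_left (nhdsWithin_le_nhds (s := Ioi 0))
    simp only [A_zero, intervalIntegral.integral_const, sub_zero, one_smul] at this
    refine this.congr' ?_
    rcases (lt_or_ge q b) with hqb | hqb
    · filter_upwards [self_mem_nhdsWithin, nhdsWithin_le_nhds (Iio_mem_nhds (sub_pos.2 hqb))]
        with h h0 h0'
      exact (D_eq h h0 h0').symm
    · linarith
  have := tendsto_nhds_unique lim1 lim2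
  linarith


/-- A Cauchy estimate near an end point. ‖i U(t) - i U(s)‖² equals ‖i U(t)‖² - ‖i U(s)‖² - 2 ∫ ⟨R,
U(s)⟩, and the V-norm of U(s) is not controlled for arbitrary s. If s is chosen where ‖U(s)‖² does
not exceed its mean over (c, d), then √(d - c) ‖U(s)‖ ≤ ‖U‖, and √(d - c) is precisely the factor
that Cauchy–Schwarz supplies. The resulting bound tends to zero with the length of the interval. -/
theorem exists_forall_norm_sub_sq_le {a b c d : ℝ} (i : V →L[ℝ] L)
    (U R : Lp V 2 (volume : Measure ℝ)) {Z : Set ℝ} (hZ : ∀ᵐ t, t ∈ Ioo a b → t ∈ Z)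
    (H : ∀ s ∈ Z, ∀ t ∈ Z, inner ℝ (i (U t) - i (U s)) (i (U s)) = ∫ r in s..t, inner ℝ (R r) (U s))
    {β : ℝ → ℝ} {k : ℝ} (hβ : IntervalIntegrable β volume a b)
    (hN : ∀ t ∈ Z, ‖i (U t)‖ ^ 2 = k + ∫ s in a..t, β s)
    (hac : a ≤ c) (hcd : c < d) (hdb : d ≤ b) :
    ∃ s ∈ Z ∩ Ioo c d, ∀ t ∈ Z ∩ Ioo c d, ‖i (U t) - i (U s)‖ ^ 2 ≤
      (∫ r in c..d, |β r|) + 2 * (‖U‖ * √(∫ r in c..d, ‖R r‖ ^ 2)) := by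
  have hU2 : Integrable fun t => ‖U t‖ ^ 2 := (Lp.memLp U).integrable_norm_pow (by norm_num)
  have hR2 : Integrable fun t => ‖R t‖ ^ 2 := (Lp.memLp R).integrable_norm_pow (by norm_num)
  have hvol : volume (Ioo c d) = ENNReal.ofReal (d - c) := Real.volume_Ioo
  have hUn : ∫ t, ‖U t‖ ^ 2 = ‖U‖ ^ 2 := by
    rw [← real_inner_self_eq_norm_sq U, L2.inner_def]
    simp
  obtain ⟨s, hs, hsn, hsle⟩ : ∃ s, s ∈ Ioo c d ∧ s ∈ Z ∧ ‖U s‖ ^ 2 ≤ ⨍ t in Ioo c d, ‖U t‖ ^ 2 := by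
    set Bad : Set ℝ := {t | ¬ (t ∈ Ioo a b → t ∈ Z)} 
    have hBad : volume.restrict (Ioo c d) (Bad ∪ (Ioo c d)ᶜ) = 0 := by
      have h0 : volume Bad = 0 := hZ
      refine measure_union_null (Measure.absolutelyContinuous_of_le Measure.restrict_le_self h0) ?_
      rw [Measure.restrict_apply' measurableSet_Ioo]
      simp
    have hne : volume.restrict (Ioo c d) ≠ 0 := by
      rw [Ne, Measure.restrict_eq_zero, hvol]; simp [hcd]
    have hfin : IsFiniteMeasure (volume.restrict (Ioo c d)) := ⟨by simp⟩
    obtain ⟨s, hs, hs'⟩ := exists_notMem_null_le_average hne hU2.integrableOn hBad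
    simp only [mem_union, not_or, mem_compl_iff, not_not, Bad, mem_ofPred_eq] at hs
    exact ⟨s, hs.2, hs.1 ⟨by linarith [hs.2.1], by linarith [hs.2.2]⟩, hs'⟩
  have hs3 : (d - c) * ‖U s‖ ^ 2 ≤ ‖U‖ ^ 2 := by
    rw [setAverage_eq, Measure.real, hvol, ENNReal.toReal_ofReal (by linarith), smul_eq_mul] at hsle
    have h0 : 0 < d - c := by linarith
    rw [← hUn]
    calc (d - c) * ‖U s‖ ^ 2 ≤ (d - c) * ((d - c)⁻¹ * ∫ t in Ioo c d, ‖U t‖ ^ 2) := by gcongr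
      _ = ∫ t in Ioo c d, ‖U t‖ ^ 2 := by field_simp
      _ ≤ _ := setIntegral_le_integral hU2 (Eventually.of_forall fun t => sq_nonneg _)
  refine ⟨s, ⟨hsn, hs⟩, fun t ⟨htZ, ht⟩ => ?_⟩
  have e1 : ‖i (U t) - i (U s)‖ ^ 2 = (‖i (U t)‖ ^ 2 - ‖i (U s)‖ ^ 2)
      - 2 * ∫ r in s..t, inner ℝ (R r) (U s) := by
    rw [← H s hsn t htZ, inner_sub_left, real_inner_self_eq_norm_sq, norm_sub_sq_real]
    ring
  have hst : uIoc s t ⊆ Ioc c d := by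
    intro x hx
    rcases mem_uIoc.1 hx with h | h
    · exact ⟨by linarith [hs.1, h.1], by linarith [ht.2, h.2]⟩
    · exact ⟨by linarith [ht.1, h.1], by linarith [hs.2, h.2]⟩
  have hβcd : IntegrableOn β (Ioc c d) := by
    have := (intervalIntegrable_iff_integrableOn_Ioc_of_le (by linarith)).1 hβ
    exact this.mono_set (Ioc_subset_Ioc hac hdb)
  have e2 : ‖i (U t)‖ ^ 2 - ‖i (U s)‖ ^ 2 ≤ ∫ r in c..d, |β r| := by
    have hsub : ∀ x ∈ Ioo c d, IntervalIntegrable β volume a x := fun x hx =>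
      hβ.mono_set (by
        rw [uIcc_of_le (by linarith [hx.1]), uIcc_of_le (by linarith)]
        exact Icc_subset_Icc_right (by linarith [hx.2]))
    rw [hN t htZ, hN s hsn, add_sub_add_left_eq_sub,
      intervalIntegral.integral_interval_sub_left (hsub t ht) (hsub s hs)]
    refine (le_abs_self _).trans ?_
    rw [← Real.norm_eq_abs]
    refine intervalIntegral.norm_integral_le_integral_norm_uIoc.trans ?_
    rw [intervalIntegral.integral_of_le hcd.le]
    exact setIntegral_mono_set hβcd.norm (Eventually.of_forall fun x => norm_nonneg _)
      hst.eventuallyLE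
  have hRi : IntegrableOn (fun r => ‖R r‖) (Ioc c d) := by
    have hR : LocallyIntegrable R volume := (Lp.memLp R).locallyIntegrable (by norm_num)
    exact ((hR.integrableOn_isCompact isCompact_Icc).mono_set Ioc_subset_Icc_self).norm
  have e3 : ∫ r in Ioc c d, ‖R r‖ ≤ √(d - c) * √(∫ r in c..d, ‖R r‖ ^ 2) := by
    have h1 : MemLp (fun r => ‖R r‖) 2 (volume.restrict (Ioc c d)) := (Lp.memLp R).norm.restrict _
    have hfin : IsFiniteMeasure (volume.restrict (Ioc c d)) := ⟨by simp⟩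
    have := integral_mul_le_Lp_mul_Lq_of_nonneg (μ := volume.restrict (Ioc c d))
      (f := fun _ => (1 : ℝ)) (g := fun r => ‖R r‖) (p := 2) (q := 2) ⟨by norm_num, by norm_num, by norm_num⟩
      (Eventually.of_forall fun _ => zero_le_one) (Eventually.of_forall fun _ => norm_nonneg _)
      (by simpa using memLp_const _) (by simpa using h1)
    simp only [one_mul, Real.one_rpow, integral_const, smul_eq_mul, mul_one, Measure.real,
      Measure.restrict_apply_univ, Real.volume_Ioc] at this
    rw [ENNReal.toReal_ofReal (by linarith)] at this
    rw [intervalIntegral.integral_of_le hcd.le, Real.sqrt_eq_rpow, Real.sqrt_eq_rpow]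
    simp_rw [Real.rpow_two] at this
    exact this
  have e4 : |∫ r in s..t, inner ℝ (R r) (U s)| ≤ ‖U‖ * √(∫ r in c..d, ‖R r‖ ^ 2) := by
    rw [← Real.norm_eq_abs]
    refine intervalIntegral.norm_integral_le_integral_norm_uIoc.trans ?_
    calc ∫ r in uIoc s t, ‖inner ℝ (R r) (U s)‖ ≤ ∫ r in uIoc s t, ‖R r‖ * ‖U s‖ := by
          refine setIntegral_mono ?_ ?_ fun r => norm_inner_le_norm _ _
          · exact ((intervalIntegrable_inner_left R (U s) s t).def').norm
          · exact (hRi.mono_set hst).mul_const _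
      _ = (∫ r in uIoc s t, ‖R r‖) * ‖U s‖ := integral_mul_const _ _
      _ ≤ (∫ r in Ioc c d, ‖R r‖) * ‖U s‖ := by
          refine mul_le_mul_of_nonneg_right ?_ (norm_nonneg _)
          exact setIntegral_mono_set hRi (Eventually.of_forall fun x => norm_nonneg _)
            hst.eventuallyLE
      _ ≤ (√(d - c) * √(∫ r in c..d, ‖R r‖ ^ 2)) * ‖U s‖ := by gcongr
      _ = (√(d - c) * ‖U s‖) * √(∫ r in c..d, ‖R r‖ ^ 2) := by ring
      _ ≤ _ := by
          gcongr
          refine Real.sqrt_le_sqrt hs3 |>.trans' ?_ |>.trans ?_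
          · rw [Real.sqrt_mul (by linarith), Real.sqrt_sq (norm_nonneg _)]
          · rw [Real.sqrt_sq (norm_nonneg _)]
  have := (abs_le.1 e4).1
  linarith

theorem tendsto_integral_Ioo_right {f : ℝ → ℝ} {a b : ℝ} (hab : a < b)
    (hf : IntervalIntegrable f volume a b) :
    Tendsto (fun d => ∫ r in a..d, f r) (𝓝[>] a) (𝓝 0) := by
  have h := intervalIntegral.continuousOn_primitive_interval'  hf (a := a) (by simp)
  have h2 := (h a (by simp)).tendsto
  simp only [intervalIntegral.integral_same] at h2
  refine h2.mono_left ?_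
  rw [uIcc_of_le hab.le, ← nhdsWithin_Ioo_eq_nhdsGT hab]
  exact nhdsWithin_mono _ Ioo_subset_Icc_self

theorem tendsto_integral_Ioo_left {f : ℝ → ℝ} {a b : ℝ} (hab : a < b)
    (hf : IntervalIntegrable f volume a b) :
    Tendsto (fun d => ∫ r in a..d, f r) (𝓝[<] b) (𝓝 (∫ r in a..b, f r)) := by
  have h := intervalIntegral.continuousOn_primitive_interval'  hf (a := a) (by simp)
  have h2 := (h b (by simp)).tendsto
  refine h2.mono_left ?_
  rw [uIcc_of_le hab.le, ← nhdsWithin_Ioo_eq_nhdsLT hab]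
  exact nhdsWithin_mono _ Ioo_subset_Icc_self

/-- One-sided neighbourhoods meet every set of full measure. Limits along this filter ignore null
sets of times and are nevertheless unique. -/
theorem neBot_nhdsGT_inf_ae (a : ℝ) : (𝓝[>] a ⊓ ae (volume : Measure ℝ)).NeBot := by
  rw [inf_neBot_iff]
  intro s hs s' hs'
  obtain ⟨u, hu, hus⟩ := mem_nhdsGT_iff_exists_Ioo_subset.1 hs
  by_contra hne
  rw [not_nonempty_iff_eq_empty] at hne
  have h1 : Ioo a u ⊆ s'ᶜ := fun x hx hx' => by
    have : x ∈ s ∩ s' := ⟨hus hx, hx'⟩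
    simp [hne] at this
  have := measure_mono_null h1 hs'
  simp only [Real.volume_Ioo, ENNReal.ofReal_eq_zero, tsub_le_iff_right, zero_add] at this
  exact absurd hu (not_lt.2 this)

theorem neBot_nhdsLT_inf_ae (a : ℝ) : (𝓝[<] a ⊓ ae (volume : Measure ℝ)).NeBot := by
  rw [inf_neBot_iff]
  intro s hs s' hs'
  obtain ⟨u, hu, hus⟩ := mem_nhdsLT_iff_exists_Ioo_subset.1 hs
  by_contra hne
  rw [not_nonempty_iff_eq_empty] at hne
  have h1 : Ioo u a ⊆ s'ᶜ := fun x hx hx' => by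
    have : x ∈ s ∩ s' := ⟨hus hx, hx'⟩
    simp [hne] at this
  have := measure_mono_null h1 hs'
  simp only [Real.volume_Ioo, ENNReal.ofReal_eq_zero, tsub_le_iff_right, zero_add] at this
  exact absurd hu (not_lt.2 this)

omit [InnerProductSpace ℝ L] in
theorem exists_tendsto_of_forall_exists_norm_sub_sq_lt [CompleteSpace L] {F : Filter ℝ} [F.NeBot]
    {u : ℝ → L} (h : ∀ ε > 0, ∃ s, ∀ᶠ t in F, ‖u t - u s‖ ^ 2 ≤ ε) :
    ∃ l, Tendsto u F (𝓝 l) := by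
  refine CompleteSpace.complete (Metric.cauchy_iff.2 ⟨map_neBot, fun ε hε => ?_⟩)
  obtain ⟨s, hs⟩ := h ((ε / 3) ^ 2) (by positivity)
  refine ⟨u '' {t | ‖u t - u s‖ ^ 2 ≤ (ε / 3) ^ 2}, image_mem_map hs, ?_⟩
  rintro _ ⟨x, hx, rfl⟩ _ ⟨y, hy, rfl⟩
  have hx' : ‖u x - u s‖ ≤ ε / 3 := by
    exact le_of_sq_le_sq hx (by positivity)
  have hy' : ‖u y - u s‖ ≤ ε / 3 := by
    exact le_of_sq_le_sq hy (by positivity)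
  rw [dist_eq_norm, show u x - u y = (u x - u s) - (u y - u s) by abel]
  linarith [norm_sub_le (u x - u s) (u y - u s)]

/-- The Lions lemma: a square integrable `V`-valued function whose `V'`-valued weak derivative
is square integrable has one-sided limits in `L`, and satisfies the energy identity. -/
theorem exists_tendsto_and_energy_identity [CompleteSpace L] {a b : ℝ} (hab : a < b) (i : V →L[ℝ] L)
    (U R : Lp V 2 (volume : Measure ℝ)) {Z : Set ℝ}
    (hZ : ∀ᵐ t, t ∈ Ioo a b → t ∈ Z)
    (H : ∀ s ∈ Z, ∀ t ∈ Z,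
      inner ℝ (i (U t) - i (U s)) (i (U s)) = ∫ r in s..t, inner ℝ (R r) (U s)) :
    ∃ la lb : L, Tendsto (fun t => i (U t)) (𝓝[>] a ⊓ ae volume) (𝓝 la) ∧
      Tendsto (fun t => i (U t)) (𝓝[<] b ⊓ ae volume) (𝓝 lb) ∧
      ‖lb‖ ^ 2 - ‖la‖ ^ 2 = ∫ t in Ioo a b, 2 * inner ℝ (R t) (U t) := by
  set β : ℝ → ℝ := fun t => 2 * inner ℝ (R t) (U t) with hβdef
  have hβ : Integrable β := (L2.integrable_inner R U).const_mul 2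
  have hNint : Integrable fun t => ‖i (U t)‖ ^ 2 :=
    (i.comp_memLp' (Lp.memLp U)).integrable_norm_pow (by norm_num)
  -- At almost all times ‖i U‖² agrees with the absolutely continuous function k + ∫ β. Discarding
  -- the other times makes the Cauchy estimate available at both ends.
  obtain ⟨k, hk⟩ := exists_ae_eq_const_add_integral hab hNint.integrableOn hβ.integrableOn
    (fun θ h1 h2 h3 => by
      have := integral_deriv_mul_norm_sq i U R hZ H h1 h2 h3
      have z1 : ∀ t, t ∉ Ioo a b → θ t = 0 := fun t ht =>
        image_eq_zero_of_notMem_tsupport fun hh => ht (h3 hh)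
      have z2 : ∀ t, t ∉ Ioo a b → deriv θ t = 0 := fun t ht =>
        image_eq_zero_of_notMem_tsupport fun hh => ht (h3 (tsupport_deriv_subset hh))
      rw [setIntegral_eq_integral_of_forall_compl_eq_zero fun t ht => by rw [z2 t ht, zero_mul],
        setIntegral_eq_integral_of_forall_compl_eq_zero fun t ht => by rw [z1 t ht, zero_mul]]
      exact this)
  rw [ae_restrict_iff' measurableSet_Ioo] at hk
  set Z' : Set ℝ := {t ∈ Z | ‖i (U t)‖ ^ 2 = k + ∫ s in a..t, β s}
  have hZ' : ∀ᵐ t, t ∈ Ioo a b → t ∈ Z' := by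
    filter_upwards [hZ, hk] with t h1 h2 h3 using ⟨h1 h3, h2 h3⟩
  have H' : ∀ s ∈ Z', ∀ t ∈ Z', inner ℝ (i (U t) - i (U s)) (i (U s))
      = ∫ r in s..t, inner ℝ (R r) (U s) := fun s hs t ht => H s hs.1 t ht.1
  have hβi : IntervalIntegrable β volume a b := hβ.intervalIntegrable
  have main := fun c d => exists_forall_norm_sub_sq_le (c := c) (d := d) i U R hZ' H' hβi
    fun t ht => ht.2
  have hβabs : IntervalIntegrable (fun r => |β r|) volume a b := hβi.abs
  have hR2 : IntervalIntegrable (fun r => ‖R r‖ ^ 2) volume a b :=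
    ((Lp.memLp R).integrable_norm_pow (by norm_num)).intervalIntegrable
  have := neBot_nhdsGT_inf_ae a
  have := neBot_nhdsLT_inf_ae b
  have hZa : ∀ᶠ t in 𝓝[>] a ⊓ ae volume, t ∈ Z' := by
    rw [eventually_inf]
    exact ⟨Ioo a b, Ioo_mem_nhdsGT hab, _, hZ', fun t ht => ht.2 ht.1⟩
  have hZb : ∀ᶠ t in 𝓝[<] b ⊓ ae volume, t ∈ Z' := by
    rw [eventually_inf]
    exact ⟨Ioo a b, Ioo_mem_nhdsLT hab, _, hZ', fun t ht => ht.2 ht.1⟩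
  obtain ⟨la, hla⟩ : ∃ l, Tendsto (fun t => i (U t)) (𝓝[>] a ⊓ ae volume) (𝓝 l) := by
    refine exists_tendsto_of_forall_exists_norm_sub_sq_lt fun ε hε => ?_
    have lim : Tendsto (fun d => (∫ r in a..d, |β r|) + 2 * (‖U‖ * √(∫ r in a..d, ‖R r‖ ^ 2)))
        (𝓝[>] a) (𝓝 0) := by
      have := (tendsto_integral_Ioo_right hab hβabs).add
        (((tendsto_integral_Ioo_right hab hR2).sqrt.const_mul ‖U‖).const_mul 2)
      simpa using this
    obtain ⟨d, hd, hd'⟩ := ((lim.eventually_le_const hε).and (Ioo_mem_nhdsGT hab)).exists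
    obtain ⟨s, hs, hst⟩ := main a d le_rfl hd'.1 hd'.2.le
    refine ⟨s, ?_⟩
    filter_upwards [hZa, mem_inf_of_left (Ioo_mem_nhdsGT hd'.1)] with t h1 h2
    exact (hst t ⟨h1, h2⟩).trans hd
  obtain ⟨lb, hlb⟩ : ∃ l, Tendsto (fun t => i (U t)) (𝓝[<] b ⊓ ae volume) (𝓝 l) := by
    refine exists_tendsto_of_forall_exists_norm_sub_sq_lt fun ε hε => ?_
    have lim : Tendsto (fun d => (∫ r in d..b, |β r|) + 2 * (‖U‖ * √(∫ r in d..b, ‖R r‖ ^ 2)))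
        (𝓝[<] b) (𝓝 0) := by
      have aux : ∀ f : ℝ → ℝ, IntervalIntegrable f volume a b →
          Tendsto (fun d => ∫ r in d..b, f r) (𝓝[<] b) (𝓝 0) := by
        intro f hf
        have := (tendsto_integral_Ioo_left hab hf).const_sub (∫ r in a..b, f r)
        rw [sub_self] at this
        refine this.congr' ?_
        filter_upwards [Ioo_mem_nhdsLT hab] with d hd
        refine intervalIntegral.integral_interval_sub_left hf (hf.mono_set ?_)
        rw [uIcc_of_le hd.1.le, uIcc_of_le hab.le]
        exact Icc_subset_Icc_right hd.2.le
      have := (aux _ hβabs).add (((aux _ hR2).sqrt.const_mul ‖U‖).const_mul 2)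
      simpa using this
    obtain ⟨d, hd, hd'⟩ := ((lim.eventually_le_const hε).and (Ioo_mem_nhdsLT hab)).exists
    obtain ⟨s, hs, hst⟩ := main d b hd'.1.le hd'.2 le_rfl
    refine ⟨s, ?_⟩
    filter_upwards [hZb, mem_inf_of_left (Ioo_mem_nhdsLT hd'.2)] with t h1 h2
    exact (hst t ⟨h1, h2⟩).trans hd
  refine ⟨la, lb, hla, hlb, ?_⟩
  have na : ‖la‖ ^ 2 = k := by
    refine tendsto_nhds_unique (hla.norm.pow 2) ?_
    have := ((tendsto_integral_Ioo_right hab hβi).const_add k).mono_left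
      (inf_le_left : 𝓝[>] a ⊓ ae volume ≤ _)
    rw [add_zero] at this
    refine this.congr' ?_
    filter_upwards [hZa] with t ht using ht.2.symm
  have nb : ‖lb‖ ^ 2 = k + ∫ r in a..b, β r := by
    refine tendsto_nhds_unique (hlb.norm.pow 2) ?_
    have := ((tendsto_integral_Ioo_left hab hβi).const_add k).mono_left
      (inf_le_left : 𝓝[<] b ⊓ ae volume ≤ _)
    refine this.congr' ?_
    filter_upwards [hZb] with t ht using ht.2.symm
  rw [na, nb, intervalIntegral.integral_of_le hab.le, integral_Ioc_eq_integral_Ioo]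
  ring

end Lions

/-! ### Cross products and two-dimensional Jacobians -/

/-- The plane with its Euclidean norm. -/
abbrev R2 : Type := EuclideanSpace ℝ (Fin 2)

section CrossProduct

/-- The cross product on `R3`, as a continuous bilinear map. -/
noncomputable def crossL : R3 →L[ℝ] R3 →L[ℝ] R3 :=
  (LinearMap.mk₂ ℝ (fun a b : R3 =>
    (!₂[a 1 * b 2 - a 2 * b 1, a 2 * b 0 - a 0 * b 2, a 0 * b 1 - a 1 * b 0] : R3))
    (by intros; ext i; fin_cases i <;> simp <;> ring)
    (by intros; ext i; fin_cases i <;> simp <;> ring)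
    (by intros; ext i; fin_cases i <;> simp <;> ring)
    (by intros; ext i; fin_cases i <;> simp <;> ring)).toContinuousBilinearMap

theorem crossL_apply (a b : R3) : crossL a b =
    !₂[a 1 * b 2 - a 2 * b 1, a 2 * b 0 - a 0 * b 2, a 0 * b 1 - a 1 * b 0] := rfl

theorem inner_R3 (a b : R3) : inner ℝ a b = a 0 * b 0 + a 1 * b 1 + a 2 * b 2 := by
  simp [PiLp.inner_apply, Fin.sum_univ_three]; ring

theorem inner_R2 (a b : R2) : inner ℝ a b = a 0 * b 0 + a 1 * b 1 := by
  simp [PiLp.inner_apply, Fin.sum_univ_two]; ring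

theorem inner_crossL_left (a b : R3) : inner ℝ (crossL a b) a = 0 := by
  simp [inner_R3, crossL_apply]; ring

theorem inner_crossL_right (a b : R3) : inner ℝ (crossL a b) b = 0 := by
  simp [inner_R3, crossL_apply]; ring

theorem crossL_self (a : R3) : crossL a a = 0 := by
  ext i; fin_cases i <;> simp [crossL_apply] <;> ring

theorem crossL_comm (a b : R3) : crossL a b = - crossL b a := by
  ext i; fin_cases i <;> simp [crossL_apply] <;> ring

theorem norm_crossL_sq (a b : R3) :
    ‖crossL a b‖ ^ 2 = ‖a‖ ^ 2 * ‖b‖ ^ 2 - (inner ℝ a b) ^ 2 := by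
  simp only [← real_inner_self_eq_norm_sq, inner_R3, crossL_apply]
  simp; ring

theorem R3.sum_single (a : R3) : a = a 0 • EuclideanSpace.single 0 1
    + a 1 • EuclideanSpace.single 1 1 + a 2 • EuclideanSpace.single 2 1 := by
  ext i; fin_cases i <;> simp

theorem clm_apply_R3 (W : R3 →L[ℝ] R3) (a : R3) (i : Fin 3) :
    W a i = a 0 * W (EuclideanSpace.single 0 1) i + a 1 * W (EuclideanSpace.single 1 1) i
      + a 2 * W (EuclideanSpace.single 2 1) i := by
  conv_lhs => rw [R3.sum_single a]
  simp

theorem trace_R3 (W : R3 →L[ℝ] R3) : LinearMap.trace ℝ R3 W.toLinearMap =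
    W (EuclideanSpace.single 0 1) 0 + W (EuclideanSpace.single 1 1) 1
      + W (EuclideanSpace.single 2 1) 2 := by
  rw [LinearMap.trace_eq_matrix_trace ℝ (EuclideanSpace.basisFun (Fin 3) ℝ).toBasis]
  simp [Matrix.trace, Fin.sum_univ_three, LinearMap.toMatrix_apply]

/-- Derivative of the cross product along a linear flow: `Wa × b + a × Wb = (tr W - Wᵀ)(a × b)`. -/
theorem inner_crossL_add_crossL (W : R3 →L[ℝ] R3) (a b n : R3) :
    inner ℝ (crossL (W a) b + crossL a (W b)) n =
      LinearMap.trace ℝ R3 W.toLinearMap * inner ℝ (crossL a b) n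
        - inner ℝ (crossL a b) (W n) := by
  simp only [inner_R3, crossL_apply, trace_R3, PiLp.add_apply, clm_apply_R3 W a, clm_apply_R3 W b,
    clm_apply_R3 W n]
  simp; ring

/-- The two-dimensional Jacobian of a linear map from the plane to space. -/
noncomputable def jac2 (L : R2 →L[ℝ] R3) : ℝ :=
  ‖crossL (L (EuclideanSpace.single 0 1)) (L (EuclideanSpace.single 1 1))‖

theorem R2.sum_single (a : R2) : a = a 0 • EuclideanSpace.single 0 1
    + a 1 • EuclideanSpace.single 1 1 := by
  ext i; fin_cases i <;> simp

theorem clm_apply_R2 {F : Type*} [NormedAddCommGroup F] [NormedSpace ℝ F] (L : R2 →L[ℝ] F)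
    (a : R2) : L a = a 0 • L (EuclideanSpace.single 0 1) + a 1 • L (EuclideanSpace.single 1 1) := by
  conv_lhs => rw [R2.sum_single a]
  simp

theorem continuous_jac2 : Continuous jac2 := by
  unfold jac2; fun_prop

theorem jac2_nonneg (L : R2 →L[ℝ] R3) : 0 ≤ jac2 L := norm_nonneg _

/-- By Lagrange's identity the squared Jacobian is a Gram determinant. An isometry does not change
it, and in the plane it is the square of the determinant. -/
theorem jac2_isometry_comp (ι : R2 →ₗᵢ[ℝ] R3) (B : R2 →L[ℝ] R2) :
    jac2 (ι.toContinuousLinearMap.comp B) = |LinearMap.det (B : R2 →ₗ[ℝ] R2)| := by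
  rw [← abs_of_nonneg (jac2_nonneg _), ← sq_eq_sq_iff_abs_eq_abs, jac2, norm_crossL_sq]
  simp only [ContinuousLinearMap.comp_apply, LinearIsometry.coe_toContinuousLinearMap,
    LinearIsometry.norm_map, LinearIsometry.inner_map_map]
  rw [← LinearMap.det_toMatrix (EuclideanSpace.basisFun (Fin 2) ℝ).toBasis, Matrix.det_fin_two]
  simp only [← real_inner_self_eq_norm_sq, inner_R2, LinearMap.toMatrix_apply]
  simp; ring

/-- If a × b = 0, Lagrange's identity forces ‖a‖² b - ⟨a, b⟩ a = 0. This vector is the image of one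
whose second coordinate is ‖a‖² ≠ 0. -/
theorem crossL_ne_zero_of_injective {L : R2 →L[ℝ] R3} (hL : Function.Injective L) :
    crossL (L (EuclideanSpace.single 0 1)) (L (EuclideanSpace.single 1 1)) ≠ 0 := by
  intro h
  set a := L (EuclideanSpace.single 0 1)
  set b := L (EuclideanSpace.single 1 1)
  have h0 := norm_crossL_sq a b
  rw [h, norm_zero] at h0
  have ha : a ≠ 0 := fun ha => by
    have := hL (ha.trans (map_zero L).symm)
    have := congrArg (fun x : R2 => x 0) this
    simp at this
  have key : ‖‖a‖ ^ 2 • b - inner ℝ a b • a‖ ^ 2 = 0 := by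
    rw [norm_sub_sq_real, norm_smul, norm_smul, real_inner_smul_left, real_inner_smul_right,
      real_inner_comm a b, Real.norm_eq_abs, Real.norm_eq_abs, mul_pow, mul_pow, sq_abs, sq_abs]
    linear_combination (-‖a‖ ^ 2) * h0
  have h2 : L (‖a‖ ^ 2 • EuclideanSpace.single 1 1 - inner ℝ a b • EuclideanSpace.single 0 1) = 0 := by
    rw [map_sub, map_smul, map_smul]
    exact norm_eq_zero.1 (pow_eq_zero_iff (by norm_num) |>.1 key)
  have := hL (h2.trans (map_zero L).symm)
  have := congrArg (fun x : R2 => x 1) this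
  simp at this
  exact ha this

theorem jac2_pos {L : R2 →L[ℝ] R3} (hL : Function.Injective L) : 0 < jac2 L :=
  norm_pos_iff.2 (crossL_ne_zero_of_injective hL)

end CrossProduct

/-! ### The area formula for immersed surfaces -/

section AreaFormula

open Measure

/-- With an orthonormal basis of the range, L factors into a planar endomorphism followed by an
isometry; only the former changes areas, by its determinant. -/
theorem measure_image_linear (L : R2 →L[ℝ] R3) (hL : Function.Injective L) (A : Set R2) :
    (euclideanHausdorffMeasure 2 : Measure R3) (L '' A) = ENNReal.ofReal (jac2 L) * volume A := by
  have hfr : Module.finrank ℝ (LinearMap.range L.toLinearMap) = 2 := by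
    rw [LinearMap.finrank_range_of_inj hL]; simp
  let e : R2 ≃ₗᵢ[ℝ] LinearMap.range L.toLinearMap :=
    ((stdOrthonormalBasis ℝ (LinearMap.range L.toLinearMap)).reindex (finCongr hfr)).repr.symm
  let ι : R2 →ₗᵢ[ℝ] R3 := (Submodule.subtypeₗᵢ _).comp e.toLinearIsometry
  let B : R2 →L[ℝ] R2 := (e.symm.toContinuousLinearEquiv : _ →L[ℝ] R2).comp
    (L.codRestrict (LinearMap.range L.toLinearMap) fun x => LinearMap.mem_range_self L.toLinearMap x)
  have hLB : L = ι.toContinuousLinearMap.comp B := by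
    ext1 x
    change L x = ((e (e.symm ⟨L x, LinearMap.mem_range_self L.toLinearMap x⟩) :
      LinearMap.range L.toLinearMap) : R3)
    rw [e.apply_symm_apply]
  rw [hLB, jac2_isometry_comp, ContinuousLinearMap.coe_comp, image_comp,
    LinearIsometry.coe_toContinuousLinearMap, ι.isometry.euclideanHausdorffMeasure_image,
    EuclideanSpace.euclideanHausdorffMeasure_eq_volume, addHaar_image_continuousLinearMap]

/-- The hypothesis says that f factors through g on A by a k-Lipschitz map on g(A), and such a map
enlarges two-dimensional measure at most by k². -/
theorem measure_image_le_of_dist_le {X : Type*} {f g : X → R3} {K : ℝ≥0∞} {k : NNReal} (hK : K = k)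
    {A : Set X} (h : ∀ x ∈ A, ∀ y ∈ A, dist (f x) (f y) ≤ k * dist (g x) (g y)) :
    (euclideanHausdorffMeasure 2 : Measure R3) (f '' A) ≤
      K ^ 2 * (euclideanHausdorffMeasure 2 : Measure R3) (g '' A) := by
  rcases A.eq_empty_or_nonempty with rfl | ⟨x0, hx0⟩
  · simp
  have : Nonempty X := ⟨x0⟩
  have hlip : LipschitzOnWith k (f ∘ Function.invFunOn g A) (g '' A) := by
    refine LipschitzOnWith.of_dist_le_mul ?_
    intro p hp q hq
    have := h _ (Function.invFunOn_mem hp) _ (Function.invFunOn_mem hq)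
    rwa [Function.invFunOn_eq hp, Function.invFunOn_eq hq] at this
  have himg : f '' A ⊆ (f ∘ Function.invFunOn g A) '' (g '' A) := by
    rintro _ ⟨x, hx, rfl⟩
    refine ⟨g x, mem_image_of_mem g hx, ?_⟩
    have hm : g x ∈ g '' A := mem_image_of_mem g hx
    have := h _ (Function.invFunOn_mem hm) x hx
    rw [Function.invFunOn_eq hm, dist_self, mul_zero] at this
    exact dist_le_zero.1 this
  have h2 := hlip.hausdorffMeasure_image_le (d := (2 : ℕ)) (by norm_num)
  rw [euclideanHausdorffMeasure_def, Measure.smul_apply, Measure.smul_apply, hK]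
  refine (smul_le_smul_of_nonneg_left (measure_mono himg) (zero_le)).trans ?_
  rw [mul_smul_comm]
  refine smul_le_smul_of_nonneg_left (h2.trans_eq ?_) zero_le
  simp

variable {ψ : R2 → R3} {O : Set R2}

/-- Near ξ the distances of images under ψ and under its differential L agree up to the factor k,
hence areas up to k². The Jacobian varies by at most one more factor k, so that k³ appears in total.
-/
theorem exists_ball_area_estimate (hO : IsOpen O) (hψ : ContDiffOn ℝ 1 ψ O)
    (hinj : ∀ ξ ∈ O, Function.Injective (fderiv ℝ ψ ξ)) {k : NNReal} (hk : 1 < k) {ξ : R2}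
    (hξ : ξ ∈ O) :
    ∃ U : Set R2, IsOpen U ∧ ξ ∈ U ∧ ∀ A : Set R2, MeasurableSet A → A ⊆ U ∩ O →
      (euclideanHausdorffMeasure 2 : Measure R3) (ψ '' A)
        ≤ (k : ℝ≥0∞) ^ 3 * ∫⁻ x in A, ENNReal.ofReal (jac2 (fderiv ℝ ψ x)) ∧
      ∫⁻ x in A, ENNReal.ofReal (jac2 (fderiv ℝ ψ x))
        ≤ (k : ℝ≥0∞) ^ 3 * (euclideanHausdorffMeasure 2 : Measure R3) (ψ '' A) := by
  set L := fderiv ℝ ψ ξ with hLdef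
  have hL : Function.Injective L := hinj ξ hξ
  have hk0 : (0 : ℝ) < k := lt_trans zero_lt_one hk
  have hk1 : (1 : ℝ) < k := hk
  obtain ⟨K, hK0, hK⟩ := L.toLinearMap.exists_antilipschitzWith (LinearMap.ker_eq_bot.2 hL)
  have hstrict : HasStrictFDerivAt ψ L ξ :=
    (hψ.contDiffAt (hO.mem_nhds hξ)).hasStrictFDerivAt (by norm_num)
  -- the admissible defect
  set c : ℝ := (1 - (k : ℝ)⁻¹) / K
  have hkinv : (k : ℝ)⁻¹ < 1 := inv_lt_one_of_one_lt₀ hk1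
  have hK0' : (0 : ℝ) < K := hK0
  have hc : 0 < c := div_pos (by linarith) hK0'
  have hcK : c * K = 1 - (k : ℝ)⁻¹ := by simp only [c]; field_simp
  have hb := hstrict.isLittleO.def hc
  rw [eventually_nhds_iff] at hb
  obtain ⟨W, hW, hWo, hWm⟩ := hb
  obtain ⟨U1, U2, hU1, hξ1, hU2, hξ2, hU12⟩ := mem_nhds_prod_iff'.1 (hWo.mem_nhds hWm)
  have hj0 : 0 < jac2 L := jac2_pos hL
  have hcont : ContinuousAt (fun x => jac2 (fderiv ℝ ψ x)) ξ := by
    have h1 : ContinuousOn (fderiv ℝ ψ) O := hψ.continuousOn_fderiv_of_isOpen hO le_rfl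
    exact continuous_jac2.continuousAt.comp (h1.continuousAt (hO.mem_nhds hξ))
  have hev1 : ∀ᶠ x in 𝓝 ξ, jac2 (fderiv ℝ ψ x) < k * jac2 L :=
    hcont.eventually_lt continuousAt_const (by nlinarith)
  have hev2 : ∀ᶠ x in 𝓝 ξ, jac2 L < k * jac2 (fderiv ℝ ψ x) :=
    ContinuousAt.eventually_lt continuousAt_const (continuousAt_const.mul hcont) (by
      change jac2 L < k * jac2 L; nlinarith)
  obtain ⟨U3, hU3, hU3o, hξ3⟩ := eventually_nhds_iff.1 (hev1.and hev2)
  refine ⟨U1 ∩ U2 ∩ U3, (hU1.inter hU2).inter hU3o, ⟨⟨hξ1, hξ2⟩, hξ3⟩, fun A hA hAU => ?_⟩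
  have hdist : ∀ x ∈ A, ∀ y ∈ A, ‖ψ x - ψ y - (L x - L y)‖ ≤ (1 - (k : ℝ)⁻¹) * dist (L x) (L y) := by
    intro x hx y hy
    have h1 := hW (x, y) (hU12 ⟨(hAU hx).1.1.1, (hAU hy).1.1.2⟩)
    simp only [map_sub] at h1
    refine h1.trans ?_
    have h2 := hK.le_mul_dist x y
    rw [dist_eq_norm] at h2
    calc c * ‖x - y‖ ≤ c * (K * dist (L x) (L y)) := by gcongr; exact h2
      _ = _ := by rw [← mul_assoc, hcK]
  have up : ∀ x ∈ A, ∀ y ∈ A, dist (ψ x) (ψ y) ≤ k * dist (L x) (L y) := by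
    intro x hx y hy
    have h1 := hdist x hx y hy
    have h2 : dist (ψ x) (ψ y) ≤ ‖ψ x - ψ y - (L x - L y)‖ + dist (L x) (L y) := by
      rw [dist_eq_norm, dist_eq_norm]
      calc ‖ψ x - ψ y‖ = ‖(ψ x - ψ y - (L x - L y)) + (L x - L y)‖ := by congr 1; abel
        _ ≤ _ := norm_add_le _ _
    have h3 : 2 - (k : ℝ)⁻¹ ≤ k := by
      have : (k : ℝ) * (k : ℝ)⁻¹ = 1 := mul_inv_cancel₀ hk0.ne'
      nlinarith [sq_nonneg ((k : ℝ) - 1), inv_pos.2 hk0]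
    nlinarith [dist_nonneg (x := L x) (y := L y)]
  have lo : ∀ x ∈ A, ∀ y ∈ A, dist (L x) (L y) ≤ k * dist (ψ x) (ψ y) := by
    intro x hx y hy
    have h1 := hdist x hx y hy
    have h2 : dist (L x) (L y) ≤ ‖ψ x - ψ y - (L x - L y)‖ + dist (ψ x) (ψ y) := by
      rw [dist_eq_norm, dist_eq_norm]
      calc ‖L x - L y‖ = ‖(ψ x - ψ y) - (ψ x - ψ y - (L x - L y))‖ := by congr 1; abel
        _ ≤ _ := norm_sub_le _ _
        _ = _ := add_comm _ _
    have h3 : (k : ℝ)⁻¹ * dist (L x) (L y) ≤ dist (ψ x) (ψ y) := by linarith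
    rw [inv_mul_le_iff₀ hk0] at h3
    exact h3
  have m1 := measure_image_le_of_dist_le (K := k) rfl up
  have m2 := measure_image_le_of_dist_le (K := k) rfl lo
  rw [measure_image_linear L hL] at m1 m2
  have j1 : ENNReal.ofReal (jac2 L) * volume A
      ≤ k * ∫⁻ x in A, ENNReal.ofReal (jac2 (fderiv ℝ ψ x)) := by
    rw [← setLIntegral_const, ← lintegral_const_mul' _ _ (by simp)]
    refine setLIntegral_mono' hA fun x hx => ?_
    rw [← ENNReal.ofReal_coe_nnreal, ← ENNReal.ofReal_mul hk0.le]
    exact ENNReal.ofReal_le_ofReal (hU3 x (hAU hx).1.2).2.le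
  have j2 : ∫⁻ x in A, ENNReal.ofReal (jac2 (fderiv ℝ ψ x))
      ≤ k * (ENNReal.ofReal (jac2 L) * volume A) := by
    rw [← mul_assoc, ← setLIntegral_const]
    refine setLIntegral_mono' hA fun x hx => ?_
    rw [← ENNReal.ofReal_coe_nnreal, ← ENNReal.ofReal_mul hk0.le]
    exact ENNReal.ofReal_le_ofReal (hU3 x (hAU hx).1.2).1.le
  constructor
  · calc _ ≤ (k : ℝ≥0∞) ^ 2 * (ENNReal.ofReal (jac2 L) * volume A) := m1
      _ ≤ (k : ℝ≥0∞) ^ 2 * (k * ∫⁻ x in A, ENNReal.ofReal (jac2 (fderiv ℝ ψ x))) := by gcongr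
      _ = _ := by ring
  · calc _ ≤ _ := j2
      _ ≤ k * ((k : ℝ≥0∞) ^ 2 * (euclideanHausdorffMeasure 2 : Measure R3) (ψ '' A)) := by gcongr
      _ = _ := by ring

/-- The area formula for an injective `C¹` immersion of an open subset of the plane. -/
theorem measure_image_eq_lintegral_jac2 (hO : IsOpen O) (hψ : ContDiffOn ℝ 1 ψ O)
    (hinjOn : InjOn ψ O) (hinj : ∀ ξ ∈ O, Function.Injective (fderiv ℝ ψ ξ)) {A : Set R2}
    (hA : MeasurableSet A) (hAO : A ⊆ O) :
    (euclideanHausdorffMeasure 2 : Measure R3) (ψ '' A)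
      = ∫⁻ x in A, ENNReal.ofReal (jac2 (fderiv ℝ ψ x)) := by
  have approx : ∀ k : NNReal, 1 < k → 
      (euclideanHausdorffMeasure 2 : Measure R3) (ψ '' A)
        ≤ (k : ℝ≥0∞) ^ 3 * ∫⁻ x in A, ENNReal.ofReal (jac2 (fderiv ℝ ψ x)) ∧
      ∫⁻ x in A, ENNReal.ofReal (jac2 (fderiv ℝ ψ x))
        ≤ (k : ℝ≥0∞) ^ 3 * (euclideanHausdorffMeasure 2 : Measure R3) (ψ '' A) := by
    intro k hk
    rcases A.eq_empty_or_nonempty with rfl | hne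
    · simp
    choose! U hUo hUm hU using fun ξ (hξ : ξ ∈ O) => exists_ball_area_estimate hO hψ hinj hk hξ
    -- Countably many good neighbourhoods cover A. Once they are made disjoint, both estimates add
    -- up because ψ is injective.
    obtain ⟨T, hTO, hTc, hTU⟩ := TopologicalSpace.countable_cover_nhdsWithin
      (s := O) (f := U) fun x hx => mem_nhdsWithin_of_mem_nhds ((hUo x hx).mem_nhds (hUm x hx))
    have hTne : T.Nonempty := by
      by_contra h
      rw [not_nonempty_iff_eq_empty] at h
      obtain ⟨x, hx⟩ := hne
      have := hTU (hAO hx)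
      simp [h] at this
    obtain ⟨e, he⟩ := hTc.exists_eq_range hTne
    have heO : ∀ n, e n ∈ O := fun n => hTO (he ▸ mem_range_self n)
    set D : ℕ → Set R2 := fun n => A ∩ disjointed (fun n => U (e n)) n
    have hDm : ∀ n, MeasurableSet (D n) := fun n =>
      hA.inter (MeasurableSet.disjointed (fun n => (hUo _ (heO n)).measurableSet) n)
    have hDd : Pairwise (Function.onFun Disjoint D) := fun i j hij =>
      (disjoint_disjointed (fun n => U (e n)) hij).mono inter_subset_right inter_subset_right
    have hDU : A = ⋃ n, D n := by
      rw [← inter_iUnion, iUnion_disjointed, eq_comm, inter_eq_left]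
      intro x hx
      have := hTU (hAO hx)
      rw [he] at this
      simpa using this
    have hDsub : ∀ n, D n ⊆ U (e n) ∩ O := fun n x hx =>
      ⟨disjointed_subset (fun n => U (e n)) n hx.2, hAO hx.1⟩
    have est := fun n => hU (e n) (heO n) (D n) (hDm n) (hDsub n)
    have s1 : (euclideanHausdorffMeasure 2 : Measure R3) (ψ '' A)
        = ∑' n, (euclideanHausdorffMeasure 2 : Measure R3) (ψ '' D n) := by
      conv_lhs => rw [hDU, image_iUnion]
      refine measure_iUnion (fun i j hij => ?_) fun n => ?_
      · have := hDd hij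
        rw [Function.onFun, Set.disjoint_left]
        rintro _ ⟨x, hx, rfl⟩ ⟨y, hy, hxy⟩
        have := hinjOn (hDsub j hy).2 (hDsub i hx).2 hxy
        subst this
        exact (Set.disjoint_left.1 (hDd hij)) hx hy
      · exact (hDm n).image_of_continuousOn_injOn
          (hψ.continuousOn.mono fun x hx => (hDsub n hx).2)
          (hinjOn.mono fun x hx => (hDsub n hx).2)
    have s2 : ∫⁻ x in A, ENNReal.ofReal (jac2 (fderiv ℝ ψ x))
        = ∑' n, ∫⁻ x in D n, ENNReal.ofReal (jac2 (fderiv ℝ ψ x)) := by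
      conv_lhs => rw [hDU]
      exact lintegral_iUnion hDm hDd _
    rw [s1, s2, ← ENNReal.tsum_mul_left, ← ENNReal.tsum_mul_left]
    exact ⟨ENNReal.tsum_le_tsum fun n => (est n).1, ENNReal.tsum_le_tsum fun n => (est n).2⟩
  have lim : ∀ x y : ℝ≥0∞, (∀ k : NNReal, 1 < k → x ≤ (k : ℝ≥0∞) ^ 3 * y) → x ≤ y := by
    intro x y h
    have t : Tendsto (fun k : NNReal => (k : ℝ≥0∞) ^ 3 * y) (𝓝[>] 1) (𝓝 (((1 : NNReal) : ℝ≥0∞) ^ 3 * y)) := by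
      refine ENNReal.Tendsto.mul_const ?_ (Or.inl (by simp))
      exact (((ENNReal.continuous_pow 3).comp ENNReal.continuous_coe).tendsto 1).mono_left nhdsWithin_le_nhds
    simp only [ENNReal.coe_one, one_pow, one_mul] at t
    exact ge_of_tendsto t (by filter_upwards [self_mem_nhdsWithin] with k hk using h k hk)
  exact le_antisymm (lim _ _ fun k hk => (approx k hk).1) (lim _ _ fun k hk => (approx k hk).2)

theorem restrict_image_eq_map_withDensity (hO : IsOpen O) (hψ : ContDiffOn ℝ 1 ψ O)
    (hinjOn : InjOn ψ O) (hinj : ∀ ξ ∈ O, Function.Injective (fderiv ℝ ψ ξ)) :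
    (euclideanHausdorffMeasure 2 : Measure R3).restrict (ψ '' O) =
      ((volume.restrict O).withDensity fun x => ENNReal.ofReal (jac2 (fderiv ℝ ψ x))).map ψ := by
  have hae : AEMeasurable ψ (volume.restrict O) := hψ.continuousOn.aemeasurable hO.measurableSet
  have hae' := hae.mono_ac (withDensity_absolutelyContinuous (volume.restrict O)
    fun x => ENNReal.ofReal (jac2 (fderiv ℝ ψ x)))
  ext B hB
  have hpre : MeasurableSet (O ∩ ψ ⁻¹' B) := by
    classical
    have := hψ.continuousOn.measurable_piecewise (continuous_const (y := (0 : R3))).continuousOn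
      hO.measurableSet
    have := (this hB).inter hO.measurableSet
    convert this using 1
    ext x
    simp only [mem_inter_iff, mem_preimage]
    constructor
    · rintro ⟨h1, h2⟩; exact ⟨by rwa [piecewise_eq_of_mem _ _ _ h1], h1⟩
    · rintro ⟨h1, h2⟩; exact ⟨h2, by rwa [piecewise_eq_of_mem _ _ _ h2] at h1⟩
  rw [Measure.restrict_apply hB, Measure.map_apply_of_aemeasurable hae' hB,
    show B ∩ ψ '' O = ψ '' (O ∩ ψ ⁻¹' B) by rw [image_inter_preimage, inter_comm],
    measure_image_eq_lintegral_jac2 hO hψ hinjOn hinj hpre inter_subset_left,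
    withDensity_apply' , Measure.restrict_restrict' hO.measurableSet, inter_comm]

end AreaFormula

/-! ### Smooth extensions, local inverses and cutoff functions -/

section SmoothTools

variable {E F : Type*} [NormedAddCommGroup E] [NormedSpace ℝ E] [FiniteDimensional ℝ E]
  [NormedAddCommGroup F] [NormedSpace ℝ F]

open scoped Manifold in
/-- A function on a closed set which locally extends smoothly extends smoothly. -/
theorem exists_contDiff_eqOn_of_local {K : Set E} (hK : IsClosed K) {u : E → F}
    (h : ∀ x ∈ K, ∃ U ∈ 𝓝 x, ∃ g : E → F, ContDiffOn ℝ ∞ g U ∧ EqOn g u (K ∩ U)) :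
    ∃ G : E → F, ContDiff ℝ ∞ G ∧ EqOn G u K := by
  classical
  -- The prescribed value at a point of K is a convex constraint, and off K there is none. Hence
  -- local extensions can be averaged by a partition of unity.
  obtain ⟨g, hg⟩ := exists_contMDiffMap_forall_mem_convex_of_local (n := (⊤ : ℕ∞)) 𝓘(ℝ, E)
    (t := fun x => if x ∈ K then {u x} else univ)
    (fun x => by by_cases hx : x ∈ K <;> simp [hx, convex_univ]) (fun x => by
      by_cases hx : x ∈ K
      · obtain ⟨U, hU, g, hg, hgu⟩ := h x hx
        refine ⟨U, hU, g, hg.contMDiffOn, fun y hy => ?_⟩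
        by_cases hyK : y ∈ K
        · simp [hyK, hgu ⟨hyK, hy⟩]
        · simp [hyK]
      · refine ⟨Kᶜ, hK.isOpen_compl.mem_nhds hx, fun _ => 0, contMDiffOn_const, fun y hy => ?_⟩
        have : y ∉ K := hy
        simp [this])
  refine ⟨g, g.contMDiff.contDiff, fun x hx => ?_⟩
  simpa [hx] using hg x

/-- The inverse function theorem, with a smooth inverse on the whole target. -/
theorem exists_openPartialHomeomorph_of_contDiffOn [FiniteDimensional ℝ F] {G : E → F} {W : Set E}
    (hW : IsOpen W) (hG : ContDiffOn ℝ ∞ G W) {a : E} (ha : a ∈ W)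
    (hinj : Function.Injective (fderiv ℝ G a))
    (hdim : Module.finrank ℝ E = Module.finrank ℝ F) :
    ∃ e : OpenPartialHomeomorph E F, (∀ x, e x = G x) ∧ a ∈ e.source ∧ e.source ⊆ W ∧
      ContDiffOn ℝ ∞ e.symm e.target := by
  have hcd : ∀ x ∈ W, ContDiffAt ℝ ∞ G x := fun x hx => hG.contDiffAt (hW.mem_nhds hx)
  have hmem : ∀ x, Function.Injective (fderiv ℝ G x) →
      fderiv ℝ G x ∈ range ((↑) : (E ≃L[ℝ] F) → (E →L[ℝ] F)) := by
    intro x hx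
    exact ⟨(LinearMap.linearEquivOfInjective (fderiv ℝ G x).toLinearMap hx hdim).toContinuousLinearEquiv,
      by ext v; rfl⟩
  obtain ⟨f', hf'⟩ := hmem a hinj
  have hd : HasFDerivAt G (f' : E →L[ℝ] F) a := by
    rw [hf']; exact ((hcd a ha).differentiableAt (by simp)).hasFDerivAt
  let e0 := (hcd a ha).toOpenPartialHomeomorph G hd (by simp)
  -- Only points with invertible differential are kept, so the inverse is smooth on the whole target
  -- and not just near the image of `a`.
  set W' : Set E := W ∩ fderiv ℝ G ⁻¹' range ((↑) : (E ≃L[ℝ] F) → (E →L[ℝ] F)) with hW'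
  have hW'o : IsOpen W' :=
    (hG.continuousOn_fderiv_of_isOpen hW (by simp)).isOpen_inter_preimage hW
      (ContinuousLinearEquiv.isOpen)
  let e := e0.restrOpen W' hW'o
  refine ⟨e, fun x => rfl, ?_, ?_, ?_⟩
  · exact ⟨(hcd a ha).mem_toOpenPartialHomeomorph_source hd (by simp), ha, ⟨f', hf'⟩⟩
  · exact fun x hx => hx.2.1
  · intro y hy
    have hx : e.symm y ∈ e.source := e.map_target hy
    obtain ⟨g', hg'⟩ := hx.2.2
    refine ContDiffAt.contDiffWithinAt ?_
    refine e.contDiffAt_symm (f₀' := g') hy ?_ ?_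
    · rw [hg']
      exact ((hcd _ hx.2.1).differentiableAt (by simp)).hasFDerivAt
    · exact hcd _ hx.2.1

/-- A local-to-global principle: an additive property of smooth functions that holds for all
functions with small support holds for a cutoff function of a given compact set. -/
theorem exists_eventually_eq_one_of_local {K : Set E} (hK : IsCompact K) (P : (E → ℝ) → Prop)
    (h0 : P 0) (hadd : ∀ f g, ContDiff ℝ ∞ f → ContDiff ℝ ∞ g → P f → P g → P (f + g))
    (hloc : ∀ x ∈ K, ∃ V ∈ 𝓝 x, ∀ χ : E → ℝ, ContDiff ℝ ∞ χ → HasCompactSupport χ →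
      tsupport χ ⊆ V → P χ) :
    ∃ χ : E → ℝ, ContDiff ℝ ∞ χ ∧ HasCompactSupport χ ∧ (∀ x ∈ K, ∀ᶠ y in 𝓝 x, χ y = 1) ∧ P χ := by
  classical
  choose! V hV hVP using hloc
  have hf : ∀ x ∈ K, ∃ f : E → ℝ, ContDiff ℝ ∞ f ∧ HasCompactSupport f ∧ tsupport f ⊆ V x ∧
      ∀ᶠ y in 𝓝 x, f y = 1 := by
    intro x hx
    obtain ⟨r, hr, hrV⟩ := Metric.nhds_basis_closedBall.mem_iff.1 (hV x hx)
    let f : ContDiffBump x := ⟨r / 2, r, by positivity, by linarith⟩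
    exact ⟨f, f.contDiff, f.hasCompactSupport, by rw [f.tsupport_eq]; exact hrV,
      f.eventuallyEq_one⟩
  choose! f f1 f2 f3 f4 using hf
  obtain ⟨t, htK, ht⟩ := hK.elim_nhds_subcover (fun x => {y | ∀ᶠ z in 𝓝 y, f x z = 1})
    fun x hx => (eventually_eventually_nhds.2 (f4 x hx))
  suffices H : ∀ s : Finset E, (∀ x ∈ s, x ∈ K) → ∃ χ : E → ℝ, ContDiff ℝ ∞ χ ∧ HasCompactSupport χ ∧
      (∀ y, (∃ x ∈ s, f x y = 1) → χ y = 1) ∧ P χ by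
    obtain ⟨χ, c1, c2, c3, c4⟩ := H t htK
    refine ⟨χ, c1, c2, fun y hy => ?_, c4⟩
    obtain ⟨x, hx, hxy⟩ := mem_iUnion₂.1 (ht hy)
    filter_upwards [hxy] with z hz using c3 z ⟨x, hx, hz⟩
  intro s
  induction s using Finset.induction_on with
  | empty => exact fun _ => ⟨0, contDiff_const, HasCompactSupport.zero, by simp, h0⟩
  | insert x s hxs ih =>
    intro hs
    obtain ⟨χ, c1, c2, c3, c4⟩ := ih fun y hy => hs y (Finset.mem_insert_of_mem hy)
    have hx := hs x (Finset.mem_insert_self x s)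
    have g1 : ContDiff ℝ ∞ (fun y => f x y * (1 - χ y)) := (f1 x hx).mul (contDiff_const.sub c1)
    have g2 : HasCompactSupport (fun y => f x y * (1 - χ y)) := (f2 x hx).mul_right
    -- The new function is 1 - (1 - χ)(1 - f). It equals one wherever χ or f does, and the added
    -- term has its support near x.
    refine ⟨χ + fun y => f x y * (1 - χ y), c1.add g1, c2.add g2, ?_, hadd _ _ c1 g1 c4 ?_⟩
    · rintro y ⟨z, hz, hzy⟩
      rcases Finset.mem_insert.1 hz with rfl | hz
      · simp [hzy]
      · simp [c3 y ⟨z, hz, hzy⟩]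
    · refine hVP x hx _ g1 g2 (Subset.trans (closure_mono ?_) (f3 x hx))
      exact Function.support_mul_subset_left _ _

end SmoothTools

/-! ### Tangential projections and traces -/

/-- The unit tangential part of the trace: `tr((I - n nᵀ) A)`. -/
noncomputable def tanTrace (n : R3) (A : R3 →L[ℝ] R3) : ℝ :=
  LinearMap.trace ℝ R3 A.toLinearMap - inner ℝ (A n) n

/-- The tangential part of a vector, for a unit normal `n`. -/
noncomputable def tanPart (n w : R3) : R3 := w - inner ℝ w n • n

section CrossAlgebra

/-- Since n is orthogonal to a and b, the double product n × (a × b) vanishes, so n is parallel to a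
× b. -/
theorem smul_eq_inner_smul_cross {a b n : R3} (ha : inner ℝ n a = 0) (hb : inner ℝ n b = 0) :
    ‖crossL a b‖ ^ 2 • n = inner ℝ n (crossL a b) • crossL a b := by
  have h1 : crossL n (crossL a b) = 0 := by
    have : crossL n (crossL a b) = inner ℝ n b • a - inner ℝ n a • b := by
      ext i; fin_cases i <;> simp [crossL_apply, inner_R3] <;> ring
    rw [this, ha, hb]; simp
  have h2 := norm_crossL_sq n (crossL a b)
  rw [h1, norm_zero] at h2
  set c := crossL a b
  rw [← sub_eq_zero, ← norm_eq_zero, ← pow_eq_zero_iff (n := 2) (by norm_num)]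
  rw [norm_sub_sq_real, norm_smul, norm_smul, real_inner_smul_left, real_inner_smul_right,
    Real.norm_eq_abs, Real.norm_eq_abs, mul_pow, mul_pow, sq_abs, sq_abs]
  linear_combination (-‖c‖ ^ 2) * h2

theorem eq_inner_smul_cross {a b n : R3} (ha : inner ℝ n a = 0) (hb : inner ℝ n b = 0)
    (hc : crossL a b ≠ 0) :
    n = (inner ℝ n (crossL a b) / ‖crossL a b‖ ^ 2) • crossL a b := by
  have h := smul_eq_inner_smul_cross ha hb
  have : ‖crossL a b‖ ^ 2 ≠ 0 := by simpa using hc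
  rw [div_eq_inv_mul, mul_smul, ← h, smul_smul, inv_mul_cancel₀ this, one_smul]

theorem inner_sq_eq_of_unit_normal {a b n : R3} (ha : inner ℝ n a = 0) (hb : inner ℝ n b = 0)
    (hn : ‖n‖ = 1) : inner ℝ n (crossL a b) ^ 2 = ‖crossL a b‖ ^ 2 := by
  have h := congrArg (inner ℝ n) (smul_eq_inner_smul_cross ha hb)
  rw [real_inner_smul_right, real_inner_smul_right, real_inner_self_eq_norm_sq, hn] at h
  linarith

/-- Quadratic expressions in the unit normal do not depend on the orientation. -/
theorem quad_normal_eq {a b n : R3} (ha : inner ℝ n a = 0) (hb : inner ℝ n b = 0)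
    (hn : ‖n‖ = 1) (hc : crossL a b ≠ 0) {F : Type*} [AddCommGroup F] [Module ℝ F]
    (Q : R3 →ₗ[ℝ] R3 →ₗ[ℝ] F) :
    Q n n = (‖crossL a b‖ ^ 2)⁻¹ • Q (crossL a b) (crossL a b) := by
  have h := eq_inner_smul_cross ha hb hc
  have h2 := inner_sq_eq_of_unit_normal ha hb hn
  have h3 : ‖crossL a b‖ ^ 2 ≠ 0 := by simpa using hc
  conv_lhs => rw [h]
  rw [map_smul, map_smul, LinearMap.smul_apply, smul_smul, div_mul_div_comm, ← sq, h2]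
  congr 1
  field_simp

theorem tanPart_eq {a b n : R3} (ha : inner ℝ n a = 0) (hb : inner ℝ n b = 0)
    (hn : ‖n‖ = 1) (hc : crossL a b ≠ 0) (w : R3) :
    tanPart n w = w - (inner ℝ w (crossL a b) / ‖crossL a b‖ ^ 2) • crossL a b := by
  have := quad_normal_eq ha hb hn hc
    (LinearMap.mk₂ ℝ (fun p q : R3 => inner ℝ w p • q) (by intros; rw [inner_add_right, add_smul])
      (by intros; rw [real_inner_smul_right, smul_smul]) (by intros; rw [smul_add])
      (by intros; exact smul_comm _ _ _))
  simp only [LinearMap.mk₂_apply] at this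
  rw [tanPart, this, smul_smul, div_eq_inv_mul]

theorem tanTrace_eq {a b n : R3} (ha : inner ℝ n a = 0) (hb : inner ℝ n b = 0)
    (hn : ‖n‖ = 1) (hc : crossL a b ≠ 0) (A : R3 →L[ℝ] R3) :
    tanTrace n A = LinearMap.trace ℝ R3 A.toLinearMap
      - inner ℝ (A (crossL a b)) (crossL a b) / ‖crossL a b‖ ^ 2 := by
  have := quad_normal_eq ha hb hn hc
    (LinearMap.mk₂ ℝ (fun p q : R3 => inner ℝ (A p) q) (by intros; rw [map_add, inner_add_left])
      (by intros; rw [map_smul, real_inner_smul_left, smul_eq_mul]) (by intros; rw [inner_add_right])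
      (by intros; rw [real_inner_smul_right, smul_eq_mul]))
  simp only [LinearMap.mk₂_apply] at this
  rw [tanTrace, this, smul_eq_mul, div_eq_inv_mul]

theorem inner_tanPart_normal {n : R3} (hn : ‖n‖ = 1) (w : R3) : inner ℝ (tanPart n w) n = 0 := by
  simp [tanPart, inner_sub_left, real_inner_smul_left, hn]

theorem norm_tanPart_le {n : R3} (hn : ‖n‖ = 1) (w : R3) : ‖tanPart n w‖ ≤ ‖w‖ := by
  refine le_of_sq_le_sq ?_ (norm_nonneg w)
  rw [tanPart, norm_sub_sq_real, norm_smul, real_inner_smul_right, hn, Real.norm_eq_abs, mul_one,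
    sq_abs]
  nlinarith [sq_nonneg (inner ℝ w n : ℝ)]

theorem tanPart_add (n w w' : R3) : tanPart n (w + w') = tanPart n w + tanPart n w' := by
  simp only [tanPart, inner_add_left, add_smul]; abel

theorem tanPart_smul (n w : R3) (r : ℝ) : tanPart n (r • w) = r • tanPart n w := by
  simp only [tanPart, real_inner_smul_left, smul_sub, mul_smul]

/-- Leibniz rule for the surface divergence of a scalar multiple of a tangential field. -/
theorem tanTrace_smul_add (n : R3) (A : R3 →L[ℝ] R3) (r : ℝ) (g : R3 →L[ℝ] ℝ) (X : R3)
    (hX : inner ℝ X n = 0) : tanTrace n (r • A + g.smulRight X) = r * tanTrace n A + g X := by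
  have : LinearMap.trace ℝ R3 (g.smulRight X).toLinearMap = g X := by
    rw [trace_R3]
    conv_rhs => rw [R3.sum_single X]
    simp; ring
  simp only [tanTrace, ContinuousLinearMap.toLinearMap_add, ContinuousLinearMap.toLinearMap_smul,
    map_add, map_smul, this]
  simp [inner_add_left, real_inner_smul_left, hX]
  ring

end CrossAlgebra

/-! ### Normals and charts of a closed surface -/

namespace IsClosedOrientedSurface

variable {M : Set R3} {ν : R3 → R3}

theorem norm_normal (hM : IsClosedOrientedSurface M ν) {x : R3} (hx : x ∈ M) : ‖ν x‖ = 1 := by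
  obtain ⟨U, f, hU, hxU, hf, hMU, hn⟩ := hM.exists_local x hx
  obtain ⟨h0, h1⟩ := hn x ⟨hx, hxU⟩
  rw [h1, norm_smul, norm_inv, norm_norm, inv_mul_cancel₀ (by simpa using h0)]

/-- The normal field has a smooth extension to all of space. -/
theorem exists_contDiff_normal (hM : IsClosedOrientedSurface M ν) :
    ∃ N : R3 → R3, ContDiff ℝ ∞ N ∧ EqOn N ν M := by
  refine exists_contDiff_eqOn_of_local hM.isCompact.isClosed fun x hx => ?_
  obtain ⟨U, f, hU, hxU, hf, hMU, hn⟩ := hM.exists_local x hx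
  have hg : ContDiffOn ℝ ∞ (fun y => gradient f y) U := by
    have h1 : ContDiffOn ℝ ∞ (fderiv ℝ f) U := hf.fderiv_of_isOpen hU (by simp)
    exact (InnerProductSpace.toDual ℝ R3).symm.contDiff.comp_contDiffOn h1
  have hV : IsOpen (U ∩ (fun y => gradient f y) ⁻¹' {0}ᶜ) :=
    hg.continuousOn.isOpen_inter_preimage hU isOpen_compl_singleton
  refine ⟨_, hV.mem_nhds ⟨hxU, (hn x ⟨hx, hxU⟩).1⟩, fun y => ‖gradient f y‖⁻¹ • gradient f y, ?_, ?_⟩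
  · have hg' := hg.mono (inter_subset_left : U ∩ (fun y => gradient f y) ⁻¹' {0}ᶜ ⊆ U)
    refine ContDiffOn.smul (ContDiffOn.inv (hg'.norm ℝ fun y hy => hy.2) fun y hy => ?_) hg'
    exact norm_ne_zero_iff.2 hy.2
  · rintro y ⟨hyM, hyU, -⟩
    exact ((hn y ⟨hyM, hyU⟩).2).symm

/-- The normal is orthogonal to the derivative of any map into the surface. -/
theorem inner_normal_fderiv (hM : IsClosedOrientedSurface M ν) {E : Type*} [NormedAddCommGroup E]
    [NormedSpace ℝ E] {γ : E → R3} {L : E →L[ℝ] R3} {ξ : E} (hγ : HasFDerivAt γ L ξ)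
    (hm : ∀ᶠ ξ' in 𝓝 ξ, γ ξ' ∈ M) (v : E) : inner ℝ (ν (γ ξ)) (L v) = 0 := by
  have hx := hm.self_of_nhds
  obtain ⟨U, f, hU, hxU, hf, hMU, hn⟩ := hM.exists_local _ hx
  have hfd : HasFDerivAt f (fderiv ℝ f (γ ξ)) (γ ξ) :=
    ((hf.contDiffAt (hU.mem_nhds hxU)).differentiableAt (by simp)).hasFDerivAt
  have hc := hfd.comp ξ hγ
  have hz : (fun ξ' => f (γ ξ')) =ᶠ[𝓝 ξ] fun _ => 0 := by
    filter_upwards [hm, hγ.continuousAt.eventually (hU.mem_nhds hxU)] with y hy hyU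
    have : γ y ∈ M ∩ U := ⟨hy, hyU⟩
    rw [hMU] at this
    exact this.2
  have h0 := (hc.congr_of_eventuallyEq hz.symm).unique (hasFDerivAt_const (0 : ℝ) ξ)
  have h1 : fderiv ℝ f (γ ξ) (L v) = 0 := by
    have := congrArg (fun A => A v) h0
    simpa using this
  rw [(hn _ ⟨hx, hxU⟩).2, real_inner_smul_left, gradient, InnerProductSpace.toDual_symm_apply, h1,
    mul_zero]

end IsClosedOrientedSurface

/-- A chart of a surface, whose inverse is the restriction of a linear map. -/
structure IsSurfaceChart (M : Set R3) (ν : R3 → R3) (U : Set R3) (O : Set R2) (ψ : R2 → R3)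
    (π : R3 →L[ℝ] R2) : Prop where
  isOpen_space : IsOpen U
  isOpen_plane : IsOpen O
  contDiffOn : ContDiffOn ℝ ∞ ψ O
  image_eq : ψ '' O = M ∩ U
  left_inv : ∀ ξ ∈ O, π (ψ ξ) = ξ
  mapsTo : MapsTo π U O

/-- The orthogonal projection along the gradient of f, together with f itself, is a local
diffeomorphism onto plane × ℝ. Its inverse at height zero represents the surface as a graph over the
tangent plane, and the projection is a linear left inverse. -/
theorem IsClosedOrientedSurface.exists_chart {M : Set R3} {ν : R3 → R3}
    (hM : IsClosedOrientedSurface M ν) {y : R3} (hy : y ∈ M) :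
    ∃ U O ψ π, y ∈ U ∧ IsSurfaceChart M ν U O ψ π := by
  obtain ⟨V, f, hV, hyV, hf, hMV, hn⟩ := hM.exists_local y hy
  set n := gradient f y with hndef
  have hn0 : n ≠ 0 := (hn y ⟨hy, hyV⟩).1
  have hfr : Module.finrank ℝ (ℝ ∙ n)ᗮ = 2 := by
    have := Submodule.finrank_add_finrank_orthogonal (ℝ ∙ n)
    rw [finrank_span_singleton hn0] at this
    simp at this
    omega
  let b : (ℝ ∙ n)ᗮ ≃ₗᵢ[ℝ] R2 := ((stdOrthonormalBasis ℝ (ℝ ∙ n)ᗮ).reindex (finCongr hfr)).repr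
  let π : R3 →L[ℝ] R2 := (b.toContinuousLinearEquiv : _ →L[ℝ] R2).comp (ℝ ∙ n)ᗮ.orthogonalProjectionOnto
  let G : R3 → R2 × ℝ := fun x => (π x, f x)
  have hG : ContDiffOn ℝ ∞ G V := π.contDiff.contDiffOn.prodMk hf
  have hfy : HasFDerivAt f (fderiv ℝ f y) y :=
    ((hf.contDiffAt (hV.mem_nhds hyV)).differentiableAt (by simp)).hasFDerivAt
  have hGd : fderiv ℝ G y = π.prod (fderiv ℝ f y) := (π.hasFDerivAt.prodMk hfy).fderiv
  have hinj : Function.Injective (fderiv ℝ G y) := by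
    rw [hGd, injective_iff_map_eq_zero]
    intro v hv
    have h1 : π v = 0 := congrArg Prod.fst hv
    have h2 : fderiv ℝ f y v = 0 := congrArg Prod.snd hv
    have h3 : (ℝ ∙ n)ᗮ.orthogonalProjectionOnto v = 0 := by
      have h4 : b ((ℝ ∙ n)ᗮ.orthogonalProjectionOnto v) = 0 := h1
      exact b.map_eq_zero_iff.1 h4
    rw [Submodule.orthogonalProjectionOnto_eq_zero_iff, Submodule.orthogonal_orthogonal] at h3
    obtain ⟨c, rfl⟩ := Submodule.mem_span_singleton.1 h3
    have h5 : inner ℝ n (c • n) = 0 := by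
      rw [hndef, gradient, InnerProductSpace.toDual_symm_apply]
      exact h2
    rw [real_inner_smul_right, real_inner_self_eq_norm_sq] at h5
    rcases mul_eq_zero.1 h5 with h | h
    · rw [h, zero_smul]
    · exact absurd (by simpa using h) hn0
  obtain ⟨e, heG, hye, heV, hes⟩ := exists_openPartialHomeomorph_of_contDiffOn hV hG hyV hinj
    (by simp)
  let ψ : R2 → R3 := fun ξ => e.symm (ξ, 0)
  let O : Set R2 := (fun ξ => ((ξ, 0) : R2 × ℝ)) ⁻¹' e.target
  have hO : IsOpen O := e.open_target.preimage (by fun_prop)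
  have hyz : ∀ x ∈ M, x ∈ e.source → f x = 0 := fun x hx hxe => by
    have : x ∈ M ∩ V := ⟨hx, heV hxe⟩
    rw [hMV] at this
    exact this.2
  have hOm : ∀ x ∈ M, x ∈ e.source → π x ∈ O := fun x hx hxe => by
    have := e.map_source hxe
    rw [heG] at this
    change (π x, (0 : ℝ)) ∈ e.target
    rwa [← hyz x hx hxe]
  have hπ : ∀ ξ ∈ O, π (ψ ξ) = ξ ∧ f (ψ ξ) = 0 := fun ξ hξ => by
    have := e.right_inv hξ
    rw [heG] at this
    exact ⟨congrArg Prod.fst this, congrArg Prod.snd this⟩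
  -- After intersection with π⁻¹(O), the projection sends the whole neighbourhood into O, and not
  -- only its part on the surface. Functions on O can then be extended to it along the fibres of π.
  refine ⟨e.source ∩ π ⁻¹' O, O, ψ, π, ⟨hye, hOm y hy hye⟩, ?_, hO, ?_, ?_, ?_, ?_⟩
  · exact e.open_source.inter (hO.preimage π.continuous)
  · exact hes.comp (by fun_prop : ContDiff ℝ ∞ fun ξ : R2 => ((ξ, 0) : R2 × ℝ)).contDiffOn fun _ h => h
  · ext x
    constructor
    · rintro ⟨ξ, hξ, rfl⟩
      have hs : ψ ξ ∈ e.source := e.map_target hξ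
      have : ψ ξ ∈ M ∩ V := by rw [hMV]; exact ⟨heV hs, (hπ ξ hξ).2⟩
      exact ⟨this.1, hs, by rw [mem_preimage, (hπ ξ hξ).1]; exact hξ⟩
    · rintro ⟨hxM, hxs, hxO⟩
      refine ⟨π x, hxO, ?_⟩
      have := e.left_inv hxs
      rw [heG] at this
      change e.symm (π x, 0) = x
      rw [← hyz x hxM hxs]
      exact this
  · exact fun ξ hξ => (hπ ξ hξ).1
  · exact fun x hx => hx.2

namespace IsSurfaceChart

variable {M : Set R3} {ν : R3 → R3} {U : Set R3} {O : Set R2} {ψ : R2 → R3} {π : R3 →L[ℝ] R2}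

theorem injOn (h : IsSurfaceChart M ν U O ψ π) : InjOn ψ O := fun x hx y hy hxy => by
  rw [← h.left_inv x hx, ← h.left_inv y hy, hxy]

theorem mem_surface (h : IsSurfaceChart M ν U O ψ π) {ξ : R2} (hξ : ξ ∈ O) : ψ ξ ∈ M ∩ U :=
  h.image_eq ▸ mem_image_of_mem ψ hξ

theorem right_inv (h : IsSurfaceChart M ν U O ψ π) {x : R3} (hx : x ∈ M ∩ U) : ψ (π x) = x := by
  rw [← h.image_eq] at hx
  obtain ⟨ξ, hξ, rfl⟩ := hx
  rw [h.left_inv ξ hξ]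

theorem differentiableAt (h : IsSurfaceChart M ν U O ψ π) {ξ : R2} (hξ : ξ ∈ O) :
    DifferentiableAt ℝ ψ ξ :=
  (h.contDiffOn.contDiffAt (h.isOpen_plane.mem_nhds hξ)).differentiableAt (by simp)

theorem comp_fderiv (h : IsSurfaceChart M ν U O ψ π) {ξ : R2} (hξ : ξ ∈ O) (v : R2) :
    π (fderiv ℝ ψ ξ v) = v := by
  have h1 := π.hasFDerivAt.comp ξ (h.differentiableAt hξ).hasFDerivAt
  have h2 : (π ∘ ψ) =ᶠ[𝓝 ξ] id := by
    filter_upwards [h.isOpen_plane.mem_nhds hξ] with x hx using h.left_inv x hx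
  have := (h1.congr_of_eventuallyEq h2.symm).unique (hasFDerivAt_id ξ)
  exact congrArg (fun A => A v) this

theorem injective_fderiv (h : IsSurfaceChart M ν U O ψ π) {ξ : R2} (hξ : ξ ∈ O) :
    Function.Injective (fderiv ℝ ψ ξ) := fun v w hvw => by
  rw [← h.comp_fderiv hξ v, hvw, h.comp_fderiv hξ]

theorem inner_normal (hM : IsClosedOrientedSurface M ν) (h : IsSurfaceChart M ν U O ψ π) {ξ : R2}
    (hξ : ξ ∈ O) (v : R2) : inner ℝ (ν (ψ ξ)) (fderiv ℝ ψ ξ v) = 0 := by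
  refine hM.inner_normal_fderiv (h.differentiableAt hξ).hasFDerivAt ?_ v
  filter_upwards [h.isOpen_plane.mem_nhds hξ] with x hx using (h.mem_surface hx).1

theorem restrict_eq_map (h : IsSurfaceChart M ν U O ψ π) :
    (Measure.euclideanHausdorffMeasure 2 : Measure R3).restrict (M ∩ U) =
      ((volume.restrict O).withDensity fun x => ENNReal.ofReal (jac2 (fderiv ℝ ψ x))).map ψ := by
  rw [← h.image_eq]
  exact restrict_image_eq_map_withDensity h.isOpen_plane (h.contDiffOn.of_le (by simp)) h.injOn
    fun ξ hξ => h.injective_fderiv hξ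

theorem continuousOn_jac2 (h : IsSurfaceChart M ν U O ψ π) :
    ContinuousOn (fun x => jac2 (fderiv ℝ ψ x)) O :=
  continuous_jac2.comp_continuousOn (h.contDiffOn.continuousOn_fderiv_of_isOpen h.isOpen_plane
    (by simp))

theorem aemeasurable (h : IsSurfaceChart M ν U O ψ π) : AEMeasurable ψ
    ((volume.restrict O).withDensity fun x => ENNReal.ofReal (jac2 (fderiv ℝ ψ x))) :=
  (h.contDiffOn.continuousOn.aemeasurable h.isOpen_plane.measurableSet).mono_ac
    (withDensity_absolutelyContinuous _ _)

theorem aemeasurable_jac2 (h : IsSurfaceChart M ν U O ψ π) : AEMeasurable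
    (fun x => ENNReal.ofReal (jac2 (fderiv ℝ ψ x))) (volume.restrict O) :=
  (h.continuousOn_jac2.aemeasurable h.isOpen_plane.measurableSet).ennreal_ofReal

/-- Change of variables in a chart. -/
theorem setIntegral_eq (h : IsSurfaceChart M ν U O ψ π) {f : R3 → ℝ}
    (hf : AEStronglyMeasurable f
      ((Measure.euclideanHausdorffMeasure 2 : Measure R3).restrict (M ∩ U))) :
    ∫ x in M ∩ U, f x ∂(Measure.euclideanHausdorffMeasure 2 : Measure R3)
      = ∫ ξ in O, jac2 (fderiv ℝ ψ ξ) * f (ψ ξ) := by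
  rw [h.restrict_eq_map] at hf ⊢
  rw [integral_map h.aemeasurable hf,
    integral_withDensity_eq_integral_toReal_smul₀ h.aemeasurable_jac2 (by simp)]
  refine integral_congr_ae (Eventually.of_forall fun ξ => ?_)
  simp [ENNReal.toReal_ofReal (jac2_nonneg _)]

end IsSurfaceChart

/-! ### Extension by zero and integrals of derivatives -/

section CompactSupport

variable {E F : Type*} [NormedAddCommGroup E] [NormedSpace ℝ E]
  [NormedAddCommGroup F] [NormedSpace ℝ F]

/-- Points outside O have a neighbourhood that misses the compact set K ⊆ O, so nothing happens at
the boundary of O. -/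
theorem contDiff_indicator_of_compact {O K : Set E} {f : E → F} {n : WithTop ℕ∞} (hO : IsOpen O)
    (hf : ContDiffOn ℝ n f O) (hK : IsCompact K) (hKO : K ⊆ O) (hz : ∀ x ∈ O, x ∉ K → f x = 0) :
    ContDiff ℝ n (O.indicator f) ∧ tsupport (O.indicator f) ⊆ K ∧
      HasCompactSupport (O.indicator f) := by
  have hsub : tsupport (O.indicator f) ⊆ K := by
    refine closure_minimal (fun x hx => ?_) hK.isClosed
    by_contra hxK
    refine hx ?_
    by_cases hxO : x ∈ O
    · rw [indicator_of_mem hxO, hz x hxO hxK]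
    · exact indicator_of_notMem hxO _
  refine ⟨contDiff_iff_contDiffAt.2 fun x => ?_, hsub, hK.of_isClosed_subset (isClosed_tsupport _) hsub⟩
  by_cases hxO : x ∈ O
  · refine (hf.contDiffAt (hO.mem_nhds hxO)).congr_of_eventuallyEq ?_
    filter_upwards [hO.mem_nhds hxO] with y hy using indicator_of_mem hy f
  · refine (contDiffAt_const (c := (0 : F))).congr_of_eventuallyEq ?_
    filter_upwards [hK.isClosed.isOpen_compl.mem_nhds fun h => hxO (hKO h)] with y hy
    exact image_eq_zero_of_notMem_tsupport fun h => hy (hsub h)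

theorem integral_fderiv_eq_zero [FiniteDimensional ℝ E] [MeasurableSpace E] [BorelSpace E]
    (μ : Measure E) [μ.IsAddHaarMeasure] {f : E → ℝ} (hf : ContDiff ℝ 1 f)
    (hc : HasCompactSupport f) (v : E) : ∫ x, fderiv ℝ f x v ∂μ = 0 := by
  have hd : Continuous fun x => fderiv ℝ f x v := hf.continuous_fderiv_apply (by simp) |>.comp
    (Continuous.prodMk continuous_id continuous_const)
  have hi : Integrable (fun x => fderiv ℝ f x v) μ :=
    hd.integrable_of_hasCompactSupport (hc.fderiv_apply ℝ v)
  have := integral_mul_fderiv_eq_neg_fderiv_mul_of_integrable (μ := μ) (f := fun _ : E => (1 : ℝ))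
    (g := f) (v := v) (by simp) (by simpa using hi)
    (by simpa using hf.continuous.integrable_of_hasCompactSupport hc) (by simp)
    (fun x _ => (hf.differentiable (by simp)) x)
  simpa using this

theorem setIntegral_fderiv_eq_zero [FiniteDimensional ℝ E] [MeasurableSpace E] [BorelSpace E]
    (μ : Measure E) [μ.IsAddHaarMeasure] {O K : Set E} {f : E → ℝ} (hO : IsOpen O)
    (hf : ContDiffOn ℝ 1 f O) (hK : IsCompact K) (hKO : K ⊆ O) (hz : ∀ x ∈ O, x ∉ K → f x = 0)
    (v : E) : IntegrableOn (fun x => fderiv ℝ f x v) O μ ∧ ∫ x in O, fderiv ℝ f x v ∂μ = 0 := by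
  obtain ⟨h1, h2, h3⟩ := contDiff_indicator_of_compact hO hf hK hKO hz
  have e : ∀ x ∈ O, fderiv ℝ f x v = fderiv ℝ (O.indicator f) x v := fun x hx => by
    rw [Filter.EventuallyEq.fderiv_eq]
    filter_upwards [hO.mem_nhds hx] with y hy using (indicator_of_mem hy f).symm
  have hd : Continuous fun x => fderiv ℝ (O.indicator f) x v :=
    h1.continuous_fderiv_apply (by simp) |>.comp (Continuous.prodMk continuous_id continuous_const)
  have hi : Integrable (fun x => fderiv ℝ (O.indicator f) x v) μ :=
    hd.integrable_of_hasCompactSupport (h3.fderiv_apply ℝ v)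
  refine ⟨hi.integrableOn.congr_fun (fun x hx => (e x hx).symm) hO.measurableSet, ?_⟩
  rw [setIntegral_congr_fun hO.measurableSet e, setIntegral_eq_integral_of_forall_compl_eq_zero,
    integral_fderiv_eq_zero μ h1 h3]
  intro x hx
  have : fderiv ℝ (O.indicator f) x = 0 := image_eq_zero_of_notMem_tsupport fun hh =>
    hx (hKO (h2 (tsupport_fderiv_subset ℝ hh)))
  rw [this]; rfl

end CompactSupport

/-! ### The surface divergence in a chart -/

namespace IsSurfaceChart

variable {M : Set R3} {ν : R3 → R3} {U : Set R3} {O : Set R2} {ψ : R2 → R3} {π : R3 →L[ℝ] R2}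

/-- The normal vector given by a parametrization. -/
noncomputable def paramNormal (ψ : R2 → R3) (ξ : R2) : R3 :=
  crossL (fderiv ℝ ψ ξ (EuclideanSpace.single 0 1)) (fderiv ℝ ψ ξ (EuclideanSpace.single 1 1))

theorem contDiffOn_fderiv_apply (h : IsSurfaceChart M ν U O ψ π) (v : R2) :
    ContDiffOn ℝ ∞ (fun ξ => fderiv ℝ ψ ξ v) O :=
  (h.contDiffOn.fderiv_of_isOpen h.isOpen_plane (by simp)).clm_apply contDiffOn_const

theorem contDiffOn_paramNormal (h : IsSurfaceChart M ν U O ψ π) :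
    ContDiffOn ℝ ∞ (paramNormal ψ) O :=
  (crossL.contDiff.comp_contDiffOn (h.contDiffOn_fderiv_apply _)).clm_apply
    (h.contDiffOn_fderiv_apply _)

theorem paramNormal_ne_zero (h : IsSurfaceChart M ν U O ψ π) {ξ : R2} (hξ : ξ ∈ O) :
    paramNormal ψ ξ ≠ 0 := crossL_ne_zero_of_injective (h.injective_fderiv hξ)

theorem contDiffOn_unitNormal (h : IsSurfaceChart M ν U O ψ π) :
    ContDiffOn ℝ ∞ (fun ξ => ‖paramNormal ψ ξ‖⁻¹ • paramNormal ψ ξ) O := by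
  have := h.contDiffOn_paramNormal
  refine ContDiffOn.smul (ContDiffOn.inv (this.norm ℝ fun y hy => h.paramNormal_ne_zero hy)
    fun y hy => ?_) this
  exact norm_ne_zero_iff.2 (h.paramNormal_ne_zero hy)

/-- The first component of the (Piola transformed) field `X` in the parameter plane. -/
noncomputable def planeField₀ (ψ X : R2 → R3) (ξ : R2) : ℝ :=
  inner ℝ (crossL (X ξ) (fderiv ℝ ψ ξ (EuclideanSpace.single 1 1)))
    (‖paramNormal ψ ξ‖⁻¹ • paramNormal ψ ξ)

/-- The second component of the (Piola transformed) field `X` in the parameter plane. -/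
noncomputable def planeField₁ (ψ X : R2 → R3) (ξ : R2) : ℝ :=
  inner ℝ (crossL (fderiv ℝ ψ ξ (EuclideanSpace.single 0 1)) (X ξ))
    (‖paramNormal ψ ξ‖⁻¹ • paramNormal ψ ξ)

theorem contDiffOn_planeField₀ (h : IsSurfaceChart M ν U O ψ π) {X : R2 → R3}
    (hX : ContDiffOn ℝ 1 X O) : ContDiffOn ℝ 1 (planeField₀ ψ X) O :=
  ContDiffOn.inner ℝ ((crossL.contDiff.comp_contDiffOn hX).clm_apply
    ((h.contDiffOn_fderiv_apply _).of_le (by simp))) (h.contDiffOn_unitNormal.of_le (by simp))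

theorem contDiffOn_planeField₁ (h : IsSurfaceChart M ν U O ψ π) {X : R2 → R3}
    (hX : ContDiffOn ℝ 1 X O) : ContDiffOn ℝ 1 (planeField₁ ψ X) O :=
  ContDiffOn.inner ℝ ((crossL.contDiff.comp_contDiffOn
    ((h.contDiffOn_fderiv_apply _).of_le (by simp))).clm_apply hX)
    (h.contDiffOn_unitNormal.of_le (by simp))

/-- The surface divergence in a chart. -/
theorem jac2_mul_tanTrace (hM : IsClosedOrientedSurface M ν) (h : IsSurfaceChart M ν U O ψ π)
    {X : R2 → R3} {W : R3 →L[ℝ] R3} {ξ : R2} (hξ : ξ ∈ O)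
    (hX : HasFDerivAt X (W.comp (fderiv ℝ ψ ξ)) ξ) (htan : inner ℝ (X ξ) (ν (ψ ξ)) = 0) :
    jac2 (fderiv ℝ ψ ξ) * tanTrace (ν (ψ ξ)) W =
      fderiv ℝ (planeField₀ ψ X) ξ (EuclideanSpace.single 0 1)
        + fderiv ℝ (planeField₁ ψ X) ξ (EuclideanSpace.single 1 1) := by
  set e₀ : R2 := EuclideanSpace.single 0 1
  set e₁ : R2 := EuclideanSpace.single 1 1
  set D := fderiv ℝ (fun ζ => fderiv ℝ ψ ζ) ξ with hD
  have hψ2 : HasFDerivAt (fun ζ => fderiv ℝ ψ ζ) D ξ :=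
    (((h.contDiffOn.fderiv_of_isOpen (m := ∞) h.isOpen_plane (by simp)).contDiffAt
      (h.isOpen_plane.mem_nhds hξ)).differentiableAt (by simp)).hasFDerivAt
  -- Second derivatives of ψ enter the planar divergence only through these mixed terms, and those
  -- cancel.
  have hsymm : D e₀ e₁ = D e₁ e₀ := by
    have := (h.contDiffOn.contDiffAt (h.isOpen_plane.mem_nhds hξ)).isSymmSndFDerivAt (by simp; exact WithTop.coe_le_coe.2 (le_top : (2 : ℕ∞) ≤ ⊤))
    exact this e₀ e₁
  set n : R2 → R3 := fun ζ => ‖paramNormal ψ ζ‖⁻¹ • paramNormal ψ ζ with hn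
  have hnd : HasFDerivAt n (fderiv ℝ n ξ) ξ :=
    ((h.contDiffOn_unitNormal.contDiffAt (h.isOpen_plane.mem_nhds hξ)).differentiableAt
      (by simp)).hasFDerivAt
  have hunit : ∀ ζ ∈ O, ‖n ζ‖ = 1 := fun ζ hζ => by
    have := norm_ne_zero_iff.2 (h.paramNormal_ne_zero hζ)
    rw [hn]; simp only [norm_smul, norm_inv, norm_norm]; exact inv_mul_cancel₀ this
  have hnn : ∀ v, inner ℝ (n ξ) (fderiv ℝ n ξ v) = 0 := fun v => by
    have h1 := (hnd.inner ℝ hnd)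
    have h2 : (fun ζ => (inner ℝ (n ζ) (n ζ) : ℝ)) =ᶠ[𝓝 ξ] fun _ => 1 := by
      filter_upwards [h.isOpen_plane.mem_nhds hξ] with ζ hζ
      rw [real_inner_self_eq_norm_sq, hunit ζ hζ, one_pow]
    have h3 := (h1.congr_of_eventuallyEq h2.symm).unique (hasFDerivAt_const (1 : ℝ) ξ)
    have h4 := congrArg (fun A => A v) h3
    simp only [ContinuousLinearMap.coe_comp, Function.comp_apply, fderivInnerCLM_apply,
      ContinuousLinearMap.prod_apply, _root_.zero_apply] at h4
    rw [real_inner_comm (n ξ)] at h4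
    linarith
  set p := fderiv ℝ ψ ξ e₀ with hp
  set q := fderiv ℝ ψ ξ e₁ with hq
  have hpn : inner ℝ (n ξ) p = 0 := by
    simp only [hn, paramNormal, real_inner_smul_left]
    rw [inner_crossL_left, mul_zero]
  have hqn : inner ℝ (n ξ) q = 0 := by
    simp only [hn, paramNormal, real_inner_smul_left]
    rw [inner_crossL_right, mul_zero]
  have hνp : inner ℝ (ν (ψ ξ)) p = 0 := h.inner_normal hM hξ e₀
  have hνq : inner ℝ (ν (ψ ξ)) q = 0 := h.inner_normal hM hξ e₁
  have hc : crossL p q ≠ 0 := h.paramNormal_ne_zero hξ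
  have hν1 : ‖ν (ψ ξ)‖ = 1 := hM.norm_normal (h.mem_surface hξ).1
  have hXn : inner ℝ (n ξ) (X ξ) = 0 := by
    rw [eq_inner_smul_cross hνp hνq hc, real_inner_smul_right] at htan
    have h0 : (inner ℝ (ν (ψ ξ)) (crossL p q) / ‖crossL p q‖ ^ 2 : ℝ) ≠ 0 := by
      intro h0
      have := eq_inner_smul_cross hνp hνq hc
      rw [h0, zero_smul] at this
      rw [this] at hν1; simp at hν1
    have := (mul_eq_zero.1 htan).resolve_left h0
    simp only [hn, real_inner_smul_left]
    rw [real_inner_comm]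
    change _ * inner ℝ (X ξ) (crossL p q) = 0
    rw [this, mul_zero]
  -- derivatives of the two components
  have d0 := ((crossL.hasFDerivAt_of_bilinear hX (hψ2.clm_apply (hasFDerivAt_const e₁ ξ)))).inner ℝ hnd
  have d1 := ((crossL.hasFDerivAt_of_bilinear (hψ2.clm_apply (hasFDerivAt_const e₀ ξ)) hX)).inner ℝ hnd
  have e0 := congrArg (fun A => A e₀) d0.fderiv
  have e1 := congrArg (fun A => A e₁) d1.fderiv
  have f0 : fderiv ℝ (planeField₀ ψ X) ξ e₀ = inner ℝ (crossL (X ξ) q) (fderiv ℝ n ξ e₀)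
      + inner ℝ (crossL (W p) q + crossL (X ξ) (D e₀ e₁)) (n ξ) := by
    refine e0.trans ?_
    simp [ContinuousLinearMap.precompR_apply, ContinuousLinearMap.precompL_apply, fderivInnerCLM_apply,
      ← hp, ← hq, inner_add_left]
    ring
  have f1 : fderiv ℝ (planeField₁ ψ X) ξ e₁ = inner ℝ (crossL p (X ξ)) (fderiv ℝ n ξ e₁)
      + inner ℝ (crossL p (W q) + crossL (D e₁ e₀) (X ξ)) (n ξ) := by
    refine e1.trans ?_
    simp [ContinuousLinearMap.precompR_apply, ContinuousLinearMap.precompL_apply, fderivInnerCLM_apply,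
      ← hp, ← hq, inner_add_left]
  -- Products of two tangent vectors are normal, while derivatives of the unit normal are
  -- tangential. Hence all terms that differentiate the normal vanish.
  have z : ∀ a b : R3, inner ℝ (n ξ) a = 0 → inner ℝ (n ξ) b = 0 → ∀ v,
      inner ℝ (crossL a b) (fderiv ℝ n ξ v) = 0 := by
    intro a b ha hb v
    have h1 := hnn v
    by_cases hab : crossL a b = 0
    · rw [hab, inner_zero_left]
    · rw [eq_inner_smul_cross ha hb hab, real_inner_smul_left] at h1
      refine (mul_eq_zero.1 h1).resolve_left fun h0 => ?_
      have h2 := eq_inner_smul_cross ha hb hab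
      rw [h0, zero_smul] at h2
      have := hunit ξ hξ
      rw [h2] at this; simp at this
  rw [f0, f1, z _ _ hXn hqn, z _ _ hpn hXn, hsymm, crossL_comm (D e₁ e₀)]
  have key := inner_crossL_add_crossL W p q (n ξ)
  have hcn : n ξ = ‖crossL p q‖⁻¹ • crossL p q := rfl
  have hcn0 : ‖crossL p q‖ ≠ 0 := norm_ne_zero_iff.2 hc
  have hj : jac2 (fderiv ℝ ψ ξ) = ‖crossL p q‖ := rfl
  rw [tanTrace_eq hνp hνq hν1 hc W, hj]
  simp only [inner_add_left, inner_neg_left] at key ⊢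
  have k2 : inner ℝ (crossL p q) (n ξ) = ‖crossL p q‖ := by
    rw [hcn, real_inner_smul_right, real_inner_self_eq_norm_sq]; field_simp
  have k3 : inner ℝ (crossL p q) (W (n ξ)) =
      ‖crossL p q‖⁻¹ * inner ℝ (W (crossL p q)) (crossL p q) := by
    rw [hcn, map_smul, real_inner_smul_right, real_inner_comm]
  rw [k2, k3] at key
  have k4 : ‖crossL p q‖ * (inner ℝ (W (crossL p q)) (crossL p q) / ‖crossL p q‖ ^ 2)
      = ‖crossL p q‖⁻¹ * inner ℝ (W (crossL p q)) (crossL p q) := by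
    field_simp
  rw [mul_sub, k4]
  linarith

end IsSurfaceChart

/-! ### Surface integrals and the divergence theorem -/

/-- The surface measure of a subset of `ℝ³`. -/
noncomputable abbrev surfaceMeasure (M : Set R3) : Measure R3 :=
  (Measure.euclideanHausdorffMeasure 2).restrict M

theorem continuous_tanTrace : Continuous fun p : R3 × (R3 →L[ℝ] R3) => tanTrace p.1 p.2 := by
  simp only [tanTrace, trace_R3]
  fun_prop

theorem continuous_tanPart : Continuous fun p : R3 × R3 => tanPart p.1 p.2 := by
  simp only [tanPart]
  fun_prop

namespace IsClosedOrientedSurface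

variable {M : Set R3} {ν : R3 → R3}

theorem measurableSet (hM : IsClosedOrientedSurface M ν) : MeasurableSet M :=
  hM.isCompact.isClosed.measurableSet

theorem isFiniteMeasure (hM : IsClosedOrientedSurface M ν) : IsFiniteMeasure (surfaceMeasure M) := by
  refine ⟨?_⟩
  rw [Measure.restrict_apply_univ]
  refine hM.isCompact.measure_lt_top_of_nhdsWithin fun x hx => ?_
  obtain ⟨U, O, ψ, π, hxU, h⟩ := hM.exists_chart hx
  have hπx : π x ∈ O := h.mapsTo hxU
  obtain ⟨r, hr, hrO⟩ := Metric.nhds_basis_closedBall.mem_iff.1 (h.isOpen_plane.mem_nhds hπx)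
  obtain ⟨C, hC⟩ := (isCompact_closedBall (π x) r).exists_bound_of_continuousOn
    (h.continuousOn_jac2.mono hrO)
  refine ⟨M ∩ (U ∩ π ⁻¹' Metric.closedBall (π x) r), ?_, ?_⟩
  · refine inter_mem self_mem_nhdsWithin (mem_nhdsWithin_of_mem_nhds (inter_mem ?_ ?_))
    · exact h.isOpen_space.mem_nhds hxU
    · exact π.continuous.continuousAt.preimage_mem_nhds (Metric.closedBall_mem_nhds _ hr)
  · have hsub : M ∩ (U ∩ π ⁻¹' Metric.closedBall (π x) r) ⊆ ψ '' Metric.closedBall (π x) r := by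
      rintro y ⟨hy1, hy2, hy3⟩
      exact ⟨π y, hy3, h.right_inv ⟨hy1, hy2⟩⟩
    refine (measure_mono hsub).trans_lt ?_
    rw [measure_image_eq_lintegral_jac2 h.isOpen_plane (h.contDiffOn.of_le (by simp)) h.injOn
      (fun ξ hξ => h.injective_fderiv hξ) Metric.isClosed_closedBall.measurableSet hrO]
    calc _ ≤ ∫⁻ y in Metric.closedBall (π x) r, ENNReal.ofReal C := by
          refine setLIntegral_mono measurable_const fun y hy => ENNReal.ofReal_le_ofReal ?_
          exact (le_abs_self _).trans (hC y hy)
      _ < ⊤ := by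
          rw [setLIntegral_const]
          exact ENNReal.mul_lt_top ENNReal.ofReal_lt_top measure_closedBall_lt_top

/-- Continuous functions of the position and the normal are measurable on the surface. -/
theorem aestronglyMeasurable_comp_normal (hM : IsClosedOrientedSurface M ν) {F : Type*}
    [TopologicalSpace F] [TopologicalSpace.PseudoMetrizableSpace F] [SecondCountableTopology F]
    {G : R3 × R3 → F} (hG : Continuous G) :
    AEStronglyMeasurable (fun x => G (x, ν x)) (surfaceMeasure M) := by
  obtain ⟨N, hN, hNν⟩ := hM.exists_contDiff_normal
  have hc : Continuous fun x => G (x, N x) := hG.comp (continuous_id.prodMk hN.continuous)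
  have hm : AEStronglyMeasurable (fun x => G (x, N x)) (surfaceMeasure M) := hc.aestronglyMeasurable
  refine hm.congr ?_
  filter_upwards [ae_restrict_mem hM.measurableSet] with x hx
  rw [hNν hx]

theorem integrable_comp_normal (hM : IsClosedOrientedSurface M ν) {F : Type*}
    [NormedAddCommGroup F] [SecondCountableTopology F] {G : R3 × R3 → F} (hG : Continuous G) :
    Integrable (fun x => G (x, ν x)) (surfaceMeasure M) := by
  obtain ⟨N, hN, hNν⟩ := hM.exists_contDiff_normal
  have hc : Continuous fun x => G (x, N x) := hG.comp (continuous_id.prodMk hN.continuous)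
  obtain ⟨C, hC⟩ := hM.isCompact.exists_bound_of_continuousOn hc.continuousOn
  have := hM.isFiniteMeasure
  refine Integrable.of_bound (hM.aestronglyMeasurable_comp_normal hG) C ?_
  filter_upwards [ae_restrict_mem hM.measurableSet] with x hx
  rw [← hNν hx]
  exact hC x hx

theorem integrable_of_continuous (hM : IsClosedOrientedSurface M ν) {F : Type*}
    [NormedAddCommGroup F] [SecondCountableTopology F] {G : R3 → F} (hG : Continuous G) :
    Integrable G (surfaceMeasure M) :=
  hM.integrable_comp_normal (G := fun p => G p.1) (hG.comp continuous_fst)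

theorem integrable_tanTrace (hM : IsClosedOrientedSurface M ν) {Ψ : R3 → R3} (hΨ : ContDiff ℝ 1 Ψ) :
    Integrable (fun x => tanTrace (ν x) (fderiv ℝ Ψ x)) (surfaceMeasure M) :=
  hM.integrable_comp_normal (G := fun p => tanTrace p.2 (fderiv ℝ Ψ p.1))
    (continuous_tanTrace.comp (continuous_snd.prodMk
      ((hΨ.continuous_fderiv (by simp)).comp continuous_fst)))

/-- The divergence theorem on a closed surface. -/
theorem integral_tanTrace_eq_zero (hM : IsClosedOrientedSurface M ν) {Ψ : R3 → R3}
    (hΨ : ContDiff ℝ 1 Ψ) (htan : ∀ x ∈ M, inner ℝ (Ψ x) (ν x) = 0) :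
    ∫ x, tanTrace (ν x) (fderiv ℝ Ψ x) ∂surfaceMeasure M = 0 := by
  have hsm : ∀ χ : R3 → ℝ, ContDiff ℝ ∞ χ → ContDiff ℝ 1 fun x => χ x • Ψ x := fun χ hχ =>
    (hχ.of_le (by simp)).smul hΨ
  -- The assertion for χ Ψ is additive in χ, so cutoffs supported in one chart suffice. There the
  -- integrand times the Jacobian is the divergence of a compactly supported planar field.
  obtain ⟨χ, hχ, -, hχ1, hχP⟩ := exists_eventually_eq_one_of_local hM.isCompact
    (fun χ => ContDiff ℝ ∞ χ → 
      ∫ x, tanTrace (ν x) (fderiv ℝ (fun y => χ y • Ψ y) x) ∂surfaceMeasure M = 0)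
    (fun _ => by simp [tanTrace])
    (fun f g hf hg Pf Pg _ => by
      have : ∀ x, tanTrace (ν x) (fderiv ℝ (fun y => (f + g) y • Ψ y) x)
          = tanTrace (ν x) (fderiv ℝ (fun y => f y • Ψ y) x)
            + tanTrace (ν x) (fderiv ℝ (fun y => g y • Ψ y) x) := fun x => by
        have e : (fun y => (f + g) y • Ψ y) = (fun y => f y • Ψ y) + fun y => g y • Ψ y := by
          funext y; simp [add_smul]
        rw [e, fderiv_add ((hsm f hf).differentiable (by simp) x)
          ((hsm g hg).differentiable (by simp) x)]
        simp only [tanTrace, ContinuousLinearMap.toLinearMap_add, map_add, _root_.add_apply,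
          inner_add_left]
        ring
      simp only [this]
      rw [integral_add (hM.integrable_tanTrace (hsm f hf)) (hM.integrable_tanTrace (hsm g hg)),
        Pf hf, Pg hg, add_zero])
    (fun x hx => by
      obtain ⟨U, O, ψ, π, hxU, h⟩ := hM.exists_chart hx
      refine ⟨U, h.isOpen_space.mem_nhds hxU, fun χ hχ hχc hχU _ => ?_⟩
      have hΨ' := hsm χ hχ
      set Ψ' : R3 → R3 := fun y => χ y • Ψ y with hΨ'def
      have hts : tsupport Ψ' ⊆ tsupport χ := closure_mono (Function.support_smul_subset_left χ Ψ)
      have hz : ∀ y ∈ M, y ∉ M ∩ U → tanTrace (ν y) (fderiv ℝ Ψ' y) = 0 := fun y hy hyU => by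
        have : fderiv ℝ Ψ' y = 0 := image_eq_zero_of_notMem_tsupport fun hh =>
          hyU ⟨hy, hχU (hts (tsupport_fderiv_subset ℝ hh))⟩
        simp [this, tanTrace]
      have hUm := h.isOpen_space.measurableSet
      rw [setIntegral_eq_of_subset_of_forall_sdiff_eq_zero hM.measurableSet inter_subset_left
        (fun y hy => hz y hy.1 hy.2)]
      rw [h.setIntegral_eq ((hM.integrable_tanTrace hΨ').aestronglyMeasurable.mono_measure
        (Measure.restrict_mono inter_subset_left le_rfl))]
      have hX : ContDiffOn ℝ 1 (Ψ' ∘ ψ) O := hΨ'.comp_contDiffOn (h.contDiffOn.of_le (by simp))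
      have e : ∀ ξ ∈ O, jac2 (fderiv ℝ ψ ξ) * tanTrace (ν (ψ ξ)) (fderiv ℝ Ψ' (ψ ξ)) =
          fderiv ℝ (IsSurfaceChart.planeField₀ ψ (Ψ' ∘ ψ)) ξ (EuclideanSpace.single 0 1)
          + fderiv ℝ (IsSurfaceChart.planeField₁ ψ (Ψ' ∘ ψ)) ξ (EuclideanSpace.single 1 1) := by
        intro ξ hξ
        refine h.jac2_mul_tanTrace hM hξ ?_ ?_
        · exact ((hΨ'.differentiable (by simp)) _).hasFDerivAt.comp ξ
            (h.differentiableAt hξ).hasFDerivAt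
        · simp [hΨ'def, real_inner_smul_left, htan _ (h.mem_surface hξ).1]
      rw [setIntegral_congr_fun h.isOpen_plane.measurableSet e]
      set K : Set R2 := π '' (tsupport χ ∩ M)
      have hK : IsCompact K := (hχc.isCompact.inter_right hM.isCompact.isClosed).image π.continuous
      have hKO : K ⊆ O := by
        rintro _ ⟨y, hy, rfl⟩
        exact h.mapsTo (hχU hy.1)
      have hzero : ∀ ξ ∈ O, ξ ∉ K → Ψ' (ψ ξ) = 0 := fun ξ hξ hξK => by
        have : ψ ξ ∉ tsupport χ := fun hh =>
          hξK ⟨ψ ξ, ⟨hh, (h.mem_surface hξ).1⟩, h.left_inv ξ hξ⟩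
        simp [hΨ'def, image_eq_zero_of_notMem_tsupport this]
      obtain ⟨i0, z0⟩ := setIntegral_fderiv_eq_zero volume h.isOpen_plane
        (h.contDiffOn_planeField₀ hX) hK hKO (fun ξ hξ hξK => by
          simp [IsSurfaceChart.planeField₀, hzero ξ hξ hξK]) (EuclideanSpace.single 0 1)
      obtain ⟨i1, z1⟩ := setIntegral_fderiv_eq_zero volume h.isOpen_plane
        (h.contDiffOn_planeField₁ hX) hK hKO (fun ξ hξ hξK => by
          simp [IsSurfaceChart.planeField₁, hzero ξ hξ hξK]) (EuclideanSpace.single 1 1)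
      rw [integral_add i0 i1, z0, z1, add_zero])
  rw [← hχP hχ]
  refine integral_congr_ae ?_
  filter_upwards [ae_restrict_mem hM.measurableSet] with x hx
  congr 1
  refine Filter.EventuallyEq.fderiv_eq ?_
  filter_upwards [hχ1 x hx] with y hy
  rw [hy, one_smul]

theorem fderiv_smul_eq {φ : R3 → ℝ} {Ψ : R3 → R3} (hφ : ContDiff ℝ 1 φ) (hΨ : ContDiff ℝ 1 Ψ)
    (x : R3) : fderiv ℝ (fun y => φ y • Ψ y) x
      = φ x • fderiv ℝ Ψ x + (fderiv ℝ φ x).smulRight (Ψ x) :=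
  fderiv_fun_smul ((hφ.differentiable (by simp)) x) ((hΨ.differentiable (by simp)) x)

/-- Integration by parts on a closed surface. -/
theorem integral_mul_tanTrace (hM : IsClosedOrientedSurface M ν) {φ : R3 → ℝ} {Ψ : R3 → R3}
    (hφ : ContDiff ℝ 1 φ) (hΨ : ContDiff ℝ 1 Ψ) (htan : ∀ x ∈ M, inner ℝ (Ψ x) (ν x) = 0) :
    ∫ x, φ x * tanTrace (ν x) (fderiv ℝ Ψ x) ∂surfaceMeasure M
      = - ∫ x, fderiv ℝ φ x (Ψ x) ∂surfaceMeasure M := by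
  have h0 := hM.integral_tanTrace_eq_zero (hφ.smul hΨ)
    (fun x hx => by simp [real_inner_smul_left, htan x hx])
  have e : ∀ᵐ x ∂surfaceMeasure M, tanTrace (ν x) (fderiv ℝ (fun y => φ y • Ψ y) x)
      = φ x * tanTrace (ν x) (fderiv ℝ Ψ x) + fderiv ℝ φ x (Ψ x) := by
    filter_upwards [ae_restrict_mem hM.measurableSet] with x hx
    rw [fderiv_smul_eq hφ hΨ, tanTrace_smul_add _ _ _ _ _ (htan x hx)]
  have i1 : Integrable (fun x => φ x * tanTrace (ν x) (fderiv ℝ Ψ x)) (surfaceMeasure M) :=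
    hM.integrable_comp_normal (G := fun p => φ p.1 * tanTrace p.2 (fderiv ℝ Ψ p.1))
      ((hφ.continuous.comp continuous_fst).mul (continuous_tanTrace.comp (continuous_snd.prodMk
        ((hΨ.continuous_fderiv (by simp)).comp continuous_fst))))
  have i2 : Integrable (fun x => fderiv ℝ φ x (Ψ x)) (surfaceMeasure M) :=
    hM.integrable_of_continuous ((hφ.continuous_fderiv (by simp)).clm_apply hΨ.continuous)
  have h1 := (integral_congr_ae e).symm.trans h0
  rw [integral_add i1 i2] at h1
  linarith

end IsClosedOrientedSurface

/-! ### Weak derivatives tested against annihilators of smooth functions -/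

section Mollification

variable {E : Type*} [NormedAddCommGroup E] [NormedSpace ℝ E] [FiniteDimensional ℝ E]
  [MeasurableSpace E] [BorelSpace E] (μ : Measure E) [μ.IsAddHaarMeasure]

/-- If a first order distribution with square integrable coefficients vanishes on smooth functions
supported near a compact set `K`, then it vanishes on weakly differentiable functions
supported in `K`. -/
theorem integral_eq_zero_of_forall_smooth {ι : Type*} [Fintype ι] {e : ι → E} {K : Set E}
    {δ : ℝ} (hδ : 0 < δ) {h : E → ℝ} {hd : ι → E → ℝ} (hL : MemLp h 2 μ)
    (hdL : ∀ i, MemLp (hd i) 2 μ) (hz : ∀ x, x ∉ K → h x = 0)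
    (hweak : ∀ ζ : E → ℝ, ContDiff ℝ ∞ ζ → HasCompactSupport ζ → ∀ i,
      ∫ x, h x * fderiv ℝ ζ x (e i) ∂μ = - ∫ x, hd i x * ζ x ∂μ)
    {p : E → ℝ} {q : ι → E → ℝ} (hp : MemLp p 2 μ) (hq : ∀ i, MemLp (q i) 2 μ)
    (htest : ∀ η : E → ℝ, ContDiff ℝ ∞ η → tsupport η ⊆ Metric.cthickening δ K →
      ∫ x, η x * p x ∂μ + ∑ i, ∫ x, fderiv ℝ η x (e i) * q i x ∂μ = 0) :
    ∫ x, h x * p x ∂μ + ∑ i, ∫ x, hd i x * q i x ∂μ = 0 := by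
  -- A(z) is the pairing with the data translated by z. Averaged against a mollifier ρ it becomes
  -- the pairing with the smooth function ρ ⋆ h, hence zero. As A is continuous, A(0) = 0 follows,
  -- and no convergence of mollified derivatives has to be shown.
  set A : E → ℝ := fun z => ∫ x, h (x - z) * p x ∂μ + ∑ i, ∫ x, hd i (x - z) * q i x ∂μ with hA
  have corr : ∀ {u w : E → ℝ}, MemLp u 2 μ → MemLp w 2 μ →
      Continuous fun z => ∫ x, u (x - z) * w x ∂μ := by
    intro u w hu hw
    have c := (continuous_translateL2 μ (hu.toLp u)).comp continuous_neg
    have c2 : Continuous fun z : E => inner ℝ (translateL2 μ (-z) (hu.toLp u)) (hw.toLp w) :=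
      c.inner continuous_const
    refine c2.congr fun z => ?_
    rw [L2.inner_def]
    refine integral_congr_ae ?_
    have hu' : ∀ᵐ x ∂μ, (hu.toLp u) (x + -z) = u (x + -z) :=
      (quasiMeasurePreserving_add_right μ (-z)).ae hu.coeFn_toLp
    filter_upwards [translateL2_coeFn μ (-z) (hu.toLp u), hw.coeFn_toLp, hu'] with x h1 h2 h3
    rw [h1, h2, h3, sub_eq_add_neg]
    simp [mul_comm]
  have hAc : Continuous A := (corr hL hp).add (continuous_finsetSum _ fun i _ => corr (hdL i) (hq i))
  suffices hA0 : A 0 = 0 by simpa [hA] using hA0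
  by_contra hne
  have hpos : 0 < |A 0| / 2 := by positivity
  obtain ⟨r, hr, hrA⟩ := Metric.continuousAt_iff.1 hAc.continuousAt (|A 0| / 2) hpos
  -- The bound ε < δ keeps the support of ρ ⋆ h admissible, and ε < r keeps the average of A close
  -- to A(0).
  set ε := min r δ / 2
  have hε : 0 < ε := by have := lt_min hr hδ; positivity
  have hεr : ε < r := by have := min_le_left r δ; have := lt_min hr hδ; simp only [ε]; linarith
  have hεδ : ε < δ := by have := min_le_right r δ; have := lt_min hr hδ; simp only [ε]; linarith
  let f : ContDiffBump (0 : E) := ⟨ε / 2, ε, by positivity, by linarith⟩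
  set ρ : E → ℝ := f.normed μ with hρ
  have ρ1 : ContDiff ℝ ∞ ρ := f.contDiff_normed
  have ρ2 : HasCompactSupport ρ := f.hasCompactSupport_normed
  have ρ3 : ∀ x, 0 ≤ ρ x := fun x => f.nonneg_normed x
  have ρ4 : ∫ x, ρ x ∂μ = 1 := f.integral_normed
  let m : Measure E := μ.withDensity fun x => ENNReal.ofReal (ρ x)
  have ρint : Integrable ρ μ := ρ1.continuous.integrable_of_hasCompactSupport ρ2
  have hm : IsProbabilityMeasure m := ⟨by
    rw [withDensity_apply _ MeasurableSet.univ, Measure.restrict_univ,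
      ← ofReal_integral_eq_lintegral_ofReal ρint (Eventually.of_forall ρ3), ρ4, ENNReal.ofReal_one]⟩
  have hmint : ∀ F : E → ℝ, ∫ z, F z ∂m = ∫ z, ρ z * F z ∂μ := fun F => by
    rw [integral_withDensity_eq_integral_toReal_smul (by
      exact ρ1.continuous.measurable.ennreal_ofReal) (by simp)]
    simp [ENNReal.toReal_ofReal (ρ3 _)]
  have hmp : MeasurePreserving (fun z : E × E => z.2 - z.1) (m.prod μ) μ := by
    refine ⟨by fun_prop, ?_⟩
    ext s hs
    have hmeas : Measurable fun z : E × E => z.2 - z.1 := by fun_prop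
    rw [Measure.map_apply hmeas hs, Measure.prod_apply (hmeas hs)]
    have : ∀ y : E, μ (Prod.mk y ⁻¹' ((fun z : E × E => z.2 - z.1) ⁻¹' s)) = μ s := fun y => by
      rw [← measure_preimage_add_right μ (-y) s]; simp only [sub_eq_add_neg]; rfl
    simp [this]
  have swap : ∀ {u w : E → ℝ}, MemLp u 2 μ → MemLp w 2 μ →
      ∫ z, (∫ x, u (x - z) * w x ∂μ) ∂m = ∫ x, (∫ z, ρ z * u (x - z) ∂μ) * w x ∂μ := by
    intro u w hu hw
    have hint : Integrable (Function.uncurry fun z x => u (x - z) * w x) (m.prod μ) := by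
      have h1 := hu.comp_measurePreserving hmp
      have h2 := hw.comp_measurePreserving (measurePreserving_snd (μ := m) (ν := μ))
      refine (L2.integrable_inner (𝕜 := ℝ) (h1.toLp _) (h2.toLp _)).congr ?_
      filter_upwards [h1.coeFn_toLp, h2.coeFn_toLp] with z e1 e2
      rw [e1, e2]
      simp [Function.uncurry_def, mul_comm]
    rw [integral_integral_swap hint]
    refine integral_congr_ae (Eventually.of_forall fun x => ?_)
    simp only
    rw [integral_mul_const, hmint]
  set η : E → ℝ := ρ ⋆[ContinuousLinearMap.lsmul ℝ ℝ, μ] h with hη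
  have hloc : LocallyIntegrable h μ := hL.locallyIntegrable (by norm_num)
  have η1 : ContDiff ℝ ∞ η := ρ2.contDiff_convolution_left _ ρ1 hloc
  have ηeq : ∀ x, η x = ∫ z, ρ z * h (x - z) ∂μ := fun x => rfl
  have η2 : tsupport η ⊆ Metric.cthickening δ K := by
    refine closure_minimal ?_ Metric.isClosed_cthickening
    refine (support_convolution_subset _).trans ?_
    rintro _ ⟨a, ha, b, hb, rfl⟩
    have haε : dist (a + b) b ≤ δ := by
      have : a ∈ Metric.ball (0 : E) ε := by
        rw [← f.support_normed_eq (μ := μ)]; exact ha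
      rw [dist_eq_norm, add_sub_cancel_right]
      rw [mem_ball_zero_iff] at this
      linarith
    refine Metric.mem_cthickening_of_dist_le _ b δ K ?_ haε
    by_contra hbK
    exact hb (hz b hbK)
  -- The derivative falls on ρ. The weak formula with the test function y ↦ ρ (x - y) moves it on to
  -- h.
  have ηd : ∀ i x, fderiv ℝ η x (e i) = ∫ z, ρ z * hd i (x - z) ∂μ := by
    intro i x
    have h1 := ρ2.hasFDerivAt_convolution_left (ContinuousLinearMap.lsmul ℝ ℝ)
      (ρ1.of_le (by simp)) hloc x
    rw [h1.fderiv]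
    have hcont : Continuous (fderiv ℝ ρ) := ρ1.continuous_fderiv (by simp)
    have hex : ConvolutionExistsAt (fderiv ℝ ρ) h x
        ((ContinuousLinearMap.lsmul ℝ ℝ).precompL E) μ :=
      (ρ2.fderiv ℝ).convolutionExists_left _ hcont hloc x
    rw [convolution, ContinuousLinearMap.integral_apply hex]
    simp only [ContinuousLinearMap.precompL_apply, ContinuousLinearMap.lsmul_apply, smul_eq_mul]
    let ζ : E → ℝ := fun y => ρ (x - y)
    have ζ1 : ContDiff ℝ ∞ ζ := ρ1.comp (contDiff_const.sub contDiff_id)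
    have ζ2 : HasCompactSupport ζ := ρ2.comp_homeomorph (Homeomorph.subLeft x)
    have ζd : ∀ y, fderiv ℝ ζ y (e i) = - fderiv ℝ ρ (x - y) (e i) := fun y => by
      have h2 : HasFDerivAt ρ (fderiv ℝ ρ (x - y)) (x - y) :=
        ((ρ1.differentiable (by simp)) _).hasFDerivAt
      have h3 : HasFDerivAt (fun y => x - y) (-(ContinuousLinearMap.id ℝ E)) y :=
        (hasFDerivAt_id y).const_sub x
      have := (h2.comp y h3).fderiv
      change fderiv ℝ (ρ ∘ fun y => x - y) y (e i) = _
      rw [this]; simp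
    have hw := hweak ζ ζ1 ζ2 i
    simp only [ζd, mul_neg, integral_neg, neg_inj] at hw
    rw [← integral_sub_left_eq_self _ μ x] at hw
    rw [← integral_sub_left_eq_self (fun y => hd i y * ζ y) μ x] at hw
    simp only [sub_sub_cancel, ζ] at hw
    simp_rw [mul_comm (ρ _)]
    rw [← hw]
    simp_rw [mul_comm (h _)]
  have hzero : ∫ z, A z ∂m = 0 := by
    have int1 : ∀ {u w : E → ℝ}, MemLp u 2 μ → MemLp w 2 μ →
        Integrable (fun z => ∫ x, u (x - z) * w x ∂μ) m := by
      intro u w hu hw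
      rw [integrable_withDensity_iff_integrable_smul' ρ1.continuous.measurable.ennreal_ofReal
        (by simp)]
      refine Continuous.integrable_of_hasCompactSupport ?_ ?_
      · simp only [ENNReal.toReal_ofReal (ρ3 _)]
        exact ρ1.continuous.smul (corr hu hw)
      · simp only [ENNReal.toReal_ofReal (ρ3 _)]
        exact ρ2.smul_right
    simp only [hA]
    rw [integral_add (int1 hL hp) (integrable_finsetSum _ fun i _ => int1 (hdL i) (hq i)),
      integral_finsetSum _ fun i _ => int1 (hdL i) (hq i), swap hL hp]
    simp_rw [swap (hdL _) (hq _), ← ηd, ← ηeq]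
    exact htest η η1 η2
  have hclose : |∫ z, A z ∂m - A 0| ≤ |A 0| / 2 := by
    have := f.dist_normed_convolution_le (μ := μ) (g := fun x => A (-x)) (x₀ := 0)
      (ε := |A 0| / 2) (hAc.comp continuous_neg).aestronglyMeasurable (fun x hx => by
        have hx' : dist (-x) 0 < r := by
          rw [dist_zero_right, norm_neg]; rw [mem_ball_zero_iff] at hx
          exact lt_trans hx hεr
        simpa using (hrA hx').le)
    rw [Real.dist_eq] at this
    have e : (f.normed μ ⋆[ContinuousLinearMap.lsmul ℝ ℝ, μ] fun x => A (-x)) 0 = ∫ z, A z ∂m := by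
      rw [hmint, convolution]
      simp [hρ]
    rw [e] at this
    simpa using this
  rw [hzero, zero_sub, abs_neg] at hclose
  have : 0 < |A 0| := abs_pos.2 hne
  linarith

end Mollification

/-! ### Square integrable functions in a chart -/

/-- Multiplication of a square integrable function by a continuous family of bounded operators. -/
theorem MeasureTheory.MemLp.continuousOn_clm_apply {X F G : Type*} [TopologicalSpace X] [MeasurableSpace X]
    [OpensMeasurableSpace X] [NormedAddCommGroup F] [NormedSpace ℝ F] [NormedAddCommGroup G] [NormedSpace ℝ G]
    [SecondCountableTopologyEither X (F →L[ℝ] G)]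
    {μ : Measure X} {K : Set X} (hK : IsCompact K) (hKm : MeasurableSet K)
    {B : X → F →L[ℝ] G} (hB : ContinuousOn B K) {f : X → F} {p : ℝ≥0∞}
    (hf : MemLp f p (μ.restrict K)) : MemLp (fun x => B x (f x)) p (μ.restrict K) := by
  obtain ⟨C, hC⟩ := hK.exists_bound_of_continuousOn hB
  refine hf.of_le_mul (c := C) ?_ ?_
  · exact (ContinuousLinearMap.apply ℝ G : F →L[ℝ] (F →L[ℝ] G) →L[ℝ] G).flip.aestronglyMeasurable_comp₂
      (hB.aestronglyMeasurable hKm) hf.1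
  · filter_upwards [ae_restrict_mem hKm] with x hx
    exact (B x).le_of_opNorm_le (hC x hx) _

namespace IsSurfaceChart

variable {M : Set R3} {ν : R3 → R3} {U : Set R3} {O : Set R2} {ψ : R2 → R3} {π : R3 →L[ℝ] R2}

theorem jac2_pos (h : IsSurfaceChart M ν U O ψ π) {ξ : R2} (hξ : ξ ∈ O) :
    0 < jac2 (fderiv ℝ ψ ξ) :=
  norm_pos_iff.2 (h.paramNormal_ne_zero hξ)

theorem contDiffOn_jac2 (h : IsSurfaceChart M ν U O ψ π) :
    ContDiffOn ℝ ∞ (fun ξ => jac2 (fderiv ℝ ψ ξ)) O :=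
  h.contDiffOn_paramNormal.norm ℝ fun _ hy => h.paramNormal_ne_zero hy

theorem ae_comp (h : IsSurfaceChart M ν U O ψ π) {Q : R3 → Prop}
    (hQ : ∀ᵐ x ∂surfaceMeasure M, Q x) : ∀ᵐ ξ ∂volume.restrict O, Q (ψ ξ) := by
  have h1 : ∀ᵐ x ∂(Measure.euclideanHausdorffMeasure 2 : Measure R3).restrict (M ∩ U), Q x :=
    ae_mono (Measure.restrict_mono inter_subset_left le_rfl) hQ
  rw [h.restrict_eq_map] at h1
  have h2 := ae_of_ae_map h.aemeasurable h1
  rw [ae_withDensity_iff' h.aemeasurable_jac2] at h2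
  filter_upwards [h2, ae_restrict_mem h.isOpen_plane.measurableSet] with ξ h3 hξ
  exact h3 (by simpa using h.jac2_pos hξ)

/-- On a compact part of the parameter domain the Jacobian is bounded below by a positive constant,
so Lebesgue measure there is dominated by the pulled back surface measure. -/
theorem memLp_comp (h : IsSurfaceChart M ν U O ψ π) {K : Set R2} (hK : IsCompact K) (hKO : K ⊆ O)
    {F : Type*} [NormedAddCommGroup F] {f : R3 → F} {p : ℝ≥0∞} (hf : MemLp f p (surfaceMeasure M)) :
    MemLp (fun ξ => f (ψ ξ)) p (volume.restrict K) := by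
  have h1 : MemLp f p ((Measure.euclideanHausdorffMeasure 2 : Measure R3).restrict (M ∩ U)) :=
    hf.mono_measure (Measure.restrict_mono inter_subset_left le_rfl)
  rw [h.restrict_eq_map] at h1
  have h2 := (memLp_map_measure_iff h1.1 h.aemeasurable).1 h1
  rcases K.eq_empty_or_nonempty with rfl | hne
  · simp
  obtain ⟨ξ₀, hξ₀, hmin⟩ := hK.exists_isMinOn hne (h.continuousOn_jac2.mono hKO)
  set c := jac2 (fderiv ℝ ψ ξ₀)
  have hc : 0 < c := h.jac2_pos (hKO hξ₀)
  refine h2.of_measure_le_smul (c := (ENNReal.ofReal c)⁻¹) (by simpa using hc) ?_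
  refine Measure.le_iff.2 fun s hs => ?_
  rw [Measure.smul_apply, smul_eq_mul, withDensity_apply _ hs, Measure.restrict_restrict hs,
    Measure.restrict_apply hs]
  have h3 : ENNReal.ofReal c * volume (s ∩ K)
      ≤ ∫⁻ x in s ∩ O, ENNReal.ofReal (jac2 (fderiv ℝ ψ x)) := by
    calc ENNReal.ofReal c * volume (s ∩ K) = ∫⁻ x in s ∩ K, ENNReal.ofReal c := by
          rw [setLIntegral_const]
      _ ≤ ∫⁻ x in s ∩ K, ENNReal.ofReal (jac2 (fderiv ℝ ψ x)) := by
          refine setLIntegral_mono' (hs.inter hK.measurableSet) fun x hx => ?_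
          exact ENNReal.ofReal_le_ofReal (hmin hx.2)
      _ ≤ _ := lintegral_mono_set (inter_subset_inter_right _ hKO)
  rw [← one_mul (volume (s ∩ K)), ← ENNReal.inv_mul_cancel (a := ENNReal.ofReal c)
    (by simpa using hc) (by simp), mul_assoc]
  gcongr

/-- Change of variables in a chart for functions that vanish outside of the chart domain. -/
theorem integral_eq (h : IsSurfaceChart M ν U O ψ π) (hM : IsClosedOrientedSurface M ν)
    {f : R3 → ℝ} (hf : AEStronglyMeasurable f (surfaceMeasure M))
    (hz : ∀ x ∈ M, x ∉ U → f x = 0) :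
    ∫ x, f x ∂surfaceMeasure M = ∫ ξ in O, jac2 (fderiv ℝ ψ ξ) * f (ψ ξ) := by
  rw [setIntegral_eq_of_subset_of_forall_sdiff_eq_zero hM.measurableSet
    (inter_subset_left (t := U)) (fun y hy => hz y hy.1 fun hU => hy.2 ⟨hy.1, hU⟩)]
  exact h.setIntegral_eq (hf.mono_measure (Measure.restrict_mono inter_subset_left le_rfl))

/-- The surface divergence of a multiple of a coordinate field. -/
theorem jac2_mul_tanTrace_coord (h : IsSurfaceChart M ν U O ψ π) (hM : IsClosedOrientedSurface M ν)
    {a : R2 → ℝ} {Ψ : R3 → R3} {ξ : R2} (hξ : ξ ∈ O) (hΨ : DifferentiableAt ℝ Ψ (ψ ξ)) (i : Fin 2)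
    (hX : ∀ ζ ∈ O, Ψ (ψ ζ)
      = (a ζ / jac2 (fderiv ℝ ψ ζ)) • fderiv ℝ ψ ζ (EuclideanSpace.single i 1)) :
    jac2 (fderiv ℝ ψ ξ) * tanTrace (ν (ψ ξ)) (fderiv ℝ Ψ (ψ ξ))
      = fderiv ℝ a ξ (EuclideanSpace.single i 1) := by
  -- The Piola transform of (a / J) ∂ᵢψ has i-th component a, and its other component is zero.
  have h1 := h.jac2_mul_tanTrace hM hξ (X := Ψ ∘ ψ)
    (hΨ.hasFDerivAt.comp ξ (h.differentiableAt hξ).hasFDerivAt)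
    (by rw [Function.comp_apply, hX ξ hξ, real_inner_smul_left, real_inner_comm, h.inner_normal hM hξ, mul_zero])
  rw [h1]
  have hj : ∀ ζ ∈ O, ‖paramNormal ψ ζ‖ ≠ 0 := fun ζ hζ =>
    norm_ne_zero_iff.2 (h.paramNormal_ne_zero hζ)
  have hs : ∀ ζ ∈ O, inner ℝ (paramNormal ψ ζ) (‖paramNormal ψ ζ‖⁻¹ • paramNormal ψ ζ) = ‖paramNormal ψ ζ‖ :=
    fun ζ hζ => by
      have := hj ζ hζ
      rw [real_inner_smul_right, real_inner_self_eq_norm_sq]; field_simp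
  have zero : ∀ f : R2 → ℝ, (∀ ζ ∈ O, f ζ = 0) → fderiv ℝ f ξ = 0 := fun f hf => by
    have : f =ᶠ[𝓝 ξ] fun _ => 0 := by
      filter_upwards [h.isOpen_plane.mem_nhds hξ] with ζ hζ using hf ζ hζ
    rw [this.fderiv_eq]; simp
  have same : ∀ f : R2 → ℝ, (∀ ζ ∈ O, f ζ = a ζ) → fderiv ℝ f ξ = fderiv ℝ a ξ := fun f hf => by
    refine Filter.EventuallyEq.fderiv_eq ?_
    filter_upwards [h.isOpen_plane.mem_nhds hξ] with ζ hζ using hf ζ hζ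
  have hjac : ∀ ζ, jac2 (fderiv ℝ ψ ζ) = ‖paramNormal ψ ζ‖ := fun _ => rfl
  fin_cases i
  · rw [same (planeField₀ ψ (Ψ ∘ ψ)) fun ζ hζ => by
        have := hj ζ hζ
        simp only [planeField₀, Function.comp_apply, hX ζ hζ, map_smul, _root_.smul_apply,
          real_inner_smul_left, hjac]
        change a ζ / _ * inner ℝ (paramNormal ψ ζ) _ = _
        rw [hs ζ hζ]; field_simp,
      zero (planeField₁ ψ (Ψ ∘ ψ)) fun ζ hζ => by
        simp [planeField₁, Function.comp_apply, hX ζ hζ, crossL_self]]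
    simp
  · rw [same (planeField₁ ψ (Ψ ∘ ψ)) fun ζ hζ => by
        have := hj ζ hζ
        simp only [planeField₁, Function.comp_apply, hX ζ hζ, map_smul,
          real_inner_smul_left, hjac]
        change a ζ / _ * inner ℝ (paramNormal ψ ζ) _ = _
        rw [hs ζ hζ]; field_simp,
      zero (planeField₀ ψ (Ψ ∘ ψ)) fun ζ hζ => by
        simp [planeField₀, Function.comp_apply, hX ζ hζ, crossL_self]]
    simp

/-- Tangential vectors in the coordinate basis. -/
theorem fderiv_of_tangent (h : IsSurfaceChart M ν U O ψ π) (hM : IsClosedOrientedSurface M ν)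
    {ξ : R2} (hξ : ξ ∈ O) {w : R3} (hw : inner ℝ w (ν (ψ ξ)) = 0) :
    fderiv ℝ ψ ξ (π w) = w := by
  have hν : ν (ψ ξ) ≠ 0 := fun h0 => by
    have := hM.norm_normal (h.mem_surface hξ).1
    rw [h0, norm_zero] at this; exact zero_ne_one this
  have hle : (fderiv ℝ ψ ξ).range ≤ (ℝ ∙ ν (ψ ξ))ᗮ := by
    rintro _ ⟨v, rfl⟩
    exact Submodule.mem_orthogonal_singleton_iff_inner_right.2 (h.inner_normal hM hξ v)
  have : Fact (Module.finrank ℝ R3 = 2 + 1) := ⟨by simp⟩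
  have heq := Submodule.eq_of_le_of_finrank_eq hle (by
    rw [Submodule.finrank_orthogonal_span_singleton (n := 2) hν]
    have := LinearMap.finrank_range_of_inj (f := (fderiv ℝ ψ ξ).toLinearMap) (h.injective_fderiv hξ)
    simpa using this)
  have hw' : w ∈ (fderiv ℝ ψ ξ).range := by
    rw [heq]
    exact Submodule.mem_orthogonal_singleton_iff_inner_left.2 hw
  obtain ⟨v, rfl⟩ := hw'
  exact congrArg _ (h.comp_fderiv hξ v)

end IsSurfaceChart

/-! ### Weak tangential gradients on a fixed surface and density of smooth functions -/

/-- `v` has the weak tangential gradient `g` on the surface `M`. -/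
structure IsWeakGrad (M : Set R3) (ν : R3 → R3) (v : R3 → ℝ) (g : R3 → R3) : Prop where
  memLp : MemLp v 2 (surfaceMeasure M)
  memLp_grad : MemLp g 2 (surfaceMeasure M)
  tangential : ∀ᵐ x ∂surfaceMeasure M, inner ℝ (g x) (ν x) = 0
  weak : ∀ Ψ : R3 → R3, ContDiff ℝ 1 Ψ → (∀ x ∈ M, inner ℝ (Ψ x) (ν x) = 0) →
    ∫ x, v x * tanTrace (ν x) (fderiv ℝ Ψ x) ∂surfaceMeasure M
      = - ∫ x, inner ℝ (g x) (Ψ x) ∂surfaceMeasure M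

theorem exists_contDiff_cutoff {E : Type*} [NormedAddCommGroup E] [NormedSpace ℝ E] [FiniteDimensional ℝ E]
    {K U : Set E} (hK : IsCompact K) (hU : IsOpen U) (hKU : K ⊆ U) :
    ∃ χ : E → ℝ, ContDiff ℝ ∞ χ ∧ HasCompactSupport χ ∧ tsupport χ ⊆ U ∧
      ∀ x ∈ K, ∀ᶠ y in 𝓝 x, χ y = 1 := by
  obtain ⟨χ, h1, h2, h3, h4⟩ := exists_eventually_eq_one_of_local hK (fun χ => tsupport χ ⊆ U)
    (by simp [tsupport, Function.support_zero]) (fun f g _ _ hf hg =>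
      (tsupport_add f g).trans (union_subset hf hg))
    (fun x hx => ⟨U, hU.mem_nhds (hKU hx), fun χ _ _ h => h⟩)
  exact ⟨χ, h1, h2, h4, h3⟩

theorem memLp_mul_integrable {X : Type*} [MeasurableSpace X] {μ : Measure X} {f g : X → ℝ}
    (hf : MemLp f 2 μ) (hg : MemLp g 2 μ) : Integrable (fun x => f x * g x) μ :=
  MemLp.integrable_mul hf hg

theorem memLp_inner_integrable {X : Type*} [MeasurableSpace X] {μ : Measure X}
    {F : Type*} [NormedAddCommGroup F] [InnerProductSpace ℝ F] {f g : X → F}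
    (hf : MemLp f 2 μ) (hg : MemLp g 2 μ) : Integrable (fun x => inner ℝ (f x) (g x)) μ := by
  refine (L2.integrable_inner (𝕜 := ℝ) (hf.toLp f) (hg.toLp g)).congr ?_
  filter_upwards [hf.coeFn_toLp, hg.coeFn_toLp] with x e1 e2
  rw [e1, e2]

theorem integral_add_add {X : Type*} [MeasurableSpace X] {μ : Measure X} {f g h : X → ℝ}
    (hf : Integrable f μ) (hg : Integrable g μ) (hh : Integrable h μ) :
    ∫ x, (f x + (g x + h x)) ∂μ = (∫ x, f x ∂μ) + ((∫ x, g x ∂μ) + ∫ x, h x ∂μ) := by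
  have h1 : Integrable (fun x => g x + h x) μ := hg.add hh
  rw [integral_add hf h1, integral_add hg hh]

namespace IsClosedOrientedSurface

variable {M : Set R3} {ν : R3 → R3}

theorem memLp_of_continuous (hM : IsClosedOrientedSurface M ν) {F : Type*}
    [NormedAddCommGroup F] [SecondCountableTopology F] {G : R3 → F} (hG : Continuous G) {p : ℝ≥0∞} :
    MemLp G p (surfaceMeasure M) := by
  obtain ⟨C, hC⟩ := hM.isCompact.exists_bound_of_continuousOn hG.continuousOn
  have := hM.isFiniteMeasure
  refine MemLp.of_bound (hM.integrable_of_continuous hG).1 C ?_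
  filter_upwards [ae_restrict_mem hM.measurableSet] with x hx using hC x hx

theorem memLp_tanPart (hM : IsClosedOrientedSurface M ν) {q : R3 → R3}
    (hq : MemLp q 2 (surfaceMeasure M)) :
    MemLp (fun x => tanPart (ν x) (q x)) 2 (surfaceMeasure M) := by
  refine hq.of_le_mul (c := 1) ?_ ?_
  · exact continuous_tanPart.comp_aestronglyMeasurable
      ((hM.aestronglyMeasurable_comp_normal continuous_snd).prodMk hq.1)
  · filter_upwards [ae_restrict_mem hM.measurableSet] with x hx
    rw [one_mul]
    exact norm_tanPart_le (hM.norm_normal hx) _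

/-- Multiplication of a square integrable function by a continuous family of bounded operators. -/
theorem memLp_clm_apply (hM : IsClosedOrientedSurface M ν) {F G : Type*} [NormedAddCommGroup F]
    [NormedSpace ℝ F] [NormedAddCommGroup G] [NormedSpace ℝ G] {B : R3 → F →L[ℝ] G}
    (hB : Continuous B) {f : R3 → F} {p : ℝ≥0∞} (hf : MemLp f p (surfaceMeasure M)) :
    MemLp (fun x => B x (f x)) p (surfaceMeasure M) :=
  MemLp.continuousOn_clm_apply hM.isCompact hM.measurableSet hB.continuousOn hf

end IsClosedOrientedSurface

/-- In a chart, the pairing of a localized weak pair with a pair orthogonal to all smooth ones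
vanishes. -/
theorem IsWeakGrad.integral_chart_eq_zero {M : Set R3} {ν : R3 → R3} {v : R3 → ℝ} {g : R3 → R3}
    (hM : IsClosedOrientedSurface M ν) (hw : IsWeakGrad M ν v g)
    {U : Set R3} {O : Set R2} {ψ : R2 → R3} {π : R3 →L[ℝ] R2} (h : IsSurfaceChart M ν U O ψ π)
    {p : R3 → ℝ} {q : R3 → R3} (hp : MemLp p 2 (surfaceMeasure M))
    (hq : MemLp q 2 (surfaceMeasure M)) (hqt : ∀ᵐ x ∂surfaceMeasure M, inner ℝ (q x) (ν x) = 0)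
    (horth : ∀ φ : R3 → ℝ, ContDiff ℝ ∞ φ →
      ∫ x, (φ x * p x + fderiv ℝ φ x (q x)) ∂surfaceMeasure M = 0)
    {χ : R3 → ℝ} (hχ : ContDiff ℝ ∞ χ) (hχc : HasCompactSupport χ) (hχU : tsupport χ ⊆ U) :
    ∫ x, (χ x * v x * p x + (χ x * inner ℝ (g x) (q x) + v x * fderiv ℝ χ x (q x)))
      ∂surfaceMeasure M = 0 := by
  classical
  set K : Set R2 := π '' (tsupport χ ∩ M) with hKdef
  have hK : IsCompact K := (hχc.isCompact.inter_right hM.isCompact.isClosed).image π.continuous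
  have hKO : K ⊆ O := by
    rintro _ ⟨y, hy, rfl⟩
    exact h.mapsTo (hχU hy.1)
  -- The margin δ between K and the boundary of O leaves room for mollification.
  obtain ⟨δ, hδ, hδO⟩ := hK.exists_cthickening_subset_open h.isOpen_plane hKO
  set K' := Metric.cthickening δ K with hK'def
  have hK' : IsCompact K' := hK.cthickening
  have hK'm : MeasurableSet K' := hK'.measurableSet
  have hKK' : K ⊆ K' := Metric.self_subset_cthickening K
  have hUm := h.isOpen_space.measurableSet
  have hOm := h.isOpen_plane.measurableSet
  have hχ0 : ∀ ξ ∈ O, ξ ∉ K → ψ ξ ∉ tsupport χ := fun ξ hξ hξK hh =>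
    hξK ⟨ψ ξ, ⟨hh, (h.mem_surface hξ).1⟩, h.left_inv ξ hξ⟩
  have hχz : ∀ x, x ∉ tsupport χ → χ x = 0 ∧ fderiv ℝ χ x = 0 := fun x hx =>
    ⟨image_eq_zero_of_notMem_tsupport hx, image_eq_zero_of_notMem_tsupport fun hh =>
      hx (tsupport_fderiv_subset ℝ hh)⟩
  let j : R2 → ℝ := fun ξ => jac2 (fderiv ℝ ψ ξ)
  have hj : ContDiffOn ℝ ∞ j O := h.contDiffOn_jac2
  let ψi : Fin 2 → R2 → R3 := fun i ξ => fderiv ℝ ψ ξ (EuclideanSpace.single i 1)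
  have hψi : ∀ i, ContDiffOn ℝ ∞ (ψi i) O := fun i => h.contDiffOn_fderiv_apply _
  have hχψ : ContDiffOn ℝ ∞ (fun ξ => χ (ψ ξ)) O := hχ.comp_contDiffOn h.contDiffOn
  have hχd : ∀ i, ContDiffOn ℝ ∞ (fun ξ => fderiv ℝ χ (ψ ξ) (ψi i ξ)) O := fun i =>
    ((hχ.fderiv_right (m := ∞) (by simp)).comp_contDiffOn h.contDiffOn).clm_apply (hψi i)
  -- the data in the parameter plane
  let h0 : R2 → ℝ := K'.indicator fun ξ => χ (ψ ξ) * v (ψ ξ)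
  let hd : Fin 2 → R2 → ℝ := fun i => K'.indicator fun ξ =>
    χ (ψ ξ) * inner ℝ (g (ψ ξ)) (ψi i ξ) + v (ψ ξ) * fderiv ℝ χ (ψ ξ) (ψi i ξ)
  let p' : R2 → ℝ := K'.indicator fun ξ => j ξ * p (ψ ξ)
  let q' : Fin 2 → R2 → ℝ := fun i => K'.indicator fun ξ => j ξ * π (q (ψ ξ)) i
  have mulL : ∀ {a : R2 → ℝ}, ContinuousOn a O → ∀ {f : R2 → ℝ}, MemLp f 2 (volume.restrict K') →
      MemLp (fun ξ => a ξ * f ξ) 2 (volume.restrict K') := fun {a} ha {f} hf =>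
    MemLp.continuousOn_clm_apply hK' hK'm (B := fun ξ => a ξ • ContinuousLinearMap.id ℝ ℝ)
      ((ha.mono hδO).smul continuousOn_const) hf
  have vL := h.memLp_comp hK' hδO hw.memLp
  have gL := h.memLp_comp hK' hδO hw.memLp_grad
  have pL := h.memLp_comp hK' hδO hp
  have qL := h.memLp_comp hK' hδO hq
  have h0L : MemLp h0 2 volume := (memLp_indicator_iff_restrict hK'm).2 (mulL hχψ.continuousOn vL)
  have giL : ∀ i, MemLp (fun ξ => inner ℝ (g (ψ ξ)) (ψi i ξ)) 2 (volume.restrict K') := fun i =>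
    (MemLp.continuousOn_clm_apply hK' hK'm (B := fun ξ => innerSL ℝ (ψi i ξ))
      ((innerSL ℝ).continuous.comp_continuousOn ((hψi i).continuousOn.mono hδO)) gL).ae_eq
      (Eventually.of_forall fun ξ => by simp [real_inner_comm])
  have hdL : ∀ i, MemLp (hd i) 2 volume := fun i => (memLp_indicator_iff_restrict hK'm).2
    ((mulL hχψ.continuousOn (giL i)).add ((mulL (hχd i).continuousOn vL).ae_eq
      (Eventually.of_forall fun ξ => mul_comm _ _)))
  have pL' : MemLp p' 2 volume := (memLp_indicator_iff_restrict hK'm).2 (mulL hj.continuousOn pL)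
  have qL' : ∀ i, MemLp (q' i) 2 volume := fun i => (memLp_indicator_iff_restrict hK'm).2
    (mulL hj.continuousOn (MemLp.continuousOn_clm_apply hK' hK'm
      (B := fun _ => (EuclideanSpace.proj i : R2 →L[ℝ] ℝ).comp π) continuousOn_const qL))
  have hprod : ∀ a b : R2 → ℝ, ∫ ξ, K'.indicator a ξ * b ξ = ∫ ξ in K', a ξ * b ξ := fun a b => by
    rw [← integral_indicator hK'm]
    refine integral_congr_ae (Eventually.of_forall fun ξ => ?_)
    by_cases hξ : ξ ∈ K' <;> simp [hξ]
  have hprod' : ∀ a b : R2 → ℝ, ∫ ξ, a ξ * K'.indicator b ξ = ∫ ξ in K', a ξ * b ξ := fun a b => by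
    simpa [mul_comm] using hprod b a
  have hvg : AEStronglyMeasurable v (surfaceMeasure M) := hw.memLp.1
  -- tangent vectors
  have hqψ : ∀ᵐ ξ ∂volume.restrict O, q (ψ ξ) = π (q (ψ ξ)) 0 • ψi 0 ξ + π (q (ψ ξ)) 1 • ψi 1 ξ := by
    filter_upwards [h.ae_comp hqt, ae_restrict_mem hOm] with ξ h1 h2
    conv_lhs => rw [← h.fderiv_of_tangent hM h2 h1]
    rw [clm_apply_R2]
  have hprod₂ : ∀ a b : R2 → ℝ, ∫ ξ, K'.indicator a ξ * K'.indicator b ξ = ∫ ξ in K', a ξ * b ξ :=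
    fun a b => by
      rw [hprod]
      exact setIntegral_congr_fun hK'm fun ξ hξ => by simp [hξ]
  have toK' : ∀ F : R2 → ℝ, (∀ ξ ∈ O, ξ ∉ K' → F ξ = 0) → ∫ ξ in O, F ξ = ∫ ξ in K', F ξ :=
    fun F hF => setIntegral_eq_of_subset_of_forall_sdiff_eq_zero hOm hδO fun ξ hξ => hF ξ hξ.1 hξ.2
  have hfin : IsFiniteMeasure (volume.restrict K') := ⟨by
    rw [Measure.restrict_apply_univ]; exact hK'.measure_lt_top⟩
  -- In the plane, `hd i` are the weak partial derivatives of χ v, and by hypothesis (p, q)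
  -- annihilates the smooth functions supported near K. The mollification argument applies.
  have key : (∫ ξ, h0 ξ * p' ξ) + ∑ i, ∫ ξ, hd i ξ * q' i ξ = 0 := by
    refine integral_eq_zero_of_forall_smooth volume (e := fun i => EuclideanSpace.single i 1) (K := K) hδ
      h0L hdL ?_ ?_ pL' qL' ?_
    · intro ξ hξ
      by_cases hξ' : ξ ∈ K'
      · simp [h0, (hχz _ (hχ0 ξ (hδO hξ') hξ)).1]
      · simp [h0, hξ']
    · intro ζ hζ hζc i
      -- The surface divergence of (χ ζ / J) ∂ᵢψ is J⁻¹ ∂ᵢ(χ ζ). Testing the weak gradient with this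
      -- tangential field gives the i-th planar weak derivative.
      let Y : R3 → R3 := fun x => (χ x * ζ (π x) / j (π x)) • ψi i (π x)
      have hY : ContDiffOn ℝ ∞ Y U := by
        have hπ : ContDiffOn ℝ ∞ (fun x => π x) U := π.contDiff.contDiffOn
        refine ContDiffOn.smul (ContDiffOn.div (hχ.contDiffOn.mul (hζ.comp_contDiffOn hπ))
          (hj.comp hπ h.mapsTo) fun x hx => (h.jac2_pos (h.mapsTo hx)).ne') ((hψi i).comp hπ h.mapsTo)
      obtain ⟨hΨ, -, -⟩ := contDiff_indicator_of_compact h.isOpen_space hY hχc.isCompact hχU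
        (fun x _ hx => by simp [Y, (hχz x hx).1])
      set Ψ := U.indicator Y with hΨdef
      have hΨψ : ∀ ξ ∈ O, Ψ (ψ ξ) = (χ (ψ ξ) * ζ ξ / j ξ) • ψi i ξ := fun ξ hξ => by
        rw [hΨdef, indicator_of_mem (h.mem_surface hξ).2]
        simp only [Y, h.left_inv ξ hξ]
      have htan : ∀ x ∈ M, inner ℝ (Ψ x) (ν x) = 0 := fun x hx => by
        by_cases hxU : x ∈ U
        · rw [← h.right_inv ⟨hx, hxU⟩, hΨψ _ (h.mapsTo hxU), real_inner_smul_left, real_inner_comm,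
            h.inner_normal hM (h.mapsTo hxU), mul_zero]
        · simp [hΨdef, hxU]
      have h1 := hw.weak Ψ (hΨ.of_le (by simp)) htan
      have hΨz : ∀ x ∉ U, Ψ x = 0 ∧ fderiv ℝ Ψ x = 0 := fun x hx => by
        refine ⟨indicator_of_notMem hx _, ?_⟩
        have : Ψ =ᶠ[𝓝 x] fun _ => 0 := by
          filter_upwards [(isClosed_tsupport χ).isOpen_compl.mem_nhds fun hh => hx (hχU hh)] with y hy
          by_cases hyU : y ∈ U
          · simp [hΨdef, hyU, Y, (hχz y hy).1]
          · simp [hΨdef, hyU]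
        rw [this.fderiv_eq]; simp
      rw [h.integral_eq (f := fun x => v x * tanTrace (ν x) (fderiv ℝ Ψ x)) hM (hvg.mul (hM.integrable_tanTrace (hΨ.of_le (by simp))).1)
          (fun x _ hx => by simp [(hΨz x hx).2, tanTrace]),
        h.integral_eq (f := fun x => inner ℝ (g x) (Ψ x)) hM (hw.memLp_grad.1.inner hΨ.continuous.aestronglyMeasurable)
          (fun x _ hx => by simp [(hΨz x hx).1])] at h1
      have e1 : ∀ ξ ∈ O, j ξ * (v (ψ ξ) * tanTrace (ν (ψ ξ)) (fderiv ℝ Ψ (ψ ξ)))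
          = χ (ψ ξ) * (fderiv ℝ ζ ξ (EuclideanSpace.single i 1) * v (ψ ξ))
            + ζ ξ * (fderiv ℝ χ (ψ ξ) (ψi i ξ) * v (ψ ξ)) := fun ξ hξ => by
        have h2 := h.jac2_mul_tanTrace_coord hM (a := fun ξ => χ (ψ ξ) * ζ ξ) hξ
          (hΨ.differentiable (by simp) _) i hΨψ
        have h3 : HasFDerivAt (fun ξ => χ (ψ ξ)) ((fderiv ℝ χ (ψ ξ)).comp (fderiv ℝ ψ ξ)) ξ :=
          (hχ.differentiable (by simp) _).hasFDerivAt.comp ξ (h.differentiableAt hξ).hasFDerivAt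
        rw [(h3.fun_mul (hζ.differentiable (by simp) ξ).hasFDerivAt).fderiv] at h2
        simp only [_root_.add_apply, _root_.smul_apply, ContinuousLinearMap.coe_comp, Function.comp_apply,
          smul_eq_mul] at h2
        calc _ = v (ψ ξ) * (j ξ * tanTrace (ν (ψ ξ)) (fderiv ℝ Ψ (ψ ξ))) := by ring
          _ = _ := by rw [h2]; ring
      have e2 : ∀ ξ ∈ O, j ξ * inner ℝ (g (ψ ξ)) (Ψ (ψ ξ))
          = χ (ψ ξ) * (ζ ξ * inner ℝ (g (ψ ξ)) (ψi i ξ)) := fun ξ hξ => by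
        have := (h.jac2_pos hξ).ne'
        rw [hΨψ ξ hξ, real_inner_smul_right]
        simp only [j]
        field_simp
      rw [setIntegral_congr_fun hOm e1, setIntegral_congr_fun hOm e2, toK' _ (fun ξ hξ hξK => by
          have := hχz _ (hχ0 ξ hξ fun hh => hξK (hKK' hh)); simp [this.1, this.2]),
        toK' _ (fun ξ hξ hξK => by
          have := hχz _ (hχ0 ξ hξ fun hh => hξK (hKK' hh)); simp [this.1])] at h1
      rw [hprod, hprod, eq_neg_iff_add_eq_zero]
      have cζ : ContinuousOn ζ O := hζ.continuous.continuousOn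
      have cdζ : ContinuousOn (fun ξ => fderiv ℝ ζ ξ (EuclideanSpace.single i 1)) O :=
        ((hζ.continuous_fderiv (by simp)).clm_apply continuous_const).continuousOn
      have I1 := (mulL hχψ.continuousOn (mulL cdζ vL)).integrable one_le_two
      have I2 := (mulL cζ (mulL (hχd i).continuousOn vL)).integrable one_le_two
      have I3 := (mulL hχψ.continuousOn (mulL cζ (giL i))).integrable one_le_two
      rw [integral_add I1 I2, ← add_eq_zero_iff_eq_neg] at h1
      rw [← h1, add_assoc, ← integral_add_add I1 I2 I3, ← integral_add]
      · refine integral_congr_ae (Eventually.of_forall fun ξ => ?_)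
        ring
      · exact I1.congr (Eventually.of_forall fun ξ => by simp only; ring)
      · exact (I2.add I3).congr (Eventually.of_forall fun ξ => by simp only [Pi.add_apply]; ring)
    · intro η hη hηs
      -- A planar function η extends to space as η ∘ π times a cutoff, which produces a test
      -- function for the hypothesis on the surface.
      obtain ⟨κ, hκ, hκc, hκU, hκ1⟩ := exists_contDiff_cutoff
        (hK'.image_of_continuousOn (h.contDiffOn.continuousOn.mono hδO)) h.isOpen_space
        (by rintro _ ⟨ξ, hξ, rfl⟩; exact (h.mem_surface (hδO hξ)).2)
      set φ : R3 → ℝ := fun x => κ x * η (π x) with hφdef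
      have hφ : ContDiff ℝ ∞ φ := hκ.mul (hη.comp π.contDiff)
      have hφψ : ∀ ξ ∈ O, φ (ψ ξ) = η ξ := fun ξ hξ => by
        simp only [hφdef, h.left_inv ξ hξ]
        by_cases hs : ξ ∈ tsupport η
        · rw [(hκ1 _ ⟨ξ, hηs hs, rfl⟩).self_of_nhds, one_mul]
        · rw [image_eq_zero_of_notMem_tsupport hs, mul_zero]
      have hφd : ∀ ξ ∈ O, ∀ i, fderiv ℝ φ (ψ ξ) (ψi i ξ) = fderiv ℝ η ξ (EuclideanSpace.single i 1) :=
        fun ξ hξ i => by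
          have h3 := (hφ.differentiable (by simp) (ψ ξ)).hasFDerivAt.comp ξ
            (h.differentiableAt hξ).hasFDerivAt
          have h4 : φ ∘ ψ =ᶠ[𝓝 ξ] η := by
            filter_upwards [h.isOpen_plane.mem_nhds hξ] with y hy using hφψ y hy
          rw [← h4.fderiv_eq, h3.fderiv]; rfl
      have hφz : ∀ x ∉ U, φ x = 0 ∧ fderiv ℝ φ x = 0 := fun x hx => by
        have : x ∉ tsupport φ := fun hh => hx (hκU (closure_mono (Function.support_mul_subset_left _ _) hh))
        exact ⟨image_eq_zero_of_notMem_tsupport this, image_eq_zero_of_notMem_tsupport fun hh =>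
          this (tsupport_fderiv_subset ℝ hh)⟩
      have h1 := horth φ hφ
      rw [h.integral_eq (f := fun x => φ x * p x + fderiv ℝ φ x (q x)) hM ((hφ.continuous.aestronglyMeasurable.mul hp.1).add
        (hM.memLp_clm_apply (hφ.continuous_fderiv (by simp)) hq).1)
        (fun x _ hx => by simp [(hφz x hx).1, (hφz x hx).2])] at h1
      have hηz : ∀ ξ, ξ ∉ K' → η ξ = 0 ∧ fderiv ℝ η ξ = 0 := fun ξ hξ =>
        ⟨image_eq_zero_of_notMem_tsupport fun hh => hξ (hηs hh),
          image_eq_zero_of_notMem_tsupport fun hh => hξ (hηs (tsupport_fderiv_subset ℝ hh))⟩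
      have e1 : ∀ᵐ ξ ∂volume.restrict O, j ξ * (φ (ψ ξ) * p (ψ ξ) + fderiv ℝ φ (ψ ξ) (q (ψ ξ)))
          = η ξ * (j ξ * p (ψ ξ)) + (fderiv ℝ η ξ (EuclideanSpace.single 0 1) * (j ξ * π (q (ψ ξ)) 0)
            + fderiv ℝ η ξ (EuclideanSpace.single 1 1) * (j ξ * π (q (ψ ξ)) 1)) := by
        filter_upwards [hqψ, ae_restrict_mem hOm] with ξ h2 h3
        conv_lhs => rw [h2]
        rw [map_add, map_smul, map_smul, hφd ξ h3, hφd ξ h3, hφψ ξ h3, smul_eq_mul, smul_eq_mul]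
        ring
      rw [integral_congr_ae e1, toK' _ (fun ξ _ hξK => by simp [hηz ξ hξK])] at h1
      have cη : ContinuousOn η O := hη.continuous.continuousOn
      have cdη : ∀ i, ContinuousOn (fun ξ => fderiv ℝ η ξ (EuclideanSpace.single i 1)) O := fun i =>
        ((hη.continuous_fderiv (by simp)).clm_apply continuous_const).continuousOn
      have pK := (memLp_indicator_iff_restrict hK'm).1 pL'
      have qK := fun i => (memLp_indicator_iff_restrict hK'm).1 (qL' i)
      have I1 := (mulL cη pK).integrable one_le_two
      have I2 := fun i => (mulL (cdη i) (qK i)).integrable one_le_two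
      rw [integral_add_add I1 (I2 0) (I2 1)] at h1
      simp only [p', q', hprod', Fin.sum_univ_two]
      exact h1
  have hzU : ∀ x ∈ M, x ∉ U →
      χ x * v x * p x + (χ x * inner ℝ (g x) (q x) + v x * fderiv ℝ χ x (q x)) = 0 := fun x _ hx => by
    have := hχz x fun hh => hx (hχU hh)
    simp [this.1, this.2]
  rw [h.integral_eq (f := fun x => χ x * v x * p x +
      (χ x * inner ℝ (g x) (q x) + v x * fderiv ℝ χ x (q x))) hM (((hχ.continuous.aestronglyMeasurable.mul hvg).mul hp.1).add
    ((hχ.continuous.aestronglyMeasurable.mul (hw.memLp_grad.1.inner hq.1)).add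
      (hvg.mul (hM.memLp_clm_apply (hχ.continuous_fderiv (by simp)) hq).1))) hzU]
  have e1 : ∀ᵐ ξ ∂volume.restrict O, j ξ * (χ (ψ ξ) * v (ψ ξ) * p (ψ ξ) +
      (χ (ψ ξ) * inner ℝ (g (ψ ξ)) (q (ψ ξ)) + v (ψ ξ) * fderiv ℝ χ (ψ ξ) (q (ψ ξ))))
      = χ (ψ ξ) * v (ψ ξ) * (j ξ * p (ψ ξ)) +
        ((χ (ψ ξ) * inner ℝ (g (ψ ξ)) (ψi 0 ξ) + v (ψ ξ) * fderiv ℝ χ (ψ ξ) (ψi 0 ξ))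
            * (j ξ * π (q (ψ ξ)) 0)
          + (χ (ψ ξ) * inner ℝ (g (ψ ξ)) (ψi 1 ξ) + v (ψ ξ) * fderiv ℝ χ (ψ ξ) (ψi 1 ξ))
            * (j ξ * π (q (ψ ξ)) 1)) := by
    filter_upwards [hqψ] with ξ h2
    conv_lhs => rw [h2]
    rw [map_add, map_smul, map_smul, inner_add_right, real_inner_smul_right, real_inner_smul_right,
      smul_eq_mul, smul_eq_mul]
    ring
  rw [integral_congr_ae e1, toK' _ (fun ξ hξ hξK => by
    have := hχz _ (hχ0 ξ hξ fun hh => hξK (hKK' hh)); simp [this.1, this.2])]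
  have hr := fun (f : R2 → ℝ) => memLp_indicator_iff_restrict (μ := (volume : Measure R2)) (p := 2)
    (f := f) hK'm
  have I1 := memLp_mul_integrable ((hr _).1 h0L) ((hr _).1 pL')
  have I2 := fun i => memLp_mul_integrable ((hr _).1 (hdL i)) ((hr _).1 (qL' i))
  rw [integral_add_add I1 (I2 0) (I2 1)]
  simp only [h0, hd, p', q', hprod₂, Fin.sum_univ_two] at key
  exact key

section WeakGradient

variable {M : Set R3} {ν : R3 → R3} {v : R3 → ℝ} {g : R3 → R3}

theorem inner_tanPart_left {n a b : R3} : inner ℝ (tanPart n a) b = inner ℝ a (tanPart n b) := by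
  simp only [tanPart, inner_sub_left, inner_sub_right, real_inner_smul_left, real_inner_smul_right]
  rw [real_inner_comm n b]
  ring

theorem tanPart_of_tangent {n a : R3} (h : inner ℝ a n = 0) : tanPart n a = a := by
  rw [tanPart, h, zero_smul, sub_zero]

theorem ContDiff.continuous_gradient {φ : R3 → ℝ} (hφ : ContDiff ℝ 1 φ) : Continuous (gradient φ) :=
  (InnerProductSpace.toDual ℝ R3).symm.continuous.comp (hφ.continuous_fderiv (by simp))

/-- Weakly differentiable functions are orthogonal to what is orthogonal to all smooth functions. -/
theorem IsWeakGrad.integral_eq_zero_of_orthogonal (hM : IsClosedOrientedSurface M ν)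
    (hw : IsWeakGrad M ν v g) {p : R3 → ℝ} {q : R3 → R3} (hp : MemLp p 2 (surfaceMeasure M))
    (hq : MemLp q 2 (surfaceMeasure M))
    (horth : ∀ φ : R3 → ℝ, ContDiff ℝ ∞ φ →
      ∫ x, (φ x * p x + inner ℝ (tanPart (ν x) (gradient φ x)) (q x)) ∂surfaceMeasure M = 0) :
    ∫ x, (v x * p x + inner ℝ (g x) (q x)) ∂surfaceMeasure M = 0 := by
  -- Only the tangential part of q enters either of the two pairings.
  set qt : R3 → R3 := fun x => tanPart (ν x) (q x) with hqt
  have hqtL : MemLp qt 2 (surfaceMeasure M) := hM.memLp_tanPart hq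
  have hqtt : ∀ᵐ x ∂surfaceMeasure M, inner ℝ (qt x) (ν x) = 0 := by
    filter_upwards [ae_restrict_mem hM.measurableSet] with x hx
    exact inner_tanPart_normal (hM.norm_normal hx) _
  have horth' : ∀ φ : R3 → ℝ, ContDiff ℝ ∞ φ →
      ∫ x, (φ x * p x + fderiv ℝ φ x (qt x)) ∂surfaceMeasure M = 0 := fun φ hφ => by
    rw [← horth φ hφ]
    refine integral_congr_ae (Eventually.of_forall fun x => ?_)
    simp only [inner_tanPart_left, inner_gradient_left, hqt]
  have I1 : ∀ χ : R3 → ℝ, ContDiff ℝ ∞ χ →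
      Integrable (fun x => χ x * v x * p x) (surfaceMeasure M) := fun χ hχ =>
    memLp_mul_integrable (hM.memLp_clm_apply (B := fun x => χ x • ContinuousLinearMap.id ℝ ℝ)
      (hχ.continuous.smul continuous_const) hw.memLp) hp
  have I2 : ∀ χ : R3 → ℝ, ContDiff ℝ ∞ χ →
      Integrable (fun x => χ x * inner ℝ (g x) (qt x)) (surfaceMeasure M) := fun χ hχ =>
    (memLp_inner_integrable (hM.memLp_clm_apply (B := fun x => χ x • ContinuousLinearMap.id ℝ R3)
      (hχ.continuous.smul continuous_const) hw.memLp_grad) hqtL).congr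
      (Eventually.of_forall fun x => by simp [real_inner_smul_left])
  have I3 : ∀ χ : R3 → ℝ, ContDiff ℝ ∞ χ →
      Integrable (fun x => v x * fderiv ℝ χ x (qt x)) (surfaceMeasure M) := fun χ hχ =>
    memLp_mul_integrable hw.memLp (hM.memLp_clm_apply (hχ.continuous_fderiv (by simp)) hqtL)
  have I4 : ∀ χ : R3 → ℝ, ContDiff ℝ ∞ χ → Integrable (fun x => χ x * v x * p x
      + (χ x * inner ℝ (g x) (qt x) + v x * fderiv ℝ χ x (qt x))) (surfaceMeasure M) := fun χ hχ =>
    (I1 χ hχ).add ((I2 χ hχ).add (I3 χ hχ))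
  obtain ⟨χ, hχ, -, hχ1, hχP⟩ := exists_eventually_eq_one_of_local hM.isCompact
    (fun χ => ContDiff ℝ ∞ χ → ∫ x, (χ x * v x * p x + (χ x * inner ℝ (g x) (qt x)
      + v x * fderiv ℝ χ x (qt x))) ∂surfaceMeasure M = 0)
    (fun _ => by simp)
    (fun f k hf hk Pf Pk _ => by
      have hf' := (hf.differentiable (by simp) : Differentiable ℝ f)
      have hk' := (hk.differentiable (by simp) : Differentiable ℝ k)
      rw [← add_zero (0 : ℝ)]
      nth_rewrite 1 [← Pf hf]
      rw [← Pk hk, ← integral_add (I4 f hf) (I4 k hk)]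
      refine integral_congr_ae (Eventually.of_forall fun x => ?_)
      simp only [fderiv_add (hf' x) (hk' x), Pi.add_apply, _root_.add_apply]
      ring)
    (fun x hx => by
      obtain ⟨U, O, ψ, π, hxU, h⟩ := hM.exists_chart hx
      exact ⟨U, h.isOpen_space.mem_nhds hxU, fun χ hχ hχc hχU _ =>
        hw.integral_chart_eq_zero hM h hp hqtL hqtt horth' hχ hχc hχU⟩)
  rw [← hχP hχ]
  refine integral_congr_ae ?_
  filter_upwards [ae_restrict_mem hM.measurableSet, hw.tangential] with x hx ht
  have e1 : fderiv ℝ χ x = 0 := by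
    have : χ =ᶠ[𝓝 x] fun _ => (1 : ℝ) := hχ1 x hx
    rw [this.fderiv_eq]; simp
  rw [(hχ1 x hx).self_of_nhds, e1, hqt]
  simp only [← inner_tanPart_left, tanPart_of_tangent ht]
  simp

/-- The weak tangential gradient is unique. -/
theorem IsWeakGrad.grad_ae_eq_zero (hM : IsClosedOrientedSurface M ν) (hw : IsWeakGrad M ν v g)
    (hv : v =ᵐ[surfaceMeasure M] 0) : g =ᵐ[surfaceMeasure M] 0 := by
  obtain ⟨N, hN, hNν⟩ := hM.exists_contDiff_normal
  have := hM.isFiniteMeasure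
  have key : ∀ e : R3, ∀ᵐ x ∂surfaceMeasure M, inner ℝ (g x) e = 0 := fun e => by
    refine ae_eq_zero_of_integral_contDiff_smul_eq_zero (f := fun x => inner ℝ (g x) e) ?_ ?_
    · exact ((memLp_inner_integrable hw.memLp_grad (memLp_const e))).locallyIntegrable
    · intro χ hχ _
      -- Projected constant vectors times cutoffs are admissible test fields. Since g is tangential,
      -- they detect all of its components.
      let Ψ : R3 → R3 := fun x => χ x • tanPart (N x) e
      have hΨ : ContDiff ℝ 1 Ψ := by
        refine ContDiff.of_le (n := ∞) (hχ.smul ?_) (by simp)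
        exact contDiff_const.sub ((contDiff_const.inner ℝ hN).smul hN)
      have h1 := hw.weak Ψ hΨ fun x hx => by
        simp only [Ψ, real_inner_smul_left, hNν hx]
        rw [inner_tanPart_normal (hM.norm_normal hx), mul_zero]
      have h2 : ∫ x, v x * tanTrace (ν x) (fderiv ℝ Ψ x) ∂surfaceMeasure M = 0 := by
        rw [← integral_zero R3 ℝ (μ := surfaceMeasure M)]
        refine integral_congr_ae ?_
        filter_upwards [hv] with x hx
        simp [hx]
      rw [h2, eq_comm, neg_eq_zero] at h1
      rw [← h1]
      refine integral_congr_ae ?_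
      filter_upwards [ae_restrict_mem hM.measurableSet, hw.tangential] with x hx ht
      simp only [Ψ, real_inner_smul_right, hNν hx, smul_eq_mul]
      rw [← inner_tanPart_left, tanPart_of_tangent ht]
  have h3 := fun i : Fin 3 => key (EuclideanSpace.single i 1)
  filter_upwards [h3 0, h3 1, h3 2] with x h0 h1 h2
  ext i
  fin_cases i <;> simp_all [inner_R3]

/-- Smooth functions are weakly differentiable. -/
theorem IsClosedOrientedSurface.isWeakGrad_of_contDiff (hM : IsClosedOrientedSurface M ν)
    {φ : R3 → ℝ} (hφ : ContDiff ℝ 1 φ) :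
    IsWeakGrad M ν φ fun x => tanPart (ν x) (gradient φ x) where
  memLp := hM.memLp_of_continuous hφ.continuous
  memLp_grad := hM.memLp_tanPart (hM.memLp_of_continuous hφ.continuous_gradient)
  tangential := by
    filter_upwards [ae_restrict_mem hM.measurableSet] with x hx
    exact inner_tanPart_normal (hM.norm_normal hx) _
  weak Ψ hΨ ht := by
    rw [hM.integral_mul_tanTrace hφ hΨ ht]
    congr 1
    refine integral_congr_ae ?_
    filter_upwards [ae_restrict_mem hM.measurableSet] with x hx
    rw [inner_tanPart_left, tanPart_of_tangent (ht x hx), inner_gradient_left]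

end WeakGradient

/-- Pairs of a square integrable function and a square integrable vector field. -/
abbrev SurfacePair (M : Set R3) : Type :=
  WithLp 2 (Lp ℝ 2 (surfaceMeasure M) × Lp R3 2 (surfaceMeasure M))

/-- The pairs `(φ, ∇_Γ φ)` with smooth `φ`. -/
noncomputable def smoothPairs (M : Set R3) (ν : R3 → R3) : Submodule ℝ (SurfacePair M) where
  carrier := {z | ∃ φ : R3 → ℝ, ContDiff ℝ ∞ φ ∧ z.fst =ᵐ[surfaceMeasure M] φ ∧
    z.snd =ᵐ[surfaceMeasure M] fun x => tanPart (ν x) (gradient φ x)}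
  add_mem' := by
    rintro z z' ⟨φ, hφ, h1, h2⟩ ⟨φ', hφ', h1', h2'⟩
    refine ⟨φ + φ', hφ.add hφ', (Lp.coeFn_add z.fst z'.fst).trans (h1.add h1'), ?_⟩
    filter_upwards [Lp.coeFn_add z.snd z'.snd, h2, h2'] with x e1 e2 e3
    rw [WithLp.add_snd, e1, Pi.add_apply, e2, e3, ← tanPart_add]
    congr 1
    simp only [gradient]
    rw [fderiv_add (hφ.differentiable (by simp) x) (hφ'.differentiable (by simp) x), map_add]
  zero_mem' := ⟨0, contDiff_const, Lp.coeFn_zero _ _ _, by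
    filter_upwards [Lp.coeFn_zero R3 2 (surfaceMeasure M)] with x hx
    rw [WithLp.zero_snd, hx]
    simp [gradient, tanPart]⟩
  smul_mem' := by
    rintro r z ⟨φ, hφ, h1, h2⟩
    refine ⟨r • φ, hφ.const_smul r, (Lp.coeFn_smul r z.fst).trans (h1.const_smul r), ?_⟩
    filter_upwards [Lp.coeFn_smul r z.snd, h2] with x e1 e2
    rw [WithLp.smul_snd, e1, Pi.smul_apply, e2, ← tanPart_smul]
    congr 1
    simp only [gradient]
    rw [fderiv_const_smul (hφ.differentiable (by simp) x), map_smul]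

theorem inner_surfacePair {M : Set R3} (z z' : SurfacePair M) :
    inner ℝ z z' = ∫ x, (z.fst x * z'.fst x + inner ℝ (z.snd x) (z'.snd x)) ∂surfaceMeasure M := by
  rw [WithLp.prod_inner_apply, L2.inner_def, L2.inner_def, ← integral_add]
  · refine integral_congr_ae (Eventually.of_forall fun x => ?_)
    simp only [RCLike.inner_apply, conj_trivial]
    rw [mul_comm]
    rfl
  · exact L2.integrable_inner _ _
  · exact L2.integrable_inner _ _

/-- The closure is the double orthogonal complement, so approximation by smooth functions reduces to
a statement about pairs (p, q) orthogonal to all of them. -/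
theorem mem_closure_smoothPairs {M : Set R3} {ν : R3 → R3} (hM : IsClosedOrientedSurface M ν)
    {z : SurfacePair M}
    (h : ∀ (p : R3 → ℝ) (q : R3 → R3), MemLp p 2 (surfaceMeasure M) → MemLp q 2 (surfaceMeasure M) →
      (∀ φ : R3 → ℝ, ContDiff ℝ ∞ φ →
        ∫ x, (φ x * p x + inner ℝ (tanPart (ν x) (gradient φ x)) (q x)) ∂surfaceMeasure M = 0) →
      ∫ x, (z.fst x * p x + inner ℝ (z.snd x) (q x)) ∂surfaceMeasure M = 0) :
    z ∈ (smoothPairs M ν).topologicalClosure := by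
  rw [← Submodule.orthogonal_orthogonal_eq_closure, Submodule.mem_orthogonal']
  intro w hw
  rw [inner_surfacePair]
  refine h w.fst w.snd (Lp.memLp _) (Lp.memLp _) fun φ hφ => ?_
  have hg := hM.isWeakGrad_of_contDiff (hφ.of_le (by simp))
  have := Submodule.inner_right_of_mem_orthogonal (K := smoothPairs M ν)
    (u := WithLp.toLp 2 (hg.memLp.toLp, hg.memLp_grad.toLp)) ⟨φ, hφ, hg.memLp.coeFn_toLp, hg.memLp_grad.coeFn_toLp⟩ hw
  rw [inner_surfacePair] at this
  rw [← this]
  refine integral_congr_ae ?_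
  filter_upwards [hg.memLp.coeFn_toLp, hg.memLp_grad.coeFn_toLp] with x e1 e2
  exact congrArg₂ (· + ·) (congrArg (· * w.fst x) e1.symm) (congrArg (inner ℝ · (w.snd x)) e2.symm)

/-! ### The Lions lemma with a restricted class of test elements -/

section LionsWeak

variable {V L : Type*} [NormedAddCommGroup V] [InnerProductSpace ℝ V] [CompleteSpace V]
  [TopologicalSpace.SeparableSpace V]
  [NormedAddCommGroup L] [InnerProductSpace ℝ L] [CompleteSpace L]

/-- Existence of traces and the energy identity, for a function with values in the closure of a
subspace `D` whose weak time derivative is given on `D`. -/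
theorem exists_tendsto_and_energy_identity_of_weak {a b : ℝ} (hab : a < b) (i : V →L[ℝ] L)
    (U R : Lp V 2 (volume : Measure ℝ)) (D : Submodule ℝ V)
    (hU : ∀ᵐ t, t ∈ Ioo a b → U t ∈ D.topologicalClosure)
    (H : ∀ F ∈ D, ∀ θ : ℝ → ℝ, ContDiff ℝ ∞ θ → HasCompactSupport θ → tsupport θ ⊆ Ioo a b →
      ∫ t in Ioo a b, deriv θ t * inner ℝ (i (U t)) (i F)
        = - ∫ t in Ioo a b, θ t * inner ℝ (R t) F) :
    ∃ la lb : L, Tendsto (fun t => i (U t)) (𝓝[>] a ⊓ ae volume) (𝓝 la) ∧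
      Tendsto (fun t => i (U t)) (𝓝[<] b ⊓ ae volume) (𝓝 lb) ∧
      ‖lb‖ ^ 2 - ‖la‖ ^ 2 = ∫ t in Ioo a b, 2 * inner ℝ (R t) (U t) := by
  -- Each test element has its own null set of bad times. A countable dense set of test elements
  -- gives one null set for all.
  obtain ⟨C, hCD, hC, hCd⟩ : ∃ C ⊆ (D : Set V), C.Countable ∧ (D : Set V) ⊆ closure C :=
    (TopologicalSpace.IsSeparable.of_separableSpace (D : Set V)).exists_countable_dense_subset
  have hcl : ∀ F ∈ D.topologicalClosure, F ∈ closure C := fun F hF =>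
    closure_minimal hCd isClosed_closure hF
  have h1 : ∀ F ∈ D, ∃ c, ∀ᵐ t ∂volume.restrict (Ioo a b),
      inner ℝ (i (U t)) (i F) = c + ∫ s in a..t, inner ℝ (R s) F := fun F hF => by
    refine exists_ae_eq_const_add_integral hab ?_ ?_ (H F hF)
    · have := (i.comp_memLp' (Lp.memLp U)).restrict (Ioo a b)
      exact (this.integrable (by norm_num)).inner_const _
    · exact (((Lp.memLp R).restrict (Ioo a b)).integrable (by norm_num)).inner_const _
  choose! c hc using h1
  set Z : Set ℝ := {t | U t ∈ D.topologicalClosure ∧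
    ∀ F ∈ C, inner ℝ (i (U t)) (i F) = c F + ∫ s in a..t, inner ℝ (R s) F} with hZ
  refine exists_tendsto_and_energy_identity hab i U R (Z := Z) ?_ ?_
  · have h2 : ∀ᵐ t ∂volume.restrict (Ioo a b), ∀ F ∈ C,
        inner ℝ (i (U t)) (i F) = c F + ∫ s in a..t, inner ℝ (R s) F :=
      (ae_ball_iff hC).2 fun F hF => hc F (hCD hF)
    rw [ae_restrict_iff' measurableSet_Ioo] at h2
    filter_upwards [h2, hU] with t h3 h4 ht using ⟨h4 ht, h3 ht⟩
  · intro s hs t ht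
    have hint : ∀ x y, IntervalIntegrable R volume x y := fun x y => by
      have hR : LocallyIntegrable R volume := (Lp.memLp R).locallyIntegrable (by norm_num)
      rw [intervalIntegrable_iff]
      exact (hR.integrableOn_isCompact isCompact_uIcc).mono_set uIoc_subset_uIcc
    have hpull : ∀ F, ∫ r in s..t, inner ℝ (R r) F = inner ℝ (∫ r in s..t, R r) F := fun F => by
      have := (innerSL ℝ F).intervalIntegral_comp_comm (hint s t)
      simp only [innerSL_apply_apply] at this
      rw [real_inner_comm, ← this]
      simp_rw [real_inner_comm F]
    rw [hpull]
    -- Both sides are continuous in F, so the identity passes to the closure, which contains the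
    -- value U(s) itself.
    have hclosed : IsClosed {F : V | inner ℝ (i (U t) - i (U s)) (i F) = inner ℝ (∫ r in s..t, R r) F} :=
      isClosed_eq (by fun_prop) (by fun_prop)
    refine closure_minimal (fun F hF => ?_) hclosed (hcl _ hs.1)
    rw [mem_ofPred_eq, inner_sub_left, ht.2 F hF, hs.2 F hF, ← hpull]
    have := intervalIntegral.integral_add_adjacent_intervals
      (intervalIntegrable_inner_left R F a s) (intervalIntegrable_inner_left R F s t)
    linarith

end LionsWeak

/-! ### Square integrable functions as L²-valued maps -/

section Slices

/-- The preimage of a closed set is the zero set of the distance to a countable dense subset of it.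
-/
theorem measurable_of_measurable_edist {Y Z : Type*} [MeasurableSpace Y] [PseudoEMetricSpace Z]
    [SecondCountableTopology Z] [MeasurableSpace Z] [BorelSpace Z] {f : Y → Z}
    (h : ∀ z, Measurable fun y => edist (f y) z) : Measurable f := by
  refine measurable_of_isClosed fun C hC => ?_
  obtain ⟨D, hDC, hD, hCD⟩ :=
    (TopologicalSpace.IsSeparable.of_separableSpace C).exists_countable_dense_subset
  have hcl : closure D = C := (closure_minimal hDC hC).antisymm hCD
  have : f ⁻¹' C = {y | Metric.infEDist (f y) D = 0} := by
    ext y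
    rw [mem_preimage, mem_ofPred_eq, ← Metric.mem_closure_iff_infEDist_zero, hcl]
  rw [this]
  exact (Measurable.biInf D hD fun z _ => h z) (measurableSet_singleton 0)

theorem eLpNorm_two_eq {X E : Type*} [MeasurableSpace X] [NormedAddCommGroup E] {μ : Measure X}
    (f : X → E) : eLpNorm f 2 μ = (∫⁻ x, ‖f x‖ₑ ^ (2 : ℝ) ∂μ) ^ (1 / 2 : ℝ) := by
  rw [eLpNorm_eq_lintegral_rpow_enorm_toReal (by norm_num) (by norm_num)]
  simp

/-- A square integrable function on a product, as a square integrable family of slices. -/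
theorem exists_Lp_slices {Y X E : Type*} [MeasurableSpace Y] [MeasurableSpace X]
    [NormedAddCommGroup E] {ν : Measure Y} {μ : Measure X} [SFinite μ]
    [SecondCountableTopology (Lp E 2 μ)] {F : Y × X → E} (hF : MemLp F 2 (ν.prod μ)) :
    ∃ G : Lp (Lp E 2 μ) 2 ν, ∀ᵐ t ∂ν, G t =ᵐ[μ] fun x => F (t, x) := by
  classical
  obtain ⟨f, hf, hFf⟩ := hF.1
  have hfL : MemLp f 2 (ν.prod μ) := hF.ae_eq hFf
  have hfm : ∀ t, StronglyMeasurable fun x => f (t, x) := fun t => hf.comp_measurable (by fun_prop)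
  let I : Y → ℝ≥0∞ := fun t => ∫⁻ x, ‖f (t, x)‖ₑ ^ (2 : ℝ) ∂μ
  have hI : Measurable I := (hf.enorm.pow_const 2).lintegral_prod_right'
  have hIint : ∫⁻ t, I t ∂ν < ⊤ := by
    have h1 := hfL.2
    rw [eLpNorm_two_eq, lintegral_prod _ (hf.enorm.pow_const 2).aemeasurable] at h1
    exact (ENNReal.rpow_lt_top_iff_of_pos (by norm_num)).1 h1
  have hmem : ∀ t, MemLp (fun x => f (t, x)) 2 μ ↔ I t < ⊤ := fun t => by
    rw [MemLp, eLpNorm_two_eq, ENNReal.rpow_lt_top_iff_of_pos (by norm_num)]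
    exact ⟨fun h => h.2, fun h => ⟨(hfm t).aestronglyMeasurable, h⟩⟩
  let G₀ : Y → Lp E 2 μ := fun t => if h : MemLp (fun x => f (t, x)) 2 μ then h.toLp else 0
  have hG₀ : ∀ t, I t < ⊤ → G₀ t =ᵐ[μ] fun x => f (t, x) := fun t ht => by
    have h := (hmem t).2 ht
    simp only [G₀, dif_pos h]
    exact h.coeFn_toLp
  have hS : MeasurableSet {t | I t < ⊤} := measurableSet_lt hI measurable_const
  borelize ↥(Lp E 2 μ)
  -- The distance of a slice to a fixed function is a partial integral, which is measurable by
  -- Tonelli's theorem.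
  have hGm : Measurable G₀ := by
    refine measurable_of_measurable_edist fun c => ?_
    let c' : X → E := (Lp.aestronglyMeasurable c).mk c
    have hc' : StronglyMeasurable c' := (Lp.aestronglyMeasurable c).stronglyMeasurable_mk
    have e : (fun t => edist (G₀ t) c) = fun t => if I t < ⊤ then
        (∫⁻ x, ‖f (t, x) - c' x‖ₑ ^ (2 : ℝ) ∂μ) ^ (1 / 2 : ℝ) else edist 0 c := by
      funext t
      split_ifs with ht
      · rw [Lp.edist_def, ← eLpNorm_two_eq (μ := μ) fun x => f (t, x) - c' x]
        exact eLpNorm_congr_ae ((hG₀ t ht).sub (Lp.aestronglyMeasurable c).ae_eq_mk)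
      · have h : ¬ MemLp (fun x => f (t, x)) 2 μ := fun h => ht ((hmem t).1 h)
        simp only [G₀, dif_neg h]
    rw [e]
    refine Measurable.ite hS ?_ measurable_const
    refine Measurable.pow_const ?_ _
    exact ((hf.sub (hc'.comp_measurable measurable_snd)).enorm.pow_const 2).lintegral_prod_right'
  have hGn : ∀ t, ‖G₀ t‖ₑ ^ (2 : ℝ) ≤ I t := fun t => by
    by_cases ht : I t < ⊤
    · rw [Lp.enorm_def, eLpNorm_congr_ae (hG₀ t ht), eLpNorm_two_eq, ← ENNReal.rpow_mul]
      norm_num [I]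
    · rw [not_lt, top_le_iff] at ht; rw [ht]; exact le_top
  have hGL : MemLp G₀ 2 ν := by
    refine ⟨hGm.stronglyMeasurable.aestronglyMeasurable, ?_⟩
    rw [eLpNorm_two_eq, ENNReal.rpow_lt_top_iff_of_pos (by norm_num)]
    exact (lintegral_mono hGn).trans_lt hIint
  refine ⟨hGL.toLp, ?_⟩
  filter_upwards [hGL.coeFn_toLp, ae_lt_top hI hIint.ne, Measure.ae_ae_of_ae_prod hFf] with t h1 h2 h3
  rw [h1]
  have h4 : (fun x => F (t, x)) =ᵐ[μ] fun x => f (t, x) := h3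
  exact (hG₀ t h2).trans h4.symm

end Slices

/-! ### Grönwall uniqueness, tangential derivatives and cofactors -/

/-- Grönwall uniqueness in both time directions. -/
theorem eqOn_zero_of_norm_deriv_le {E : Type*} [NormedAddCommGroup E] [NormedSpace ℝ E] {T K : ℝ}
    {d d' : ℝ → E} (hd : ∀ t ∈ Icc 0 T, HasDerivWithinAt d (d' t) (Icc 0 T) t)
    (hK : ∀ t ∈ Icc 0 T, ‖d' t‖ ≤ K * ‖d t‖) {t₀ : ℝ} (ht₀ : t₀ ∈ Icc 0 T) (h0 : d t₀ = 0) :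
    d 0 = 0 := by
  -- Time is reversed, so that the usual forward estimate leads from t₀ back to 0.
  let e : ℝ → E := fun s => d (t₀ - s)
  have hmem : ∀ s ∈ Icc 0 t₀, t₀ - s ∈ Icc 0 T := fun s hs =>
    ⟨by linarith [hs.2], by linarith [hs.1, ht₀.2]⟩
  have hde : ∀ s ∈ Icc 0 t₀, HasDerivWithinAt e (-(d' (t₀ - s))) (Icc 0 t₀) s := fun s hs => by
    have h1 := (hd _ (hmem s hs)).scomp s (((hasDerivAt_id s).const_sub t₀).hasDerivWithinAt (s := Icc 0 t₀))
      (fun x hx => hmem x hx)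
    rw [neg_one_smul] at h1
    exact h1
  have h1 := eq_zero_of_abs_deriv_le_mul_abs_self_of_eq_zero_right (f := e)
    (f' := fun s => -(d' (t₀ - s))) (K := K) (a := 0) (b := t₀)
    (fun s hs => (hde s hs).continuousWithinAt)
    (fun s hs => ((hde s ⟨hs.1, hs.2.le⟩).mono_of_mem_nhdsWithin (Icc_mem_nhdsGE_of_mem hs)))
    (by simpa [e] using h0)
    (fun s hs => by
      rw [norm_neg]; exact hK _ (hmem s ⟨hs.1, hs.2.le⟩)) t₀ ⟨ht₀.1, le_rfl⟩
  simpa [e] using h1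

/-- A function that is constant on a surface has vanishing tangential derivatives. -/
theorem IsClosedOrientedSurface.fderiv_tangent_eq_zero {M : Set R3} {ν : R3 → R3}
    (hM : IsClosedOrientedSurface M ν) {F : Type*} [NormedAddCommGroup F] [NormedSpace ℝ F]
    {G : R3 → F} {y τ : R3} (hy : y ∈ M) (hG : DifferentiableAt ℝ G y) (h0 : ∀ x ∈ M, G x = 0)
    (hτ : inner ℝ τ (ν y) = 0) : fderiv ℝ G y τ = 0 := by
  obtain ⟨U, O, ψ, π, hyU, h⟩ := hM.exists_chart hy
  have hξ : π y ∈ O := h.mapsTo hyU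
  have hψ : ψ (π y) = y := h.right_inv ⟨hy, hyU⟩
  have h1 := (hψ.symm ▸ hG : DifferentiableAt ℝ G (ψ (π y))).hasFDerivAt.comp (π y)
    (h.differentiableAt hξ).hasFDerivAt
  have h2 : G ∘ ψ =ᶠ[𝓝 (π y)] fun _ => 0 := by
    filter_upwards [h.isOpen_plane.mem_nhds hξ] with x hx using h0 _ (h.mem_surface hx).1
  have h3 := (h1.congr_of_eventuallyEq h2.symm).unique (hasFDerivAt_const (0 : F) (π y))
  have h4 := congrArg (fun A => A (π τ)) h3
  simp only [ContinuousLinearMap.coe_comp, Function.comp_apply, _root_.zero_apply] at h4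
  rwa [h.fderiv_of_tangent hM hξ (by rwa [hψ]), hψ] at h4

/-- The cofactor matrix of `A` applied to a vector. -/
noncomputable def cofL (A : R3 →L[ℝ] R3) (n : R3) : R3 :=
  n 0 • crossL (A (EuclideanSpace.single 1 1)) (A (EuclideanSpace.single 2 1))
    + n 1 • crossL (A (EuclideanSpace.single 2 1)) (A (EuclideanSpace.single 0 1))
    + n 2 • crossL (A (EuclideanSpace.single 0 1)) (A (EuclideanSpace.single 1 1))

/-- If n = a × b for a tangent frame, the cofactor matrix applied to n involves only tangential
derivatives of the map. This expresses the transported normal, smooth in (y, t), through a frame. -/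
theorem cofL_crossL (A : R3 →L[ℝ] R3) (a b : R3) : cofL A (crossL a b) = crossL (A a) (A b) := by
  have h : ∀ (v : R3) (i : Fin 3), A v i = v 0 * A (EuclideanSpace.single 0 1) i
      + v 1 * A (EuclideanSpace.single 1 1) i + v 2 * A (EuclideanSpace.single 2 1) i := clm_apply_R3 A
  simp only [cofL]
  generalize A (EuclideanSpace.single 0 1) = p at *
  generalize A (EuclideanSpace.single 1 1) = q at *
  generalize A (EuclideanSpace.single 2 1) = r at *
  have h1 := h a
  have h2 := h b
  generalize A a = x at *
  generalize A b = y at *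
  ext i
  fin_cases i <;> simp [crossL_apply, h1, h2] <;> ring

theorem cofL_smul (A : R3 →L[ℝ] R3) (r : ℝ) (n : R3) : cofL A (r • n) = r • cofL A n := by
  simp only [cofL, PiLp.smul_apply, smul_eq_mul, mul_smul, smul_add]

theorem contDiff_cofL {n : WithTop ℕ∞} :
    ContDiff ℝ n fun p : (R3 →L[ℝ] R3) × R3 => cofL p.1 p.2 := by
  have h1 : ∀ v : R3, ContDiff ℝ n fun p : (R3 →L[ℝ] R3) × R3 => p.1 v := fun v =>
    contDiff_fst.clm_apply contDiff_const
  have h2 : ∀ i, ContDiff ℝ n fun p : (R3 →L[ℝ] R3) × R3 => p.2 i := fun i =>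
    (EuclideanSpace.proj i : R3 →L[ℝ] ℝ).contDiff.comp contDiff_snd
  have h3 : ∀ v w : R3, ContDiff ℝ n fun p : (R3 →L[ℝ] R3) × R3 => crossL (p.1 v) (p.1 w) :=
    fun v w => (crossL.contDiff.comp (h1 v)).clm_apply (h1 w)
  exact (((h2 0).smul (h3 _ _)).add ((h2 1).smul (h3 _ _))).add ((h2 2).smul (h3 _ _))

/-! ### The flow map and its differential along the initial surface -/

namespace EvolvingSurface

variable (S : EvolvingSurface)

theorem zero_mem_Icc : (0 : ℝ) ∈ Icc 0 S.T := ⟨le_rfl, S.T_pos.le⟩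

theorem isSurface_zero : IsClosedOrientedSurface (S.Γ 0) (S.normal 0) := S.isSurface 0 S.zero_mem_Icc

theorem Φ_mem {y : R3} (hy : y ∈ S.Γ 0) {t : ℝ} (ht : t ∈ Icc 0 S.T) : S.Φ (y, t) ∈ S.Γ t :=
  S.image_Φ t ht ▸ mem_image_of_mem (fun y => S.Φ (y, t)) hy

theorem hasFDerivAt_Φ (p : R3 × ℝ) : HasFDerivAt S.Φ (fderiv ℝ S.Φ p) p :=
  (S.contDiff_Φ.differentiable (by simp) p).hasFDerivAt

/-- The spatial derivative of the flow map. -/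
noncomputable def dΦ (y : R3) (t : ℝ) : R3 →L[ℝ] R3 :=
  (fderiv ℝ S.Φ (y, t)).comp (ContinuousLinearMap.inl ℝ R3 ℝ)

theorem hasFDerivAt_Φ_space (y : R3) (t : ℝ) : HasFDerivAt (fun x => S.Φ (x, t)) (S.dΦ y t) y :=
  (S.hasFDerivAt_Φ (y, t)).comp y (hasFDerivAt_prodMk_left y t)

theorem hasDerivAt_Φ_time {y : R3} (hy : y ∈ S.Γ 0) {t : ℝ} (ht : t ∈ Icc 0 S.T) :
    HasDerivAt (fun s => S.Φ (y, s)) (S.w (S.Φ (y, t), t)) t := by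
  have h1 : HasDerivAt (fun s => S.Φ (y, s)) (fderiv ℝ S.Φ (y, t) (0, 1)) t := by
    have := (S.hasFDerivAt_Φ (y, t)).comp_hasDerivAt t ((hasDerivAt_const t y).prodMk (hasDerivAt_id t))
    exact this
  have h2 := (h1.hasDerivWithinAt (s := Icc 0 S.T)).derivWithin ((uniqueDiffOn_Icc S.T_pos) t ht)
  rw [(S.hasDeriv_Φ y hy t ht).derivWithin ((uniqueDiffOn_Icc S.T_pos) t ht)] at h2
  rwa [h2]

theorem fderiv_Φ_time {y : R3} (hy : y ∈ S.Γ 0) {t : ℝ} (ht : t ∈ Icc 0 S.T) :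
    fderiv ℝ S.Φ (y, t) (0, 1) = S.w (S.Φ (y, t), t) := by
  have := (S.hasFDerivAt_Φ (y, t)).comp_hasDerivAt t ((hasDerivAt_const t y).prodMk (hasDerivAt_id t))
  exact this.unique (S.hasDerivAt_Φ_time hy ht)

/-- The spatial derivative of the velocity field. -/
noncomputable def dw (x : R3) (t : ℝ) : R3 →L[ℝ] R3 := fderiv ℝ (fun x => S.w (x, t)) x

theorem hasFDerivAt_w_space (x : R3) (t : ℝ) : HasFDerivAt (fun x => S.w (x, t)) (S.dw x t) x :=
  ((S.contDiff_w.comp (contDiff_id.prodMk contDiff_const)).differentiable (by simp) x).hasFDerivAt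

theorem dw_eq (x : R3) (t : ℝ) :
    S.dw x t = (fderiv ℝ S.w (x, t)).comp (ContinuousLinearMap.inl ℝ R3 ℝ) :=
  (S.hasFDerivAt_w_space x t).unique
    ((S.contDiff_w.differentiable (by simp) (x, t)).hasFDerivAt.comp x (hasFDerivAt_prodMk_left x t))

theorem divw_eq (x : R3) (t : ℝ) : S.divw (x, t) = tanTrace (S.normal t x) (S.dw x t) := rfl

theorem contDiff_dΦ : ContDiff ℝ ∞ fun p : R3 × ℝ => S.dΦ p.1 p.2 :=
  (S.contDiff_Φ.fderiv_right (m := ∞) (by simp)).clm_comp contDiff_const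

theorem continuous_dw : Continuous fun p : R3 × ℝ => S.dw p.1 p.2 := by
  simp only [dw_eq]
  exact (S.contDiff_w.continuous_fderiv (by simp)).clm_comp continuous_const

/-- The variational equation along tangent vectors. -/
theorem hasDerivAt_dΦ {y τ : R3} (hy : y ∈ S.Γ 0) (hτ : inner ℝ τ (S.normal 0 y) = 0) {t : ℝ}
    (ht : t ∈ Icc 0 S.T) :
    HasDerivAt (fun s => S.dΦ y s τ) (S.dw (S.Φ (y, t)) t (S.dΦ y t τ)) t := by
  set D2 := fderiv ℝ (fderiv ℝ S.Φ) (y, t) with hD2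
  have hd2 : HasFDerivAt (fderiv ℝ S.Φ) D2 (y, t) :=
    ((S.contDiff_Φ.fderiv_right (m := ∞) (by simp)).differentiable (by simp) _).hasFDerivAt
  have hsymm : D2 (0, 1) (τ, 0) = D2 (τ, 0) (0, 1) :=
    (S.contDiff_Φ.contDiffAt.isSymmSndFDerivAt
      (by simp; exact WithTop.coe_le_coe.2 (le_top : (2 : ℕ∞) ≤ ⊤))) _ _
  have h1 : HasDerivAt (fun s => S.dΦ y s τ) (D2 (0, 1) (τ, 0)) t := by
    have := (hd2.comp_hasDerivAt t ((hasDerivAt_const t y).prodMk (hasDerivAt_id t))).clm_apply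
      (hasDerivAt_const t ((τ, 0) : R3 × ℝ))
    simpa [dΦ] using this
  -- The flow equation is assumed only for starting points on Γ(0), so it may be differentiated only
  -- in tangential directions. The order of the space and time derivatives is exchanged by `hsymm`.
  have h2 : HasFDerivAt (fun x => fderiv ℝ S.Φ (x, t) (0, 1) - S.w (S.Φ (x, t), t))
      (((ContinuousLinearMap.apply ℝ R3 ((0, 1) : R3 × ℝ)).comp
        (D2.comp (ContinuousLinearMap.inl ℝ R3 ℝ))) - (S.dw (S.Φ (y, t)) t).comp (S.dΦ y t)) y := by
    refine HasFDerivAt.sub ?_ ?_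
    · exact (ContinuousLinearMap.apply ℝ R3 ((0, 1) : R3 × ℝ)).hasFDerivAt.comp y
        (hd2.comp y (hasFDerivAt_prodMk_left y t))
    · exact (S.hasFDerivAt_w_space (S.Φ (y, t)) t).comp y (S.hasFDerivAt_Φ_space y t)
  have h3 := S.isSurface_zero.fderiv_tangent_eq_zero hy h2.differentiableAt
    (fun x hx => sub_eq_zero.2 (S.fderiv_Φ_time hx ht)) hτ
  rw [h2.fderiv] at h3
  have h4 : D2 (τ, 0) (0, 1) = S.dw (S.Φ (y, t)) t (S.dΦ y t τ) := by
    simpa [sub_eq_zero] using h3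
  rw [hsymm, h4] at h1
  exact h1

theorem dΦ_zero {y τ : R3} (hy : y ∈ S.Γ 0) (hτ : inner ℝ τ (S.normal 0 y) = 0) :
    S.dΦ y 0 τ = τ := by
  have h2 : HasFDerivAt (fun x => S.Φ (x, 0) - x) (S.dΦ y 0 - ContinuousLinearMap.id ℝ R3) y :=
    (S.hasFDerivAt_Φ_space y 0).sub (hasFDerivAt_id y)
  have h3 := S.isSurface_zero.fderiv_tangent_eq_zero hy h2.differentiableAt
    (fun x hx => sub_eq_zero.2 (S.Φ_zero x hx)) hτ
  rw [h2.fderiv] at h3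
  simpa [sub_eq_zero] using h3

/-- The variational equation is linear: a tangent vector carried to zero at time t was zero at time
0. -/
theorem dΦ_injective_tangent {y τ : R3} (hy : y ∈ S.Γ 0) (hτ : inner ℝ τ (S.normal 0 y) = 0) {t : ℝ}
    (ht : t ∈ Icc 0 S.T) (h : S.dΦ y t τ = 0) : τ = 0 := by
  have hc : ContinuousOn (fun s => S.dw (S.Φ (y, s)) s) (Icc 0 S.T) :=
    (S.continuous_dw.comp ((S.contDiff_Φ.continuous.comp (Continuous.prodMk_right y)).prodMk
      continuous_id)).continuousOn
  obtain ⟨K, hK⟩ := isCompact_Icc.exists_bound_of_continuousOn hc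
  rw [← S.dΦ_zero hy hτ]
  exact eqOn_zero_of_norm_deriv_le (fun s hs => (S.hasDerivAt_dΦ hy hτ hs).hasDerivWithinAt)
    (fun s hs => (S.dw (S.Φ (y, s)) s).le_of_opNorm_le (hK s hs) _) ht h

/-- On a ball that contains all trajectories the velocity is Lipschitz, so trajectories that meet at
time t have the same starting point. -/
theorem Φ_injOn {t : ℝ} (ht : t ∈ Icc 0 S.T) : InjOn (fun y => S.Φ (y, t)) (S.Γ 0) := by
  intro y hy y' hy' h
  have hcpt : IsCompact (S.Φ '' (S.Γ 0 ×ˢ Icc 0 S.T)) :=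
    (S.isSurface_zero.isCompact.prod isCompact_Icc).image S.contDiff_Φ.continuous
  obtain ⟨r, hr⟩ := hcpt.isBounded.subset_closedBall 0
  obtain ⟨K, hK⟩ := ((isCompact_closedBall (0 : R3) r).prod (isCompact_Icc (a := 0) (b := S.T))).exists_bound_of_continuousOn
    S.continuous_dw.continuousOn
  have hlip : ∀ s ∈ Icc 0 S.T, ‖S.w (S.Φ (y, s), s) - S.w (S.Φ (y', s), s)‖
      ≤ K * ‖S.Φ (y, s) - S.Φ (y', s)‖ := fun s hs =>
    (convex_closedBall (0 : R3) r).norm_image_sub_le_of_norm_hasFDerivWithin_le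
      (fun x hx => (S.hasFDerivAt_w_space x s).hasFDerivWithinAt) (fun x hx => hK (x, s) ⟨hx, hs⟩)
      (hr ⟨(y', s), ⟨hy', hs⟩, rfl⟩) (hr ⟨(y, s), ⟨hy, hs⟩, rfl⟩)
  have := eqOn_zero_of_norm_deriv_le (d := fun s => S.Φ (y, s) - S.Φ (y', s))
    (fun s hs => ((S.hasDerivAt_Φ_time hy hs).sub (S.hasDerivAt_Φ_time hy' hs)).hasDerivWithinAt)
    hlip ht (sub_eq_zero.2 h)
  simpa [S.Φ_zero y hy, S.Φ_zero y' hy', sub_eq_zero] using this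

end EvolvingSurface

/-! ### Area distortion and its evolution -/

namespace EvolvingSurface

variable (S : EvolvingSurface)

/-- A smooth extension of the unit normal field of the initial surface. -/
noncomputable def normalExt : R3 → R3 := S.isSurface_zero.exists_contDiff_normal.choose

theorem contDiff_normalExt : ContDiff ℝ ∞ S.normalExt :=
  S.isSurface_zero.exists_contDiff_normal.choose_spec.1

theorem normalExt_eq {y : R3} (hy : y ∈ S.Γ 0) : S.normalExt y = S.normal 0 y :=
  S.isSurface_zero.exists_contDiff_normal.choose_spec.2 hy

/-- The normal vector of `Γ(t)` at `Φ(y, t)` whose length is the area distortion of the flow. -/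
noncomputable def flowNormal (p : R3 × ℝ) : R3 := cofL (S.dΦ p.1 p.2) (S.normalExt p.1)

theorem contDiff_flowNormal : ContDiff ℝ ∞ S.flowNormal :=
  contDiff_cofL.comp (S.contDiff_dΦ.prodMk (S.contDiff_normalExt.comp contDiff_fst))

/-- The area distortion of the flow. -/
noncomputable def jac (p : R3 × ℝ) : ℝ := ‖S.flowNormal p‖

theorem continuous_jac : Continuous S.jac := S.contDiff_flowNormal.continuous.norm

theorem inner_normal_dΦ {y τ : R3} (hy : y ∈ S.Γ 0) (hτ : inner ℝ τ (S.normal 0 y) = 0) {t : ℝ}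
    (ht : t ∈ Icc 0 S.T) : inner ℝ (S.normal t (S.Φ (y, t))) (S.dΦ y t τ) = 0 := by
  obtain ⟨U, O, ψ, π, hyU, h⟩ := S.isSurface_zero.exists_chart hy
  have hξ : π y ∈ O := h.mapsTo hyU
  have hψ : ψ (π y) = y := h.right_inv ⟨hy, hyU⟩
  have h1 := (hψ.symm ▸ S.hasFDerivAt_Φ_space y t :
    HasFDerivAt (fun x => S.Φ (x, t)) (S.dΦ y t) (ψ (π y))).comp (π y)
    (h.differentiableAt hξ).hasFDerivAt
  have h2 := (S.isSurface t ht).inner_normal_fderiv h1 (by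
    filter_upwards [h.isOpen_plane.mem_nhds hξ] with x hx
    exact S.Φ_mem (h.mem_surface hx).1 ht) (π τ)
  simp only [ContinuousLinearMap.coe_comp, Function.comp_apply] at h2
  rwa [h.fderiv_of_tangent S.isSurface_zero hξ (by rwa [hψ]), hψ] at h2

/-- One coordinate vector of a chart is rescaled until the cross product of the frame is the unit
normal. Then the flow normal is dΦ a × dΦ b at all times. -/
theorem exists_tangent_frame {y : R3} (hy : y ∈ S.Γ 0) : ∃ a b : R3,
    inner ℝ a (S.normal 0 y) = 0 ∧ inner ℝ b (S.normal 0 y) = 0 ∧ crossL a b = S.normal 0 y ∧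
    ∀ t ∈ Icc 0 S.T, crossL (S.dΦ y t a) (S.dΦ y t b) ≠ 0 := by
  obtain ⟨U, O, ψ, π, hyU, h⟩ := S.isSurface_zero.exists_chart hy
  have hξ : π y ∈ O := h.mapsTo hyU
  have hψ : ψ (π y) = y := h.right_inv ⟨hy, hyU⟩
  have hν := h.inner_normal S.isSurface_zero hξ
  rw [hψ] at hν
  set a := fderiv ℝ ψ (π y) (EuclideanSpace.single 0 1)
  set b := fderiv ℝ ψ (π y) (EuclideanSpace.single 1 1)
  have hc : crossL a b ≠ 0 := h.paramNormal_ne_zero hξ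
  have hn := eq_inner_smul_cross (hν _) (hν _) hc
  set r := inner ℝ (S.normal 0 y) (crossL a b) / ‖crossL a b‖ ^ 2
  have hr : r ≠ 0 := fun h0 => by
    have := S.isSurface_zero.norm_normal hy
    rw [hn, h0, zero_smul, norm_zero] at this
    exact zero_ne_one this
  refine ⟨r • a, b, ?_, ?_, ?_, fun t ht => ?_⟩
  · rw [real_inner_smul_left, real_inner_comm, hν, mul_zero]
  · rw [real_inner_comm, hν]
  · rw [map_smul, _root_.smul_apply, ← hn]
  · rw [map_smul, map_smul, _root_.smul_apply]
    refine smul_ne_zero hr ?_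
    exact crossL_ne_zero_of_injective (L := (S.dΦ y t).comp (fderiv ℝ ψ (π y))) (by
      rw [injective_iff_map_eq_zero]
      intro v hv
      refine (injective_iff_map_eq_zero _).1 (h.injective_fderiv hξ) v ?_
      exact S.dΦ_injective_tangent hy (by rw [real_inner_comm, hν]) ht hv)

theorem flowNormal_ne_zero {y : R3} (hy : y ∈ S.Γ 0) {t : ℝ} (ht : t ∈ Icc 0 S.T) :
    S.flowNormal (y, t) ≠ 0 := by
  obtain ⟨a, b, -, -, hab, h⟩ := S.exists_tangent_frame hy
  simp only [flowNormal, S.normalExt_eq hy]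
  rw [← hab, cofL_crossL]
  exact h t ht

theorem jac_pos {y : R3} (hy : y ∈ S.Γ 0) {t : ℝ} (ht : t ∈ Icc 0 S.T) : 0 < S.jac (y, t) :=
  norm_pos_iff.2 (S.flowNormal_ne_zero hy ht)

/-- The derivative of the area distortion (Liouville's formula). -/
theorem hasDerivAt_jac {y : R3} (hy : y ∈ S.Γ 0) {t : ℝ} (ht : t ∈ Icc 0 S.T) :
    HasDerivAt (fun s => S.jac (y, s)) (S.divw (S.Φ (y, t), t) * S.jac (y, t)) t := by
  obtain ⟨a, b, ha, hb, hab, h⟩ := S.exists_tangent_frame hy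
  have e : ∀ s, S.flowNormal (y, s) = crossL (S.dΦ y s a) (S.dΦ y s b) := fun s => by
    simp only [flowNormal, S.normalExt_eq hy]
    rw [← hab, cofL_crossL]
  have hd := (crossL.hasFDerivAt.comp_hasDerivAt t (S.hasDerivAt_dΦ hy ha ht)).clm_apply
    (S.hasDerivAt_dΦ hy hb ht)
  have hd2 := (hd.inner ℝ hd)
  set W := S.dw (S.Φ (y, t)) t
  set c := crossL (S.dΦ y t a) (S.dΦ y t b) with hc
  have hc0 : c ≠ 0 := h t ht
  have hn0 : ‖c‖ ≠ 0 := norm_ne_zero_iff.2 hc0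
  have hdiv : S.divw (S.Φ (y, t), t) = _ := (S.divw_eq _ _).trans (tanTrace_eq
    (S.inner_normal_dΦ hy ha ht) (S.inner_normal_dΦ hy hb ht)
    ((S.isSurface t ht).norm_normal (S.Φ_mem hy ht)) hc0 W)
  -- The squared distortion is ‖c‖² with c' = (tr W - Wᵀ) c. Since c is normal to Γ(t), the quotient
  -- ⟨c', c⟩ / ‖c‖² is the tangential trace of W.
  have hsq : HasDerivAt (fun s => S.jac (y, s) ^ 2) (2 * S.divw (S.Φ (y, t), t) * ‖c‖ ^ 2) t := by
    have e2 : (fun s => S.jac (y, s) ^ 2) = fun s => inner ℝ (crossL (S.dΦ y s a) (S.dΦ y s b))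
        (crossL (S.dΦ y s a) (S.dΦ y s b)) := by
      funext s
      rw [real_inner_self_eq_norm_sq, ← e, jac]
    rw [e2]
    refine hd2.congr_deriv ?_
    have key := inner_crossL_add_crossL W (S.dΦ y t a) (S.dΦ y t b) c
    rw [hdiv]
    rw [← hc, real_inner_self_eq_norm_sq] at key
    rw [Function.comp_apply, ← hc, real_inner_comm]
    rw [key, real_inner_comm c (W c)]
    field_simp
    ring
  have hj : S.jac (y, t) = ‖c‖ := by rw [jac, e]
  have h3 := hsq.sqrt (by rw [hj]; positivity)
  have e3 : (fun s => √(S.jac (y, s) ^ 2)) = fun s => S.jac (y, s) := by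
    funext s; exact Real.sqrt_sq (norm_nonneg _)
  rw [e3] at h3
  refine h3.congr_deriv ?_
  rw [hj, Real.sqrt_sq (norm_nonneg _)]
  field_simp

/-- The space-time track of the initial surface in Lagrangian coordinates. -/
def track : Set (R3 × ℝ) := S.Γ 0 ×ˢ Icc 0 S.T

theorem isCompact_track : IsCompact S.track := S.isSurface_zero.isCompact.prod isCompact_Icc

/-- The distortion is a norm, hence smooth only where the flow normal does not vanish, which
includes the track. Its square root and the inverse of that root can therefore be replaced by
globally smooth functions. -/
theorem exists_contDiff_comp_jac {f : ℝ → ℝ} (hf : ContDiffOn ℝ ∞ f (Ioi 0)) :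
    ∃ G : R3 × ℝ → ℝ, ContDiff ℝ ∞ G ∧ EqOn G (fun p => f (S.jac p)) S.track := by
  refine exists_contDiff_eqOn_of_local S.isCompact_track.isClosed fun p hp => ?_
  have hopen : IsOpen {p | S.flowNormal p ≠ 0} :=
    isOpen_ne_fun S.contDiff_flowNormal.continuous continuous_const
  refine ⟨_, hopen.mem_nhds (S.flowNormal_ne_zero hp.1 hp.2), fun p => f (S.jac p), ?_, fun _ _ => rfl⟩
  exact hf.comp (S.contDiff_flowNormal.contDiffOn.norm ℝ fun q hq => hq) fun q hq => norm_pos_iff.2 hq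

/-- A smooth extension of the square root of the area distortion. -/
noncomputable def sqrtJac : R3 × ℝ → ℝ :=
  (S.exists_contDiff_comp_jac (f := Real.sqrt) fun _ hx =>
    (Real.contDiffAt_sqrt (ne_of_gt hx)).contDiffWithinAt).choose

theorem contDiff_sqrtJac : ContDiff ℝ ∞ S.sqrtJac := (Exists.choose_spec (S.exists_contDiff_comp_jac
  (f := Real.sqrt) fun _ hx => (Real.contDiffAt_sqrt (ne_of_gt hx)).contDiffWithinAt)).1

theorem sqrtJac_eq {p : R3 × ℝ} (hp : p ∈ S.track) : S.sqrtJac p = √(S.jac p) :=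
  (Exists.choose_spec (S.exists_contDiff_comp_jac
  (f := Real.sqrt) fun _ hx => (Real.contDiffAt_sqrt (ne_of_gt hx)).contDiffWithinAt)).2 hp

/-- A smooth extension of the inverse square root of the area distortion. -/
noncomputable def invSqrtJac : R3 × ℝ → ℝ :=
  (S.exists_contDiff_comp_jac (f := fun x => (√x)⁻¹) fun _ hx =>
    ((Real.contDiffAt_sqrt (ne_of_gt hx)).inv (Real.sqrt_ne_zero'.2 hx)).contDiffWithinAt).choose

theorem contDiff_invSqrtJac : ContDiff ℝ ∞ S.invSqrtJac :=
  (Exists.choose_spec (S.exists_contDiff_comp_jac (f := fun x => (√x)⁻¹) fun _ hx =>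
    ((Real.contDiffAt_sqrt (ne_of_gt hx)).inv (Real.sqrt_ne_zero'.2 hx)).contDiffWithinAt)).1

theorem invSqrtJac_eq {p : R3 × ℝ} (hp : p ∈ S.track) : S.invSqrtJac p = (√(S.jac p))⁻¹ :=
  (Exists.choose_spec (S.exists_contDiff_comp_jac (f := fun x => (√x)⁻¹) fun _ hx =>
    ((Real.contDiffAt_sqrt (ne_of_gt hx)).inv (Real.sqrt_ne_zero'.2 hx)).contDiffWithinAt)).2 hp

theorem sqrtJac_pos {p : R3 × ℝ} (hp : p ∈ S.track) : 0 < S.sqrtJac p := by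
  rw [S.sqrtJac_eq hp]; exact Real.sqrt_pos.2 (S.jac_pos hp.1 hp.2)

theorem sqrtJac_sq {p : R3 × ℝ} (hp : p ∈ S.track) : S.sqrtJac p ^ 2 = S.jac p := by
  rw [S.sqrtJac_eq hp]; exact Real.sq_sqrt (S.jac_pos hp.1 hp.2).le

theorem sqrtJac_mul_invSqrtJac {p : R3 × ℝ} (hp : p ∈ S.track) :
    S.sqrtJac p * S.invSqrtJac p = 1 := by
  rw [S.invSqrtJac_eq hp, ← S.sqrtJac_eq hp]
  exact mul_inv_cancel₀ (S.sqrtJac_pos hp).ne'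

theorem hasDerivAt_invSqrtJac {y : R3} (hy : y ∈ S.Γ 0) {t : ℝ} (ht : t ∈ Ioo 0 S.T) :
    HasDerivAt (fun s => S.invSqrtJac (y, s))
      (-(1 / 2) * S.divw (S.Φ (y, t), t) * S.invSqrtJac (y, t)) t := by
  have ht' := Ioo_subset_Icc_self ht
  have hj := S.jac_pos hy ht'
  have hs : √(S.jac (y, t)) ≠ 0 := Real.sqrt_ne_zero'.2 hj
  have h1 := ((S.hasDerivAt_jac hy ht').sqrt hj.ne').inv hs
  have h2 : (fun s => S.invSqrtJac (y, s)) =ᶠ[𝓝 t] fun s => (√(S.jac (y, s)))⁻¹ := by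
    filter_upwards [Ioo_mem_nhds ht.1 ht.2] with s hs
    exact S.invSqrtJac_eq ⟨hy, Ioo_subset_Icc_self hs⟩
  refine (h1.congr_of_eventuallyEq h2).congr_deriv ?_
  rw [S.invSqrtJac_eq ⟨hy, ht'⟩]
  have h3 : S.jac (y, t) = √(S.jac (y, t)) ^ 2 := (Real.sq_sqrt hj.le).symm
  set r := √(S.jac (y, t))
  rw [h3]
  field_simp

end EvolvingSurface

/-! ### The inverse flow and transport of the surface measure -/

namespace EvolvingSurface

variable (S : EvolvingSurface)

/-- The map from Lagrangian to Eulerian coordinates. -/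
def flow (p : R3 × ℝ) : R3 × ℝ := (S.Φ p, p.2)

theorem contDiff_flow : ContDiff ℝ ∞ S.flow := S.contDiff_Φ.prodMk contDiff_snd

theorem flow_injOn : InjOn S.flow S.track := by
  rintro ⟨y, t⟩ hp ⟨y', t'⟩ hp' h
  obtain rfl : t = t' := congrArg Prod.snd h
  obtain rfl : y = y' := S.Φ_injOn hp.2 hp.1 hp'.1 (congrArg Prod.fst h)
  rfl

/-- The flow need not be invertible off the surface. Near a point of the track, with f a defining
function of Γ(0), a multiple of f is added to the flow so that its differential becomes invertible
while its values on the track stay the same. The local inverses so obtained are glued into one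
smooth map. It turns functions of (y, t) into test functions on space-time. -/
theorem exists_smooth_inverse : ∃ Ξ : R3 × ℝ → R3, ContDiff ℝ ∞ Ξ ∧
    ∀ y ∈ S.Γ 0, ∀ t ∈ Icc 0 S.T, Ξ (S.Φ (y, t), t) = y := by
  have hK : IsCompact (S.flow '' S.track) := S.isCompact_track.image S.contDiff_flow.continuous
  have hu : ∀ p ∈ S.track, (Function.invFunOn S.flow S.track (S.flow p)).1 = p.1 := fun p hp => by
    rw [S.flow_injOn.leftInvOn_invFunOn hp]
  obtain ⟨Ξ, h1, h2⟩ := exists_contDiff_eqOn_of_local hK.isClosed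
    (u := fun q => (Function.invFunOn S.flow S.track q).1) (by
      rintro _ ⟨⟨y, t⟩, hp, rfl⟩
      have hy : y ∈ S.Γ 0 := hp.1
      have ht : t ∈ Icc 0 S.T := hp.2
      obtain ⟨V, f, hV, hyV, hf, hMV, hn⟩ := S.isSurface_zero.exists_local y hy
      obtain ⟨hg0, hν⟩ := hn y ⟨hy, hyV⟩
      set g := gradient f y with hg
      set c := S.flowNormal (y, t) with hc
      have hc0 : c ≠ 0 := S.flowNormal_ne_zero hy ht
      -- Chosen so that the spatial differential of the modified flow sends the gradient g to the
      -- flow normal: dΦ g + ‖g‖² e = c.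
      set e : R3 := (‖g‖ ^ 2)⁻¹ • (c - S.dΦ y t g) with he
      let G : R3 × ℝ → R3 × ℝ := fun p => (S.Φ p + f p.1 • e, p.2)
      have hfV : ContDiffOn ℝ ∞ (fun p : R3 × ℝ => f p.1) (V ×ˢ univ) :=
        hf.comp contDiff_fst.contDiffOn fun p hp => hp.1
      have hG : ContDiffOn ℝ ∞ G (V ×ˢ univ) :=
        (S.contDiff_Φ.contDiffOn.add (hfV.smul contDiffOn_const)).prodMk contDiff_snd.contDiffOn
      have hfd : HasFDerivAt f (fderiv ℝ f y) y :=
        ((hf.contDiffAt (hV.mem_nhds hyV)).differentiableAt (by simp)).hasFDerivAt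
      have hGd : HasFDerivAt G ((fderiv ℝ S.Φ (y, t)
          + ((fderiv ℝ f y).comp (ContinuousLinearMap.fst ℝ R3 ℝ)).smulRight e).prod
            (ContinuousLinearMap.snd ℝ R3 ℝ)) (y, t) := by
        refine HasFDerivAt.prodMk ?_ hasFDerivAt_snd
        refine (S.hasFDerivAt_Φ (y, t)).add ?_
        exact (hfd.comp (y, t) (hasFDerivAt_fst (p := ((y, t) : R3 × ℝ)))).smul_const e
      have hinj : Function.Injective (fderiv ℝ G (y, t)) := by
        rw [hGd.fderiv, injective_iff_map_eq_zero]
        rintro ⟨v, s⟩ hvs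
        obtain rfl : s = 0 := congrArg Prod.snd hvs
        have h1 : S.dΦ y t v + fderiv ℝ f y v • e = 0 := congrArg Prod.fst hvs
        have hgn : ‖g‖ ^ 2 ≠ 0 := by simpa using hg0
        set r := inner ℝ g v / ‖g‖ ^ 2 with hr
        set τ := v - r • g with hτ
        have hτg : inner ℝ τ g = 0 := by
          rw [hτ, inner_sub_left, real_inner_smul_left, real_inner_self_eq_norm_sq, hr,
            real_inner_comm]
          field_simp
          ring
        have hτν : inner ℝ τ (S.normal 0 y) = 0 := by
          rw [hν, real_inner_smul_right, hτg, mul_zero]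
        have hfv : fderiv ℝ f y v = r * ‖g‖ ^ 2 := by
          rw [← inner_gradient_left, ← hg, hr]
          field_simp
        have hv : v = τ + r • g := by rw [hτ]; abel
        have h2 : S.dΦ y t τ + r • c = 0 := by
          rw [hfv, he, smul_smul, mul_assoc, mul_inv_cancel₀ hgn, mul_one] at h1
          rw [hv, map_add, map_smul] at h1
          rw [← h1, smul_sub]
          abel
        obtain ⟨a, b, ha, hb, hab, -⟩ := S.exists_tangent_frame hy
        have hcn : inner ℝ (S.dΦ y t τ) c = 0 := by
          have hn1 := S.inner_normal_dΦ hy hτν ht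
          have hca : c = crossL (S.dΦ y t a) (S.dΦ y t b) := by
            rw [hc, flowNormal, S.normalExt_eq hy, ← hab, cofL_crossL]
          have h3 := eq_inner_smul_cross (S.inner_normal_dΦ hy ha ht) (S.inner_normal_dΦ hy hb ht)
            (hca ▸ hc0)
          rw [← hca] at h3
          rw [h3, real_inner_smul_left] at hn1
          rcases mul_eq_zero.1 hn1 with h4 | h4
          · rw [h4, zero_smul] at h3
            have := (S.isSurface t ht).norm_normal (S.Φ_mem hy ht)
            rw [h3, norm_zero] at this
            exact absurd this zero_ne_one
          · rw [real_inner_comm]; exact h4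
        have hr0 : r = 0 := by
          have h3 := congrArg (fun x => inner ℝ x c) h2
          simp only [inner_add_left, hcn, real_inner_smul_left, inner_zero_left, zero_add,
            real_inner_self_eq_norm_sq] at h3
          exact (mul_eq_zero.1 h3).resolve_right (by simpa using hc0)
        rw [hr0, zero_smul, add_zero] at h2 hv
        rw [hv, S.dΦ_injective_tangent hy hτν ht h2]
        rfl
      obtain ⟨E, hEG, hyE, hEV, hEs⟩ := exists_openPartialHomeomorph_of_contDiffOn
        (hV.prod isOpen_univ) hG (a := (y, t)) ⟨hyV, mem_univ _⟩ hinj rfl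
      have hGf : ∀ p ∈ S.track, p ∈ E.source → G p = S.flow p := fun p hp hpE => by
        have hpV : p.1 ∈ S.Γ 0 ∩ V := ⟨hp.1, (hEV hpE).1⟩
        rw [hMV] at hpV
        simp only [G, flow, hpV.2, zero_smul, add_zero]
      -- The rest of the track has a compact image that misses the point in question. After its
      -- removal, the local inverse agrees with the global one.
      have hC : IsCompact (S.flow '' (S.track \ E.source)) :=
        (S.isCompact_track.diff E.open_source).image S.contDiff_flow.continuous
      refine ⟨E.target ∩ (S.flow '' (S.track \ E.source))ᶜ, ?_, fun q => (E.symm q).1, ?_, ?_⟩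
      · refine (E.open_target.inter hC.isClosed.isOpen_compl).mem_nhds ⟨?_, ?_⟩
        · rw [← hGf _ hp hyE, ← hEG]; exact E.map_source hyE
        · rintro ⟨p', ⟨hp', hpE'⟩, h⟩
          rw [S.flow_injOn hp' hp h] at hpE'
          exact hpE' hyE
      · exact contDiff_fst.comp_contDiffOn (hEs.mono inter_subset_left)
      · rintro _ ⟨⟨p, hp, rfl⟩, -, hq⟩
        have hpE : p ∈ E.source := by
          by_contra h
          exact hq ⟨p, ⟨hp, h⟩, rfl⟩
        simp only [hu p hp]
        rw [← hGf p hp hpE, ← hEG, E.left_inv hpE])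
  refine ⟨Ξ, h1, fun y hy t ht => ?_⟩
  have hp : ((y, t) : R3 × ℝ) ∈ S.track := ⟨hy, ht⟩
  exact (h2 ⟨_, hp, rfl⟩).trans (hu _ hp)

/-- A smooth map that recovers the initial position from the position at time `t`. -/
noncomputable def back : R3 × ℝ → R3 := S.exists_smooth_inverse.choose

theorem contDiff_back : ContDiff ℝ ∞ S.back := S.exists_smooth_inverse.choose_spec.1

theorem back_Φ {y : R3} (hy : y ∈ S.Γ 0) {t : ℝ} (ht : t ∈ Icc 0 S.T) : S.back (S.Φ (y, t), t) = y :=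
  S.exists_smooth_inverse.choose_spec.2 y hy t ht

theorem Φ_back {x : R3} {t : ℝ} (ht : t ∈ Icc 0 S.T) (hx : x ∈ S.Γ t) :
    S.back (x, t) ∈ S.Γ 0 ∧ S.Φ (S.back (x, t), t) = x := by
  rw [S.image_Φ t ht] at hx
  obtain ⟨y, hy, rfl⟩ := hx
  rw [S.back_Φ hy ht]
  exact ⟨hy, rfl⟩

/-- The area formula is applied to the composition of a chart with the flow. Its Jacobian is that of
the chart times the distortion. -/
theorem measure_image_Φ {t : ℝ} (ht : t ∈ Icc 0 S.T) {U : Set R3} {O : Set R2} {ψ : R2 → R3}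
    {π : R3 →L[ℝ] R2} (h : IsSurfaceChart (S.Γ 0) (S.normal 0) U O ψ π) {A : Set R3}
    (hA : MeasurableSet A) (hAU : A ⊆ U) :
    (Measure.euclideanHausdorffMeasure 2 : Measure R3) ((fun y => S.Φ (y, t)) '' (S.Γ 0 ∩ A))
      = ∫⁻ y in A, ENNReal.ofReal (S.jac (y, t)) ∂S.surf 0 := by
  have hOm := h.isOpen_plane.measurableSet
  set B : Set R2 := O ∩ ψ ⁻¹' A with hB
  have hBm : MeasurableSet B := by
    have h1 := (continuousOn_iff_continuous_domRestrict.1 h.contDiffOn.continuousOn).measurable hA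
    have h2 : B = (↑) '' (O.domRestrict ψ ⁻¹' A) := by
      ext x
      constructor
      · rintro ⟨hx, hxA⟩
        exact ⟨⟨x, hx⟩, hxA, rfl⟩
      · rintro ⟨⟨z, hz⟩, hzA, rfl⟩
        exact ⟨hz, hzA⟩
    rw [h2]
    exact hOm.subtype_image h1
  have hψB : ψ '' B = S.Γ 0 ∩ A := by
    ext x
    constructor
    · rintro ⟨ξ, hξ, rfl⟩
      exact ⟨(h.mem_surface hξ.1).1, hξ.2⟩
    · rintro ⟨hx, hxA⟩
      have := h.right_inv ⟨hx, hAU hxA⟩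
      exact ⟨π x, ⟨h.mapsTo (hAU hxA), by rwa [mem_preimage, this]⟩, this⟩
  set F : R2 → R3 := fun ξ => S.Φ (ψ ξ, t) with hF
  have hFc : ContDiffOn ℝ 1 F O := (S.contDiff_Φ.of_le (by simp)).comp_contDiffOn
    ((h.contDiffOn.of_le (by simp)).prodMk contDiffOn_const)
  have hFd : ∀ ξ ∈ O, fderiv ℝ F ξ = (S.dΦ (ψ ξ) t).comp (fderiv ℝ ψ ξ) := fun ξ hξ =>
    ((S.hasFDerivAt_Φ_space (ψ ξ) t).comp ξ (h.differentiableAt hξ).hasFDerivAt).fderiv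
  have hFi : InjOn F O := fun ξ hξ ζ hζ e =>
    h.injOn hξ hζ (S.Φ_injOn ht (h.mem_surface hξ).1 (h.mem_surface hζ).1 e)
  have hν := fun ξ hξ v => h.inner_normal S.isSurface_zero (ξ := ξ) hξ v
  have hFinj : ∀ ξ ∈ O, Function.Injective (fderiv ℝ F ξ) := fun ξ hξ => by
    rw [hFd ξ hξ, injective_iff_map_eq_zero]
    intro v hv
    refine (injective_iff_map_eq_zero _).1 (h.injective_fderiv hξ) v ?_
    exact S.dΦ_injective_tangent (h.mem_surface hξ).1 (by rw [real_inner_comm, hν ξ hξ]) ht hv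
  have hjac : ∀ ξ ∈ O, jac2 (fderiv ℝ F ξ) = jac2 (fderiv ℝ ψ ξ) * S.jac (ψ ξ, t) := fun ξ hξ => by
    have hy := (h.mem_surface hξ).1
    have hn := eq_inner_smul_cross (hν ξ hξ (EuclideanSpace.single 0 1))
      (hν ξ hξ (EuclideanSpace.single 1 1)) (h.paramNormal_ne_zero hξ)
    set r := inner ℝ (S.normal 0 (ψ ξ)) (crossL (fderiv ℝ ψ ξ (EuclideanSpace.single 0 1))
      (fderiv ℝ ψ ξ (EuclideanSpace.single 1 1))) / ‖crossL (fderiv ℝ ψ ξ (EuclideanSpace.single 0 1))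
      (fderiv ℝ ψ ξ (EuclideanSpace.single 1 1))‖ ^ 2
    have h1 : |r| * jac2 (fderiv ℝ ψ ξ) = 1 := by
      have := S.isSurface_zero.norm_normal hy
      rw [hn, norm_smul] at this
      exact this
    have h2 : S.jac (ψ ξ, t) = |r| * jac2 (fderiv ℝ F ξ) := by
      rw [jac, flowNormal, S.normalExt_eq hy, hn, cofL_smul, cofL_crossL, norm_smul, hFd ξ hξ]
      rfl
    rw [h2]
    linear_combination -jac2 (fderiv ℝ F ξ) * h1
  have hAm : MeasurableSet (A : Set R3) := hA
  have hJ : Measurable fun y => ENNReal.ofReal (S.jac (y, t)) :=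
    (S.continuous_jac.comp (Continuous.prodMk_left t)).measurable.ennreal_ofReal
  have e1 : (S.surf 0).restrict A
      = ((Measure.euclideanHausdorffMeasure 2 : Measure R3).restrict (S.Γ 0 ∩ U)).restrict A := by
    rw [surf, Measure.restrict_restrict hA, Measure.restrict_restrict hA]
    congr 1
    ext x
    exact ⟨fun hx => ⟨hx.1, hx.2, hAU hx.1⟩, fun hx => ⟨hx.1, hx.2.1⟩⟩
  rw [← hψB, image_image, measure_image_eq_lintegral_jac2 h.isOpen_plane hFc hFi hFinj hBm inter_subset_left,
    e1, ← lintegral_indicator hA, h.restrict_eq_map,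
    lintegral_map' (hJ.indicator hA).aemeasurable h.aemeasurable,
    lintegral_withDensity_eq_lintegral_mul₀
      (g := fun ξ => A.indicator (fun y => ENNReal.ofReal (S.jac (y, t))) (ψ ξ)) h.aemeasurable_jac2
      ((hJ.indicator hA).comp_aemeasurable
        (h.contDiffOn.continuousOn.aemeasurable hOm)), ← lintegral_indicator hBm,
    ← lintegral_indicator hOm]
  refine lintegral_congr fun ξ => ?_
  by_cases hξ : ξ ∈ O
  · by_cases hξA : ψ ξ ∈ A
    · have hξB : ξ ∈ B := ⟨hξ, hξA⟩
      simp only [indicator_of_mem hξ, indicator_of_mem hξB, Pi.mul_apply, indicator_of_mem hξA]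
      rw [hjac ξ hξ, ENNReal.ofReal_mul (jac2_nonneg _)]
    · have hξB : ξ ∉ B := fun hh => hξA hh.2
      rw [indicator_of_notMem hξB, indicator_of_mem hξ, Pi.mul_apply, indicator_of_notMem hξA, mul_zero]
  · have hξB : ξ ∉ B := fun hh => hξ hh.1
    simp [hξB, hξ]

/-- Equality of measures is checked on a countable cover whose members either lie in a chart or miss
Γ(0). -/
theorem map_back_surf {t : ℝ} (ht : t ∈ Icc 0 S.T) :
    (S.surf t).map (fun x => S.back (x, t))
      = (S.surf 0).withDensity fun y => ENNReal.ofReal (S.jac (y, t)) := by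
  have hb : Measurable fun x => S.back (x, t) :=
    (S.contDiff_back.continuous.comp (Continuous.prodMk_left t)).measurable
  have himg : ∀ A : Set R3, MeasurableSet A → (S.surf t).map (fun x => S.back (x, t)) A
      = (Measure.euclideanHausdorffMeasure 2 : Measure R3) ((fun y => S.Φ (y, t)) '' (S.Γ 0 ∩ A)) :=
    fun A hA => by
      rw [Measure.map_apply hb hA, surf, Measure.restrict_apply (hb hA)]
      congr 1
      ext x
      constructor
      · rintro ⟨hx, hxt⟩
        exact ⟨S.back (x, t), ⟨(S.Φ_back ht hxt).1, hx⟩, (S.Φ_back ht hxt).2⟩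
      · rintro ⟨y, ⟨hy, hyA⟩, rfl⟩
        refine ⟨?_, S.Φ_mem hy ht⟩
        simpa [S.back_Φ hy ht] using hyA
  have hloc : ∀ x : R3, ∃ V ∈ 𝓝 x, ∀ A : Set R3, MeasurableSet A → A ⊆ V →
      (Measure.euclideanHausdorffMeasure 2 : Measure R3) ((fun y => S.Φ (y, t)) '' (S.Γ 0 ∩ A))
        = ∫⁻ y in A, ENNReal.ofReal (S.jac (y, t)) ∂S.surf 0 := fun x => by
    by_cases hx : x ∈ S.Γ 0
    · obtain ⟨U, O, ψ, π, hxU, h⟩ := S.isSurface_zero.exists_chart hx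
      exact ⟨U, h.isOpen_space.mem_nhds hxU, fun A hA hAU => S.measure_image_Φ ht h hA hAU⟩
    · refine ⟨_, S.isSurface_zero.isCompact.isClosed.isOpen_compl.mem_nhds hx, fun A hA hAU => ?_⟩
      have h1 : S.Γ 0 ∩ A = ∅ := by
        ext z; simp only [mem_inter_iff, mem_empty_iff_false, iff_false, not_and]
        exact fun hz hzA => hAU hzA hz
      have h2 : (S.surf 0).restrict A = 0 := by
        rw [surf, Measure.restrict_restrict hA, inter_comm, h1, Measure.restrict_empty]
      rw [h1, image_empty, measure_empty, h2, lintegral_zero_measure]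
  choose V hV hVA using hloc
  obtain ⟨s, hs, hsV⟩ := TopologicalSpace.countable_cover_nhds fun x => interior_mem_nhds.2 (hV x)
  refine Measure.ext_of_biUnion_eq_univ (s := fun x => interior (V x)) hs hsV fun x _ => ?_
  ext A hA
  have hAV := hA.inter (isOpen_interior (s := V x)).measurableSet
  rw [Measure.restrict_apply hA, Measure.restrict_apply hA, himg _ hAV, withDensity_apply _ hAV]
  exact hVA x _ hAV (inter_subset_right.trans interior_subset)

theorem surf_eq_map {t : ℝ} (ht : t ∈ Icc 0 S.T) :
    S.surf t = ((S.surf 0).withDensity fun y => ENNReal.ofReal (S.jac (y, t))).map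
      fun y => S.Φ (y, t) := by
  have hb : Measurable fun x => S.back (x, t) :=
    (S.contDiff_back.continuous.comp (Continuous.prodMk_left t)).measurable
  have hΦ : Measurable fun y => S.Φ (y, t) :=
    (S.contDiff_Φ.continuous.comp (Continuous.prodMk_left t)).measurable
  rw [← S.map_back_surf ht, Measure.map_map hΦ hb]
  conv_lhs => rw [← Measure.map_id (μ := S.surf t)]
  refine Measure.map_congr ?_
  filter_upwards [ae_restrict_mem (S.isSurface t ht).measurableSet] with x hx
  exact (S.Φ_back ht hx).2.symm

end EvolvingSurface

/-! ### Lagrangian coordinates on the space-time manifold and Fubini's theorem -/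

namespace EvolvingSurface

variable (S : EvolvingSurface)

/-- The product measure in Lagrangian coordinates `(t, y)`. -/
noncomputable def lagMeasure : Measure (ℝ × R3) := (volume.restrict (Ioo 0 S.T)).prod (S.surf 0)

instance isFiniteMeasure_surf_zero : IsFiniteMeasure (S.surf 0) := S.isSurface_zero.isFiniteMeasure

theorem isFiniteMeasure_surf {t : ℝ} (ht : t ∈ Icc 0 S.T) : IsFiniteMeasure (S.surf t) :=
  (S.isSurface t ht).isFiniteMeasure

instance isFiniteMeasure_lagMeasure : IsFiniteMeasure S.lagMeasure := by
  rw [lagMeasure]; infer_instance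

/-- The map from Lagrangian coordinates `(t, y)` to the space-time manifold. -/
def lag (p : ℝ × R3) : R3 × ℝ := (S.Φ (p.2, p.1), p.1)

theorem continuous_lag : Continuous S.lag :=
  (S.contDiff_Φ.continuous.comp continuous_swap).prodMk continuous_fst

theorem measurable_lag : Measurable S.lag := S.continuous_lag.measurable

theorem measurable_jac_swap : Measurable fun p : ℝ × R3 => ENNReal.ofReal (S.jac p.swap) :=
  (S.continuous_jac.comp continuous_swap).measurable.ennreal_ofReal

theorem measurable_Φ_slice (t : ℝ) : Measurable fun y => S.Φ (y, t) :=
  (S.contDiff_Φ.continuous.comp (Continuous.prodMk_left t)).measurable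

theorem measurable_jac_slice (t : ℝ) : Measurable fun y => ENNReal.ofReal (S.jac (y, t)) :=
  (S.continuous_jac.comp (Continuous.prodMk_left t)).measurable.ennreal_ofReal

theorem ae_mem_surf_zero : ∀ᵐ y ∂S.surf 0, y ∈ S.Γ 0 :=
  ae_restrict_mem S.isSurface_zero.measurableSet

theorem ae_mem_surf {t : ℝ} (ht : t ∈ Icc 0 S.T) : ∀ᵐ y ∂S.surf t, y ∈ S.Γ t :=
  ae_restrict_mem (S.isSurface t ht).measurableSet

theorem ae_lagMeasure_mem : ∀ᵐ p ∂S.lagMeasure, p.2 ∈ S.Γ 0 ∧ p.1 ∈ Ioo 0 S.T := by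
  have h1 : ∀ᵐ p ∂S.lagMeasure, p.2 ∈ S.Γ 0 :=
    Measure.quasiMeasurePreserving_snd.ae S.ae_mem_surf_zero
  have h2 : ∀ᵐ p ∂S.lagMeasure, p.1 ∈ Ioo 0 S.T :=
    Measure.quasiMeasurePreserving_fst.ae (ae_restrict_mem measurableSet_Ioo)
  exact h1.and h2

/-- The space-time measure in Lagrangian coordinates. -/
theorem stMeasure_eq_map : S.stMeasure =
    (S.lagMeasure.withDensity fun p => ENNReal.ofReal (S.jac p.swap)).map S.lag := by
  -- This kernel is measurable in t, as required for evaluating `bind`, and for t ∈ (0, T) it is the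
  -- kernel in the definition of `stMeasure`.
  let κ : ℝ → Measure (R3 × ℝ) := fun t =>
    ((S.surf 0).withDensity fun y => ENNReal.ofReal (S.jac (y, t))).map fun y => S.lag (t, y)
  have hm : ∀ t, Measurable fun y => S.lag (t, y) := fun t =>
    S.measurable_lag.comp measurable_prodMk_left
  have hκB : ∀ B : Set (R3 × ℝ), MeasurableSet B → ∀ t, κ t B = ∫⁻ y,
      (S.lag ⁻¹' B).indicator (fun p => ENNReal.ofReal (S.jac p.swap)) (t, y) ∂S.surf 0 := fun B hB t => by
    rw [Measure.map_apply (hm t) hB, withDensity_apply _ (hm t hB), ← lintegral_indicator (hm t hB)]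
    rfl
  have hκ : Measurable κ := by
    refine Measure.measurable_of_measurable_coe _ fun B hB => ?_
    simp only [hκB B hB]
    exact (S.measurable_jac_swap.indicator (S.measurable_lag hB)).lintegral_prod_right'
  have hcongr : (fun t => (S.surf t).map fun x => (x, t)) =ᵐ[volume.restrict (Ioo 0 S.T)] κ := by
    filter_upwards [ae_restrict_mem measurableSet_Ioo] with t ht
    simp only [κ]
    rw [S.surf_eq_map (Ioo_subset_Icc_self ht), Measure.map_map (by fun_prop) (S.measurable_Φ_slice t)]
    rfl
  rw [stMeasure, Measure.bind, Measure.map_congr hcongr, ← Measure.bind]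
  ext B hB
  rw [Measure.bind_apply hB hκ.aemeasurable, Measure.map_apply S.measurable_lag hB,
    withDensity_apply _ (S.measurable_lag hB), ← lintegral_indicator (S.measurable_lag hB), lagMeasure,
    lintegral_prod _ (S.measurable_jac_swap.indicator (S.measurable_lag hB)).aemeasurable]
  simp only [hκB B hB]

theorem ae_lag {Q : R3 × ℝ → Prop} (h : ∀ᵐ p ∂S.stMeasure, Q p) : ∀ᵐ p ∂S.lagMeasure, Q (S.lag p) := by
  rw [stMeasure_eq_map] at h
  have h1 := ae_of_ae_map S.measurable_lag.aemeasurable h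
  rw [ae_withDensity_iff S.measurable_jac_swap] at h1
  filter_upwards [S.ae_lagMeasure_mem, h1] with p hp h2
  exact h2 (ENNReal.ofReal_pos.2 (S.jac_pos hp.1 (Ioo_subset_Icc_self hp.2))).ne'

theorem aestronglyMeasurable_lag {F : Type*} [TopologicalSpace F] 
    {f : R3 × ℝ → F} (hf : AEStronglyMeasurable f S.stMeasure) :
    AEStronglyMeasurable (fun p => f (S.lag p)) S.lagMeasure := by
  obtain ⟨g, hg, hfg⟩ := hf
  exact ⟨fun p => g (S.lag p), hg.comp_measurable S.measurable_lag, S.ae_lag hfg⟩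

theorem integral_stMeasure {f : R3 × ℝ → ℝ} (hf : AEStronglyMeasurable f S.stMeasure) :
    ∫ p, f p ∂S.stMeasure = ∫ p, S.jac p.swap * f (S.lag p) ∂S.lagMeasure := by
  rw [stMeasure_eq_map] at hf ⊢
  rw [integral_map S.measurable_lag.aemeasurable hf,
    integral_withDensity_eq_integral_toReal_smul S.measurable_jac_swap (by simp)]
  refine integral_congr_ae (Eventually.of_forall fun p => ?_)
  simp [jac]

theorem integrable_stMeasure_iff {f : R3 × ℝ → ℝ} (hf : AEStronglyMeasurable f S.stMeasure) :
    Integrable f S.stMeasure ↔ Integrable (fun p => S.jac p.swap * f (S.lag p)) S.lagMeasure := by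
  rw [stMeasure_eq_map] at hf ⊢
  rw [integrable_map_measure hf S.measurable_lag.aemeasurable,
    integrable_withDensity_iff_integrable_smul' S.measurable_jac_swap (by simp)]
  refine integrable_congr (Eventually.of_forall fun p => ?_)
  simp [jac]

/-- The factor √J turns the L² norm with respect to ds dt into the one of the product measure. -/
theorem memLp_lag {F : Type*} [NormedAddCommGroup F] [NormedSpace ℝ F] {f : R3 × ℝ → F}
    (hf : MemLp f 2 S.stMeasure) :
    MemLp (fun p => S.sqrtJac p.swap • f (S.lag p)) 2 S.lagMeasure := by
  refine ⟨((S.contDiff_sqrtJac.continuous.comp continuous_swap).aestronglyMeasurable).smul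
    (S.aestronglyMeasurable_lag hf.1), ?_⟩
  have h1 := hf.2
  have hm := hf.1
  rw [eLpNorm_two_eq, ENNReal.rpow_lt_top_iff_of_pos (by norm_num)] at h1 ⊢
  rw [stMeasure_eq_map] at h1 hf
  rw [lintegral_map' (hf.1.enorm.pow_const 2) S.measurable_lag.aemeasurable,
    lintegral_withDensity_eq_lintegral_mul₀ S.measurable_jac_swap.aemeasurable] at h1
  · refine lt_of_le_of_lt (le_of_eq (lintegral_congr_ae ?_)) h1
    filter_upwards [S.ae_lagMeasure_mem] with p hp
    have hp' : p.swap ∈ S.track := ⟨hp.1, Ioo_subset_Icc_self hp.2⟩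
    rw [Pi.mul_apply, enorm_smul, ENNReal.mul_rpow_of_nonneg _ _ (by norm_num), ← S.sqrtJac_sq hp']
    congr 1
    rw [Real.enorm_eq_ofReal (S.sqrtJac_pos hp').le, ENNReal.ofReal_rpow_of_pos (S.sqrtJac_pos hp')]
    norm_num
  · exact (S.aestronglyMeasurable_lag hm).enorm.pow_const 2

theorem ae_slice {Q : R3 × ℝ → Prop} (h : ∀ᵐ p ∂S.stMeasure, Q p) :
    ∀ᵐ t ∂volume.restrict (Ioo 0 S.T), ∀ᵐ x ∂S.surf t, Q (x, t) := by
  obtain ⟨B, hBQ, hB, hB0⟩ := exists_measurable_superset_of_null (ae_iff.1 h)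
  have h1 : ∀ᵐ p ∂S.stMeasure, p ∉ B := measure_eq_zero_iff_ae_notMem.1 hB0
  filter_upwards [Measure.ae_ae_of_ae_prod (S.ae_lag h1), ae_restrict_mem measurableSet_Ioo] with t h2 ht
  have h3 : ∀ᵐ x ∂S.surf t, (x, t) ∉ B := by
    rw [S.surf_eq_map (Ioo_subset_Icc_self ht), ae_map_iff (p := fun x => (x, t) ∉ B)
      (S.measurable_Φ_slice t).aemeasurable (measurable_prodMk_right hB.compl)]
    exact (withDensity_absolutelyContinuous _ _).ae_le h2
  filter_upwards [h3] with x hx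
  by_contra hQ
  exact hx (hBQ hQ)

theorem ae_surf_comp {t : ℝ} (ht : t ∈ Icc 0 S.T) {Q : R3 → Prop} (h : ∀ᵐ x ∂S.surf t, Q x) :
    ∀ᵐ y ∂S.surf 0, Q (S.Φ (y, t)) := by
  rw [S.surf_eq_map ht] at h
  have h1 := ae_of_ae_map (S.measurable_Φ_slice t).aemeasurable h
  rw [ae_withDensity_iff (S.measurable_jac_slice t)] at h1
  filter_upwards [S.ae_mem_surf_zero, h1] with y hy h2
  exact h2 (ENNReal.ofReal_pos.2 (S.jac_pos hy ht)).ne'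

theorem integral_surf {t : ℝ} (ht : t ∈ Icc 0 S.T) {f : R3 → ℝ}
    (hf : AEStronglyMeasurable f (S.surf t)) :
    ∫ x, f x ∂S.surf t = ∫ y, S.jac (y, t) * f (S.Φ (y, t)) ∂S.surf 0 := by
  rw [S.surf_eq_map ht] at hf ⊢
  rw [integral_map (S.measurable_Φ_slice t).aemeasurable hf,
    integral_withDensity_eq_integral_toReal_smul (S.measurable_jac_slice t) (by simp)]
  refine integral_congr_ae (Eventually.of_forall fun p => ?_)
  simp [jac]

theorem integrable_surf_iff {t : ℝ} (ht : t ∈ Icc 0 S.T) {f : R3 → ℝ}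
    (hf : AEStronglyMeasurable f (S.surf t)) : Integrable f (S.surf t) ↔
      Integrable (fun y => S.jac (y, t) * f (S.Φ (y, t))) (S.surf 0) := by
  rw [S.surf_eq_map ht] at hf ⊢
  rw [integrable_map_measure hf (S.measurable_Φ_slice t).aemeasurable,
    integrable_withDensity_iff_integrable_smul' (S.measurable_jac_slice t) (by simp)]
  refine integrable_congr (Eventually.of_forall fun p => ?_)
  simp [jac]

theorem ae_aestronglyMeasurable_slice {F : Type*} [TopologicalSpace F] {f : R3 × ℝ → F}
    (hf : AEStronglyMeasurable f S.stMeasure) :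
    ∀ᵐ t ∂volume.restrict (Ioo 0 S.T), AEStronglyMeasurable (fun x => f (x, t)) (S.surf t) := by
  obtain ⟨g, hg, hfg⟩ := hf
  filter_upwards [S.ae_slice hfg] with t ht
  exact ⟨fun x => g (x, t), hg.comp_measurable measurable_prodMk_right, ht⟩

theorem ae_integrable_slice {f : R3 × ℝ → ℝ} (hf : Integrable f S.stMeasure) :
    ∀ᵐ t ∂volume.restrict (Ioo 0 S.T), Integrable (fun x => f (x, t)) (S.surf t) := by
  have h1 := (S.integrable_stMeasure_iff hf.1).1 hf
  filter_upwards [h1.prod_right_ae, S.ae_aestronglyMeasurable_slice hf.1,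
    ae_restrict_mem measurableSet_Ioo] with t h2 h3 ht
  exact (S.integrable_surf_iff (Ioo_subset_Icc_self ht) h3).2 h2

/-- Fubini's theorem on the space-time manifold. -/
theorem integral_stMeasure_eq_integral_surf {f : R3 × ℝ → ℝ} (hf : Integrable f S.stMeasure) :
    IntegrableOn (fun t => ∫ x, f (x, t) ∂S.surf t) (Ioo 0 S.T) ∧
      ∫ p, f p ∂S.stMeasure = ∫ t in Ioo 0 S.T, ∫ x, f (x, t) ∂S.surf t := by
  have h1 := (S.integrable_stMeasure_iff hf.1).1 hf
  have h2 : ∀ᵐ t ∂volume.restrict (Ioo 0 S.T),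
      ∫ y, S.jac (t, y).swap * f (S.lag (t, y)) ∂S.surf 0 = ∫ x, f (x, t) ∂S.surf t := by
    filter_upwards [S.ae_aestronglyMeasurable_slice hf.1,
      ae_restrict_mem measurableSet_Ioo] with t h3 ht
    rw [S.integral_surf (Ioo_subset_Icc_self ht) h3]
    rfl
  refine ⟨h1.integral_prod_left.congr h2, ?_⟩
  rw [S.integral_stMeasure hf.1, lagMeasure, integral_prod _ h1]
  exact integral_congr_ae h2

theorem ae_memLp_slice {F : Type*} [NormedAddCommGroup F] {f : R3 × ℝ → F} (hf : MemLp f 2 S.stMeasure) :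
    ∀ᵐ t ∂volume.restrict (Ioo 0 S.T), MemLp (fun x => f (x, t)) 2 (S.surf t) := by
  filter_upwards [S.ae_integrable_slice (hf.integrable_norm_pow (by norm_num)),
    S.ae_aestronglyMeasurable_slice hf.1] with t h1 h2
  exact (memLp_two_iff_integrable_sq_norm h2).2 h1

instance isFiniteMeasure_stMeasure : IsFiniteMeasure S.stMeasure := by
  obtain ⟨C, hC⟩ := S.isCompact_track.exists_bound_of_continuousOn S.continuous_jac.continuousOn
  have h : Integrable (fun p : ℝ × R3 => S.jac p.swap) S.lagMeasure := by
    refine Integrable.of_bound (S.continuous_jac.comp continuous_swap).aestronglyMeasurable C ?_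
    filter_upwards [S.ae_lagMeasure_mem] with p hp
    exact hC p.swap ⟨hp.1, Ioo_subset_Icc_self hp.2⟩
  have := isFiniteMeasure_withDensity_ofReal h.2
  rw [stMeasure_eq_map]
  infer_instance

end EvolvingSurface

/-! ### Transport of tangent vectors between Γ(0) and Γ(t) -/

/-- Maps between surfaces send tangent vectors to tangent vectors. -/
theorem IsClosedOrientedSurface.inner_normal_fderiv_of_mapsTo {M M' : Set R3} {ν ν' : R3 → R3}
    (hM : IsClosedOrientedSurface M ν) (hM' : IsClosedOrientedSurface M' ν') {F : R3 → R3} {y τ : R3}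
    {L : R3 →L[ℝ] R3} (hF : HasFDerivAt F L y) (hFM : MapsTo F M M') (hy : y ∈ M)
    (hτ : inner ℝ τ (ν y) = 0) : inner ℝ (L τ) (ν' (F y)) = 0 := by
  obtain ⟨U, O, ψ, π, hyU, h⟩ := hM.exists_chart hy
  have hξ : π y ∈ O := h.mapsTo hyU
  have hψ : ψ (π y) = y := h.right_inv ⟨hy, hyU⟩
  have h1 := (hψ.symm ▸ hF : HasFDerivAt F L (ψ (π y))).comp (π y) (h.differentiableAt hξ).hasFDerivAt
  have h2 := hM'.inner_normal_fderiv h1 (by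
    filter_upwards [h.isOpen_plane.mem_nhds hξ] with x hx
    exact hFM (h.mem_surface hx).1) (π τ)
  simp only [ContinuousLinearMap.coe_comp, Function.comp_apply] at h2
  rw [h.fderiv_of_tangent hM hξ (by rwa [hψ]), hψ] at h2
  rwa [real_inner_comm]

namespace EvolvingSurface

variable (S : EvolvingSurface)

/-- The orthogonal projection to the tangent space of `Γ(t)` at `Φ(y, t)`. -/
noncomputable def tproj (q : R3 × ℝ) : R3 →L[ℝ] R3 :=
  ContinuousLinearMap.id ℝ R3
    - (‖S.flowNormal q‖ ^ 2)⁻¹ • (innerSL ℝ (S.flowNormal q)).smulRight (S.flowNormal q)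

theorem tproj_apply (q : R3 × ℝ) (w : R3) : S.tproj q w
    = w - (inner ℝ w (S.flowNormal q) / ‖S.flowNormal q‖ ^ 2) • S.flowNormal q := by
  simp only [tproj, _root_.sub_apply, _root_.smul_apply, ContinuousLinearMap.id_apply,
    ContinuousLinearMap.smulRight_apply, innerSL_apply_apply, smul_smul]
  rw [div_eq_inv_mul, real_inner_comm]

theorem continuousOn_tproj : ContinuousOn S.tproj S.track := by
  have hc : Continuous S.flowNormal := S.contDiff_flowNormal.continuous
  have hinv : ContinuousOn (fun q => (‖S.flowNormal q‖ ^ 2)⁻¹) S.track :=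
    ContinuousOn.inv₀ (hc.norm.pow 2).continuousOn fun q hq =>
      pow_ne_zero 2 (norm_ne_zero_iff.2 (S.flowNormal_ne_zero hq.1 hq.2))
  have h : Continuous fun q => (innerSL ℝ (S.flowNormal q)).smulRight (S.flowNormal q) :=
    ((ContinuousLinearMap.smulRightL ℝ R3 R3).continuous.comp ((innerSL ℝ).continuous.comp hc)).clm_apply hc
  exact continuousOn_const.sub (hinv.smul h.continuousOn)

/-- The fields `normal t` are given separately for each t, without continuity in time; the
orientation might even switch. The projection does not depend on it and is continuous in the form
`tproj`. -/
theorem tproj_eq_tanPart {y : R3} (hy : y ∈ S.Γ 0) {t : ℝ} (ht : t ∈ Icc 0 S.T) (w : R3) :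
    S.tproj (y, t) w = tanPart (S.normal t (S.Φ (y, t))) w := by
  obtain ⟨a, b, ha, hb, hab, h⟩ := S.exists_tangent_frame hy
  have hc : S.flowNormal (y, t) = crossL (S.dΦ y t a) (S.dΦ y t b) := by
    rw [flowNormal, S.normalExt_eq hy, ← hab, cofL_crossL]
  rw [tproj_apply, tanPart_eq (S.inner_normal_dΦ hy ha ht) (S.inner_normal_dΦ hy hb ht)
    ((S.isSurface t ht).norm_normal (S.Φ_mem hy ht)) (h t ht), hc]

/-- The derivative of `back` in space, at `Φ(y, t)`. -/
noncomputable def dBack (q : R3 × ℝ) : R3 →L[ℝ] R3 :=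
  (fderiv ℝ S.back (S.flow q)).comp (ContinuousLinearMap.inl ℝ R3 ℝ)

theorem continuous_dBack : Continuous S.dBack :=
  ((S.contDiff_back.continuous_fderiv (by simp)).comp S.contDiff_flow.continuous).clm_comp
    continuous_const

theorem hasFDerivAt_back_space (q : R3 × ℝ) :
    HasFDerivAt (fun x => S.back (x, q.2)) (S.dBack q) (S.Φ q) :=
  ((S.contDiff_back.differentiable (by simp) (S.flow q)).hasFDerivAt).comp (S.Φ q)
    (hasFDerivAt_prodMk_left (S.Φ q) q.2)

theorem inner_dBack_normal {y : R3} (hy : y ∈ S.Γ 0) {t : ℝ} (ht : t ∈ Icc 0 S.T) {w : R3}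
    (hw : inner ℝ w (S.normal t (S.Φ (y, t))) = 0) :
    inner ℝ (S.dBack (y, t) w) (S.normal 0 y) = 0 := by
  have h := (S.isSurface t ht).inner_normal_fderiv_of_mapsTo S.isSurface_zero
    (S.hasFDerivAt_back_space (y, t)) (fun x hx => (S.Φ_back ht hx).1) (S.Φ_mem hy ht) hw
  rwa [S.back_Φ hy ht] at h

theorem dΦ_dBack {y : R3} (hy : y ∈ S.Γ 0) {t : ℝ} (ht : t ∈ Icc 0 S.T) {w : R3}
    (hw : inner ℝ w (S.normal t (S.Φ (y, t))) = 0) : S.dΦ y t (S.dBack (y, t) w) = w := by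
  have h1 := S.hasFDerivAt_back_space (y, t)
  have h2 : HasFDerivAt (fun x => S.Φ (x, t)) (S.dΦ y t) (S.back (S.Φ (y, t), t)) := by
    rw [S.back_Φ hy ht]; exact S.hasFDerivAt_Φ_space y t
  have h3 := (h2.comp (S.Φ (y, t)) h1).sub (hasFDerivAt_id (S.Φ (y, t)))
  have h4 := (S.isSurface t ht).fderiv_tangent_eq_zero (S.Φ_mem hy ht) h3.differentiableAt
    (fun x hx => sub_eq_zero.2 (S.Φ_back ht hx).2) hw
  rw [h3.fderiv] at h4
  simpa [sub_eq_zero] using h4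

/-- The spatial derivative of the square root of the area distortion. -/
noncomputable def dSqrtJac (q : R3 × ℝ) : R3 →L[ℝ] ℝ :=
  (fderiv ℝ S.sqrtJac q).comp (ContinuousLinearMap.inl ℝ R3 ℝ)

/-- The spatial derivative of the inverse square root of the area distortion. -/
noncomputable def dInvSqrtJac (q : R3 × ℝ) : R3 →L[ℝ] ℝ :=
  (fderiv ℝ S.invSqrtJac q).comp (ContinuousLinearMap.inl ℝ R3 ℝ)

theorem continuous_dSqrtJac : Continuous S.dSqrtJac :=
  (S.contDiff_sqrtJac.continuous_fderiv (by simp)).clm_comp continuous_const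

theorem continuous_dInvSqrtJac : Continuous S.dInvSqrtJac :=
  (S.contDiff_invSqrtJac.continuous_fderiv (by simp)).clm_comp continuous_const

theorem hasFDerivAt_sqrtJac_space (y : R3) (t : ℝ) :
    HasFDerivAt (fun x => S.sqrtJac (x, t)) (S.dSqrtJac (y, t)) y :=
  ((S.contDiff_sqrtJac.differentiable (by simp) (y, t)).hasFDerivAt).comp y (hasFDerivAt_prodMk_left y t)

theorem hasFDerivAt_invSqrtJac_space (y : R3) (t : ℝ) :
    HasFDerivAt (fun x => S.invSqrtJac (x, t)) (S.dInvSqrtJac (y, t)) y :=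
  ((S.contDiff_invSqrtJac.differentiable (by simp) (y, t)).hasFDerivAt).comp y
    (hasFDerivAt_prodMk_left y t)

/-- The product √J · (1 / √J) is constant along Γ(0), so its tangential derivative vanishes. -/
theorem dSqrtJac_tangent {y : R3} (hy : y ∈ S.Γ 0) {t : ℝ} (ht : t ∈ Icc 0 S.T) {τ : R3}
    (hτ : inner ℝ τ (S.normal 0 y) = 0) :
    S.dSqrtJac (y, t) τ = - (S.jac (y, t) * S.dInvSqrtJac (y, t) τ) := by
  have h1 := ((S.hasFDerivAt_sqrtJac_space y t).fun_mul (S.hasFDerivAt_invSqrtJac_space y t)).sub_const 1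
  have h2 := S.isSurface_zero.fderiv_tangent_eq_zero hy h1.differentiableAt (fun x hx => by
    rw [S.sqrtJac_mul_invSqrtJac ⟨hx, ht⟩, sub_self]) hτ
  rw [h1.fderiv] at h2
  simp only [_root_.add_apply, _root_.smul_apply, smul_eq_mul] at h2
  have h3 := S.sqrtJac_mul_invSqrtJac (p := (y, t)) ⟨hy, ht⟩
  have h4 := S.sqrtJac_sq (p := (y, t)) ⟨hy, ht⟩
  rw [← h4]
  linear_combination S.sqrtJac (y, t) * h2 - S.dSqrtJac (y, t) τ * h3

section Measurability

variable {S} {F G : Type*} [NormedAddCommGroup F] [NormedSpace ℝ F] [NormedAddCommGroup G]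
  [NormedSpace ℝ G]

/-- Multiplication of a square integrable function by a continuous family of bounded operators. -/
theorem memLp_lag_clm_apply {B : R3 × ℝ → F →L[ℝ] G} (hB : ContinuousOn B S.track) {f : ℝ × R3 → F}
    {p : ℝ≥0∞} (hf : MemLp f p S.lagMeasure) : MemLp (fun x => B x.swap (f x)) p S.lagMeasure := by
  set K : Set (ℝ × R3) := Icc 0 S.T ×ˢ S.Γ 0 with hKdef
  have hK : IsCompact K := isCompact_Icc.prod S.isSurface_zero.isCompact
  have h : S.lagMeasure.restrict K = S.lagMeasure := by
    refine Measure.restrict_eq_self_of_ae_mem ?_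
    filter_upwards [S.ae_lagMeasure_mem] with x hx
    exact ⟨Ioo_subset_Icc_self hx.2, hx.1⟩
  rw [← h] at hf ⊢
  refine MemLp.continuousOn_clm_apply hK hK.measurableSet (B := fun x => B x.swap) ?_ hf
  exact hB.comp continuous_swap.continuousOn fun x hx => ⟨hx.2, hx.1⟩

/-- A square integrable function on Lagrangian space-time as a family of functions on `Γ(0)`. -/
theorem exists_Lp_lag_slices {E : Type*} [NormedAddCommGroup E] [SecondCountableTopology E]
    {f : ℝ × R3 → E} (hf : MemLp f 2 S.lagMeasure) :
    ∃ u : Lp (Lp E 2 (surfaceMeasure (S.Γ 0))) 2 (volume : Measure ℝ),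
      ∀ᵐ t ∂volume.restrict (Ioo 0 S.T), u t =ᵐ[surfaceMeasure (S.Γ 0)] fun y => f (t, y) := by
  have : Fact ((2 : ℝ≥0∞) ≠ ⊤) := ⟨by simp⟩
  have : IsFiniteMeasure (surfaceMeasure (S.Γ 0)) := S.isFiniteMeasure_surf_zero
  obtain ⟨u, hu⟩ := exists_Lp_slices (ν := volume.restrict (Ioo 0 S.T))
    (μ := surfaceMeasure (S.Γ 0)) hf
  have h1 : MemLp ((Ioo 0 S.T).indicator u) 2 volume :=
    (memLp_indicator_iff_restrict measurableSet_Ioo).2 (Lp.memLp u)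
  refine ⟨h1.toLp, ?_⟩
  filter_upwards [hu, ae_restrict_of_ae h1.coeFn_toLp, ae_restrict_mem measurableSet_Ioo] with t h2 h3 h4
  rw [h3, indicator_of_mem h4]
  exact h2

end Measurability

end EvolvingSurface

/-! ### Slices of elements of H and test functions in H -/

theorem IsWeakGrad.congr {M : Set R3} {ν : R3 → R3} {v v' : R3 → ℝ} {g g' : R3 → R3}
    (h : IsWeakGrad M ν v g) (hv : v =ᵐ[surfaceMeasure M] v') (hg : g =ᵐ[surfaceMeasure M] g') :
    IsWeakGrad M ν v' g' where
  memLp := h.memLp.ae_eq hv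
  memLp_grad := h.memLp_grad.ae_eq hg
  tangential := by
    filter_upwards [h.tangential, hg] with x h1 h2
    rwa [← h2]
  weak Ψ h1 h2 := by
    have e1 : ∫ x, v x * tanTrace (ν x) (fderiv ℝ Ψ x) ∂surfaceMeasure M
        = ∫ x, v' x * tanTrace (ν x) (fderiv ℝ Ψ x) ∂surfaceMeasure M := integral_congr_ae <| by
      filter_upwards [hv] with x hx
      rw [hx]
    have e2 : ∫ x, inner ℝ (g x) (Ψ x) ∂surfaceMeasure M
        = ∫ x, inner ℝ (g' x) (Ψ x) ∂surfaceMeasure M := integral_congr_ae <| by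
      filter_upwards [hg] with x hx
      rw [hx]
    rw [← e1, ← e2, h.weak Ψ h1 h2]

namespace EvolvingSurface

variable {S : EvolvingSurface}

theorem HasWeakGrad.isWeakGrad {t : ℝ} {v : R3 → ℝ} {g : R3 → R3} (h : S.HasWeakGrad t v g) :
    IsWeakGrad (S.Γ t) (S.normal t) v g :=
  ⟨h.memLp, h.memLp_grad, h.tangential, fun Ψ h1 h2 => (h.weak Ψ h1 h2).2.2⟩

theorem _root_.IsWeakGrad.hasWeakGrad {t : ℝ} (ht : t ∈ Icc 0 S.T) {v : R3 → ℝ} {g : R3 → R3}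
    (h : IsWeakGrad (S.Γ t) (S.normal t) v g) : S.HasWeakGrad t v g := by
  have hM := S.isSurface t ht
  refine ⟨h.memLp, h.memLp_grad, h.tangential, fun Ψ h1 h2 => ⟨?_, ?_, h.weak Ψ h1 h2⟩⟩
  · refine memLp_mul_integrable h.memLp ?_
    obtain ⟨N, hN, hNν⟩ := hM.exists_contDiff_normal
    refine (hM.memLp_of_continuous (G := fun x => tanTrace (N x) (fderiv ℝ Ψ x))
      (continuous_tanTrace.comp (hN.continuous.prodMk (h1.continuous_fderiv (by simp))))).ae_eq ?_
    filter_upwards [ae_restrict_mem hM.measurableSet] with x hx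
    rw [hNν hx]
    rfl
  · exact memLp_inner_integrable h.memLp_grad (hM.memLp_of_continuous h1.continuous)

/-- Slices of elements of `H`. -/
theorem ae_isWeakGrad_of_mem_H {z : S.L2Pair} (hz : z ∈ S.H) :
    ∀ᵐ t ∂volume.restrict (Ioo 0 S.T),
      IsWeakGrad (S.Γ t) (S.normal t) (fun x => z.fst (x, t)) (fun x => z.snd (x, t)) := by
  obtain ⟨v, g, hv, hg, h⟩ := hz
  filter_upwards [h, S.ae_slice hv, S.ae_slice hg] with t h1 h2 h3
  exact h1.isWeakGrad.congr (EventuallyEq.symm h2) (EventuallyEq.symm h3)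

/-- The gradient in space of a function of space and time. -/
noncomputable def spaceGradient (φ : R3 × ℝ → ℝ) (p : R3 × ℝ) : R3 :=
  (InnerProductSpace.toDual ℝ R3).symm ((fderiv ℝ φ p).comp (ContinuousLinearMap.inl ℝ R3 ℝ))

theorem inner_spaceGradient (φ : R3 × ℝ → ℝ) (p : R3 × ℝ) (w : R3) :
    inner ℝ (spaceGradient φ p) w = fderiv ℝ φ p (w, 0) := by
  rw [spaceGradient, InnerProductSpace.toDual_symm_apply]
  rfl

theorem continuous_spaceGradient {φ : R3 × ℝ → ℝ} (hφ : ContDiff ℝ 1 φ) :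
    Continuous (spaceGradient φ) :=
  (InnerProductSpace.toDual ℝ R3).symm.continuous.comp
    ((hφ.continuous_fderiv (by simp)).clm_comp continuous_const)

theorem gradient_slice {φ : R3 × ℝ → ℝ} (hφ : ContDiff ℝ 1 φ) (p : R3 × ℝ) :
    gradient (fun x => φ (x, p.2)) p.1 = spaceGradient φ p := by
  have h : HasFDerivAt (fun x => φ (x, p.2)) ((fderiv ℝ φ p).comp (ContinuousLinearMap.inl ℝ R3 ℝ)) p.1 :=
    ((hφ.differentiable (by simp) p).hasFDerivAt).comp p.1 (hasFDerivAt_prodMk_left p.1 p.2)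
  rw [gradient, h.fderiv, spaceGradient]

theorem ae_stMeasure_of_ae_lag {Q : R3 × ℝ → Prop} (hQ : MeasurableSet {p | Q p})
    (h : ∀ᵐ p ∂S.lagMeasure, Q (S.lag p)) : ∀ᵐ p ∂S.stMeasure, Q p := by
  rw [stMeasure_eq_map, ae_map_iff S.measurable_lag.aemeasurable hQ]
  exact (withDensity_absolutelyContinuous _ _).ae_le h

theorem ae_stMeasure_mem : ∀ᵐ p ∂S.stMeasure, p.2 ∈ Ioo 0 S.T ∧ p.1 ∈ S.Γ p.2 := by
  have h : ∀ᵐ p ∂S.stMeasure, p.2 ∈ Ioo 0 S.T ∧ p ∈ S.flow '' S.track := by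
    refine ae_stMeasure_of_ae_lag ((measurable_snd measurableSet_Ioo).inter
      (S.isCompact_track.image S.contDiff_flow.continuous).measurableSet) ?_
    filter_upwards [S.ae_lagMeasure_mem] with p hp
    exact ⟨hp.2, p.swap, ⟨hp.1, Ioo_subset_Icc_self hp.2⟩, rfl⟩
  filter_upwards [h] with p hp
  obtain ⟨h1, q, hq, rfl⟩ := hp
  exact ⟨h1, S.Φ_mem hq.1 hq.2⟩

/-- Elements of `H` given by test functions. -/
theorem exists_mem_HSlab_of_contDiff {a b : ℝ} {φ : R3 × ℝ → ℝ} (hφ : ContDiff ℝ 1 φ)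
    (hc : HasCompactSupport φ) (hs : tsupport φ ⊆ {p | p.2 ∈ Ioo a b}) :
    ∃ ζ : S.L2Pair, ζ ∈ S.HSlab a b ∧ ζ.fst =ᵐ[S.stMeasure] φ ∧
      ζ.snd =ᵐ[S.stMeasure] fun p => tanPart (S.normal p.2 p.1) (spaceGradient φ p) := by
  have hae := ae_stMeasure_mem (S := S)
  have m1 : MemLp φ 2 S.stMeasure := hφ.continuous.memLp_of_hasCompactSupport hc
  have m2 : MemLp (spaceGradient φ) 2 S.stMeasure := by
    refine (continuous_spaceGradient hφ).memLp_of_hasCompactSupport ?_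
    refine (hc.fderiv ℝ).mono fun p hp => ?_
    contrapose! hp
    simp only [Function.mem_support, not_not] at hp ⊢
    rw [spaceGradient, hp]; simp
  -- Joint measurability of the tangential gradient is read off from `tproj` and `back`, because
  -- `normal` carries no measurability in time.
  have hm : Measurable fun p : R3 × ℝ => S.tproj (S.back p, p.2) (spaceGradient φ p) := by
    have hc : Measurable fun p : R3 × ℝ => S.flowNormal (S.back p, p.2) :=
      (S.contDiff_flowNormal.continuous.comp
        (S.contDiff_back.continuous.prodMk continuous_snd)).measurable
    have hg := (continuous_spaceGradient hφ).measurable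
    simp only [tproj_apply]
    fun_prop
  have e : (fun p : R3 × ℝ => S.tproj (S.back p, p.2) (spaceGradient φ p)) =ᵐ[S.stMeasure]
      fun p => tanPart (S.normal p.2 p.1) (spaceGradient φ p) := by
    filter_upwards [hae] with p hp
    have ht := Ioo_subset_Icc_self hp.1
    obtain ⟨h1, h2⟩ := S.Φ_back ht hp.2
    rw [S.tproj_eq_tanPart h1 ht, h2]
  have m3 : MemLp (fun p => tanPart (S.normal p.2 p.1) (spaceGradient φ p)) 2 S.stMeasure := by
    refine m2.of_le_mul (c := 1) (hm.aestronglyMeasurable.congr e) ?_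
    filter_upwards [hae] with p hp
    rw [one_mul]
    exact norm_tanPart_le ((S.isSurface _ (Ioo_subset_Icc_self hp.1)).norm_normal hp.2) _
  refine ⟨WithLp.toLp 2 (m1.toLp, m3.toLp), ⟨⟨φ, _, m1.coeFn_toLp, m3.coeFn_toLp, ?_⟩, ?_⟩,
    m1.coeFn_toLp, m3.coeFn_toLp⟩
  · filter_upwards [ae_restrict_mem measurableSet_Ioo] with t ht
    have ht' := Ioo_subset_Icc_self ht
    refine IsWeakGrad.hasWeakGrad ht' ?_
    refine ((S.isSurface t ht').isWeakGrad_of_contDiff (φ := fun x => φ (x, t))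
      (hφ.comp (contDiff_id.prodMk contDiff_const))).congr EventuallyEq.rfl ?_
    refine Eventually.of_forall fun x => ?_
    simp only [gradient_slice hφ (x, t)]
  · filter_upwards [m1.coeFn_toLp] with p hp hn
    refine hp.trans (image_eq_zero_of_notMem_tsupport fun hh => hn ?_)
    exact Ioo_subset_Ioc_self (hs hh)

theorem memLp_surf_back {t : ℝ} (ht : t ∈ Icc 0 S.T) {F : Type*} [NormedAddCommGroup F] {f : R3 → F}
    (hf : MemLp f 2 (S.surf 0)) : MemLp (fun x => f (S.back (x, t))) 2 (S.surf t) := by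
  have hb : Measurable fun x => S.back (x, t) :=
    (S.contDiff_back.continuous.comp (Continuous.prodMk_left t)).measurable
  obtain ⟨C, hC⟩ := S.isCompact_track.exists_bound_of_continuousOn S.continuous_jac.continuousOn
  have hle : (S.surf 0).withDensity (fun y => ENNReal.ofReal (S.jac (y, t)))
      ≤ ENNReal.ofReal C • S.surf 0 := by
    rw [← withDensity_const]
    refine withDensity_mono ?_
    filter_upwards [S.ae_mem_surf_zero] with y hy
    exact ENNReal.ofReal_le_ofReal ((le_abs_self _).trans (hC (y, t) ⟨hy, ht⟩))
  have h1 : MemLp f 2 ((S.surf t).map fun x => S.back (x, t)) := by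
    rw [S.map_back_surf ht]
    exact hf.of_measure_le_smul (by simp) hle
  exact h1.comp_of_map hb.aemeasurable

end EvolvingSurface

/-! ### Pull-back of weak gradients to the initial surface -/

/-- `tanPart n` as a continuous linear map. -/
noncomputable def tanL (n : R3) : R3 →L[ℝ] R3 :=
  ContinuousLinearMap.id ℝ R3 - (innerSL ℝ n).smulRight n

theorem tanL_apply (n w : R3) : tanL n w = tanPart n w := by
  simp [tanL, tanPart, real_inner_comm]

theorem continuous_tanL : Continuous tanL :=
  continuous_const.sub
    (((ContinuousLinearMap.smulRightL ℝ R3 R3).continuous.comp (innerSL ℝ).continuous).clm_apply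
      continuous_id)

namespace EvolvingSurface

variable (S : EvolvingSurface)

/-- The part of the pull-back of tangential gradients that depends on the gradient. -/
noncomputable def pullGrad (q : R3 × ℝ) : R3 →L[ℝ] R3 :=
  (tanL (S.normalExt q.1)).comp (ContinuousLinearMap.adjoint (S.dΦ q.1 q.2))

/-- The part of the pull-back of tangential gradients that depends on the value. -/
noncomputable def pullVal (q : R3 × ℝ) : ℝ →L[ℝ] R3 :=
  (1 : ℝ →L[ℝ] ℝ).smulRight (S.invSqrtJac q •
    tanL (S.normalExt q.1) ((InnerProductSpace.toDual ℝ R3).symm (S.dSqrtJac q)))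

theorem continuous_normalExt_fst : Continuous fun q : R3 × ℝ => S.normalExt q.1 :=
  S.contDiff_normalExt.continuous.comp continuous_fst

theorem continuous_pullGrad : Continuous S.pullGrad :=
  (continuous_tanL.comp S.continuous_normalExt_fst).clm_comp
    (ContinuousLinearMap.adjoint.continuous.comp S.contDiff_dΦ.continuous)

theorem continuous_pullVal : Continuous S.pullVal := by
  have h : Continuous fun q => S.invSqrtJac q •
      tanL (S.normalExt q.1) ((InnerProductSpace.toDual ℝ R3).symm (S.dSqrtJac q)) :=
    S.contDiff_invSqrtJac.continuous.smul ((continuous_tanL.comp S.continuous_normalExt_fst).clm_apply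
      ((InnerProductSpace.toDual ℝ R3).symm.continuous.comp S.continuous_dSqrtJac))
  exact (ContinuousLinearMap.smulRightL ℝ ℝ R3 (1 : ℝ →L[ℝ] ℝ)).continuous.comp h

theorem inner_pullGrad (q : R3 × ℝ) (w e : R3) :
    inner ℝ (S.pullGrad q w) e = inner ℝ w (S.dΦ q.1 q.2 (tanPart (S.normalExt q.1) e)) := by
  simp only [pullGrad, ContinuousLinearMap.comp_apply, tanL_apply]
  rw [inner_tanPart_left, ContinuousLinearMap.adjoint_inner_left]

theorem inner_pullVal (q : R3 × ℝ) (a : ℝ) (e : R3) :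
    inner ℝ (S.pullVal q a) e
      = a * S.invSqrtJac q * S.dSqrtJac q (tanPart (S.normalExt q.1) e) := by
  simp only [pullVal, ContinuousLinearMap.smulRight_apply, one_apply_eq_self, tanL_apply,
    real_inner_smul_left]
  rw [inner_tanPart_left, InnerProductSpace.toDual_symm_apply, mul_assoc]

variable {S}

/-- The pull-back of a weakly differentiable function, times the square root of the area distortion,
is orthogonal to what is orthogonal to all smooth functions. -/
theorem integral_pull_eq_zero {t : ℝ} (ht : t ∈ Icc 0 S.T) {v : R3 → ℝ} {g : R3 → R3}
    (hw : IsWeakGrad (S.Γ t) (S.normal t) v g) {p : R3 → ℝ} {q : R3 → R3}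
    (hp : MemLp p 2 (surfaceMeasure (S.Γ 0))) (hq : MemLp q 2 (surfaceMeasure (S.Γ 0)))
    (horth : ∀ φ : R3 → ℝ, ContDiff ℝ ∞ φ → ∫ y, (φ y * p y
      + inner ℝ (tanPart (S.normal 0 y) (gradient φ y)) (q y)) ∂surfaceMeasure (S.Γ 0) = 0) :
    ∫ y, (S.sqrtJac (y, t) * v (S.Φ (y, t)) * p y
      + inner ℝ (S.pullGrad (y, t) (S.sqrtJac (y, t) • g (S.Φ (y, t)))
        + S.pullVal (y, t) (S.sqrtJac (y, t) * v (S.Φ (y, t)))) (q y)) ∂surfaceMeasure (S.Γ 0)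
      = 0 := by
  have hM := S.isSurface_zero
  have hct : Continuous fun y : R3 => (y, t) := Continuous.prodMk_left t
  set q' : R3 → R3 := fun y => tanPart (S.normalExt y) (q y) with hq'
  -- (A, B) is the transposed pull-back of (p, q): its pairing with a pair on Γ(t) equals the
  -- pairing of the Lagrangian form of that pair with (p, q).
  set A : R3 → ℝ := fun y =>
    S.invSqrtJac (y, t) ^ 2 * (S.sqrtJac (y, t) * p y + S.dSqrtJac (y, t) (q' y)) with hA
  set B : R3 → R3 := fun y => S.invSqrtJac (y, t) • S.dΦ y t (q' y) with hB
  have hq'L : MemLp q' 2 (surfaceMeasure (S.Γ 0)) := by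
    have := hM.memLp_clm_apply (continuous_tanL.comp S.contDiff_normalExt.continuous) hq
    simpa only [Function.comp, tanL_apply] using this
  have hAL : MemLp A 2 (surfaceMeasure (S.Γ 0)) := by
    have c1 : Continuous fun y => (S.invSqrtJac (y, t) ^ 2 * S.sqrtJac (y, t)) •
        ContinuousLinearMap.id ℝ ℝ :=
      (((S.contDiff_invSqrtJac.continuous.comp hct).pow 2).mul
        (S.contDiff_sqrtJac.continuous.comp hct)).smul continuous_const
    have c2 : Continuous fun y => (S.invSqrtJac (y, t) ^ 2) • S.dSqrtJac (y, t) :=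
      ((S.contDiff_invSqrtJac.continuous.comp hct).pow 2).smul (S.continuous_dSqrtJac.comp hct)
    refine ((hM.memLp_clm_apply c1 hp).add (hM.memLp_clm_apply c2 hq'L)).ae_eq
      (Eventually.of_forall fun y => ?_)
    simp only [Pi.add_apply, _root_.smul_apply, ContinuousLinearMap.id_apply, smul_eq_mul, hA]
    ring
  have hBL : MemLp B 2 (surfaceMeasure (S.Γ 0)) := by
    have c1 : Continuous fun y => S.invSqrtJac (y, t) • S.dΦ y t :=
      (S.contDiff_invSqrtJac.continuous.comp hct).smul (S.contDiff_dΦ.continuous.comp hct)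
    exact hM.memLp_clm_apply c1 hq'L
  have hAt := memLp_surf_back ht hAL
  have hBt := memLp_surf_back ht hBL
  have key : ∀ (v : R3 → ℝ) (g : R3 → R3), MemLp v 2 (S.surf t) → MemLp g 2 (S.surf t) →
      ∫ x, (v x * A (S.back (x, t)) + inner ℝ (g x) (B (S.back (x, t)))) ∂S.surf t
        = ∫ y, (v (S.Φ (y, t)) * (S.sqrtJac (y, t) * p y + S.dSqrtJac (y, t) (q' y))
          + S.sqrtJac (y, t) * inner ℝ (g (S.Φ (y, t))) (S.dΦ y t (q' y))) ∂surfaceMeasure (S.Γ 0) := by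
    intro v g hv hg
    have hi : Integrable (fun x => v x * A (S.back (x, t)) + inner ℝ (g x) (B (S.back (x, t))))
        (S.surf t) := (memLp_mul_integrable hv hAt).add (memLp_inner_integrable hg hBt)
    rw [S.integral_surf ht hi.1]
    refine integral_congr_ae ?_
    filter_upwards [S.ae_mem_surf_zero] with y hy
    have hm : (y, t) ∈ S.track := ⟨hy, ht⟩
    have e := S.sqrtJac_mul_invSqrtJac hm
    simp only [S.back_Φ hy ht, hA, hB, real_inner_smul_right, ← S.sqrtJac_sq hm]
    linear_combination (S.sqrtJac (y, t) * S.invSqrtJac (y, t) + 1) *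
      (v (S.Φ (y, t)) * (S.sqrtJac (y, t) * p y + S.dSqrtJac (y, t) (q' y))) * e
      + S.sqrtJac (y, t) * inner ℝ (g (S.Φ (y, t))) (S.dΦ y t (q' y)) * e
  -- A smooth f on Γ(t) has the smooth Lagrangian form √J (f ∘ Φ). Orthogonality to smooth pairs is
  -- thus inherited from Γ(0) to Γ(t).
  have h0 := hw.integral_eq_zero_of_orthogonal (S.isSurface t ht) hAt hBt fun f hf => by
    have hM' := (S.isSurface t ht).isWeakGrad_of_contDiff (hf.of_le (by simp))
    refine (key f _ hM'.memLp hM'.memLp_grad).trans ?_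
    have hh : ContDiff ℝ ∞ fun y => S.sqrtJac (y, t) * f (S.Φ (y, t)) :=
      (S.contDiff_sqrtJac.comp (contDiff_id.prodMk contDiff_const)).mul
        (hf.comp (S.contDiff_Φ.comp (contDiff_id.prodMk contDiff_const)))
    refine Eq.trans (integral_congr_ae ?_) (horth _ hh)
    filter_upwards [S.ae_mem_surf_zero] with y hy
    have hd := (S.hasFDerivAt_sqrtJac_space y t).fun_mul
      (((hf.differentiable (by simp) (S.Φ (y, t))).hasFDerivAt).comp y (S.hasFDerivAt_Φ_space y t))
    have hτ : inner ℝ (q' y) (S.normal 0 y) = 0 := by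
      rw [← S.normalExt_eq hy]
      exact inner_tanPart_normal (by rw [S.normalExt_eq hy]; exact hM.norm_normal hy) _
    have hτ' := S.inner_normal_dΦ hy hτ ht
    rw [inner_tanPart_left, inner_tanPart_left, tanPart_of_tangent (by rw [real_inner_comm]; exact hτ'),
      ← S.normalExt_eq hy, inner_gradient_left, inner_gradient_left]
    have hd' : fderiv ℝ (fun y => S.sqrtJac (y, t) * f (S.Φ (y, t))) y = _ := hd.fderiv
    rw [hd']
    simp only [_root_.add_apply, _root_.smul_apply, ContinuousLinearMap.comp_apply, smul_eq_mul,
      Function.comp]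
    ring
  refine Eq.trans (integral_congr_ae ?_) ((key v g hw.memLp hw.memLp_grad).symm.trans h0)
  filter_upwards [S.ae_mem_surf_zero] with y hy
  have e := S.sqrtJac_mul_invSqrtJac (⟨hy, ht⟩ : (y, t) ∈ S.track)
  rw [inner_add_left, inner_pullGrad, inner_pullVal, real_inner_smul_left]
  change _ + (_ * inner ℝ _ (S.dΦ y t (q' y)) + _ * _ * S.dSqrtJac (y, t) (q' y)) = _
  linear_combination v (S.Φ (y, t)) * S.dSqrtJac (y, t) (q' y) * e

variable (S)

/-- The surface divergence is the trace of the projected velocity gradient, which is continuous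
although `normal` need not be continuous in time. -/
theorem continuousOn_divw_flow : ContinuousOn (fun q => S.divw (S.flow q)) S.track := by
  have e : ∀ q ∈ S.track, S.divw (S.flow q)
      = LinearMap.trace ℝ R3 ((S.tproj q).comp (S.dw (S.Φ q) q.2)).toLinearMap := by
    rintro ⟨y, t⟩ hq
    have hn : (S.tproj (y, t)) = tanL (S.normal t (S.Φ (y, t))) := by
      ext1 w
      rw [S.tproj_eq_tanPart hq.1 hq.2, tanL_apply]
    change S.divw (S.Φ (y, t), t) = _
    rw [divw_eq, hn, tanTrace, tanL, ContinuousLinearMap.sub_comp, ContinuousLinearMap.toLinearMap_sub,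
      map_sub]
    congr 1
    have h : (((innerSL ℝ (S.normal t (S.Φ (y, t)))).smulRight (S.normal t (S.Φ (y, t)))).comp
        (S.dw (S.Φ (y, t)) t)).toLinearMap = LinearMap.smulRight
        ((innerSL ℝ (S.normal t (S.Φ (y, t)))).toLinearMap.comp (S.dw (S.Φ (y, t)) t).toLinearMap)
        (S.normal t (S.Φ (y, t))) := rfl
    rw [h, LinearMap.trace_smulRight]
    simp [real_inner_comm]
  refine ContinuousOn.congr ?_ e
  have hL : Continuous fun A : R3 →L[ℝ] R3 => LinearMap.trace ℝ R3 A.toLinearMap :=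
    LinearMap.continuous_of_finiteDimensional
      ((LinearMap.trace ℝ R3).comp (ContinuousLinearMap.coeLM ℝ))
  exact hL.comp_continuousOn (S.continuousOn_tproj.clm_comp
    (S.continuous_dw.comp (S.contDiff_Φ.continuous.prodMk continuous_snd)).continuousOn)

end EvolvingSurface

/-! ### The weak time derivative in Lagrangian coordinates -/

namespace EvolvingSurface

variable (S : EvolvingSurface)

/-- The push-forward of tangential gradients to the initial surface. -/
noncomputable def pushGrad (q : R3 × ℝ) : R3 →L[ℝ] R3 := (S.dBack q).comp (S.tproj q)

theorem continuousOn_pushGrad : ContinuousOn S.pushGrad S.track :=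
  S.continuous_dBack.continuousOn.clm_comp S.continuousOn_tproj

theorem inner_tproj_normal {y : R3} (hy : y ∈ S.Γ 0) {t : ℝ} (ht : t ∈ Icc 0 S.T) (w : R3) :
    inner ℝ (S.tproj (y, t) w) (S.normal t (S.Φ (y, t))) = 0 := by
  rw [S.tproj_eq_tanPart hy ht]
  exact inner_tanPart_normal ((S.isSurface t ht).norm_normal (S.Φ_mem hy ht)) _

theorem inner_pushGrad_normal {y : R3} (hy : y ∈ S.Γ 0) {t : ℝ} (ht : t ∈ Icc 0 S.T) (w : R3) :
    inner ℝ (S.pushGrad (y, t) w) (S.normal 0 y) = 0 :=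
  S.inner_dBack_normal hy ht (S.inner_tproj_normal hy ht w)

theorem dΦ_pushGrad {y : R3} (hy : y ∈ S.Γ 0) {t : ℝ} (ht : t ∈ Icc 0 S.T) (w : R3) :
    S.dΦ y t (S.pushGrad (y, t) w) = S.tproj (y, t) w :=
  S.dΦ_dBack hy ht (S.inner_tproj_normal hy ht w)

/-- Test functions on the space-time manifold with prescribed Lagrangian form. -/
theorem exists_test {a b : ℝ} {f : R3 → ℝ} (hf : ContDiff ℝ ∞ f) {θ : ℝ → ℝ} (hθ : ContDiff ℝ ∞ θ)
    (hθc : HasCompactSupport θ) (hθs : tsupport θ ⊆ Ioo a b) :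
    ∃ φ : R3 × ℝ → ℝ, ContDiff ℝ 1 φ ∧ HasCompactSupport φ ∧ tsupport φ ⊆ {p | p.2 ∈ Ioo a b} ∧
      ∀ y ∈ S.Γ 0, ∀ t ∈ Ioo 0 S.T,
        φ (S.Φ (y, t), t) = θ t * (f y * S.invSqrtJac (y, t)) ∧
        S.matDer φ (S.Φ (y, t), t) = deriv θ t * (f y * S.invSqrtJac (y, t))
          - θ t * (f y * (1 / 2 * S.divw (S.Φ (y, t), t) * S.invSqrtJac (y, t))) ∧
        ∀ w, fderiv ℝ φ (S.Φ (y, t), t) (S.tproj (y, t) w, 0)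
          = θ t * (S.invSqrtJac (y, t) * fderiv ℝ f y (S.pushGrad (y, t) w)
            + f y * S.dInvSqrtJac (y, t) (S.pushGrad (y, t) w)) := by
  -- Functions of `back` have no compact support in space. The cutoff supplies it and is one at all
  -- positions reached by the surface.
  obtain ⟨ρ, hρ, hρc, -, hρ1⟩ := exists_contDiff_cutoff (S.isCompact_track.image S.contDiff_Φ.continuous)
    isOpen_univ (subset_univ _)
  -- The factor 1 / √J takes one half of the area distortion; the other half belongs to the
  -- Lagrangian form of the function that is tested.
  set φ : R3 × ℝ → ℝ := fun p =>
    θ p.2 * (ρ p.1 * (f (S.back p) * S.invSqrtJac (S.back p, p.2))) with hφ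
  have hφs : ContDiff ℝ ∞ φ := (hθ.comp contDiff_snd).mul ((hρ.comp contDiff_fst).mul
    ((hf.comp S.contDiff_back).mul (S.contDiff_invSqrtJac.comp (S.contDiff_back.prodMk contDiff_snd))))
  have hsub : tsupport φ ⊆ tsupport ρ ×ˢ tsupport θ := by
    refine closure_minimal (fun p hp => ?_) ((isClosed_tsupport ρ).prod (isClosed_tsupport θ))
    simp only [hφ, Function.mem_support, ne_eq, mul_eq_zero, not_or] at hp
    exact ⟨subset_closure hp.2.1, subset_closure hp.1⟩
  have hφΦ : ∀ y ∈ S.Γ 0, ∀ t ∈ Icc 0 S.T,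
      φ (S.Φ (y, t), t) = θ t * (f y * S.invSqrtJac (y, t)) := fun y hy t ht => by
    have h1 : ρ (S.Φ (y, t)) = 1 := (hρ1 _ ⟨(y, t), ⟨hy, ht⟩, rfl⟩).self_of_nhds
    simp only [hφ, S.back_Φ hy ht, h1, one_mul]
  have hφd : Differentiable ℝ φ := hφs.differentiable (by simp)
  refine ⟨φ, hφs.of_le (by simp), (hρc.isCompact.prod hθc.isCompact).of_isClosed_subset
    (isClosed_tsupport φ) hsub, fun p hp => hθs (hsub hp).2, fun y hy t ht => ?_⟩
  have ht' := Ioo_subset_Icc_self ht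
  refine ⟨hφΦ y hy t ht', ?_, fun w => ?_⟩
  · have h1 : HasDerivAt (fun s => φ (S.Φ (y, s), s)) (S.matDer φ (S.Φ (y, t), t)) t :=
      HasFDerivAt.comp_hasDerivAt (f := fun s => (S.Φ (y, s), s)) t
        (hφd (S.Φ (y, t), t)).hasFDerivAt ((S.hasDerivAt_Φ_time hy ht').prodMk (hasDerivAt_id t))
    have h2 : HasDerivAt (fun s => θ s * (f y * S.invSqrtJac (y, s))) _ t :=
      ((hθ.differentiable (by simp) t).hasDerivAt).fun_mul
        ((S.hasDerivAt_invSqrtJac hy ht).const_mul (f y))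
    have h3 : (fun s => φ (S.Φ (y, s), s)) =ᶠ[𝓝 t] fun s => θ s * (f y * S.invSqrtJac (y, s)) := by
      filter_upwards [Ioo_mem_nhds ht.1 ht.2] with s hs using hφΦ y hy s (Ioo_subset_Icc_self hs)
    rw [h1.unique (h2.congr_of_eventuallyEq h3)]
    ring
  · have h1 : HasFDerivAt (fun x => φ (S.Φ (x, t), t))
        ((fderiv ℝ φ (S.Φ (y, t), t)).comp ((S.dΦ y t).prod 0)) y :=
      HasFDerivAt.comp (f := fun x => (S.Φ (x, t), t)) y (hφd (S.Φ (y, t), t)).hasFDerivAt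
        ((S.hasFDerivAt_Φ_space y t).prodMk (hasFDerivAt_const t y))
    have h2 := h1.sub (((((hf.differentiable (by simp) y).hasFDerivAt)).fun_mul
      (S.hasFDerivAt_invSqrtJac_space y t)).const_mul (θ t))
    have h3 := S.isSurface_zero.fderiv_tangent_eq_zero hy h2.differentiableAt
      (fun x hx => sub_eq_zero.2 (hφΦ x hx t ht')) (S.inner_pushGrad_normal hy ht' w)
    rw [h2.fderiv] at h3
    simp only [_root_.sub_apply, ContinuousLinearMap.comp_apply, ContinuousLinearMap.prod_apply,
      S.dΦ_pushGrad hy ht' w, _root_.zero_apply, _root_.smul_apply, _root_.add_apply, smul_eq_mul] at h3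
    rw [sub_eq_zero.1 h3]
    ring

/-- The Lagrangian form of a function on the space-time manifold. -/
noncomputable def lagVal (z : S.L2Pair) (p : ℝ × R3) : ℝ := S.sqrtJac p.swap * z.fst (S.lag p)

/-- The Lagrangian form of a vector field on the space-time manifold. -/
noncomputable def lagGrad (z : S.L2Pair) (p : ℝ × R3) : R3 := S.sqrtJac p.swap • z.snd (S.lag p)

/-- The Lagrangian form of the tangential gradient. -/
noncomputable def pulledGrad (z : S.L2Pair) (p : ℝ × R3) : R3 :=
  S.pullGrad p.swap (S.lagGrad z p) + S.pullVal p.swap (S.lagVal z p)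

/-- The vector part of the Lagrangian form of the functional represented by `r`. -/
noncomputable def pushedGrad (r : S.L2Pair) (p : ℝ × R3) : R3 := S.pushGrad p.swap (S.lagGrad r p)

/-- The scalar part of the time derivative of the Lagrangian form of `z`, if the material derivative
of `z` is represented by `r`. -/
noncomputable def pushedVal (z r : S.L2Pair) (p : ℝ × R3) : ℝ :=
  S.lagVal r p + ((S.sqrtJac p.swap • (S.dInvSqrtJac p.swap).comp (S.pushGrad p.swap)) (S.lagGrad r p)
    + ((1 / 2 * S.divw (S.flow p.swap)) • ContinuousLinearMap.id ℝ ℝ) (S.lagVal z p))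

theorem memLp_lagVal (z : S.L2Pair) : MemLp (S.lagVal z) 2 S.lagMeasure := S.memLp_lag (Lp.memLp z.fst)

theorem memLp_lagGrad (z : S.L2Pair) : MemLp (S.lagGrad z) 2 S.lagMeasure :=
  S.memLp_lag (Lp.memLp z.snd)

theorem memLp_pulledGrad (z : S.L2Pair) : MemLp (S.pulledGrad z) 2 S.lagMeasure :=
  (memLp_lag_clm_apply S.continuous_pullGrad.continuousOn (S.memLp_lagGrad z)).add
    (memLp_lag_clm_apply S.continuous_pullVal.continuousOn (S.memLp_lagVal z))

theorem memLp_pushedGrad (r : S.L2Pair) : MemLp (S.pushedGrad r) 2 S.lagMeasure :=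
  memLp_lag_clm_apply S.continuousOn_pushGrad (S.memLp_lagGrad r)

theorem memLp_pushedVal (z r : S.L2Pair) : MemLp (S.pushedVal z r) 2 S.lagMeasure := by
  refine (S.memLp_lagVal r).add (MemLp.add ?_ ?_)
  · exact memLp_lag_clm_apply (B := fun q => S.sqrtJac q • (S.dInvSqrtJac q).comp (S.pushGrad q))
      (S.contDiff_sqrtJac.continuous.continuousOn.smul
        (S.continuous_dInvSqrtJac.continuousOn.clm_comp S.continuousOn_pushGrad)) (S.memLp_lagGrad r)
  · exact memLp_lag_clm_apply
      (B := fun q => (1 / 2 * S.divw (S.flow q)) • ContinuousLinearMap.id ℝ ℝ)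
      ((continuousOn_const.mul S.continuousOn_divw_flow).smul continuousOn_const) (S.memLp_lagVal z)

variable {S}

theorem memLp_lagMeasure_of_continuous {F : Type*} [NormedAddCommGroup F] [SecondCountableTopology F]
    {G : ℝ × R3 → F} (hG : Continuous G) : MemLp G 2 S.lagMeasure := by
  obtain ⟨C, hC⟩ := (isCompact_Icc.prod S.isSurface_zero.isCompact :
    IsCompact (Icc 0 S.T ×ˢ S.Γ 0)).exists_bound_of_continuousOn hG.continuousOn
  refine MemLp.of_bound hG.aestronglyMeasurable C ?_
  filter_upwards [S.ae_lagMeasure_mem] with p hp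
  exact hC p ⟨Ioo_subset_Icc_self hp.2, hp.1⟩

theorem inner_L2Pair (z z' : S.L2Pair) :
    inner ℝ z z' = ∫ p, (z.fst p * z'.fst p + inner ℝ (z.snd p) (z'.snd p)) ∂S.stMeasure := by
  rw [WithLp.prod_inner_apply, L2.inner_def, L2.inner_def, ← integral_add]
  · refine integral_congr_ae (Eventually.of_forall fun x => ?_)
    simp only [RCLike.inner_apply, conj_trivial]
    rw [mul_comm]
    rfl
  · exact L2.integrable_inner _ _
  · exact L2.integrable_inner _ _

/-- The test function is θ f / √J. By Liouville's formula (1 / √J)' = -½ div_Γ w / √J, so J z (φ̇ +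
φ div_Γ w) = θ' f √J z + ½ θ f div_Γ w √J z. The last term moves to the other side and becomes a
part of `pushedVal`. -/
theorem integral_lag_test {a b : ℝ} {z r : S.L2Pair} {ℓ : StrongDual ℝ (S.HSlab a b)}
    (hℓ : S.IsMaterialDeriv a b z ℓ) (hr : ∀ ζ : S.HSlab a b, ℓ ζ = inner ℝ r ζ.1)
    {f : R3 → ℝ} (hf : ContDiff ℝ ∞ f) {θ : ℝ → ℝ} (hθ : ContDiff ℝ ∞ θ)
    (hθc : HasCompactSupport θ) (hθs : tsupport θ ⊆ Ioo a b) :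
    ∫ p, deriv θ p.1 * (f p.2 * S.lagVal z p) ∂S.lagMeasure
      = - ∫ p, θ p.1 * (S.pushedVal z r p * f p.2
        + inner ℝ (S.pushedGrad r p) (tanPart (S.normal 0 p.2) (gradient f p.2))) ∂S.lagMeasure := by
  obtain ⟨φ, h1, h2, h3, h4⟩ := S.exists_test hf hθ hθc hθs
  obtain ⟨ζ, hζ, hζ1, hζ2⟩ := exists_mem_HSlab_of_contDiff (S := S) h1 h2 h3
  obtain ⟨hi, e⟩ := hℓ φ h1 h2 h3 ⟨ζ, hζ⟩ hζ1
  rw [hr] at e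
  change inner ℝ r ζ = _ at e
  have hi' : Integrable (fun p => r.fst p * ζ.fst p + inner ℝ (r.snd p) (ζ.snd p)) S.stMeasure :=
    (memLp_mul_integrable (Lp.memLp _) (Lp.memLp _)).add
      (memLp_inner_integrable (Lp.memLp _) (Lp.memLp _))
  rw [inner_L2Pair, S.integral_stMeasure hi'.1, S.integral_stMeasure hi.1] at e
  have ie := (S.integrable_stMeasure_iff hi.1).1 hi
  have ie' := (S.integrable_stMeasure_iff hi'.1).1 hi'
  -- both sides in Lagrangian coordinates
  have hcf : MemLp (fun p : ℝ × R3 => θ p.1 * f p.2) 2 S.lagMeasure :=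
    memLp_lagMeasure_of_continuous
      ((hθ.continuous.comp continuous_fst).mul (hf.continuous.comp continuous_snd))
  have ihalf : Integrable (fun p : ℝ × R3 => θ p.1 * f p.2 *
      (((1 / 2 * S.divw (S.flow p.swap)) • ContinuousLinearMap.id ℝ ℝ) (S.lagVal z p))) S.lagMeasure :=
    memLp_mul_integrable hcf (memLp_lag_clm_apply
      (B := fun q => (1 / 2 * S.divw (S.flow q)) • ContinuousLinearMap.id ℝ ℝ)
      ((continuousOn_const.mul S.continuousOn_divw_flow).smul continuousOn_const) (S.memLp_lagVal z))
  have a1 : (fun p => S.jac p.swap * (z.fst (S.lag p) * (S.matDer φ (S.lag p) + φ (S.lag p) * S.divw (S.lag p))))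
      =ᵐ[S.lagMeasure] fun p => deriv θ p.1 * (f p.2 * S.lagVal z p) + θ p.1 * f p.2 *
      (((1 / 2 * S.divw (S.flow p.swap)) • ContinuousLinearMap.id ℝ ℝ) (S.lagVal z p)) := by
    filter_upwards [S.ae_lagMeasure_mem] with p hp
    obtain ⟨m1, m2, -⟩ := h4 p.2 hp.1 p.1 hp.2
    have hm : (p.2, p.1) ∈ S.track := ⟨hp.1, Ioo_subset_Icc_self hp.2⟩
    have e := S.sqrtJac_mul_invSqrtJac hm
    simp only [lag, flow, Prod.swap, m1, m2, lagVal, _root_.smul_apply, ContinuousLinearMap.id_apply,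
      smul_eq_mul, ← S.sqrtJac_sq hm]
    linear_combination (S.sqrtJac (p.2, p.1) * z.fst (S.Φ (p.2, p.1), p.1) * (deriv θ p.1 * f p.2
      + θ p.1 * f p.2 * (1 / 2) * S.divw (S.Φ (p.2, p.1), p.1))) * e
  have a2 : (fun p => S.jac p.swap * (r.fst (S.lag p) * ζ.fst (S.lag p)
        + inner ℝ (r.snd (S.lag p)) (ζ.snd (S.lag p)))) =ᵐ[S.lagMeasure]
      fun p => θ p.1 * (S.pushedVal z r p * f p.2
        + inner ℝ (S.pushedGrad r p) (tanPart (S.normal 0 p.2) (gradient f p.2)))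
        - θ p.1 * f p.2 *
      (((1 / 2 * S.divw (S.flow p.swap)) • ContinuousLinearMap.id ℝ ℝ) (S.lagVal z p)) := by
    filter_upwards [S.ae_lagMeasure_mem, S.ae_lag hζ1, S.ae_lag hζ2] with p hp e1 e2
    obtain ⟨m1, -, m3⟩ := h4 p.2 hp.1 p.1 hp.2
    have ht := Ioo_subset_Icc_self hp.2
    have hm : (p.2, p.1) ∈ S.track := ⟨hp.1, ht⟩
    have e := S.sqrtJac_mul_invSqrtJac hm
    have e3 : inner ℝ (r.snd (S.lag p)) (ζ.snd (S.lag p))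
        = fderiv ℝ φ (S.Φ (p.2, p.1), p.1) (S.tproj (p.2, p.1) (r.snd (S.lag p)), 0) := by
      rw [e2, ← inner_tanPart_left, real_inner_comm, inner_spaceGradient,
        S.tproj_eq_tanPart hp.1 ht]
      rfl
    have e4 : inner ℝ (S.pushedGrad r p) (tanPart (S.normal 0 p.2) (gradient f p.2))
        = S.sqrtJac (p.2, p.1) * fderiv ℝ f p.2 (S.pushGrad (p.2, p.1) (r.snd (S.lag p))) := by
      change inner ℝ (S.pushGrad (p.2, p.1) (S.lagGrad r p)) _ = _
      rw [← inner_tanPart_left, tanPart_of_tangent (S.inner_pushGrad_normal hp.1 ht (S.lagGrad r p)),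
        real_inner_comm, inner_gradient_left, lagGrad, map_smul, map_smul]
      rfl
    have e5 : φ (S.lag p) = _ := m1
    rw [e3, e4, e1, e5, m3]
    simp only [pushedVal, lagVal, lagGrad, Prod.swap, _root_.smul_apply, ContinuousLinearMap.comp_apply,
      map_smul, smul_eq_mul, ← S.sqrtJac_sq hm]
    linear_combination (S.sqrtJac (p.2, p.1) * θ p.1 * (f p.2 * r.fst (S.lag p)
      + fderiv ℝ f p.2 (S.pushGrad (p.2, p.1) (r.snd (S.lag p))))) * e
  rw [integral_congr_ae a1, integral_congr_ae a2] at e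
  have i1 := (ie.congr a1).sub ihalf
  have i2 := (ie'.congr a2).add ihalf
  have i1' : Integrable (fun p => deriv θ p.1 * (f p.2 * S.lagVal z p)) S.lagMeasure :=
    i1.congr (Eventually.of_forall fun p => by simp only [Pi.sub_apply]; ring)
  have i2' : Integrable (fun p => θ p.1 * (S.pushedVal z r p * f p.2
        + inner ℝ (S.pushedGrad r p) (tanPart (S.normal 0 p.2) (gradient f p.2)))) S.lagMeasure :=
    i2.congr (Eventually.of_forall fun p => by simp only [Pi.add_apply]; ring)
  rw [integral_sub i2' ihalf, integral_add i1' ihalf] at e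
  linarith

end EvolvingSurface

/-! ### One-sided limits and energy identity in Lagrangian coordinates -/

namespace EvolvingSurface

variable (S : EvolvingSurface)

theorem exists_pair_slices {f : ℝ × R3 → ℝ} {g : ℝ × R3 → R3} (hf : MemLp f 2 S.lagMeasure)
    (hg : MemLp g 2 S.lagMeasure) :
    ∃ U : Lp (SurfacePair (S.Γ 0)) 2 (volume : Measure ℝ), ∀ᵐ t ∂volume.restrict (Ioo 0 S.T),
      (U t).fst =ᵐ[surfaceMeasure (S.Γ 0)] (fun y => f (t, y)) ∧
      (U t).snd =ᵐ[surfaceMeasure (S.Γ 0)] fun y => g (t, y) := by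
  obtain ⟨u, hu⟩ := S.exists_Lp_lag_slices hf
  obtain ⟨v, hv⟩ := S.exists_Lp_lag_slices hg
  set e : (Lp ℝ 2 (surfaceMeasure (S.Γ 0)) × Lp R3 2 (surfaceMeasure (S.Γ 0))) →L[ℝ] SurfacePair (S.Γ 0) :=
    ((WithLp.prodContinuousLinearEquiv 2 ℝ (Lp ℝ 2 (surfaceMeasure (S.Γ 0)))
      (Lp R3 2 (surfaceMeasure (S.Γ 0)))).symm.toContinuousLinearMap) with he
  have h : MemLp (fun t => e (u t, v t)) 2 (volume : Measure ℝ) := by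
    refine (((e.comp (ContinuousLinearMap.inl ℝ _ _)).comp_memLp' (Lp.memLp u)).add
      ((e.comp (ContinuousLinearMap.inr ℝ _ _)).comp_memLp' (Lp.memLp v))).ae_eq
      (Eventually.of_forall fun t => ?_)
    simp only [Pi.add_apply, Function.comp, ContinuousLinearMap.comp_apply, ← map_add]
    simp
  refine ⟨h.toLp, ?_⟩
  filter_upwards [hu, hv, ae_restrict_of_ae h.coeFn_toLp] with t h1 h2 h3
  rw [h3]
  exact ⟨h1, h2⟩

/-- The closed space-time manifold is compact. -/
theorem isCompact_flow_track : IsCompact (S.flow '' S.track) :=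
  S.isCompact_track.image S.contDiff_flow.continuous

theorem continuousOn_divw : ContinuousOn S.divw (S.flow '' S.track) := by
  have h : ContinuousOn (fun p : R3 × ℝ => S.divw (S.flow (S.back p, p.2))) (S.flow '' S.track) := by
    refine S.continuousOn_divw_flow.comp
      (S.contDiff_back.continuous.prodMk continuous_snd).continuousOn ?_
    rintro _ ⟨⟨y, t⟩, hq, rfl⟩
    change (S.back (S.Φ (y, t), t), t) ∈ S.track
    rwa [S.back_Φ hq.1 hq.2]
  refine h.congr ?_
  rintro _ ⟨⟨y, t⟩, hq, rfl⟩
  change _ = S.divw (S.flow (S.back (S.Φ (y, t), t), t))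
  rw [S.back_Φ hq.1 hq.2]

theorem stMeasure_restrict : S.stMeasure.restrict (S.flow '' S.track) = S.stMeasure := by
  refine Measure.restrict_eq_self_of_ae_mem (ae_stMeasure_of_ae_lag
    S.isCompact_flow_track.measurableSet ?_)
  filter_upwards [S.ae_lagMeasure_mem] with p hp
  exact ⟨p.swap, ⟨hp.1, Ioo_subset_Icc_self hp.2⟩, rfl⟩

theorem memLp_divw_mul {f : R3 × ℝ → ℝ} (hf : MemLp f 2 S.stMeasure) :
    MemLp (fun p => S.divw p * f p) 2 S.stMeasure := by
  have h := MemLp.continuousOn_clm_apply S.isCompact_flow_track S.isCompact_flow_track.measurableSet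
    (B := fun p => S.divw p • ContinuousLinearMap.id ℝ ℝ) (f := f) (p := 2)
    (S.continuousOn_divw.smul continuousOn_const) (by rwa [S.stMeasure_restrict])
  rw [S.stMeasure_restrict] at h
  simpa using h

variable {S}

/-- Membership in `HSlab` constrains only the values outside the slab. That the gradient vanishes
there too follows from the uniqueness of weak gradients. -/
theorem ae_slice_eq_zero {a b : ℝ} {z : S.L2Pair} (hz : z ∈ S.HSlab a b) :
    ∀ᵐ t ∂volume.restrict (Ioo 0 S.T), t ∉ Ioc a b →
      (fun x => z.fst (x, t)) =ᵐ[S.surf t] 0 ∧ (fun x => z.snd (x, t)) =ᵐ[S.surf t] 0 := by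
  filter_upwards [S.ae_slice hz.2, ae_isWeakGrad_of_mem_H hz.1, ae_restrict_mem measurableSet_Ioo]
    with t h1 h2 ht hn
  have h3 : (fun x => z.fst (x, t)) =ᵐ[S.surf t] 0 := by
    filter_upwards [h1] with x hx using hx hn
  exact ⟨h3, h2.grad_ae_eq_zero (S.isSurface t (Ioo_subset_Icc_self ht)) h3⟩

/-- Extension by Hahn–Banach to the full space of pairs, followed by the Riesz representation.
Closedness of the subspace is not needed. -/
theorem exists_inner_eq {a b : ℝ} (ℓ : StrongDual ℝ (S.HSlab a b)) :
    ∃ r : S.L2Pair, ∀ ζ : S.HSlab a b, ℓ ζ = inner ℝ r ζ.1 := by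
  obtain ⟨g, hg, -⟩ := exists_extension_norm_eq (S.HSlab a b) ℓ
  exact ⟨(InnerProductSpace.toDual ℝ S.L2Pair).symm g, fun ζ => by
    rw [InnerProductSpace.toDual_symm_apply, hg]⟩

theorem separableSpace_surfacePair {M : Set R3} [IsFiniteMeasure (surfaceMeasure M)] :
    TopologicalSpace.SeparableSpace (SurfacePair M) := by
  have : Fact ((2 : ℝ≥0∞) ≠ ⊤) := ⟨by simp⟩
  have h1 : SecondCountableTopology (Lp ℝ 2 (surfaceMeasure M)) := inferInstance
  have h2 : SecondCountableTopology (Lp R3 2 (surfaceMeasure M)) := inferInstance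
  exact (WithLp.prodContinuousLinearEquiv 2 ℝ (Lp ℝ 2 (surfaceMeasure M))
    (Lp R3 2 (surfaceMeasure M))).symm.surjective.denseRange.separableSpace
    (ContinuousLinearEquiv.continuous _)

/-- The first component of a pair. -/
noncomputable def fstPair (M : Set R3) : SurfacePair M →L[ℝ] Lp ℝ 2 (surfaceMeasure M) :=
  (ContinuousLinearMap.fst ℝ _ _).comp (WithLp.prodContinuousLinearEquiv 2 ℝ
    (Lp ℝ 2 (surfaceMeasure M)) (Lp R3 2 (surfaceMeasure M))).toContinuousLinearMap

theorem fstPair_apply {M : Set R3} (z : SurfacePair M) : fstPair M z = z.fst := rfl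

theorem setIntegral_test_eq {a b : ℝ} (ha : 0 ≤ a) (hb : b ≤ S.T) {θ : ℝ → ℝ}
    (hθ : tsupport θ ⊆ Ioo a b) {h : ℝ × R3 → ℝ}
    (hi : Integrable (fun p => θ p.1 * h p) S.lagMeasure) {k : ℝ → ℝ}
    (hk : ∀ᵐ t ∂volume.restrict (Ioo 0 S.T), k t = ∫ y, h (t, y) ∂surfaceMeasure (S.Γ 0)) :
    ∫ t in Ioo a b, θ t * k t = ∫ p, θ p.1 * h p ∂S.lagMeasure := by
  rw [← setIntegral_eq_of_subset_of_forall_sdiff_eq_zero measurableSet_Ioo (Ioo_subset_Ioo ha hb)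
    (f := fun t => θ t * k t), lagMeasure, integral_prod _ hi]
  · refine integral_congr_ae ?_
    filter_upwards [hk] with t ht
    rw [ht]
    exact (integral_const_mul _ _).symm
  · intro t ht
    rw [image_eq_zero_of_notMem_tsupport fun hh => ht.2 (hθ hh), zero_mul]

/-- The Lagrangian form of `z` has one-sided limits, and they satisfy the energy identity. -/
theorem exists_lag_limits {a b : ℝ} (ha : 0 ≤ a) (hab : a < b) (hb : b ≤ S.T) {z : S.L2Pair}
    (hz : z ∈ S.HSlab a b) {ℓ : StrongDual ℝ (S.HSlab a b)} (hℓ : S.IsMaterialDeriv a b z ℓ) :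
    ∃ (u : ℝ → Lp ℝ 2 (surfaceMeasure (S.Γ 0))) (la lb : Lp ℝ 2 (surfaceMeasure (S.Γ 0))),
      (∀ᵐ t ∂volume.restrict (Ioo 0 S.T), u t =ᵐ[surfaceMeasure (S.Γ 0)] fun y => S.lagVal z (t, y)) ∧
      Tendsto u (𝓝[>] a ⊓ ae volume) (𝓝 la) ∧ Tendsto u (𝓝[<] b ⊓ ae volume) (𝓝 lb) ∧
      ‖lb‖ ^ 2 - ‖la‖ ^ 2 = 2 * ℓ ⟨z, hz⟩ + ∫ p, S.divw p * z.fst p * z.fst p ∂S.stMeasure := by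
  have hM := S.isSurface_zero
  have : Fact ((2 : ℝ≥0∞) ≠ ⊤) := ⟨by simp⟩
  have : IsFiniteMeasure (surfaceMeasure (S.Γ 0)) := S.isFiniteMeasure_surf_zero
  have := separableSpace_surfacePair (M := S.Γ 0)
  obtain ⟨r, hr⟩ := exists_inner_eq ℓ
  obtain ⟨U, hU⟩ := S.exists_pair_slices (S.memLp_lagVal z) (S.memLp_pulledGrad z)
  obtain ⟨R, hR⟩ := S.exists_pair_slices (S.memLp_pushedVal z r) (S.memLp_pushedGrad r)
  -- The time derivative is tested only with smooth functions, but the energy identity inserts U(s)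
  -- itself. Hence the slices have to lie in the closure of the smooth pairs.
  have hcl : ∀ᵐ t, t ∈ Ioo a b → U t ∈ (smoothPairs (S.Γ 0) (S.normal 0)).topologicalClosure := by
    rw [← ae_restrict_iff' measurableSet_Ioo]
    refine ae_restrict_of_ae_restrict_of_subset (Ioo_subset_Ioo ha hb) ?_
    filter_upwards [hU, ae_isWeakGrad_of_mem_H hz.1, ae_restrict_mem measurableSet_Ioo] with t h1 h2 ht
    refine mem_closure_smoothPairs hM fun p q hp hq horth => ?_
    refine Eq.trans (integral_congr_ae ?_)
      (integral_pull_eq_zero (Ioo_subset_Icc_self ht) h2 hp hq horth)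
    filter_upwards [h1.1, h1.2] with y e1 e2
    rw [e1, e2]
    rfl
  obtain ⟨la, lb, h1, h2, h3⟩ := exists_tendsto_and_energy_identity_of_weak hab (fstPair (S.Γ 0)) U R
    (smoothPairs (S.Γ 0) (S.normal 0)) hcl (by
    rintro F ⟨f, hf, hF1, hF2⟩ θ hθ hθc hθs
    have hcf : MemLp (fun p : ℝ × R3 => f p.2) 2 S.lagMeasure :=
      memLp_lagMeasure_of_continuous (hf.continuous.comp continuous_snd)
    have hcg : MemLp (fun p : ℝ × R3 => tanPart (S.normal 0 p.2) (gradient f p.2)) 2 S.lagMeasure := by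
      refine (memLp_lagMeasure_of_continuous (G := fun p : ℝ × R3 =>
        tanPart (S.normalExt p.2) (gradient f p.2)) (continuous_tanPart.comp
          ((S.contDiff_normalExt.continuous.comp continuous_snd).prodMk
            ((hf.of_le (by simp)).continuous_gradient.comp continuous_snd)))).ae_eq ?_
      filter_upwards [S.ae_lagMeasure_mem] with p hp
      rw [S.normalExt_eq hp.1]
    have hbd : ∀ {θ : ℝ → ℝ}, Continuous θ → HasCompactSupport θ → ∀ {h : ℝ × R3 → ℝ},
        Integrable h S.lagMeasure → Integrable (fun p => θ p.1 * h p) S.lagMeasure := by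
      intro θ hθ hθc h hh
      obtain ⟨C, hC⟩ := hθ.bounded_above_of_compact_support hθc
      exact hh.bdd_mul (hθ.comp continuous_fst).aestronglyMeasurable
        (Eventually.of_forall fun p => hC p.1)
    rw [setIntegral_test_eq ha hb ((tsupport_deriv_subset).trans hθs) (hbd (hθ.continuous_deriv (by simp)) hθc.deriv
        (memLp_mul_integrable hcf (S.memLp_lagVal z))),
      setIntegral_test_eq ha hb hθs (hbd hθ.continuous hθc ((memLp_mul_integrable
        (S.memLp_pushedVal z r) hcf).add (memLp_inner_integrable (S.memLp_pushedGrad r) hcg)))]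
    · exact integral_lag_test hℓ hr hf hθ hθc hθs
    · filter_upwards [hR] with t ht
      rw [inner_surfacePair]
      refine integral_congr_ae ?_
      filter_upwards [ht.1, ht.2, hF1, hF2] with y e1 e2 e3 e4
      rw [e1, e2, e3, e4]
      rfl
    · filter_upwards [hU] with t ht
      rw [L2.inner_def]
      refine integral_congr_ae ?_
      filter_upwards [ht.1, hF1] with y e1 e3
      rw [fstPair_apply, fstPair_apply, e1, e3]
      rfl)
  refine ⟨fun t => fstPair (S.Γ 0) (U t), la, lb, hU.mono fun t ht => ht.1, h1, h2, ?_⟩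
  rw [h3]
  have i1 : Integrable (fun p => r.fst p * z.fst p + inner ℝ (r.snd p) (z.snd p)) S.stMeasure :=
    (memLp_mul_integrable (Lp.memLp _) (Lp.memLp _)).add
      (memLp_inner_integrable (Lp.memLp _) (Lp.memLp _))
  have i2 : Integrable (fun p => S.divw p * z.fst p * z.fst p) S.stMeasure :=
    memLp_mul_integrable (S.memLp_divw_mul (Lp.memLp _)) (Lp.memLp _)
  set E : R3 × ℝ → ℝ := fun p => 2 * (r.fst p * z.fst p + inner ℝ (r.snd p) (z.snd p))
    + S.divw p * z.fst p * z.fst p with hE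
  have iE : Integrable E S.stMeasure := (i1.const_mul 2).add i2
  rw [hr]
  change _ = 2 * inner ℝ r z + _
  rw [inner_L2Pair, ← integral_const_mul, ← integral_add (i1.const_mul 2) i2]
  change _ = ∫ p, E p ∂S.stMeasure
  rw [(S.integral_stMeasure_eq_integral_surf iE).2]
  have hsub : ∀ᵐ t ∂volume.restrict (Ioo 0 S.T),
      2 * inner ℝ (R t) (U t) = ∫ x, E (x, t) ∂S.surf t := by
    filter_upwards [hU, hR, S.ae_aestronglyMeasurable_slice iE.1, ae_restrict_mem measurableSet_Ioo,
      ae_isWeakGrad_of_mem_H hz.1] with t h1 h2 h3 ht h4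
    have ht' := Ioo_subset_Icc_self ht
    rw [S.integral_surf ht' h3, inner_surfacePair, ← integral_const_mul]
    refine integral_congr_ae ?_
    filter_upwards [h1.1, h1.2, h2.1, h2.2, S.ae_mem_surf_zero, S.ae_surf_comp ht' h4.tangential]
      with y e1 e2 e3 e4 hy e5
    have hm : (y, t) ∈ S.track := ⟨hy, ht'⟩
    have hτ := S.inner_pushGrad_normal hy ht' (S.lagGrad r (t, y))
    -- The derivative of √J in the pulled back gradient produces a term that cancels the one with
    -- the derivative of 1 / √J in `pushedVal`.
    have hl : inner ℝ (S.pushedGrad r (t, y)) (S.pulledGrad z (t, y))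
        = S.sqrtJac (y, t) * (S.sqrtJac (y, t) * inner ℝ (r.snd (S.Φ (y, t), t)) (z.snd (S.Φ (y, t), t)))
          - S.sqrtJac (y, t) * z.fst (S.Φ (y, t), t) * S.invSqrtJac (y, t)
            * (S.jac (y, t) * S.dInvSqrtJac (y, t) (S.pushGrad (y, t) (S.lagGrad r (t, y)))) := by
      rw [real_inner_comm, pulledGrad, inner_add_left, inner_pullGrad, inner_pullVal]
      change inner ℝ (S.sqrtJac (y, t) • z.snd (S.Φ (y, t), t)) (S.dΦ y t (tanPart (S.normalExt y)
          (S.pushGrad (y, t) (S.lagGrad r (t, y))))) + S.sqrtJac (y, t) * z.fst (S.Φ (y, t), t)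
          * S.invSqrtJac (y, t) * S.dSqrtJac (y, t) (tanPart (S.normalExt y)
          (S.pushGrad (y, t) (S.lagGrad r (t, y)))) = _
      rw [S.normalExt_eq hy, tanPart_of_tangent hτ, S.dΦ_pushGrad hy ht', S.dSqrtJac_tangent hy ht' hτ,
        S.tproj_eq_tanPart hy ht', ← inner_tanPart_left,
        tanPart_of_tangent (by rw [real_inner_smul_left, e5, mul_zero]), lagGrad, real_inner_smul_left,
        real_inner_smul_right, real_inner_comm]
      simp only [lag, Prod.swap]
      ring
    have e := S.sqrtJac_mul_invSqrtJac hm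
    rw [e1, e2, e3, e4, hl]
    simp only [pushedVal, lagVal, lag, flow, Prod.swap, _root_.smul_apply, ContinuousLinearMap.comp_apply,
      ContinuousLinearMap.id_apply, smul_eq_mul, hE, ← S.sqrtJac_sq hm]
    linear_combination -2 * S.sqrtJac (y, t) ^ 2 * z.fst (S.Φ (y, t), t)
      * S.dInvSqrtJac (y, t) (S.pushGrad (y, t) (S.lagGrad r (t, y))) * e
  rw [← integral_congr_ae hsub]
  -- Outside the slab the integrand vanishes. The single time b, which lies in (a, b] but not in (a,
  -- b), is negligible.
  refine (setIntegral_eq_of_subset_of_ae_sdiff_eq_zero measurableSet_Ioo.nullMeasurableSet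
    (Ioo_subset_Ioo ha hb) ?_).symm
  filter_upwards [(ae_restrict_iff' measurableSet_Ioo).1 hsub,
    (ae_restrict_iff' measurableSet_Ioo).1 (ae_slice_eq_zero hz), Measure.ae_ne volume b] with t h1 h2 h3 ht
  obtain ⟨e1, e2⟩ := h2 ht.1 fun hh => ht.2 ⟨hh.1, lt_of_le_of_ne hh.2 h3⟩
  rw [h1 ht.1]
  refine integral_eq_zero_of_ae ?_
  filter_upwards [e1, e2] with x e1 e2
  simp only [hE]
  rw [e1, e2]
  simp

end EvolvingSurface

/-! ### Traces on Γ(t) -/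

theorem enorm_sq_eq_ofReal (x : ℝ) : ‖x‖ₑ ^ 2 = ENNReal.ofReal (x ^ 2) := by
  rw [Real.enorm_eq_ofReal_abs, ← ENNReal.ofReal_pow (abs_nonneg x), sq_abs]

theorem lintegral_enorm_sq_eq {X : Type*} [MeasurableSpace X] {μ : Measure X} (f : Lp ℝ 2 μ) :
    ∫⁻ x, ‖f x‖ₑ ^ 2 ∂μ = ‖f‖ₑ ^ 2 := by
  rw [Lp.enorm_def, eLpNorm_two_eq, ← ENNReal.rpow_natCast, ← ENNReal.rpow_mul]
  simp

theorem norm_sq_eq_integral {X : Type*} [MeasurableSpace X] {μ : Measure X} (f : Lp ℝ 2 μ) :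
    ‖f‖ ^ 2 = ∫ x, f x ^ 2 ∂μ := by
  rw [← real_inner_self_eq_norm_sq, L2.inner_def]
  refine integral_congr_ae (Eventually.of_forall fun x => ?_)
  simp only [RCLike.inner_apply, conj_trivial]
  ring

namespace EvolvingSurface

variable {S : EvolvingSurface}

/-- The function on `Γ(s)` with a given Lagrangian form. -/
theorem exists_of_lag {s : ℝ} (hs : s ∈ Icc 0 S.T) (l : Lp ℝ 2 (surfaceMeasure (S.Γ 0))) :
    ∃ ψ : Lp ℝ 2 (S.surf s), ‖ψ‖ = ‖l‖ ∧
      ∀ᵐ y ∂S.surf 0, ψ (S.Φ (y, s)) = S.invSqrtJac (y, s) * l y := by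
  have h : MemLp (fun y => S.invSqrtJac (y, s) * l y) 2 (S.surf 0) := by
    change MemLp _ 2 (surfaceMeasure (S.Γ 0))
    have := S.isSurface_zero.memLp_clm_apply (B := fun y => S.invSqrtJac (y, s) •
      ContinuousLinearMap.id ℝ ℝ) ((S.contDiff_invSqrtJac.continuous.comp
        (Continuous.prodMk_left s)).smul continuous_const) (Lp.memLp l)
    simpa using this
  have h2 := memLp_surf_back hs h
  have h3 : ∀ᵐ y ∂S.surf 0, h2.toLp _ (S.Φ (y, s)) = S.invSqrtJac (y, s) * l y := by
    filter_upwards [S.ae_surf_comp hs h2.coeFn_toLp, S.ae_mem_surf_zero] with y e1 hy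
    rw [e1, S.back_Φ hy hs]
  refine ⟨h2.toLp, ?_, h3⟩
  rw [← sq_eq_sq₀ (norm_nonneg _) (norm_nonneg _), norm_sq_eq_integral, norm_sq_eq_integral,
    S.integral_surf hs (f := fun x => h2.toLp _ x ^ 2) ((Lp.aestronglyMeasurable _).pow 2)]
  refine integral_congr_ae ?_
  filter_upwards [h3, S.ae_mem_surf_zero] with y e1 hy
  have e := S.sqrtJac_mul_invSqrtJac (⟨hy, hs⟩ : (y, s) ∈ S.track)
  rw [e1, ← S.sqrtJac_sq ⟨hy, hs⟩]
  linear_combination (S.sqrtJac (y, s) * S.invSqrtJac (y, s) + 1) * l y ^ 2 * e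

theorem exists_lipschitz_invSqrtJac : ∃ K : ℝ, ∀ y ∈ S.Γ 0, ∀ s ∈ Icc 0 S.T, ∀ t ∈ Icc 0 S.T,
    |S.invSqrtJac (y, t) - S.invSqrtJac (y, s)| ≤ K * |t - s| := by
  obtain ⟨K, hK⟩ := S.isCompact_track.exists_bound_of_continuousOn
    (f := fun q => fderiv ℝ S.invSqrtJac q (0, 1))
    ((S.contDiff_invSqrtJac.continuous_fderiv (by simp)).clm_apply continuous_const).continuousOn
  refine ⟨K, fun y hy s hs t ht => ?_⟩
  have hd : ∀ x, HasDerivAt (fun x => S.invSqrtJac (y, x)) (fderiv ℝ S.invSqrtJac (y, x) (0, 1)) x :=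
    fun x => HasFDerivAt.comp_hasDerivAt (f := fun x => (y, x)) x
      (S.contDiff_invSqrtJac.differentiable (by simp) (y, x)).hasFDerivAt
      ((hasDerivAt_const x y).prodMk (hasDerivAt_id x))
  exact (convex_Icc 0 S.T).norm_image_sub_le_of_norm_hasDerivWithin_le
    (fun x _ => (hd x).hasDerivWithinAt) (fun x hx => hK (y, x) ⟨hy, hx⟩) hs ht

/-- With m = 1 / √J, the difference of the pulled back functions is m(t) (u(t) - l) + (m(t) - m(s))
l. The first part is small by convergence, the second by Lipschitz continuity of m in time. -/
theorem isTrace_of_tendsto {F : Filter ℝ} {s : ℝ} (hs : s ∈ Icc 0 S.T) (hF : F ≤ 𝓝 s)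
    (hF' : Ioo 0 S.T ∈ F) {z : S.L2Pair} {u : ℝ → Lp ℝ 2 (surfaceMeasure (S.Γ 0))}
    {l : Lp ℝ 2 (surfaceMeasure (S.Γ 0))}
    (hu : ∀ᵐ t ∂volume.restrict (Ioo 0 S.T),
      u t =ᵐ[surfaceMeasure (S.Γ 0)] fun y => S.lagVal z (t, y))
    (h : Tendsto u (F ⊓ ae volume) (𝓝 l)) {ψ : Lp ℝ 2 (S.surf s)}
    (hψ : ∀ᵐ y ∂S.surf 0, ψ (S.Φ (y, s)) = S.invSqrtJac (y, s) * l y) : S.IsTrace F s z ψ := by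
  obtain ⟨K, hK⟩ := exists_lipschitz_invSqrtJac (S := S)
  obtain ⟨C, hC⟩ := S.isCompact_track.exists_bound_of_continuousOn
    S.contDiff_invSqrtJac.continuous.continuousOn
  have lim : Tendsto (fun t => ENNReal.ofReal (2 * C ^ 2) * ‖u t - l‖ₑ ^ 2
      + ENNReal.ofReal (2 * K ^ 2 * (t - s) ^ 2) * ‖l‖ₑ ^ 2) (F ⊓ ae volume) (𝓝 0) := by
    have l1 : Tendsto (fun t => ‖u t - l‖ₑ ^ 2) (F ⊓ ae volume) (𝓝 0) := by
      have h1 : Tendsto (fun t => ‖u t - l‖ₑ) (F ⊓ ae volume) (𝓝 0) := by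
        have := (h.sub_const l).enorm
        simpa using this
      have := ENNReal.Tendsto.pow (n := 2) h1
      simpa using this
    have l2 : Tendsto (fun t => ENNReal.ofReal (2 * K ^ 2 * (t - s) ^ 2)) (F ⊓ ae volume) (𝓝 0) := by
      have hc : Continuous fun t : ℝ => ENNReal.ofReal (2 * K ^ 2 * (t - s) ^ 2) :=
        ENNReal.continuous_ofReal.comp (by fun_prop)
      have := (hc.tendsto s).mono_left (inf_le_left.trans hF : F ⊓ ae volume ≤ 𝓝 s)
      simpa using this
    have l3 := (ENNReal.Tendsto.const_mul l1 (Or.inr ENNReal.ofReal_ne_top) (a := ENNReal.ofReal (2 * C ^ 2))).add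
      (ENNReal.Tendsto.mul_const l2 (Or.inr (ENNReal.pow_ne_top (n := 2) (enorm_ne_top (x := l)))))
    simpa using l3
  refine tendsto_of_tendsto_of_tendsto_of_le_of_le' tendsto_const_nhds lim
    (Eventually.of_forall fun _ => zero_le) ?_
  have hev : ∀ᶠ t in F ⊓ ae volume, t ∈ Ioo 0 S.T := mem_inf_of_left hF'
  have hev2 : ∀ᶠ t in F ⊓ ae volume, t ∈ Ioo 0 S.T →
      u t =ᵐ[surfaceMeasure (S.Γ 0)] fun y => S.lagVal z (t, y) :=
    mem_inf_of_right ((ae_restrict_iff' measurableSet_Ioo).1 hu)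
  filter_upwards [hev, hev2] with t ht hut
  have ht' := Ioo_subset_Icc_self ht
  rw [← lintegral_enorm_sq_eq, ← lintegral_enorm_sq_eq, ← lintegral_const_mul' _ _ ENNReal.ofReal_ne_top,
    ← lintegral_const_mul' _ _ ENNReal.ofReal_ne_top, ← lintegral_add_left']
  · refine lintegral_mono_ae ?_
    filter_upwards [hut ht, hψ, Lp.coeFn_sub (u t) l, S.ae_mem_surf_zero] with y e1 e2 e3 hy
    have hm : (y, t) ∈ S.track := ⟨hy, ht'⟩
    have e := S.sqrtJac_mul_invSqrtJac hm
    have e4 : z.fst (S.Φ (y, t), t) = S.invSqrtJac (y, t) * u t y := by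
      rw [e1]
      simp only [lagVal, lag, Prod.swap]
      linear_combination - z.fst (S.Φ (y, t), t) * e
    have b1 : S.invSqrtJac (y, t) ^ 2 ≤ C ^ 2 := by
      rw [← sq_abs]
      exact pow_le_pow_left₀ (abs_nonneg _) (hC _ hm) 2
    have b2 : (S.invSqrtJac (y, t) - S.invSqrtJac (y, s)) ^ 2 ≤ K ^ 2 * (t - s) ^ 2 := by
      rw [← sq_abs, ← sq_abs (t - s), ← mul_pow]
      exact pow_le_pow_left₀ (abs_nonneg _) (hK y hy s hs t ht') 2
    rw [e2, e3, Pi.sub_apply, e4]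
    simp only [enorm_sq_eq_ofReal]
    rw [← ENNReal.ofReal_mul (by positivity), ← ENNReal.ofReal_mul (by positivity),
      ← ENNReal.ofReal_add (by positivity) (by positivity)]
    refine ENNReal.ofReal_le_ofReal ?_
    have b3 := mul_le_mul_of_nonneg_right b1 (sq_nonneg (u t y - l y))
    have b4 := mul_le_mul_of_nonneg_right b2 (sq_nonneg (l y))
    nlinarith [sq_nonneg (S.invSqrtJac (y, t) * (u t y - l y)
      - (S.invSqrtJac (y, t) - S.invSqrtJac (y, s)) * l y)]
  · exact (((Lp.aestronglyMeasurable (u t - l)).enorm).pow_const 2).const_mul _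

theorem ae_surf_of_comp {t : ℝ} (ht : t ∈ Icc 0 S.T) {Q : R3 → Prop} (hQ : MeasurableSet {x | Q x})
    (h : ∀ᵐ y ∂S.surf 0, Q (S.Φ (y, t))) : ∀ᵐ x ∂S.surf t, Q x := by
  rw [S.surf_eq_map ht, ae_map_iff (S.measurable_Φ_slice t).aemeasurable hQ]
  exact (withDensity_absolutelyContinuous _ _).ae_le h

theorem IsTrace.unique {F : Filter ℝ} [(F ⊓ ae (volume : Measure ℝ)).NeBot] {s : ℝ}
    (hs : s ∈ Icc 0 S.T) {z : S.L2Pair} {ψ ψ' : Lp ℝ 2 (S.surf s)} (h : S.IsTrace F s z ψ)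
    (h' : S.IsTrace F s z ψ') : ψ = ψ' := by
  have hz : StronglyMeasurable (z.fst : R3 × ℝ → ℝ) := Lp.stronglyMeasurable _
  have m1 : ∀ t, Measurable fun y => z.fst (S.Φ (y, t), t) := fun t =>
    hz.measurable.comp ((S.measurable_Φ_slice t).prodMk measurable_const)
  have m2 : ∀ ψ : Lp ℝ 2 (S.surf s), Measurable fun y => ψ (S.Φ (y, s)) := fun ψ =>
    (Lp.stronglyMeasurable ψ).measurable.comp (S.measurable_Φ_slice s)
  have key : ∫⁻ y, ‖ψ (S.Φ (y, s)) - ψ' (S.Φ (y, s))‖ₑ ^ 2 ∂S.surf 0 ≤ 0 := by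
    have l3 := (ENNReal.Tendsto.const_mul h (Or.inr ENNReal.ofReal_ne_top) (a := ENNReal.ofReal 2)).add
      (ENNReal.Tendsto.const_mul h' (Or.inr ENNReal.ofReal_ne_top) (a := ENNReal.ofReal 2))
    rw [mul_zero, add_zero] at l3
    refine ge_of_tendsto l3 (Eventually.of_forall fun t => ?_)
    rw [← lintegral_const_mul' _ _ ENNReal.ofReal_ne_top,
      ← lintegral_const_mul' _ _ ENNReal.ofReal_ne_top, ← lintegral_add_left]
    · refine lintegral_mono fun y => ?_
      simp only [enorm_sq_eq_ofReal]
      rw [← ENNReal.ofReal_mul (by positivity), ← ENNReal.ofReal_mul (by positivity),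
        ← ENNReal.ofReal_add (by positivity) (by positivity)]
      refine ENNReal.ofReal_le_ofReal ?_
      nlinarith [sq_nonneg (z.fst (S.Φ (y, t), t) - ψ (S.Φ (y, s)) + (z.fst (S.Φ (y, t), t)
        - ψ' (S.Φ (y, s))))]
    · exact ((((m1 t).sub (m2 ψ)).enorm).pow_const 2).const_mul _
  have h0 := (lintegral_eq_zero_iff ((((m2 ψ).sub (m2 ψ')).enorm).pow_const 2)).1 (le_zero_iff.1 key)
  refine Lp.ext (ae_surf_of_comp hs (measurableSet_eq_fun (Lp.stronglyMeasurable ψ).measurable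
    (Lp.stronglyMeasurable ψ').measurable) ?_)
  filter_upwards [h0] with y hy
  simpa [sub_eq_zero] using hy

end EvolvingSurface

/-! ### Calculus of traces and slices -/

namespace EvolvingSurface

variable {S : EvolvingSurface}

theorem IsTrace.trace_eq {F : Filter ℝ} [(F ⊓ ae (volume : Measure ℝ)).NeBot] {s : ℝ}
    (hs : s ∈ Icc 0 S.T) {z : S.L2Pair} {ψ : Lp ℝ 2 (S.surf s)} (h : S.IsTrace F s z ψ) :
    S.trace F s z = ψ := by
  have hex : ∃ ψ, S.IsTrace F s z ψ := ⟨ψ, h⟩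
  rw [trace, dif_pos hex]
  exact hex.choose_spec.unique hs h

/-- A one-sided limit depends only on times on its side, so the limits of a sum over slabs can be
computed from one summand. -/
theorem IsTrace.congr {F : Filter ℝ} {s c d : ℝ} (hc : 0 ≤ c) (hd : d ≤ S.T) (hF : Ioo c d ∈ F)
    {z z' : S.L2Pair} (hz : ∀ᵐ t ∂volume.restrict (Ioo 0 S.T), t ∈ Ioo c d →
      (fun x => z.fst (x, t)) =ᵐ[S.surf t] fun x => z'.fst (x, t))
    {ψ : Lp ℝ 2 (S.surf s)} (h : S.IsTrace F s z ψ) : S.IsTrace F s z' ψ := by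
  refine Tendsto.congr' ?_ h
  have h1 : ∀ᶠ t in F ⊓ ae volume, t ∈ Ioo c d := mem_inf_of_left hF
  have h2 := mem_inf_of_right (f := F) ((ae_restrict_iff' measurableSet_Ioo).1 hz)
  filter_upwards [h1, h2] with t ht h3
  have ht' : t ∈ Ioo 0 S.T := Ioo_subset_Ioo hc hd ht
  refine lintegral_congr_ae ?_
  filter_upwards [S.ae_surf_comp (Ioo_subset_Icc_self ht') (h3 ht' ht)] with y hy
  simp only [hy]

theorem ae_slice_smul (c : ℝ) (z : S.L2Pair) : ∀ᵐ t ∂volume.restrict (Ioo 0 S.T),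
    (fun x => (c • z).fst (x, t)) =ᵐ[S.surf t] (fun x => c * z.fst (x, t)) ∧
    (fun x => (c • z).snd (x, t)) =ᵐ[S.surf t] (fun x => c • z.snd (x, t)) := by
  filter_upwards [S.ae_slice (Lp.coeFn_smul c z.fst), S.ae_slice (Lp.coeFn_smul c z.snd)] with t h1 h2
  exact ⟨h1, h2⟩

theorem ae_slice_add (z z' : S.L2Pair) : ∀ᵐ t ∂volume.restrict (Ioo 0 S.T),
    (fun x => (z + z').fst (x, t)) =ᵐ[S.surf t] (fun x => z.fst (x, t) + z'.fst (x, t)) ∧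
    (fun x => (z + z').snd (x, t)) =ᵐ[S.surf t] (fun x => z.snd (x, t) + z'.snd (x, t)) := by
  filter_upwards [S.ae_slice (Lp.coeFn_add z.fst z'.fst), S.ae_slice (Lp.coeFn_add z.snd z'.snd)]
    with t h1 h2
  exact ⟨h1, h2⟩

theorem ae_slice_sum {ι : Type*} [DecidableEq ι] (s : Finset ι) (z : ι → S.L2Pair) :
    ∀ᵐ t ∂volume.restrict (Ioo 0 S.T),
    (fun x => (∑ i ∈ s, z i).fst (x, t)) =ᵐ[S.surf t] (fun x => ∑ i ∈ s, (z i).fst (x, t)) ∧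
    (fun x => (∑ i ∈ s, z i).snd (x, t)) =ᵐ[S.surf t] (fun x => ∑ i ∈ s, (z i).snd (x, t)) := by
  induction s using Finset.induction_on with
  | empty =>
    filter_upwards [S.ae_slice (Lp.coeFn_zero ℝ 2 S.stMeasure),
      S.ae_slice (Lp.coeFn_zero R3 2 S.stMeasure)] with t h1 h2
    exact ⟨h1, h2⟩
  | insert i s hi ih =>
    filter_upwards [ih, ae_slice_add (z i) (∑ i ∈ s, z i)] with t h1 h2
    simp only [Finset.sum_insert hi]
    refine ⟨h2.1.trans ?_, h2.2.trans ?_⟩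
    · filter_upwards [h1.1] with x hx
      rw [hx]
    · filter_upwards [h1.2] with x hx
      rw [hx]

theorem IsTrace.const_smul {F : Filter ℝ} {s : ℝ} (hs : s ∈ Icc 0 S.T) (hF : Ioo 0 S.T ∈ F)
    {z : S.L2Pair} {ψ : Lp ℝ 2 (S.surf s)} (h : S.IsTrace F s z ψ) (c : ℝ) :
    S.IsTrace F s (c • z) (c • ψ) := by
  have h1 : Tendsto (fun t => ENNReal.ofReal (c ^ 2) * ∫⁻ y,
      ‖z.fst (S.Φ (y, t), t) - ψ (S.Φ (y, s))‖ₑ ^ 2 ∂S.surf 0) (F ⊓ ae volume) (𝓝 0) := by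
    have := ENNReal.Tendsto.const_mul h (Or.inr ENNReal.ofReal_ne_top) (a := ENNReal.ofReal (c ^ 2))
    rwa [mul_zero] at this
  refine Tendsto.congr' ?_ h1
  have h2 : ∀ᶠ t in F ⊓ ae volume, t ∈ Ioo 0 S.T := mem_inf_of_left hF
  have h3 := mem_inf_of_right (f := F) ((ae_restrict_iff' measurableSet_Ioo).1 (ae_slice_smul c z))
  filter_upwards [h2, h3] with t ht h4
  rw [← lintegral_const_mul' _ _ ENNReal.ofReal_ne_top]
  refine lintegral_congr_ae ?_
  filter_upwards [S.ae_surf_comp (Ioo_subset_Icc_self ht) (h4 ht).1,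
    S.ae_surf_comp hs (Lp.coeFn_smul c ψ)] with y e1 e2
  rw [e1, e2]
  simp only [enorm_sq_eq_ofReal, Pi.smul_apply, smul_eq_mul]
  rw [← ENNReal.ofReal_mul (sq_nonneg c)]
  ring_nf

/-- Elements of `WSlab a b` have one-sided limits, and they satisfy the energy identity. -/
theorem exists_isTrace {a b : ℝ} (ha : 0 ≤ a) (hab : a < b) (hb : b ≤ S.T) (z : S.WSlab a b) :
    ∃ (ψa : Lp ℝ 2 (S.surf a)) (ψb : Lp ℝ 2 (S.surf b)), S.IsTrace (𝓝[>] a) a z ψa ∧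
      S.IsTrace (𝓝[<] b) b z ψb ∧
      ‖ψb‖ ^ 2 - ‖ψa‖ ^ 2 = 2 * S.materialDeriv z ⟨z, z.2.1⟩
        + ∫ p, S.divw p * z.1.fst p * z.1.fst p ∂S.stMeasure := by
  obtain ⟨u, la, lb, hu, h1, h2, h3⟩ := exists_lag_limits ha hab hb z.2.1 (Classical.choose_spec z.2.2)
  have hamem : a ∈ Icc 0 S.T := ⟨ha, hab.le.trans hb⟩
  have hbmem : b ∈ Icc 0 S.T := ⟨ha.trans hab.le, hb⟩
  obtain ⟨ψa, na, ea⟩ := exists_of_lag hamem la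
  obtain ⟨ψb, nb, eb⟩ := exists_of_lag hbmem lb
  refine ⟨ψa, ψb, isTrace_of_tendsto hamem nhdsWithin_le_nhds ?_ hu h1 ea,
    isTrace_of_tendsto hbmem nhdsWithin_le_nhds ?_ hu h2 eb, ?_⟩
  · exact mem_of_superset (Ioo_mem_nhdsGT hab) (Ioo_subset_Ioo ha hb)
  · exact mem_of_superset (Ioo_mem_nhdsLT hab) (Ioo_subset_Ioo ha hb)
  · rw [na, nb, h3]
    rfl

end EvolvingSurface

/-! ### The time partition and slabwise multiples -/

namespace SpaceTimeMesh

variable {S : EvolvingSurface} (D : SpaceTimeMesh S)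

theorem N_cast_pos : 0 < (D.N : ℝ) := Nat.cast_pos.2 D.N_pos

theorem step_pos : 0 < S.T / D.N := div_pos S.T_pos D.N_cast_pos

theorem time_lt (n : ℕ) : D.time n < D.time (n + 1) := by
  rw [time, time, Nat.cast_succ]
  exact mul_lt_mul_of_pos_right (lt_add_one _) D.step_pos

theorem time_mono : Monotone D.time := monotone_nat_of_le_succ fun n => (D.time_lt n).le

theorem time_zero : D.time 0 = 0 := by simp [time]

theorem time_N : D.time D.N = S.T := by
  rw [time]
  have := D.N_cast_pos.ne'
  field_simp

theorem time_nonneg (n : ℕ) : 0 ≤ D.time n := D.time_zero ▸ D.time_mono (Nat.zero_le n)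

theorem time_le {n : ℕ} (hn : n ≤ D.N) : D.time n ≤ S.T := D.time_N ▸ D.time_mono hn

theorem time_mem {n : ℕ} (hn : n ≤ D.N) : D.time n ∈ Icc 0 S.T := ⟨D.time_nonneg n, D.time_le hn⟩

theorem exists_slab {t : ℝ} (ht : t ∈ Ioo 0 S.T) :
    ∃ n : Fin D.N, t ∈ Ioc (D.time n) (D.time (n + 1)) := by
  classical
  have hex : ∃ n, t ≤ D.time n := ⟨D.N, D.time_N ▸ ht.2.le⟩
  set k := Nat.find hex
  have hk : t ≤ D.time k := Nat.find_spec hex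
  have hk0 : k ≠ 0 := fun h => by
    rw [h, time_zero] at hk
    exact absurd ht.1 (not_lt.2 hk)
  obtain ⟨n, hn⟩ := Nat.exists_eq_succ_of_ne_zero hk0
  have hkN : k ≤ D.N := Nat.find_min' hex (D.time_N ▸ ht.2.le)
  refine ⟨⟨n, by omega⟩, lt_of_not_ge fun h => ?_, by rw [hn] at hk; exact hk⟩
  have := Nat.find_min' hex h
  change k ≤ n at this
  omega

theorem eq_of_mem_slab {t : ℝ} {n m : ℕ} (hn : t ∈ Ioc (D.time n) (D.time (n + 1)))
    (hm : t ∈ Ioc (D.time m) (D.time (m + 1))) : n = m := by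
  by_contra h
  rcases lt_or_gt_of_ne h with h | h
  · exact absurd (hn.2.trans (D.time_mono h)) (not_le.2 hm.1)
  · exact absurd (hm.2.trans (D.time_mono h)) (not_le.2 hn.1)

variable {D}

theorem ae_slice_toH (u : D.Wb) : ∀ᵐ t ∂volume.restrict (Ioo 0 S.T), ∀ n : Fin D.N,
    t ∈ Ioc (D.time n) (D.time (n + 1)) →
      (fun x => (toH u).fst (x, t)) =ᵐ[S.surf t] (fun x => (u n : S.L2Pair).fst (x, t)) ∧
      (fun x => (toH u).snd (x, t)) =ᵐ[S.surf t] (fun x => (u n : S.L2Pair).snd (x, t)) ∧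
      ∀ m ≠ n, (fun x => (u m : S.L2Pair).fst (x, t)) =ᵐ[S.surf t] 0 ∧
        (fun x => (u m : S.L2Pair).snd (x, t)) =ᵐ[S.surf t] 0 := by
  have h1 : ∀ᵐ t ∂volume.restrict (Ioo 0 S.T), ∀ m : Fin D.N,
      t ∉ Ioc (D.time m) (D.time (m + 1)) →
        (fun x => (u m : S.L2Pair).fst (x, t)) =ᵐ[S.surf t] 0 ∧
        (fun x => (u m : S.L2Pair).snd (x, t)) =ᵐ[S.surf t] 0 :=
    ae_all_iff.2 fun m => EvolvingSurface.ae_slice_eq_zero (u m).2.1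
  filter_upwards [h1, EvolvingSurface.ae_slice_sum Finset.univ fun n => (u n : S.L2Pair)]
    with t h1 h2 n hn
  have h3 : ∀ m ≠ n, (fun x => (u m : S.L2Pair).fst (x, t)) =ᵐ[S.surf t] 0 ∧
      (fun x => (u m : S.L2Pair).snd (x, t)) =ᵐ[S.surf t] 0 := fun m hmn =>
    h1 m fun hm => hmn (Fin.ext (D.eq_of_mem_slab hm hn))
  have h4 : ∀ᵐ x ∂S.surf t, ∀ m ≠ n,
      (u m : S.L2Pair).fst (x, t) = 0 ∧ (u m : S.L2Pair).snd (x, t) = 0 := by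
    refine ae_all_iff.2 fun m => ?_
    by_cases hmn : m = n
    · exact Eventually.of_forall fun x h => absurd hmn h
    · filter_upwards [(h3 m hmn).1, (h3 m hmn).2] with x e1 e2 _ using ⟨e1, e2⟩
  refine ⟨h2.1.trans ?_, h2.2.trans ?_, h3⟩
  · filter_upwards [h4] with x hx
    exact Finset.sum_eq_single n (fun m _ hm => (hx m hm).1) (by simp)
  · filter_upwards [h4] with x hx
    exact Finset.sum_eq_single n (fun m _ hm => (hx m hm).2) (by simp)

/-- Inside a slab only its own component of the sum is nonzero. The limits of the whole function at
both ends of the slab are therefore those of the component, for which the energy identity holds. -/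
theorem slab_traces (u : D.Wb) (n : Fin D.N) :
    S.IsTrace (𝓝[>] D.time n) (D.time n) (u n) (uPlus u n) ∧
    S.IsTrace (𝓝[<] D.time (n + 1)) (D.time (n + 1)) (u n) (uMinus u (n + 1)) ∧
    ‖uMinus u (n + 1)‖ ^ 2 - ‖uPlus u n‖ ^ 2 = 2 * S.materialDeriv (u n) ⟨u n, (u n).2.1⟩
      + ∫ p, S.divw p * (u n : S.L2Pair).fst p * (u n : S.L2Pair).fst p ∂S.stMeasure := by
  have hlt := D.time_lt n
  have h0 := D.time_nonneg n
  have hT := D.time_le (n := n + 1) n.2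
  have m1 := D.time_mem n.2.le
  have m2 := D.time_mem (n := n + 1) n.2
  obtain ⟨ψa, ψb, h1, h2, h3⟩ := EvolvingSurface.exists_isTrace h0 hlt hT (u n)
  have hsl : ∀ᵐ t ∂volume.restrict (Ioo 0 S.T), t ∈ Ioo (D.time n) (D.time (n + 1)) →
      (fun x => (u n : S.L2Pair).fst (x, t)) =ᵐ[S.surf t] fun x => (toH u).fst (x, t) := by
    filter_upwards [ae_slice_toH u] with t ht h
    exact (ht n (Ioo_subset_Ioc_self h)).1.symm
  have := neBot_nhdsGT_inf_ae (D.time n)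
  have := neBot_nhdsLT_inf_ae (D.time (n + 1))
  have e1 : uPlus u n = ψa := (h1.congr h0 hT (Ioo_mem_nhdsGT hlt) hsl).trace_eq m1
  have e2 : uMinus u (n + 1) = ψb := (h2.congr h0 hT (Ioo_mem_nhdsLT hlt) hsl).trace_eq m2
  rw [e1, e2]
  exact ⟨h1, h2, h3⟩

/-- Multiplication by a factor that depends on the slab. -/
noncomputable def scale (c : ℕ → ℝ) (u : D.Wb) : D.Wb := fun n => c n • u n

theorem uPlus_scale (c : ℕ → ℝ) (u : D.Wb) (n : Fin D.N) :
    uPlus (scale c u) n = c n • uPlus u n := by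
  have hlt := D.time_lt n
  have m1 := D.time_mem n.2.le
  have := neBot_nhdsGT_inf_ae (D.time n)
  refine (slab_traces (scale c u) n).1.unique m1 ((slab_traces u n).1.const_smul m1 ?_ (c n))
  exact mem_of_superset (Ioo_mem_nhdsGT hlt)
    (Ioo_subset_Ioo (D.time_nonneg n) (D.time_le (n := n + 1) n.2))

theorem uMinus_scale (c : ℕ → ℝ) (u : D.Wb) (n : Fin D.N) :
    uMinus (scale c u) (n + 1) = c n • uMinus u (n + 1) := by
  have hlt := D.time_lt n
  have m2 := D.time_mem (n := n + 1) n.2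
  have := neBot_nhdsLT_inf_ae (D.time (n + 1))
  refine (slab_traces (scale c u) n).2.1.unique m2 ((slab_traces u n).2.1.const_smul m2 ?_ (c n))
  exact mem_of_superset (Ioo_mem_nhdsLT hlt)
    (Ioo_subset_Ioo (D.time_nonneg n) (D.time_le (n := n + 1) n.2))

theorem derivPairing_scale (c : ℕ → ℝ) (u : D.Wb) : derivPairing u (scale c u)
    = ∑ n : Fin D.N, c n * S.materialDeriv (u n) ⟨u n, (u n).2.1⟩ := by
  refine Finset.sum_congr rfl fun n _ => ?_
  rw [← smul_eq_mul, ← map_smul]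
  rfl

end SpaceTimeMesh

/-! ### Integration over time slices and coercivity of a_σ -/

theorem integral_sub_mean_sq {X : Type*} [MeasurableSpace X] {μ : Measure X} [IsFiniteMeasure μ]
    {v : X → ℝ} (hv : MemLp v 2 μ) :
    ∫ x, (v x - (μ.real univ)⁻¹ * ∫ y, v y ∂μ) ^ 2 ∂μ
      = ∫ x, v x ^ 2 ∂μ - (μ.real univ)⁻¹ * (∫ x, v x ∂μ) ^ 2 := by
  set c := (μ.real univ)⁻¹ * ∫ y, v y ∂μ with hc
  have i1 : Integrable v μ := hv.integrable (by norm_num)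
  have i2 : Integrable (fun x => v x ^ 2) μ := hv.integrable_sq
  have e : ∀ x, (v x - c) ^ 2 = v x ^ 2 + ((-2 * c) * v x + c ^ 2) := fun x => by ring
  simp only [e]
  rw [integral_add_add i2 (i1.const_mul _) (integrable_const _), integral_const_mul, integral_const,
    smul_eq_mul, hc]
  -- For zero total mass both terms with the mean value vanish, since 0⁻¹ = 0.
  by_cases h : μ.real univ = 0
  · simp [h]
  · field_simp
    ring

theorem sq_integral_le {X : Type*} [MeasurableSpace X] {μ : Measure X} [IsFiniteMeasure μ]
    {v : X → ℝ} (hv : MemLp v 2 μ) : (∫ x, v x ∂μ) ^ 2 ≤ μ.real univ * ∫ x, v x ^ 2 ∂μ := by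
  by_cases h : μ.real univ = 0
  · have : μ = 0 := by
      rwa [measureReal_def, ENNReal.toReal_eq_zero_iff, or_iff_left (measure_ne_top _ _),
        Measure.measure_univ_eq_zero] at h
    simp [this]
  · have h1 := integral_sub_mean_sq hv
    have h2 : 0 ≤ ∫ x, (v x - (μ.real univ)⁻¹ * ∫ y, v y ∂μ) ^ 2 ∂μ :=
      integral_nonneg fun x => sq_nonneg _
    have h3 : 0 < μ.real univ := lt_of_le_of_ne measureReal_nonneg (Ne.symm h)
    rw [h1, sub_nonneg, inv_mul_le_iff₀ h3] at h2
    exact h2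

namespace EvolvingSurface

variable {S : EvolvingSurface}

theorem exists_area_le : ∃ C, ∀ t ∈ Icc 0 S.T, S.area t ≤ C := by
  obtain ⟨C, hC⟩ := S.isCompact_track.exists_bound_of_continuousOn S.continuous_jac.continuousOn
  refine ⟨C * (S.surf 0).real univ, fun t ht => ?_⟩
  have h := S.integral_surf ht (f := fun _ => 1) aestronglyMeasurable_const
  rw [integral_const, smul_eq_mul, mul_one] at h
  rw [area, h]
  refine (Real.le_norm_self _).trans (norm_integral_le_of_norm_le_const ?_)
  filter_upwards [S.ae_mem_surf_zero] with y hy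
  rw [mul_one]
  exact hC (y, t) ⟨hy, ht⟩

/-- By Cauchy–Schwarz, ū(t)² is at most |Γ(t)| times the squared L² norm of the slice, and the areas
are bounded. -/
theorem integrableOn_bar_mul (u v : S.L2Pair) :
    IntegrableOn (fun t => S.bar u t * S.bar v t) (Ioo 0 S.T) := by
  obtain ⟨C, hC⟩ := exists_area_le (S := S)
  have i1 : ∀ u : S.L2Pair, Integrable u.fst S.stMeasure := fun u =>
    (Lp.memLp u.fst).integrable (by norm_num)
  have m : ∀ u : S.L2Pair, AEStronglyMeasurable (S.bar u) (volume.restrict (Ioo 0 S.T)) := fun u =>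
    (S.integral_stMeasure_eq_integral_surf (i1 u)).1.1
  have i2 : ∀ u : S.L2Pair, IntegrableOn (fun t => ∫ x, u.fst (x, t) ^ 2 ∂S.surf t) (Ioo 0 S.T) :=
    fun u => (S.integral_stMeasure_eq_integral_surf (Lp.memLp u.fst).integrable_sq).1
  refine Integrable.mono' (((i2 u).add (i2 v)).const_mul C) ((m u).mul (m v)) ?_
  filter_upwards [S.ae_memLp_slice (Lp.memLp u.fst), S.ae_memLp_slice (Lp.memLp v.fst),
    ae_restrict_mem measurableSet_Ioo] with t h1 h2 ht
  have := S.isFiniteMeasure_surf (Ioo_subset_Icc_self ht)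
  have b : ∀ u : S.L2Pair, MemLp (fun x => u.fst (x, t)) 2 (S.surf t) →
      S.bar u t ^ 2 ≤ C * ∫ x, u.fst (x, t) ^ 2 ∂S.surf t := fun u h =>
    (sq_integral_le h).trans (mul_le_mul_of_nonneg_right (hC t (Ioo_subset_Icc_self ht))
      (integral_nonneg fun x => sq_nonneg _))
  rw [Real.norm_eq_abs, Pi.add_apply, mul_add]
  refine le_trans ?_ (add_le_add (b u h1) (b v h2))
  rw [abs_mul]
  nlinarith [sq_abs (S.bar u t), sq_abs (S.bar v t), sq_nonneg (|S.bar u t| - |S.bar v t|),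
    sq_nonneg (|S.bar u t|), sq_nonneg (|S.bar v t|)]

/-- The contribution of `Γ(t)` to a bilinear form. -/
noncomputable def sliceForm (α γ : ℝ) (f : R3 × ℝ → ℝ) (u v : S.L2Pair) (t : ℝ) : ℝ :=
  α * ∫ x, inner ℝ (u.snd (x, t)) (v.snd (x, t)) ∂S.surf t
    + (∫ x, f (x, t) * u.fst (x, t) * v.fst (x, t) ∂S.surf t) + γ * (S.bar u t * S.bar v t)

theorem sliceForm_congr {α γ : ℝ} {f : R3 × ℝ → ℝ} {u v u' v' : S.L2Pair} {t : ℝ}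
    (h1 : (fun x => u.fst (x, t)) =ᵐ[S.surf t] fun x => u'.fst (x, t))
    (h2 : (fun x => u.snd (x, t)) =ᵐ[S.surf t] fun x => u'.snd (x, t))
    (h3 : (fun x => v.fst (x, t)) =ᵐ[S.surf t] fun x => v'.fst (x, t))
    (h4 : (fun x => v.snd (x, t)) =ᵐ[S.surf t] fun x => v'.snd (x, t)) :
    sliceForm α γ f u v t = sliceForm α γ f u' v' t := by
  have e1 : ∫ x, inner ℝ (u.snd (x, t)) (v.snd (x, t)) ∂S.surf t
      = ∫ x, inner ℝ (u'.snd (x, t)) (v'.snd (x, t)) ∂S.surf t := integral_congr_ae <| by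
    filter_upwards [h2, h4] with x a b
    rw [a, b]
  have e2 : ∫ x, f (x, t) * u.fst (x, t) * v.fst (x, t) ∂S.surf t
      = ∫ x, f (x, t) * u'.fst (x, t) * v'.fst (x, t) ∂S.surf t := integral_congr_ae <| by
    filter_upwards [h1, h3] with x a b
    rw [a, b]
  rw [sliceForm, sliceForm, e1, e2, bar, bar, bar, bar, integral_congr_ae h1, integral_congr_ae h3]

theorem sliceForm_eq_zero {α γ : ℝ} {f : R3 × ℝ → ℝ} {u v : S.L2Pair} {t : ℝ}
    (h1 : (fun x => u.fst (x, t)) =ᵐ[S.surf t] 0)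
    (h2 : (fun x => u.snd (x, t)) =ᵐ[S.surf t] 0) : sliceForm α γ f u v t = 0 := by
  have e1 : ∫ x, inner ℝ (u.snd (x, t)) (v.snd (x, t)) ∂S.surf t = 0 := integral_eq_zero_of_ae <| by
    filter_upwards [h2] with x a
    rw [a]
    simp
  have e2 : ∫ x, f (x, t) * u.fst (x, t) * v.fst (x, t) ∂S.surf t = 0 := integral_eq_zero_of_ae <| by
    filter_upwards [h1] with x a
    rw [a]
    simp
  rw [sliceForm, e1, e2, bar, integral_eq_zero_of_ae h1]
  ring

/-- Suitable choices of α, f and γ give a_σ, the inner product of H and the divergence term alone,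
so that these are decomposed over times and slabs by one argument. -/
theorem integral_sliceForm {f : R3 × ℝ → ℝ}
    (hf : ∀ z : S.L2Pair, MemLp (fun p => f p * z.fst p) 2 S.stMeasure) (α γ : ℝ) (u v : S.L2Pair) :
    IntegrableOn (sliceForm α γ f u v) (Ioo 0 S.T) ∧
    ∫ t in Ioo 0 S.T, sliceForm α γ f u v t = α * inner ℝ u.snd v.snd
      + (∫ p, f p * u.fst p * v.fst p ∂S.stMeasure) + γ * ∫ t in 0..S.T, S.bar u t * S.bar v t := by
  have i1 : Integrable (fun p => inner ℝ (u.snd p) (v.snd p)) S.stMeasure :=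
    memLp_inner_integrable (Lp.memLp _) (Lp.memLp _)
  have i2 : Integrable (fun p => f p * u.fst p * v.fst p) S.stMeasure :=
    memLp_mul_integrable (hf u) (Lp.memLp _)
  obtain ⟨j1, e1⟩ := S.integral_stMeasure_eq_integral_surf i1
  obtain ⟨j2, e2⟩ := S.integral_stMeasure_eq_integral_surf i2
  have j3 := integrableOn_bar_mul u v
  refine ⟨((j1.const_mul α).add j2).add (j3.const_mul γ), ?_⟩
  rw [L2.inner_def, e1, e2, intervalIntegral.integral_of_le S.T_pos.le, integral_Ioc_eq_integral_Ioo,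
    ← integral_const_mul, ← integral_const_mul, add_assoc,
    ← integral_add_add (j1.const_mul α) j2 (j3.const_mul γ)]
  simp only [sliceForm, add_assoc]

theorem aForm_eq_integral (νd σ : ℝ) (u v : S.L2Pair) :
    S.aForm νd σ u v = ∫ t in Ioo 0 S.T, sliceForm νd σ S.divw u v t :=
  (integral_sliceForm (fun _ => S.memLp_divw_mul (Lp.memLp _)) νd σ u v).2.symm

theorem integrableOn_sliceForm_divw (νd σ : ℝ) (u v : S.L2Pair) :
    IntegrableOn (sliceForm νd σ S.divw u v) (Ioo 0 S.T) :=
  (integral_sliceForm (fun _ => S.memLp_divw_mul (Lp.memLp _)) νd σ u v).1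

theorem memLp_one_mul (z : S.L2Pair) : MemLp (fun p => (1 : ℝ) * z.fst p) 2 S.stMeasure := by
  simpa using Lp.memLp z.fst

theorem inner_eq_integral (u v : S.L2Pair) :
    inner ℝ u v = ∫ t in Ioo 0 S.T, sliceForm 1 0 (fun _ => 1) u v t := by
  rw [(integral_sliceForm memLp_one_mul 1 0 u v).2, one_mul, zero_mul, add_zero, inner_L2Pair,
    L2.inner_def, add_comm, ← integral_add]
  · simp only [one_mul]
  · simpa only [one_mul] using memLp_mul_integrable (Lp.memLp u.fst) (Lp.memLp v.fst)
  · exact memLp_inner_integrable (Lp.memLp _) (Lp.memLp _)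

theorem aForm_smul_right (νd σ c : ℝ) (u v : S.L2Pair) :
    S.aForm νd σ u (c • v) = c * S.aForm νd σ u v := by
  rw [aForm_eq_integral, aForm_eq_integral, ← integral_const_mul]
  refine integral_congr_ae ?_
  filter_upwards [ae_slice_smul c v] with t ht
  have e1 : ∫ x, inner ℝ (u.snd (x, t)) ((c • v).snd (x, t)) ∂S.surf t
      = c * ∫ x, inner ℝ (u.snd (x, t)) (v.snd (x, t)) ∂S.surf t := by
    rw [← integral_const_mul]
    refine integral_congr_ae ?_
    filter_upwards [ht.2] with x hx
    rw [hx, real_inner_smul_right]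
  have e2 : ∫ x, S.divw (x, t) * u.fst (x, t) * (c • v).fst (x, t) ∂S.surf t
      = c * ∫ x, S.divw (x, t) * u.fst (x, t) * v.fst (x, t) ∂S.surf t := by
    rw [← integral_const_mul]
    refine integral_congr_ae ?_
    filter_upwards [ht.1] with x hx
    rw [hx]
    ring
  have e3 : S.bar (c • v) t = c * S.bar v t := by
    rw [bar, integral_congr_ae ht.1, integral_const_mul, bar]
  rw [sliceForm, sliceForm, e1, e2, e3]
  ring

/-- Coercivity of `a_σ` up to half of the divergence term, by the Friedrichs inequality. -/
theorem aForm_coercive {νd c₀ σ : ℝ} {cF : ℝ → ℝ} (hνd : 0 < νd) (hcF : S.IsFriedrichs cF)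
    (hdiv : ∀ t ∈ Icc 0 S.T, ∀ x ∈ S.Γ t, c₀ ≤ S.divw (x, t) + νd * cF t)
    (hσ : ∀ t ∈ Icc 0 S.T, νd / 2 * (cF t / S.area t) ≤ σ) {c : ℝ} (hc1 : 2 * c ≤ νd) (hc2 : 2 * c ≤ c₀)
    {z : S.L2Pair} (hz : z ∈ S.H) :
    c * ‖z‖ ^ 2 + 1 / 2 * ∫ p, S.divw p * z.fst p * z.fst p ∂S.stMeasure ≤ S.aForm νd σ z z := by
  have hd : ∀ z : S.L2Pair, MemLp (fun p => S.divw p * z.fst p) 2 S.stMeasure :=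
    fun z => S.memLp_divw_mul (Lp.memLp _)
  have e0 := (integral_sliceForm hd 0 0 z z).2
  have j0 := (integral_sliceForm hd 0 0 z z).1
  have j1 := (integral_sliceForm memLp_one_mul 1 0 z z).1
  rw [zero_mul, zero_mul, zero_add, add_zero] at e0
  rw [← e0, ← real_inner_self_eq_norm_sq, inner_eq_integral, aForm_eq_integral, ← integral_const_mul,
    ← integral_const_mul, ← integral_add (j1.const_mul c) (j0.const_mul (1 / 2))]
  refine setIntegral_mono_ae_restrict ((j1.const_mul c).add (j0.const_mul (1 / 2)))
    (integrableOn_sliceForm_divw νd σ z z) ?_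
  filter_upwards [ae_isWeakGrad_of_mem_H hz, S.ae_memLp_slice (hd z), ae_restrict_mem measurableSet_Ioo]
    with t hw hm ht
  have ht' := Ioo_subset_Icc_self ht
  have := S.isFiniteMeasure_surf ht'
  have hv : MemLp (fun x => z.fst (x, t)) 2 (S.surf t) := hw.memLp
  obtain ⟨hF0, hF⟩ := hcF t ht'
  have hF1 := hF _ _ (hw.hasWeakGrad ht')
  rw [area, integral_sub_mean_sq hv] at hF1
  have hs : νd / 2 * (cF t * ((S.surf t).real univ)⁻¹) ≤ σ := by
    rw [← div_eq_mul_inv]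
    exact hσ t ht'
  simp only [sliceForm, real_inner_self_eq_norm_sq]
  set G := ∫ x, ‖z.snd (x, t)‖ ^ 2 ∂S.surf t
  have hG : 0 ≤ G := integral_nonneg fun x => sq_nonneg _
  have hB : 0 ≤ ∫ x, z.fst (x, t) ^ 2 ∂S.surf t := integral_nonneg fun x => sq_nonneg _
  have eB : ∫ x, 1 * z.fst (x, t) * z.fst (x, t) ∂S.surf t = ∫ x, z.fst (x, t) ^ 2 ∂S.surf t := by
    simp only [one_mul, sq]
  have hD : (c₀ - νd * cF t) * ∫ x, z.fst (x, t) ^ 2 ∂S.surf t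
      ≤ ∫ x, S.divw (x, t) * z.fst (x, t) * z.fst (x, t) ∂S.surf t := by
    rw [← integral_const_mul]
    refine integral_mono_ae (hv.integrable_sq.const_mul _) (memLp_mul_integrable hm hv) ?_
    filter_upwards [S.ae_mem_surf ht'] with x hx
    have := hdiv t ht' x hx
    nlinarith [mul_nonneg (sub_nonneg.2 this) (sq_nonneg (z.fst (x, t)))]
  rw [eB]
  set B := ∫ x, z.fst (x, t) ^ 2 ∂S.surf t
  set E := ∫ x, S.divw (x, t) * z.fst (x, t) * z.fst (x, t) ∂S.surf t
  change _ ≤ νd * G + E + σ * (S.bar z t * S.bar z t)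
  have hF2 : cF t * (B - ((S.surf t).real univ)⁻¹ * S.bar z t ^ 2) ≤ G := hF1
  -- Half of ν_d G yields ½ ν_d c_F B minus a multiple of the squared mean quantity, which σ covers
  -- by `b2`. Added to the bound ½ (c₀ - ν_d c_F) B for half of E this is ½ c₀ B. The other halves
  -- of ν_d G and of E remain.
  have b1 := mul_le_mul_of_nonneg_left hF2 hνd.le
  have b2 := mul_le_mul_of_nonneg_right hs (sq_nonneg (S.bar z t))
  have b3 := mul_le_mul_of_nonneg_right hc1 hG
  have b4 := mul_le_mul_of_nonneg_right hc2 hB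
  nlinarith

end EvolvingSurface

/-! ### Decomposition over the slabs -/

namespace SpaceTimeMesh

variable {S : EvolvingSurface} {D : SpaceTimeMesh S}

/-- At almost every time exactly one slab is active, and the other components vanish together with
their gradients. No mixed terms occur. -/
theorem integral_sliceForm_toH {f : R3 × ℝ → ℝ}
    (hf : ∀ z : S.L2Pair, MemLp (fun p => f p * z.fst p) 2 S.stMeasure) (α γ : ℝ) (u v : D.Wb) :
    ∫ t in Ioo 0 S.T, EvolvingSurface.sliceForm α γ f (toH u) (toH v) t
      = ∑ n, ∫ t in Ioo 0 S.T, EvolvingSurface.sliceForm α γ f (u n : S.L2Pair) (v n : S.L2Pair) t := by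
  rw [← integral_finsetSum _ fun n _ => (EvolvingSurface.integral_sliceForm hf α γ _ _).1]
  refine integral_congr_ae ?_
  filter_upwards [ae_slice_toH u, ae_slice_toH v, ae_restrict_mem measurableSet_Ioo] with t h1 h2 ht
  obtain ⟨n, hn⟩ := D.exists_slab ht
  obtain ⟨a1, a2, a3⟩ := h1 n hn
  obtain ⟨b1, b2, -⟩ := h2 n hn
  rw [EvolvingSurface.sliceForm_congr a1 a2 b1 b2]
  refine Eq.symm (Finset.sum_eq_single n (fun m _ hm => ?_) fun h => absurd (Finset.mem_univ n) h)
  exact EvolvingSurface.sliceForm_eq_zero (a3 m hm).1 (a3 m hm).2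

theorem aForm_toH (νd σ : ℝ) (u v : D.Wb) : S.aForm νd σ (toH u) (toH v)
    = ∑ n, S.aForm νd σ (u n : S.L2Pair) (v n : S.L2Pair) := by
  rw [EvolvingSurface.aForm_eq_integral,
    integral_sliceForm_toH (fun _ => S.memLp_divw_mul (Lp.memLp _))]
  exact Finset.sum_congr rfl fun n _ => (EvolvingSurface.aForm_eq_integral _ _ _ _).symm

theorem norm_sq_toH (u : D.Wb) : ‖toH u‖ ^ 2 = ∑ n, ‖(u n : S.L2Pair)‖ ^ 2 := by
  rw [← real_inner_self_eq_norm_sq, EvolvingSurface.inner_eq_integral,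
    integral_sliceForm_toH EvolvingSurface.memLp_one_mul]
  refine Finset.sum_congr rfl fun n _ => ?_
  rw [← EvolvingSurface.inner_eq_integral, real_inner_self_eq_norm_sq]

end SpaceTimeMesh

/-! ### Elementary inequalities behind the weighted test function -/

/-- The differences of p telescope to p N because p 0 = 0. The condition 4c ≤ 1 lowers the factor ½
of p N and of the jumps to 2c. -/
theorem sum_slab_ge {N : ℕ} {e p J w : ℕ → ℝ} {c : ℝ} (hc : 4 * c ≤ 1)
    (hp0 : p 0 = 0) (hp : ∀ n, 0 ≤ p n) (hJ : ∀ n, 0 ≤ J n)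
    (he : ∀ n < N, 1 / 2 * (p (n + 1) - p n + J n) + 2 * c * w n ≤ e n) :
    2 * c * (p N + ∑ n ∈ Finset.range N, (J n + w n)) ≤ ∑ n ∈ Finset.range N, e n := by
  have h1 : ∑ n ∈ Finset.range N, (1 / 2 * (p (n + 1) - p n) + 2 * c * (J n + w n))
      ≤ ∑ n ∈ Finset.range N, e n := Finset.sum_le_sum fun n hn => by
    have h2 := he n (Finset.mem_range.1 hn)
    nlinarith [mul_nonneg (sub_nonneg.2 hc) (hJ n)]
  rw [Finset.sum_add_distrib, ← Finset.mul_sum, ← Finset.mul_sum, Finset.sum_range_sub, hp0] at h1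
  nlinarith [mul_nonneg (sub_nonneg.2 hc) (hp N)]

theorem sum_range_ite_le (N k : ℕ) (hk : k < N) (f : ℕ → ℝ) :
    ∑ n ∈ Finset.range N, (if n ≤ k then f n else 0) = ∑ n ∈ Finset.range (k + 1), f n := by
  rw [← Finset.sum_filter]
  refine Finset.sum_congr ?_ fun _ _ => rfl
  ext n
  simp only [Finset.mem_filter, Finset.mem_range]
  omega

/-- The weights 3 and 1 amount to the estimate over all slabs plus twice the estimate up to slab k.
From the former the nonnegative term p N is dropped; the latter contributes 2 p (k + 1). -/
theorem weighted_sum_slab_ge {N k : ℕ} (hk : k < N) {e p J w : ℕ → ℝ} {c : ℝ} (hc0 : 0 ≤ c)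
    (hc : 4 * c ≤ 1) (hp0 : p 0 = 0) (hp : ∀ n, 0 ≤ p n) (hJ : ∀ n, 0 ≤ J n)
    (he : ∀ n < N, 1 / 2 * (p (n + 1) - p n + J n) + 2 * c * w n ≤ e n) :
    2 * c * (2 * p (k + 1) + ∑ n ∈ Finset.range N, (J n + w n)
        + 2 * ∑ n ∈ Finset.range (k + 1), (J n + w n))
      ≤ ∑ n ∈ Finset.range N, (if n ≤ k then 3 else 1) * e n := by
  have h1 := sum_slab_ge hc hp0 hp hJ he
  have h2 := sum_slab_ge (N := k + 1) hc hp0 hp hJ fun n hn => he n (by omega)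
  have h3 : ∑ n ∈ Finset.range N, (if n ≤ k then 3 else 1) * e n
      = ∑ n ∈ Finset.range N, e n + 2 * ∑ n ∈ Finset.range (k + 1), e n := by
    rw [← sum_range_ite_le N k hk, Finset.mul_sum, ← Finset.sum_add_distrib]
    refine Finset.sum_congr rfl fun n _ => ?_
    split_ifs <;> ring
  rw [h3]
  nlinarith [mul_nonneg hc0 (hp N)]

/-- M stands for the largest squared left limit, A and C for the contributions up to and after slab
k. The difference of the two sides is a sum of nonnegative terms. It is zero for A = 0 and M = C, so
the bound has no slack. -/
theorem weight_inequality {M A C : ℝ} (hM : 0 ≤ M) (hA : 0 ≤ A) (hC : 0 ≤ C) :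
    (13 * M + 9 * A + C + 4 * (√M * √C)) * (M + A + C) ≤ (2 * (2 * M + 3 * A + C)) ^ 2 := by
  obtain ⟨m, hm, rfl⟩ : ∃ m, 0 ≤ m ∧ M = m ^ 2 := ⟨√M, Real.sqrt_nonneg _, (Real.sq_sqrt hM).symm⟩
  obtain ⟨c, hc, rfl⟩ : ∃ c, 0 ≤ c ∧ C = c ^ 2 := ⟨√C, Real.sqrt_nonneg _, (Real.sq_sqrt hC).symm⟩
  rw [Real.sqrt_sq hm, Real.sqrt_sq hc]
  have h1 : 0 ≤ (m - c) ^ 2 * (3 * m ^ 2 + 2 * (m * c) + 3 * c ^ 2) := by positivity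
  have h2 : 0 ≤ A * (2 * (m - c) ^ 2 + 24 * m ^ 2 + 27 * A + 12 * c ^ 2) := by positivity
  linarith [h1, h2, show (2 * (2 * m ^ 2 + 3 * A + c ^ 2)) ^ 2
    - (13 * m ^ 2 + 9 * A + c ^ 2 + 4 * (m * c)) * (m ^ 2 + A + c ^ 2)
    = (m - c) ^ 2 * (3 * m ^ 2 + 2 * (m * c) + 3 * c ^ 2)
      + A * (2 * (m - c) ^ 2 + 24 * m ^ 2 + 27 * A + 12 * c ^ 2) by ring]

theorem sqrt_weight_inequality {M A C : ℝ} (hM : 0 ≤ M) (hA : 0 ≤ A) (hC : 0 ≤ C) :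
    √(13 * M + 9 * A + C + 4 * (√M * √C)) * √(M + A + C) ≤ 2 * (2 * M + 3 * A + C) := by
  rw [← Real.sqrt_mul (by positivity)]
  exact Real.sqrt_le_iff.2 ⟨by positivity, weight_inequality hM hA hC⟩

/-! ### Coercivity and the inf-sup estimate -/

namespace SpaceTimeMesh

variable {S : EvolvingSurface} {D : SpaceTimeMesh S}

/-- The contribution of a slab to the stabilized form. -/
noncomputable def slabForm (νd σ : ℝ) (u : D.Wb) (n : Fin D.N) : ℝ :=
  S.materialDeriv (u n) ⟨u n, (u n).2.1⟩ + S.aForm νd σ (u n : S.L2Pair) (u n : S.L2Pair)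
    + inner ℝ (jump u n) (uPlus u n)

/-- The jump form sees its second argument only through right limits. Factors that are constant on
slabs therefore come out slab by slab, without coupling of neighbours. -/
theorem form_scale (νd σ : ℝ) (c : ℕ → ℝ) (u : D.Wb) :
    form νd σ u (scale c u) = ∑ n : Fin D.N, c n * slabForm νd σ u n := by
  rw [form, derivPairing_scale, aForm_toH, dForm, Finset.sum_range, ← Finset.sum_add_distrib,
    ← Finset.sum_add_distrib]
  refine Finset.sum_congr rfl fun n _ => ?_
  rw [uPlus_scale, real_inner_smul_right, slabForm]
  change _ + S.aForm νd σ (u n : S.L2Pair) (c n • (u n : S.L2Pair)) + _ = _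
  rw [EvolvingSurface.aForm_smul_right]
  ring

theorem scale_one (u : D.Wb) : scale (fun _ => 1) u = u := funext fun n => one_smul ℝ (u n)

/-- The squared norm of the value at `t_n` from the left, `0` for `n = 0`. -/
noncomputable def sqMinus (u : D.Wb) (n : ℕ) : ℝ := if n = 0 then 0 else ‖uMinus u n‖ ^ 2

theorem sqMinus_nonneg (u : D.Wb) (n : ℕ) : 0 ≤ sqMinus u n := by
  rw [sqMinus]; split_ifs <;> positivity

theorem sqMinus_succ (u : D.Wb) (n : ℕ) : sqMinus u (n + 1) = ‖uMinus u (n + 1)‖ ^ 2 :=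
  if_neg n.succ_ne_zero

/-- Polarization. At n = 0 the jump is the right limit itself, in accordance with the value zero in
`sqMinus`. -/
theorem inner_jump_uPlus (u : D.Wb) (n : ℕ) :
    inner ℝ (jump u n) (uPlus u n) = 1 / 2 * (‖uPlus u n‖ ^ 2 + ‖jump u n‖ ^ 2 - sqMinus u n) := by
  rw [jump, sqMinus]
  split_ifs with h
  · rw [real_inner_self_eq_norm_sq]
    ring
  · have h1 := norm_sub_sq_real (uPlus u n) (uMinus u n)
    rw [inner_sub_left, real_inner_self_eq_norm_sq, real_inner_comm, h1]
    ring

variable {νd c₀ σ : ℝ} {cF : ℝ → ℝ}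

/-- The energy identity turns the derivative pairing into ½ (‖u_-‖² - ‖u_+‖²) minus half of the
divergence term. The square of u_+ cancels against the jump term, and the divergence is absorbed by
the coercivity of a_σ. -/
theorem le_slabForm (hνd : 0 < νd) (hcF : S.IsFriedrichs cF)
    (hdiv : ∀ t ∈ Icc 0 S.T, ∀ x ∈ S.Γ t, c₀ ≤ S.divw (x, t) + νd * cF t)
    (hσ : ∀ t ∈ Icc 0 S.T, νd / 2 * (cF t / S.area t) ≤ σ) {c : ℝ} (hc1 : 4 * c ≤ νd) (hc2 : 4 * c ≤ c₀)
    (u : D.Wb) (n : Fin D.N) :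
    1 / 2 * (sqMinus u (n + 1) - sqMinus u n + ‖jump u n‖ ^ 2) + 2 * c * ‖(u n : S.L2Pair)‖ ^ 2
      ≤ slabForm νd σ u n := by
  have h1 := (slab_traces u n).2.2
  have h2 := EvolvingSurface.aForm_coercive hνd hcF hdiv hσ (c := 2 * c) (by linarith) (by linarith)
    (u n).2.1.1
  rw [slabForm, inner_jump_uPlus, sqMinus_succ]
  linarith

theorem slab_sum (f : Fin D.N → ℝ) :
    ∑ n, f n = ∑ n ∈ Finset.range D.N, if h : n < D.N then f ⟨n, h⟩ else 0 := by
  rw [Finset.sum_range]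
  exact Finset.sum_congr rfl fun n _ => by rw [dif_pos n.2]

/-- The squared norm of the restriction to a slab. -/
noncomputable def sqSlab (u : D.Wb) (n : ℕ) : ℝ :=
  if h : n < D.N then ‖(u ⟨n, h⟩ : S.L2Pair)‖ ^ 2 else 0

theorem sqSlab_nonneg (u : D.Wb) (n : ℕ) : 0 ≤ sqSlab u n := by
  rw [sqSlab]; split_ifs <;> positivity

theorem norm_sq_toH_eq (u : D.Wb) : ‖toH u‖ ^ 2 = ∑ n ∈ Finset.range D.N, sqSlab u n :=
  (norm_sq_toH u).trans (slab_sum _)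

theorem norm_sq_toH_scale (c : ℕ → ℝ) (u : D.Wb) :
    ‖toH (scale c u)‖ ^ 2 = ∑ n ∈ Finset.range D.N, c n ^ 2 * sqSlab u n := by
  rw [norm_sq_toH_eq]
  refine Finset.sum_congr rfl fun n hn => ?_
  rw [sqSlab, sqSlab, dif_pos (Finset.mem_range.1 hn), dif_pos (Finset.mem_range.1 hn)]
  change ‖c n • (u _ : S.L2Pair)‖ ^ 2 = _
  rw [norm_smul, mul_pow, Real.norm_eq_abs, sq_abs]

theorem form_scale_eq (νd σ : ℝ) (c : ℕ → ℝ) (u : D.Wb) : form νd σ u (scale c u)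
    = ∑ n ∈ Finset.range D.N, c n * if h : n < D.N then slabForm νd σ u ⟨n, h⟩ else 0 := by
  rw [form_scale, Finset.sum_range]
  exact Finset.sum_congr rfl fun n _ => by rw [dif_pos n.2]

theorem form_self_ge (hνd : 0 < νd) (hcF : S.IsFriedrichs cF)
    (hdiv : ∀ t ∈ Icc 0 S.T, ∀ x ∈ S.Γ t, c₀ ≤ S.divw (x, t) + νd * cF t)
    (hσ : ∀ t ∈ Icc 0 S.T, νd / 2 * (cF t / S.area t) ≤ σ) {c : ℝ} (hc : 4 * c ≤ 1)
    (hc1 : 4 * c ≤ νd) (hc2 : 4 * c ≤ c₀) (u : D.Wb) :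
    2 * c * (‖uMinus u D.N‖ ^ 2 + ∑ n ∈ Finset.range D.N, ‖jump u n‖ ^ 2 + ‖toH u‖ ^ 2)
      ≤ form νd σ u u := by
  have h := sum_slab_ge (N := D.N) (p := sqMinus u) (J := fun n => ‖jump u n‖ ^ 2) (w := sqSlab u)
    (e := fun n => if h : n < D.N then slabForm νd σ u ⟨n, h⟩ else 0) hc (if_pos rfl)
    (sqMinus_nonneg u) (fun n => sq_nonneg _) fun n hn => by
      have := le_slabForm hνd hcF hdiv hσ hc1 hc2 u ⟨n, hn⟩
      simpa only [sqSlab, dif_pos hn] using this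
  have e := form_scale_eq νd σ (fun _ => 1) u
  simp only [scale_one, one_mul] at e
  rw [e, norm_sq_toH_eq, add_assoc, ← Finset.sum_add_distrib]
  rwa [sqMinus, if_neg D.N_pos.ne'] at h

theorem meshNorm_pos {u : D.Wb} (hu : u ≠ 0) : 0 < meshNorm u := by
  obtain ⟨n, hn⟩ := Function.ne_iff.1 hu
  have h1 : 0 < ‖toH u‖ ^ 2 := by
    rw [norm_sq_toH]
    refine Finset.sum_pos' (fun m _ => sq_nonneg _) ⟨n, Finset.mem_univ n, ?_⟩
    have : (u n : S.L2Pair) ≠ 0 := fun h => hn (Subtype.ext h)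
    positivity
  have h2 : 0 ≤ ⨆ n : Fin D.N, ‖uMinus u (n + 1)‖ ^ 2 := Real.iSup_nonneg fun n => sq_nonneg _
  exact Real.sqrt_pos.2 (by positivity)

/-- The weights of the test function: `3` up to slab `k`, and `1` afterwards. -/
noncomputable def weight (k n : ℕ) : ℝ := if n ≤ k then 3 else 1

theorem weight_pos (k n : ℕ) : 0 < weight k n := by
  rw [weight]; split_ifs <;> norm_num

theorem weight_sq_le (k n : ℕ) : weight k n ^ 2 ≤ 9 := by
  rw [weight]; split_ifs <;> norm_num

/-- Only at n = k + 1 do the weights on the two sides differ. There the jump is u_+ - 3 u_- = [u] -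
2 u_-, and its square is expanded. -/
theorem norm_sq_jump_scale_le (u : D.Wb) (k n : ℕ) (hn : n < D.N) :
    ‖jump (scale (weight k) u) n‖ ^ 2 ≤ weight k n ^ 2 * ‖jump u n‖ ^ 2
      + if n = k + 1 then 4 * sqMinus u (k + 1) + 4 * (√(sqMinus u (k + 1)) * ‖jump u n‖) else 0 := by
  have hP := uPlus_scale (weight k) u ⟨n, hn⟩
  simp only at hP
  rcases Nat.eq_zero_or_pos n with rfl | hpos
  · rw [jump, if_pos rfl, hP, jump, if_pos rfl, if_neg (by omega), norm_smul, mul_pow, Real.norm_eq_abs,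
      sq_abs, add_zero]
  · obtain ⟨m, rfl⟩ : ∃ m, n = m + 1 := ⟨n - 1, by omega⟩
    have hM := uMinus_scale (weight k) u ⟨m, by omega⟩
    simp only at hM
    have hj : jump u (m + 1) = uPlus u (m + 1) - uMinus u (m + 1) := if_neg m.succ_ne_zero
    rw [jump, if_neg m.succ_ne_zero, hP, hM]
    by_cases h : m = k
    · subst h
      have e : weight m (m + 1) • uPlus u (m + 1) - weight m m • uMinus u (m + 1)
          = jump u (m + 1) - (2 : ℝ) • uMinus u (m + 1) := by
        rw [hj, weight, weight, if_neg (by omega), if_pos le_rfl]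
        module
      rw [e, if_pos rfl, sqMinus_succ, Real.sqrt_sq (norm_nonneg _), weight, if_neg (by omega),
        norm_sub_sq_real, real_inner_smul_right, norm_smul, Real.norm_ofNat]
      have := neg_le_of_abs_le (abs_real_inner_le_norm (jump u (m + 1)) (uMinus u (m + 1)))
      nlinarith
    · have e : weight k (m + 1) = weight k m := by
        simp only [weight]
        split_ifs <;> first | rfl | omega
      rw [e, ← smul_sub, ← hj, norm_smul, mul_pow, Real.norm_eq_abs, sq_abs, if_neg (by omega), add_zero]

/-- The index k is the slab at whose end the largest left limit occurs. With C = B - A, the form is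
at least 2c (2M + 3A + C), while the squared norms of u and of the test function are M + A + C and
at most 13M + 9A + C + 4 √(M C). -/
theorem exists_test_ge (hνd : 0 < νd) (hcF : S.IsFriedrichs cF)
    (hdiv : ∀ t ∈ Icc 0 S.T, ∀ x ∈ S.Γ t, c₀ ≤ S.divw (x, t) + νd * cF t)
    (hσ : ∀ t ∈ Icc 0 S.T, νd / 2 * (cF t / S.area t) ≤ σ) {c : ℝ} (hc0 : 0 ≤ c) (hc : 4 * c ≤ 1)
    (hc1 : 4 * c ≤ νd) (hc2 : 4 * c ≤ c₀) (u : D.Wb) :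
    ∃ k, c * (meshNorm (scale (weight k) u) * meshNorm u) ≤ form νd σ u (scale (weight k) u) := by
  have : Nonempty (Fin D.N) := ⟨⟨0, D.N_pos⟩⟩
  obtain ⟨k, hk⟩ := exists_eq_ciSup_of_finite (f := fun n : Fin D.N => ‖uMinus u (n + 1)‖ ^ 2)
  set M := sqMinus u (k + 1) with hM
  have hsup : (⨆ n : Fin D.N, ‖uMinus u (n + 1)‖ ^ 2) = M := by rw [← hk, hM, sqMinus_succ]
  have hle : ∀ n : Fin D.N, ‖uMinus u (n + 1)‖ ^ 2 ≤ M := fun n => by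
    rw [← hsup]
    exact le_ciSup (f := fun n : Fin D.N => ‖uMinus u (n + 1)‖ ^ 2) (Set.finite_range _).bddAbove n
  set A := ∑ n ∈ Finset.range (k + 1), (‖jump u n‖ ^ 2 + sqSlab u n) with hA
  set B := ∑ n ∈ Finset.range D.N, (‖jump u n‖ ^ 2 + sqSlab u n) with hB
  have hnn : ∀ n, 0 ≤ ‖jump u n‖ ^ 2 + sqSlab u n := fun n =>
    add_nonneg (sq_nonneg _) (sqSlab_nonneg u n)
  have hM0 : 0 ≤ M := sqMinus_nonneg _ _
  have hA0 : 0 ≤ A := Finset.sum_nonneg fun n _ => hnn n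
  have hBA : B - A = ∑ n ∈ Finset.Ico (k + 1 : ℕ) D.N, (‖jump u n‖ ^ 2 + sqSlab u n) :=
    (Finset.sum_Ico_eq_sub _ k.2).symm
  have hC0 : 0 ≤ B - A := hBA ▸ Finset.sum_nonneg fun n _ => hnn n
  have h := weighted_sum_slab_ge (N := D.N) k.2 (p := sqMinus u) (J := fun n => ‖jump u n‖ ^ 2)
    (w := sqSlab u) (e := fun n => if h : n < D.N then slabForm νd σ u ⟨n, h⟩ else 0) hc0 hc (if_pos rfl)
    (sqMinus_nonneg u) (fun n => sq_nonneg _) fun n hn => by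
      have := le_slabForm hνd hcF hdiv hσ hc1 hc2 u ⟨n, hn⟩
      simpa only [sqSlab, dif_pos hn] using this
  refine ⟨k, ?_⟩
  rw [form_scale_eq]
  refine le_trans ?_ h
  have hu : meshNorm u = √(M + A + (B - A)) := by
    rw [meshNorm, hsup, norm_sq_toH_eq, add_assoc, ← Finset.sum_add_distrib]
    congr 1
    ring
  -- Of the 13M, 9M come from the maximum and 4M from the enlarged jump after slab k. That jump of u
  -- is itself counted in B - A, and it is absent if k is the last slab.
  have hv : meshNorm (scale (weight k) u) ≤ √(13 * M + 9 * A + (B - A) + 4 * (√M * √(B - A))) := by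
    refine Real.sqrt_le_sqrt ?_
    have b1 : (⨆ n : Fin D.N, ‖uMinus (scale (weight k) u) (n + 1)‖ ^ 2) ≤ 9 * M := by
      refine ciSup_le fun n => ?_
      rw [uMinus_scale, norm_smul, mul_pow, Real.norm_eq_abs, sq_abs]
      exact mul_le_mul (weight_sq_le k n) (hle n) (sq_nonneg _) (by norm_num)
    have b2 : ∑ n ∈ Finset.range D.N, ‖jump (scale (weight k) u) n‖ ^ 2
        ≤ ∑ n ∈ Finset.range D.N, weight k n ^ 2 * ‖jump u n‖ ^ 2 + (4 * M + 4 * (√M * √(B - A))) := by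
      refine (Finset.sum_le_sum fun n hn =>
        norm_sq_jump_scale_le u k n (Finset.mem_range.1 hn)).trans ?_
      rw [Finset.sum_add_distrib, Finset.sum_ite_eq' (Finset.range D.N)]
      refine add_le_add_right ?_ _
      split_ifs with hk1
      · have : ‖jump u (k + 1)‖ ≤ √(B - A) := by
          refine Real.le_sqrt_of_sq_le ?_
          rw [hBA]
          refine le_trans (le_add_of_nonneg_right (sqSlab_nonneg u _)) (Finset.single_le_sum
            (f := fun n => ‖jump u n‖ ^ 2 + sqSlab u n) (fun n _ => hnn n)
            (Finset.mem_Ico.2 ⟨le_rfl, Finset.mem_range.1 hk1⟩))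
        have := mul_le_mul_of_nonneg_left this (Real.sqrt_nonneg M)
        linarith
      · positivity
    have b3 : ∑ n ∈ Finset.range D.N, weight k n ^ 2 * (‖jump u n‖ ^ 2 + sqSlab u n) = B + 8 * A := by
      rw [hA, hB, ← sum_range_ite_le D.N k k.2, Finset.mul_sum, ← Finset.sum_add_distrib]
      refine Finset.sum_congr rfl fun n _ => ?_
      rw [weight]
      split_ifs <;> ring
    simp only [mul_add, Finset.sum_add_distrib] at b3
    rw [norm_sq_toH_scale]
    linarith
  have hfin : meshNorm (scale (weight k) u) * meshNorm u ≤ 2 * (2 * M + 3 * A + (B - A)) := by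
    rw [hu]
    exact (mul_le_mul_of_nonneg_right hv (Real.sqrt_nonneg _)).trans
      (sqrt_weight_inequality hM0 hA0 hC0)
  calc c * (meshNorm (scale (weight k) u) * meshNorm u)
      ≤ c * (2 * (2 * M + 3 * A + (B - A))) := mul_le_mul_of_nonneg_left hfin hc0
    _ = _ := by ring

theorem scale_ne_zero {c : ℕ → ℝ} (hc : ∀ n, c n ≠ 0) {u : D.Wb} (hu : u ≠ 0) : scale c u ≠ 0 := by
  obtain ⟨n, hn⟩ := Function.ne_iff.1 hu
  exact Function.ne_iff.2 ⟨n, smul_ne_zero (hc n) hn⟩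

theorem const_mul_mem_P1 {n : Fin D.N} {φ : R3 → ℝ} (hφ : φ ∈ D.P1 n) (c : ℝ) :
    (fun x => c * φ x) ∈ D.P1 n := by
  refine ⟨continuousOn_const.mul hφ.1, fun s hs h4 => ?_⟩
  obtain ⟨A, hA⟩ := hφ.2 s hs h4
  refine ⟨c • A, fun x hx => ?_⟩
  simp only [hA hx]
  rfl

/-- No condition links the finite element functions across time levels, so slabwise multiples stay
in the space. This is the only property of W_h that the estimates use. -/
theorem scale_mem_Wh (c : ℕ → ℝ) {u : D.Wb} (hu : u ∈ D.Wh) : scale c u ∈ D.Wh := by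
  intro n
  obtain ⟨φ₀, h0, φ₁, h1, h⟩ := hu n
  refine ⟨_, const_mul_mem_P1 h0 (c n), _, const_mul_mem_P1 h1 (c n), ?_⟩
  filter_upwards [h, Lp.coeFn_smul (c n) (u n : S.L2Pair).fst] with p hp e ht
  refine Eq.trans e ?_
  rw [Pi.smul_apply, smul_eq_mul, hp ht]
  ring

/-- The set X enters only through its stability under the weights, which treats W^b and W_h at the
same time. -/
theorem le_infSup (hνd : 0 < νd) (hcF : S.IsFriedrichs cF)
    (hdiv : ∀ t ∈ Icc 0 S.T, ∀ x ∈ S.Γ t, c₀ ≤ S.divw (x, t) + νd * cF t)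
    (hσ : ∀ t ∈ Icc 0 S.T, νd / 2 * (cF t / S.area t) ≤ σ) {c : ℝ} (hc0 : 0 ≤ c) (hc : 4 * c ≤ 1)
    (hc1 : 4 * c ≤ νd) (hc2 : 4 * c ≤ c₀) {X : Set D.Wb} (hX : ∀ u ∈ X, ∀ k, scale (weight k) u ∈ X) :
    (c : EReal) ≤ D.infSup νd σ X := by
  refine le_iInf₂ fun u hu => ?_
  obtain ⟨k, hk⟩ := exists_test_ge hνd hcF hdiv hσ hc0 hc hc1 hc2 u
  have hv := scale_ne_zero (fun n => (weight_pos k n).ne') hu.2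
  refine le_iSup₂_of_le (scale (weight k) u) ⟨hX u hu.1 k, hv⟩ ?_
  exact EReal.coe_le_coe_iff.2 ((le_div_iff₀ (mul_pos (meshNorm_pos hv) (meshNorm_pos hu.2))).2 hk)

end SpaceTimeMesh

theorem theorem4p1 (S : EvolvingSurface) (D : SpaceTimeMesh S) (νd c₀ σ : ℝ) (cF : ℝ → ℝ)
    (hνd : 0 < νd) (hc₀ : 0 < c₀) (hcF : S.IsFriedrichs cF)
    (hdiv : ∀ t ∈ Icc 0 S.T, ∀ x ∈ S.Γ t, c₀ ≤ S.divw (x, t) + νd * cF t)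
    (hσ : ∀ t ∈ Icc 0 S.T, νd / 2 * (cF t / S.area t) ≤ σ)
    (cs : ℝ) (hcs : cs = 1 / 4 * min 1 (min νd c₀)) :
    ((cs : EReal) ≤ D.infSup νd σ Set.univ ∧
      ∀ u : D.Wb, 2 * cs * (‖SpaceTimeMesh.uMinus u D.N‖ ^ 2
          + ∑ n ∈ Finset.range D.N, ‖SpaceTimeMesh.jump u n‖ ^ 2 + ‖SpaceTimeMesh.toH u‖ ^ 2)
        ≤ SpaceTimeMesh.form νd σ u u) ∧
    ((cs : EReal) ≤ D.infSup νd σ D.Wh ∧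
      ∀ u ∈ D.Wh, 2 * cs * (‖SpaceTimeMesh.uMinus u D.N‖ ^ 2
          + ∑ n ∈ Finset.range D.N, ‖SpaceTimeMesh.jump u n‖ ^ 2 + ‖SpaceTimeMesh.toH u‖ ^ 2)
        ≤ SpaceTimeMesh.form νd σ u u) := by
  have h0 : 0 ≤ cs := by rw [hcs]; positivity
  have h1 : 4 * cs ≤ 1 := by
    have := min_le_left 1 (min νd c₀)
    linarith
  have h2 : 4 * cs ≤ νd := by
    have := (min_le_right 1 (min νd c₀)).trans (min_le_left _ _)
    linarith
  have h3 : 4 * cs ≤ c₀ := by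
    have := (min_le_right 1 (min νd c₀)).trans (min_le_right _ _)
    linarith
  exact ⟨⟨SpaceTimeMesh.le_infSup hνd hcF hdiv hσ h0 h1 h2 h3 fun _ _ _ => mem_univ _,
      SpaceTimeMesh.form_self_ge hνd hcF hdiv hσ h1 h2 h3⟩,
    SpaceTimeMesh.le_infSup hνd hcF hdiv hσ h0 h1 h2 h3 fun _ hu _ => SpaceTimeMesh.scale_mem_Wh _ hu,
    fun u _ => SpaceTimeMesh.form_self_ge hνd hcF hdiv hσ h1 h2 h3 u⟩
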